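/- **Setting.** Let $\mathbb T=\mathbb R/2\pi\mathbb Z$, $\mathcal S=\mathbb T\times(0,1)$, $0<\varepsilon\le 1$, $\nabla_\varepsilon=(\varepsilon\partial_x,\partial_y)$, $\Delta_\varepsilon=\varepsilon^2\partial_x^2+\partial_y^2$, $\langle k\rangle=(1+k^2)^{1/2}$. For $\lambda\ge1$ and a function $f$ on $\mathcal S$ depending on time put, at time $t$ and with $\tau(t)=1-\lambda t$, $$\|f(t)\|_{X^r}=\big\|e^{\tau(t)\langle D_x\rangle^{2/3}}f(t)\big\|_{H^{r,0}},\qquad \|g\|_{H^{r,0}}^2=2\pi\int_0^1\sum_{k\in\mathbb Z}\langle k\rangle^{2r}|\widehat g(k,y)|^2\,dy,$$ where $\widehat g(k,y)=\frac1{2\pi}\int_0^{2\pi}g(x,y)e^{-ikx}dx$. Write $|g|_{X^r}$ for the same norm, without the integral in $y$, of a function of $x$. Squared norms of vectors are sums over the components, and $|\nabla_\varepsilon\phi|_{y=0,1}|^2_{X^r}$ is the sum of the contributions of $y=0$ and $y=1$. **Approximate solution.** For $0<t<T_p$ let $(u_p^0,v_p^0,p_p^0)$ be a classical solution of the hydrostatic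 Navier–Stokes system $$\partial_tu_p^0+u_p^0\partial_xu_p^0+v_p^0\partial_yu_p^0-\partial_y^2u_p^0+\partial_xp_p^0=0,\quad \partial_yp_p^0=0,\quad \partial_xu_p^0+\partial_yv_p^0=0,\quad (u_p^0,v_p^0)|_{y=0,1}=0,$$ and $(u_p^2,v_p^2,p_p^2)$ a classical solution of $$\begin{aligned}&\partial_tu_p^2+u_p^0\partial_xu_p^2+v_p^0\partial_yu_p^2+u_p^2\partial_xu_p^0+v_p^2\partial_yu_p^0+\partial_xp_p^2-\partial_y^2u_p^2=-\partial_x^2u_p^0,\\ &\partial_yp_p^2=-(\partial_tv_p^0+u_p^0\partial_xv_p^0+v_p^0\partial_yv_p^0-\partial_y^2v_p^0),\quad \partial_xu_p^2+\partial_yv_p^2=0,\quad (u_p^2,v_p^2)|_{y=0,1}=0,\end{aligned}$$ the velocities being $2\pi$-periodic in $x$ (the pressures need not be periodic), with $u_p^i\in C^4$, $v_p^i\in C^3$, $p_p^i\in C^2$ up to the walls for $0<t<T_p$. Put $u^p=u_p^0+\varepsilon^2u_p^2$, $v^p=v_p^0+\varepsilon^2v_p^2$, $\omega^p=\partial_yu^p$.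 Assume that for all $t\in(0,T_p)$ $$\|v_p^0\|_{X^{11}}^2+\|u_p^0\|_{X^{12}}^2+\|\partial_yu_p^0\|_{X^{12}}^2+\|\partial_y^3u_p^0\|_{X^8}^2\le M^2,\qquad \|v_p^2\|_{X^{9}}^2+\|u_p^2\|_{X^{10}}^2+\|\partial_yu_p^2\|_{X^{10}}^2+\|\partial_y^3u_p^2\|_{X^6}^2\le M^2,$$ and $\partial_y\omega^p\ge c_0$ in $\mathcal S$. **Claim.** For all $M>0$, $c_0>0$ there are $\lambda_0>1$ and $K>0$, depending only on $M$ and $c_0$, with the following property. Let $\lambda\ge\lambda_0$, $0<\varepsilon\le1$, $T_p>0$, let the approximate solution be as above, and let $0<T<\min\{T_p,\frac1{2\lambda}\}$. Let $\mathcal N_u,\mathcal N_v$ (of class $C^1$) and $f_1,f_2$ (continuous) be functions on $(0,T)\times\mathbb T\times[0,1]$ and let $C$ be a continuous function of $t\in(0,T)$. Let $\phi$ be $2\pi$-periodic in $x$, of class $C^4$ on $(0,T]\times\mathbb T\times[0,1]$, and, with $\omega=\Delta_\varepsilon\phi$, let it satisfy $$\begin{aligned}&(\partial_t-\Delta_\varepsilon)\omega+u^p\partial_x\omega+v^p\partial_y\omega+\partial_y\phi\,\partial_x\omega^p-\partial_x\phi\,\partial_y\omega^p=\partial_y\mathcal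 N_u-\varepsilon^2\partial_x\mathcal N_v+\varepsilon^2f_1+f_2-C(t)\partial_x\omega^p,\\ &\phi|_{y=0,1}=0,\qquad \Delta_\varepsilon\phi|_{y=0,1}=0,\qquad \phi|_{t=0}=0,\end{aligned}$$ where the initial condition includes $\|\omega(t)\|_{L^2(\mathcal S)}\to0$ as $t\to0^+$. Then for all $t\in[0,T]$, as an inequality in $[0,\infty]$, $$\begin{aligned}&\|\omega(t)\|_{X^2}^2+\lambda\int_0^t\Big(\|\omega\|_{X^{7/3}}^2+\|\nabla_\varepsilon\phi\|_{X^{7/3}}^2+\big|\nabla_\varepsilon\phi|_{y=0,1}\big|_{X^{7/3}}^2\Big)ds+\int_0^t\|\nabla_\varepsilon\omega\|_{X^2}^2ds\\ &\qquad\le K\int_0^t\|(\mathcal N_u,\varepsilon\mathcal N_v)\|_{X^2}^2ds+\frac K\lambda\int_0^t\|(C,\varepsilon^2f_1,f_2)\|_{X^{5/3}}^2ds.\end{aligned}$$ -/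

import Mathlib

open Set Filter Topology MeasureTheory
open scoped ENNReal

namespace HydroNS

noncomputable section

/-! Functions on the periodic strip are written `f t x y` with `t` the time, `x` in the torus of
length `2 * π` (that is, `2 * π`-periodic in `x`), and `y` in the closed interval from `0` to `1`. -/

/-! ## Derivatives -/

/-- Time derivative. -/
def dt (f : ℝ → ℝ → ℝ → ℝ) (t x y : ℝ) : ℝ := deriv (fun s => f s x y) t

/-- Tangential derivative. -/
def dx (f : ℝ → ℝ → ℝ → ℝ) (t x y : ℝ) : ℝ := deriv (fun z => f t z y) x

/-- Normal derivative, one-sided at the walls `y = 0` and `y = 1`. -/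
def dy (f : ℝ → ℝ → ℝ → ℝ) (t x y : ℝ) : ℝ := derivWithin (fun z => f t x z) (Icc 0 1) y

/-- The anisotropic Laplacian `ε² ∂ₓ² + ∂ᵧ²`. -/
def lap (ε : ℝ) (f : ℝ → ℝ → ℝ → ℝ) (t x y : ℝ) : ℝ :=
  ε ^ 2 * dx (dx f) t x y + dy (dy f) t x y

/-- `f` is `2 * π`-periodic in `x`. -/
def PeriodicX (f : ℝ → ℝ → ℝ → ℝ) : Prop := ∀ t x y, f t (x + 2 * Real.pi) y = f t x y

/-- `f` is of class `Cⁿ` for times in `I`, up to the walls. -/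
def SmoothOn (n : WithTop ℕ∞) (I : Set ℝ) (f : ℝ → ℝ → ℝ → ℝ) : Prop :=
  ContDiffOn ℝ n (fun z : ℝ × ℝ × ℝ => f z.1 z.2.1 z.2.2) (I ×ˢ univ ×ˢ Icc 0 1)

/-! ## Gevrey norms -/

/-- The bracket `⟨k⟩ = (1 + k²)^(1/2)`. -/
def bracket (k : ℤ) : ℝ := Real.sqrt (1 + (k : ℝ) ^ 2)

/-- The squared norm `‖e^{τ⟨D⟩^{2/3}} g‖²` in `H^r` of the torus, for a function `g` of `x`,
normalised so that it is the squared `L²` norm over one period when `r = τ = 0`. -/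
def traceNormSq (r τ : ℝ) (g : ℝ → ℝ) : ℝ≥0∞ :=
  ENNReal.ofReal (2 * Real.pi) * ∑' k : ℤ, ENNReal.ofReal
    ((bracket k ^ r * Real.exp (τ * bracket k ^ (2 / 3 : ℝ)) *
      ‖fourierCoeffOn Real.two_pi_pos (fun x => (g x : ℂ)) k‖) ^ 2)

/-- The squared norm of `X^r_τ`: the squared norm `‖e^{τ⟨D_x⟩^{2/3}} f‖²` in `H^{r,0}` of the
strip, that is `H^r` in `x` and `L²` in `y`, for a function `f x y`. -/
def normSq (r τ : ℝ) (f : ℝ → ℝ → ℝ) : ℝ≥0∞ :=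
  ∫⁻ y in Ioo (0 : ℝ) 1, traceNormSq r τ (fun x => f x y)

/-- The squared `X^r_τ` norm of the anisotropic gradient `(ε ∂ₓ f, ∂ᵧ f)` at time `t`. -/
def gradNormSq (ε r τ : ℝ) (f : ℝ → ℝ → ℝ → ℝ) (t : ℝ) : ℝ≥0∞ :=
  normSq r τ (fun x y => ε * dx f t x y) + normSq r τ (dy f t)

/-- The squared boundary `X^r_τ` norm of `(ε ∂ₓ f, ∂ᵧ f)` at the wall `y = b`, at time `t`. -/
def gradTraceSqAt (ε r τ : ℝ) (f : ℝ → ℝ → ℝ → ℝ) (t b : ℝ) : ℝ≥0∞ :=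
  traceNormSq r τ (fun x => ε * dx f t x b) + traceNormSq r τ (fun x => dy f t x b)

/-- The squared boundary norm of the anisotropic gradient on both walls together. -/
def gradTraceSq (ε r τ : ℝ) (f : ℝ → ℝ → ℝ → ℝ) (t : ℝ) : ℝ≥0∞ :=
  gradTraceSqAt ε r τ f t 0 + gradTraceSqAt ε r τ f t 1

/-- The radius of Gevrey regularity at time `t`. -/
def radius (lam t : ℝ) : ℝ := 1 - lam * t

/-! ## The approximate solution -/

/-- `(u, v, p)` is a classical solution, for `0 < t < T`, of the hydrostatic Navier-Stokes /
Prandtl system with no-slip walls. The velocity and, as a consequence of the equations, the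
pressure gradient are periodic in `x`; the pressure may have a nonzero increment over a period. -/
structure IsHydrostatic (T : ℝ) (u v p : ℝ → ℝ → ℝ → ℝ) : Prop where
  smooth_u : SmoothOn 4 (Ioo 0 T) u
  smooth_v : SmoothOn 3 (Ioo 0 T) v
  smooth_p : SmoothOn 2 (Ioo 0 T) p
  periodic_u : PeriodicX u
  periodic_v : PeriodicX v
  momentum : ∀ t ∈ Ioo 0 T, ∀ x, ∀ y ∈ Ioo (0 : ℝ) 1,
    dt u t x y + u t x y * dx u t x y + v t x y * dy u t x y - dy (dy u) t x y
      + dx p t x y = 0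
  hydrostatic : ∀ t ∈ Ioo 0 T, ∀ x, ∀ y ∈ Ioo (0 : ℝ) 1, dy p t x y = 0
  divFree : ∀ t ∈ Ioo 0 T, ∀ x, ∀ y ∈ Ioo (0 : ℝ) 1, dx u t x y + dy v t x y = 0
  noSlip : ∀ t ∈ Ioo 0 T, ∀ x, ∀ y ∈ ({0, 1} : Set ℝ), u t x y = 0 ∧ v t x y = 0

/-- `(u₂, v₂, p₂)` is a classical solution, for `0 < t < T`, of the linear system for the second
order corrector to the hydrostatic flow with velocity `(u₀, v₀)`. -/
structure IsCorrector (T : ℝ) (u₀ v₀ u₂ v₂ p₂ : ℝ → ℝ → ℝ → ℝ) : Prop where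
  smooth_u : SmoothOn 4 (Ioo 0 T) u₂
  smooth_v : SmoothOn 3 (Ioo 0 T) v₂
  smooth_p : SmoothOn 2 (Ioo 0 T) p₂
  periodic_u : PeriodicX u₂
  periodic_v : PeriodicX v₂
  momentum : ∀ t ∈ Ioo 0 T, ∀ x, ∀ y ∈ Ioo (0 : ℝ) 1,
    dt u₂ t x y + u₀ t x y * dx u₂ t x y + v₀ t x y * dy u₂ t x y
      + u₂ t x y * dx u₀ t x y + v₂ t x y * dy u₀ t x y + dx p₂ t x y - dy (dy u₂) t x y
      = - dx (dx u₀) t x y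
  normal : ∀ t ∈ Ioo 0 T, ∀ x, ∀ y ∈ Ioo (0 : ℝ) 1,
    dy p₂ t x y = -(dt v₀ t x y + u₀ t x y * dx v₀ t x y + v₀ t x y * dy v₀ t x y
      - dy (dy v₀) t x y)
  divFree : ∀ t ∈ Ioo 0 T, ∀ x, ∀ y ∈ Ioo (0 : ℝ) 1, dx u₂ t x y + dy v₂ t x y = 0
  noSlip : ∀ t ∈ Ioo 0 T, ∀ x, ∀ y ∈ ({0, 1} : Set ℝ), u₂ t x y = 0 ∧ v₂ t x y = 0

/-- The composite profile `f₀ + ε² f₂`. -/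
def composite (ε : ℝ) (f₀ f₂ : ℝ → ℝ → ℝ → ℝ) (t x y : ℝ) : ℝ := f₀ t x y + ε ^ 2 * f₂ t x y

/-- For `0 < t < T`, `(u, v)` has Gevrey norms `‖v‖_{X^{m-1}}`, `‖u‖_{X^m}`, `‖∂ᵧ u‖_{X^m}`,
`‖∂ᵧ³ u‖_{X^{m-4}}` with root sum of squares at most `M`, the radius being `1 - lam * t`. -/
def GevreyBound (T lam M m : ℝ) (u v : ℝ → ℝ → ℝ → ℝ) : Prop :=
  ∀ t ∈ Ioo 0 T,
    normSq (m - 1) (radius lam t) (v t) + normSq m (radius lam t) (u t)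
      + normSq m (radius lam t) (dy u t) + normSq (m - 4) (radius lam t) (dy (dy (dy u)) t)
      ≤ ENNReal.ofReal (M ^ 2)

/-! ## The vorticity problem with artificial boundary conditions -/

/-- `φ` is a solution on the time interval from `0` to `T`, classical for positive times, of the
linearised vorticity equation around the flow `(u, v)`, whose vorticity is `∂ᵧ u`, with sources
`Nu`, `Nv`, `f₁`, `f₂`, `C`, with the conditions `φ = Δ_ε φ = 0` on the walls, and with zero initial
datum; the initial vorticity is attained in `L²`. -/
structure IsSlipSolution (ε T : ℝ) (u v Nu Nv f₁ f₂ : ℝ → ℝ → ℝ → ℝ) (C : ℝ → ℝ)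
    (φ : ℝ → ℝ → ℝ → ℝ) : Prop where
  smooth : SmoothOn 4 (Ioc 0 T) φ
  periodic : PeriodicX φ
  equation : ∀ t ∈ Ioo 0 T, ∀ x, ∀ y ∈ Ioo (0 : ℝ) 1,
    dt (lap ε φ) t x y - lap ε (lap ε φ) t x y
      + u t x y * dx (lap ε φ) t x y + v t x y * dy (lap ε φ) t x y
      + dy φ t x y * dx (dy u) t x y - dx φ t x y * dy (dy u) t x y
      = dy Nu t x y - ε ^ 2 * dx Nv t x y + ε ^ 2 * f₁ t x y + f₂ t x y - C t * dx (dy u) t x y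
  dirichlet : ∀ t ∈ Ioc 0 T, ∀ x, ∀ y ∈ ({0, 1} : Set ℝ), φ t x y = 0
  slip : ∀ t ∈ Ioc 0 T, ∀ x, ∀ y ∈ ({0, 1} : Set ℝ), lap ε φ t x y = 0
  initial : ∀ x, ∀ y ∈ Icc (0 : ℝ) 1, φ 0 x y = 0
  initial_vorticity : Tendsto (fun t => normSq 0 0 (lap ε φ t)) (𝓝[>] 0) (𝓝 0)

end

end HydroNS

/-!
The difficulty is that the term `∂ₓφ ∂ᵧω^p` costs a derivative in `x` relative to the vorticity
`ω`, with nothing but the shrinking of the Gevrey radius, which gains `1/3` of a derivative on each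
factor of the energy, to pay for it. The convexity `∂ᵧω^p ≥ c₀` removes this loss by the
hydrostatic trick. Let `g` be the weighted vorticity `⟨D⟩² e^{τ⟨D⟩^{2/3}} ω`, let `b = ∂ᵧω^p`, and
test the equation for `g` with `h = g / b`. The dangerous term becomes the integral of `∂ₓΦ · g`,
where `Φ` is the weighted stream function, plus a commutator. The first vanishes exactly, because
`∂ₓΦ` is orthogonal to `Δ_ε Φ = g` (`Stream.I2_dx_mul_vort`); the second loses only `2/3` of a
derivative, `1/3` for each factor (`commutator_deriv_bound`), since on the Gevrey weight
`|w(k) - w(l)| |l|` is at most a constant times `⟨k⟩^{1/3} ⟨l⟩^{1/3} w(l)` and a factor that grows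
like the weight itself in `k - l`, absorbed by the Fourier coefficients of the profile
(`weight_sub_mul_le`). The loss in the transport by `u^p` is a commutator of the same kind. The
decay of the radius gives `-λ ⟨b^{-1} ⟨D⟩^{2/3} g, g⟩`, which is coercive up to a commutator
(`gain_coercive`), and for `λ` large it absorbs all of this. As `ω` vanishes on the walls, so does
`h`, and the diffusion gives the dissipation without boundary terms (`Slice.production_le`).

The weight `1 / b` in `h` is itself differentiated in time, which involves `∂ₜ∂ᵧω^p`. After an
integration by parts in `y` only `∂ₜω^p` is needed, and this is bounded by the vorticity equations
of the two profiles (`abs_dt_vorticity_le`); the pressure of the corrector brings in `∂ₜ∂ₓv_p^0`,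
which is bounded through the fact that the hydrostatic pressure gradient does not depend on `y`
(`IsHydrostatic.abs_dx_dt_v_le`). Like `∂ᵧ³u^p`, this quantity is only square integrable in `y`,
and the dissipation compensates for that (`I2_sq_mul_sq_le`).

All of these operations have to be legitimate for a solution which is merely of class `C⁴`. So the
weight is truncated: it is a function of `min |k| N`, hence a multiple of the identity plus a finite
sum of spectral projections, and acts on continuous functions (`mult`). Since `k ↦ min |k| N` is a
contraction, all symbol estimates survive with constants independent of `N`. The Gronwall argument
is run for each `N` on compact time intervals (`Evolution.integrated`). A truncated norm is at most
a constant times the `L²` norm, so the initial energy tends to zero with the initial time; then `N`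
tends to infinity by monotone convergence in `[0, ∞]` (`normSq_eq_iSup`). The norms of the velocity
and of its traces follow from elliptic estimates for the Dirichlet problem (`Stream.grad_le`,
`Stream.trace_le`).
-/

namespace HydroNS

noncomputable section

section

/-! ### Fourier coefficients on a period -/

/-- The Fourier coefficient of index `k` of a complex function on the period from `0` to `2π`. -/
def cfc (f : ℝ → ℂ) (k : ℤ) : ℂ := fourierCoeffOn Real.two_pi_pos f k

/-- The Fourier coefficient of index `k` of a real function on the period from `0` to `2π`. -/
def fc (f : ℝ → ℝ) (k : ℤ) : ℂ := cfc (fun x => (f x : ℂ)) k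

/-- The character `x ↦ e^{ikx}`. -/
def char (k : ℤ) (x : ℝ) : ℂ := Complex.exp (Complex.I * k * x)

lemma char_eq_fourier (k : ℤ) (x : ℝ) :
    fourier k (x : AddCircle (2 * Real.pi - 0)) = char k x := by
  rw [fourier_coe_apply, char]
  congr 1
  have : (Real.pi : ℂ) ≠ 0 := by exact_mod_cast Real.pi_ne_zero
  push_cast
  field_simp
  ring

@[fun_prop] lemma continuous_char (k : ℤ) : Continuous (char k) := by
  unfold char; fun_prop

lemma char_eq (k : ℤ) (x : ℝ) :
    char k x = Real.cos (k * x) + Real.sin (k * x) * Complex.I := by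
  rw [char, show Complex.I * k * x = ((k * x : ℝ) : ℂ) * Complex.I by push_cast; ring,
    Complex.exp_mul_I]
  push_cast; ring

lemma conj_char (k : ℤ) (x : ℝ) : (starRingEnd ℂ) (char k x) = char (-k) x := by
  rw [char, char, ← Complex.exp_conj]
  simp

lemma char_mul (k l : ℤ) (x : ℝ) : char k x * char l x = char (k + l) x := by
  rw [char, char, char, ← Complex.exp_add]; congr 1; push_cast; ring

lemma cfc_eq_integral (f : ℝ → ℂ) (k : ℤ) :
    cfc f k = (1 / (2 * Real.pi) : ℝ) • ∫ x in 0..2 * Real.pi, char (-k) x * f x := by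
  rw [cfc, fourierCoeffOn_eq_integral]
  simp only [char_eq_fourier, smul_eq_mul, sub_zero]

/-- Parseval's identity on the interval from `0` to `2π`; no periodicity is needed. -/
lemma hasSum_conj_cfc_mul_cfc {f g : ℝ → ℂ} (hf : Continuous f) (hg : Continuous g) :
    HasSum (fun k => (starRingEnd ℂ) (cfc f k) * cfc g k)
      ((1 / (2 * Real.pi) : ℝ) • ∫ x in 0..2 * Real.pi, (starRingEnd ℂ) (f x) * g x) := by
  have hab : (0 : ℝ) < 2 * Real.pi := Real.two_pi_pos
  have := Fact.mk (by linarith : 0 < 2 * Real.pi - 0)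
  have mem : ∀ {f : ℝ → ℂ}, Continuous f →
      MemLp f 2 (volume.restrict (Ioc (0 : ℝ) (0 + (2 * Real.pi - 0)))) := by
    intro f hf
    obtain ⟨B, hB⟩ := isCompact_Icc.exists_bound_of_continuousOn
      (s := Icc (0 : ℝ) (0 + (2 * Real.pi - 0))) hf.continuousOn
    refine MemLp.of_bound hf.aestronglyMeasurable B ?_
    filter_upwards [ae_restrict_mem measurableSet_Ioc] with x hx
    exact hB x (Ioc_subset_Icc_self hx)
  have h1 := (mem hf).memLp_liftIoc.haarAddCircle
  have h2 := (mem hg).memLp_liftIoc.haarAddCircle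
  have key := fourierBasis.hasSum_inner_mul_inner h1.toLp h2.toLp
  have e : ∀ (F : Lp ℂ 2 <| @AddCircle.haarAddCircle (2 * Real.pi - 0) _) (i : ℤ),
      inner ℂ (fourierBasis i) F = fourierCoeff F i := by
    intro F i
    rw [← fourierBasis_repr, HilbertBasis.repr_apply_apply]
  have e1 : ∀ k, (starRingEnd ℂ) (cfc f k) * cfc g k
      = inner ℂ h1.toLp (fourierBasis k) * inner ℂ (fourierBasis k) h2.toLp := by
    intro i
    rw [← inner_conj_symm (h1.toLp), e, e, fourierCoeff_congr_ae h1.coeFn_toLp,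
      fourierCoeff_congr_ae h2.coeFn_toLp]
    rfl
  have e2 : (1 / (2 * Real.pi) : ℝ) • ∫ x in 0..2 * Real.pi, (starRingEnd ℂ) (f x) * g x
      = inner ℂ h1.toLp h2.toLp := by
    rw [L2.inner_def]
    simp only [RCLike.inner_apply']
    rw [integral_congr_ae (g := fun x => (starRingEnd ℂ)
      (AddCircle.liftIoc (2 * Real.pi - 0) 0 f x) * AddCircle.liftIoc (2 * Real.pi - 0) 0 g x)]
    · rw [AddCircle.integral_haarAddCircle]
      have := AddCircle.integral_liftIoc_eq_intervalIntegral (T := 2 * Real.pi - 0) (t := 0)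
        (f := fun x => (starRingEnd ℂ) (f x) * g x)
      rw [zero_add] at this
      have e3 : ∫ x in 0..2 * Real.pi, (starRingEnd ℂ) (f x) * g x
          = ∫ x in 0..2 * Real.pi - 0, (starRingEnd ℂ) (f x) * g x := by rw [sub_zero]
      have e4 : 1 / (2 * Real.pi) = (2 * Real.pi - 0)⁻¹ := by rw [sub_zero, one_div]
      rw [e3, ← this, e4]
      rfl
    · filter_upwards [h1.coeFn_toLp, h2.coeFn_toLp] with x hx hy
      rw [hx, hy]
  rw [e2]
  simp only [e1]
  exact key

/-- The Fourier coefficients of a product are the convolution of the Fourier coefficients. -/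
lemma hasSum_fc_mul {b f : ℝ → ℝ} (hb : Continuous b) (hf : Continuous f) (k : ℤ) :
    HasSum (fun l => fc b (k - l) * fc f l) (fc (fun x => b x * f x) k) := by
  have := hasSum_conj_cfc_mul_cfc (f := fun x => (b x : ℂ) * char k x) (g := fun x => (f x : ℂ))
    (by fun_prop) (by fun_prop)
  convert this using 1
  · ext l
    rw [fc, fc]
    congr 1
    rw [cfc_eq_integral, cfc_eq_integral, Complex.real_smul, Complex.real_smul, map_mul,
      Complex.conj_ofReal, ← intervalIntegral.intervalIntegral_conj]
    congr 1
    apply intervalIntegral.integral_congr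
    intro x _
    simp only [map_mul, conj_char, Complex.conj_ofReal]
    rw [mul_left_comm, char_mul, mul_comm]
    congr 2
    ring
  · rw [fc, cfc_eq_integral]
    congr 1
    apply intervalIntegral.integral_congr
    intro x _
    simp only [map_mul, conj_char, Complex.conj_ofReal]
    push_cast; ring

lemma hasSum_conj_fc_mul_fc {f g : ℝ → ℝ} (hf : Continuous f) (hg : Continuous g) :
    HasSum (fun k => (starRingEnd ℂ) (fc f k) * fc g k)
      (((1 / (2 * Real.pi)) * ∫ x in 0..2 * Real.pi, f x * g x : ℝ) : ℂ) := by
  have := hasSum_conj_cfc_mul_cfc (f := fun x => (f x : ℂ)) (g := fun x => (g x : ℂ))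
    (by fun_prop) (by fun_prop)
  have e : (((1 / (2 * Real.pi)) * ∫ x in 0..2 * Real.pi, f x * g x : ℝ) : ℂ)
      = (1 / (2 * Real.pi) : ℝ) • ∫ x in 0..2 * Real.pi,
        (starRingEnd ℂ) (f x : ℂ) * (g x : ℂ) := by
    simp only [Complex.conj_ofReal, Complex.real_smul, ← Complex.ofReal_mul]
    rw [intervalIntegral.integral_ofReal]
    push_cast
    rfl
  rw [e]
  exact this

lemma hasSum_sq_fc {f : ℝ → ℝ} (hf : Continuous f) :
    HasSum (fun k => ‖fc f k‖ ^ 2) ((1 / (2 * Real.pi)) * ∫ x in 0..2 * Real.pi, f x ^ 2) := by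
  have := hasSum_conj_fc_mul_fc hf hf
  rw [← Complex.hasSum_ofReal]
  have e : ∀ k, ((‖fc f k‖ ^ 2 : ℝ) : ℂ) = (starRingEnd ℂ) (fc f k) * fc f k := fun k => by
    rw [mul_comm, Complex.mul_conj, Complex.normSq_eq_norm_sq]
  simp only [e, pow_two (f _)]
  exact this

/-- Parseval's identity with values in `[0, ∞]`. -/
lemma tsum_ofReal_sq_fc {f : ℝ → ℝ} (hf : Continuous f) :
    ENNReal.ofReal (2 * Real.pi) * ∑' k, ENNReal.ofReal (‖fc f k‖ ^ 2)
      = ENNReal.ofReal (∫ x in 0..2 * Real.pi, f x ^ 2) := by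
  have h := hasSum_sq_fc hf
  rw [← ENNReal.ofReal_tsum_of_nonneg (fun _ => by positivity) h.summable, h.tsum_eq,
    ← ENNReal.ofReal_mul Real.two_pi_pos.le]
  congr 1
  field_simp

lemma eq_zero_of_integral_sq {f : ℝ → ℝ} {a b : ℝ} (hab : a < b) (hf : Continuous f)
    (h : ∫ x in a..b, f x ^ 2 = 0) : ∀ x ∈ Icc a b, f x = 0 := by
  by_contra! hx
  obtain ⟨x, hx, hfx⟩ := hx
  have := intervalIntegral.integral_pos hab (f := fun x => f x ^ 2) (by fun_prop)
    (fun x _ => by positivity) ⟨x, hx, by positivity⟩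
  linarith

/-- A continuous periodic function is determined by its Fourier coefficients. -/
lemma eq_of_fc_eq {f g : ℝ → ℝ} (hf : Continuous f) (hg : Continuous g)
    (pf : Function.Periodic f (2 * Real.pi)) (pg : Function.Periodic g (2 * Real.pi))
    (h : ∀ k, fc f k = fc g k) : f = g := by
  have hd : ∀ k, fc (fun x => f x - g x) k = 0 := by
    intro k
    have : fc (fun x => f x - g x) k = fc f k - fc g k := by
      simp only [fc, cfc_eq_integral, Complex.ofReal_sub, mul_sub]
      rw [intervalIntegral.integral_sub, smul_sub]
      · exact Continuous.intervalIntegrable (by fun_prop) _ _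
      · exact Continuous.intervalIntegrable (by fun_prop) _ _
    rw [this, h, sub_self]
  have hz := hasSum_sq_fc (f := fun x => f x - g x) (by fun_prop)
  simp only [hd, norm_zero, ne_eq, OfNat.ofNat_ne_zero, not_false_eq_true, zero_pow] at hz
  have h0 := hz.unique hasSum_zero
  have h1 : ∫ x in 0..2 * Real.pi, (f x - g x) ^ 2 = 0 := by
    have := Real.pi_pos
    field_simp at h0
    linarith
  have h2 := eq_zero_of_integral_sq Real.two_pi_pos (f := fun x => f x - g x) (by fun_prop) h1
  have pd : Function.Periodic (fun x => f x - g x) (2 * Real.pi) := pf.sub pg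
  ext x
  obtain ⟨y, hy, hxy⟩ := pd.exists_mem_Ico₀ Real.two_pi_pos x
  have := h2 y (Ico_subset_Icc_self hy)
  linarith

lemma fc_deriv {f f' : ℝ → ℝ} (hf : ∀ x, HasDerivAt f (f' x) x) (hf' : Continuous f')
    (pf : Function.Periodic f (2 * Real.pi)) (k : ℤ) :
    fc f' k = Complex.I * k * fc f k := by
  have hc : Continuous f := continuous_iff_continuousAt.2 fun x => (hf x).continuousAt
  rw [fc, fc, cfc_eq_integral, cfc_eq_integral, mul_smul_comm]
  congr 1
  have d1 : ∀ x : ℝ, HasDerivAt (char (-k)) (-Complex.I * k * char (-k) x) x := by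
    intro x
    have := ((hasDerivAt_id (x : ℂ)).const_mul (Complex.I * (-k : ℤ))).cexp.comp_ofReal
    simp only [id, Int.cast_neg, mul_one] at this
    have e : -Complex.I * k * char (-k) x
        = Complex.exp (Complex.I * -↑k * ↑x) * (Complex.I * -↑k) := by
      simp only [char]; push_cast; ring
    rw [e]
    have e' : char (-k) = fun y : ℝ => Complex.exp (Complex.I * -↑k * ↑y) := by
      ext y; simp only [char]; push_cast; rfl
    rw [e']
    exact this
  have := intervalIntegral.integral_mul_deriv_eq_deriv_mul (a := 0) (b := 2 * Real.pi)
    (u := char (-k)) (v := fun x => (f x : ℂ)) (u' := fun x => -Complex.I * k * char (-k) x)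
    (v' := fun x => (f' x : ℂ)) (fun x _ => d1 x) (fun x _ => (hf x).ofReal_comp)
    (Continuous.intervalIntegrable (by fun_prop) _ _)
    (Continuous.intervalIntegrable (by fun_prop) _ _)
  rw [this]
  have e0 : f (2 * Real.pi) = f 0 := by simpa using pf 0
  have e1 : char (-k) (2 * Real.pi) = char (-k) 0 := by
    rw [char, char]
    have := Complex.exp_int_mul_two_pi_mul_I (-k)
    simp only [Complex.ofReal_zero, mul_zero, Complex.exp_zero]
    rw [← this]; congr 1; push_cast; ring
  rw [e0, e1, sub_self, zero_sub, ← intervalIntegral.integral_neg,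
    ← intervalIntegral.integral_const_mul]
  apply intervalIntegral.integral_congr
  intro x _
  ring

/-- An absolutely summable Fourier series bounds the function. -/
lemma abs_le_tsum_norm_fc {f : ℝ → ℝ} (hf : Continuous f)
    (pf : Function.Periodic f (2 * Real.pi)) (h : Summable fun k => ‖fc f k‖) (x : ℝ) :
    |f x| ≤ ∑' k, ‖fc f k‖ := by
  have := Fact.mk (by linarith [Real.two_pi_pos] : 0 < 2 * Real.pi)
  have pf' : Function.Periodic (fun x => (f x : ℂ)) (2 * Real.pi) := fun x => by simp [pf x]
  let F : C(AddCircle (2 * Real.pi), ℂ) := ⟨pf'.lift, continuous_coinduced_dom.mpr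
    (by change Continuous (fun x => (f x : ℂ)); fun_prop)⟩
  have hF : ∀ k, fourierCoeff F k = fc f k := by
    intro k
    rw [fc, cfc_eq_integral, fourierCoeff_eq_intervalIntegral _ _ 0]
    simp only [zero_add]
    congr 1
    apply intervalIntegral.integral_congr
    intro x _
    have : fourier (-k) (x : AddCircle (2 * Real.pi)) = char (-k) x := by
      rw [← char_eq_fourier]
      rw [fourier_coe_apply, fourier_coe_apply, sub_zero]
    simp only [this, smul_eq_mul]
    congr 1
  have hs : Summable (fourierCoeff F) := by
    apply Summable.of_norm; simpa only [hF] using h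
  have h1 := has_pointwise_sum_fourier_series_of_summable hs (x : AddCircle (2 * Real.pi))
  have h2 : ‖F (x : AddCircle (2 * Real.pi))‖ ≤ ∑' k, ‖fc f k‖ := by
    rw [← h1.tsum_eq]
    refine tsum_of_norm_bounded h.hasSum fun k => ?_
    rw [norm_smul, hF, fourier_apply, Circle.norm_coe, mul_one]
  have h3 : F (x : AddCircle (2 * Real.pi)) = (f x : ℂ) := rfl
  rw [h3, Complex.norm_real] at h2
  exact h2

/-! ### Young's inequality for sequences -/

lemma ennreal_two_mul_le (a b : ℝ≥0∞) : 2 * (a * b) ≤ a ^ 2 + b ^ 2 := by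
  induction a using ENNReal.recTopCoe with
  | top => simp
  | coe a =>
    induction b using ENNReal.recTopCoe with
    | top => simp
    | coe b =>
      norm_cast
      have := two_mul_le_add_sq (a : ℝ) b
      rw [← NNReal.coe_le_coe]
      push_cast
      linarith

/-- The Cauchy-Schwarz inequality for the weights `κ`. -/
lemma sq_tsum_mul_le {ι : Type*} (κ x : ι → ℝ≥0∞) :
    (∑' l, κ l * x l) ^ 2 ≤ (∑' l, κ l) * ∑' l, κ l * x l ^ 2 := by
  have h : 2 * (∑' l, κ l * x l) ^ 2 ≤ 2 * ((∑' l, κ l) * ∑' l, κ l * x l ^ 2) := by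
    calc 2 * (∑' l, κ l * x l) ^ 2
        = ∑' l, ∑' m, κ l * κ m * (2 * (x l * x m)) := by
          rw [pow_two, ← ENNReal.tsum_mul_right, ← ENNReal.tsum_mul_left]
          refine tsum_congr fun l => ?_
          rw [← ENNReal.tsum_mul_left, ← ENNReal.tsum_mul_left]
          refine tsum_congr fun m => ?_
          ring
      _ ≤ ∑' l, ∑' m, (κ m * (κ l * x l ^ 2) + κ l * (κ m * x m ^ 2)) := by
          refine ENNReal.tsum_le_tsum fun l => ENNReal.tsum_le_tsum fun m => ?_
          calc _ ≤ κ l * κ m * (x l ^ 2 + x m ^ 2) := by gcongr; exact ennreal_two_mul_le _ _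
            _ = _ := by ring
      _ = 2 * ((∑' l, κ l) * ∑' l, κ l * x l ^ 2) := by
          simp_rw [ENNReal.tsum_add, ENNReal.tsum_mul_left, ENNReal.tsum_mul_right]
          rw [ENNReal.tsum_mul_left]
          ring
  exact (ENNReal.mul_le_mul_iff_right (by simp) (by simp)).1 h

/-- Young's inequality: convolution with a summable sequence is bounded on `ℓ²`. -/
lemma tsum_sq_conv_le (κ x : ℤ → ℝ≥0∞) :
    ∑' k, (∑' l, κ (k - l) * x l) ^ 2 ≤ (∑' j, κ j) ^ 2 * ∑' l, x l ^ 2 := by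
  have e1 : ∀ k : ℤ, ∑' l, κ (k - l) = ∑' j, κ j := fun k =>
    (Equiv.subLeft k).tsum_eq κ
  have e2 : ∀ l : ℤ, ∑' k, κ (k - l) = ∑' j, κ j := fun l =>
    (Equiv.subRight l).tsum_eq κ
  calc ∑' k, (∑' l, κ (k - l) * x l) ^ 2
      ≤ ∑' k, (∑' j, κ j) * ∑' l, κ (k - l) * x l ^ 2 := by
        refine ENNReal.tsum_le_tsum fun k => ?_
        rw [← e1 k]; exact sq_tsum_mul_le _ _
    _ = (∑' j, κ j) ^ 2 * ∑' l, x l ^ 2 := by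
        rw [ENNReal.tsum_mul_left, ENNReal.tsum_comm]
        simp_rw [ENNReal.tsum_mul_right, e2]
        rw [ENNReal.tsum_mul_left]; ring

end

section

/-! ### Weights -/

/-- The weight `⟨n⟩^(1/3)`, half of the derivative of order `2/3` that the shrinking radius gains. -/
def th (n : ℕ) : ℝ := bracket n ^ (1 / 3 : ℝ)

/-- The weight `⟨n⟩² e^{τ⟨n⟩^(2/3)}` of the `X²` norm. With `X = th n` it is `X⁶ e^{τX²}`, and the
symbol estimates below are inequalities between such expressions. -/
def gw (τ : ℝ) (n : ℕ) : ℝ := th n ^ 6 * Real.exp (τ * th n ^ 2)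

lemma bracket_pos (k : ℤ) : 0 < bracket k := by unfold bracket; positivity

lemma one_le_bracket (k : ℤ) : 1 ≤ bracket k := by
  rw [bracket, Real.one_le_sqrt]; nlinarith [sq_nonneg (k : ℝ)]

lemma bracket_sq (k : ℤ) : bracket k ^ 2 = 1 + (k : ℝ) ^ 2 := by
  rw [bracket, Real.sq_sqrt (by positivity)]

lemma bracket_natAbs (k : ℤ) : bracket (k.natAbs : ℤ) = bracket k := by
  simp [bracket]

lemma abs_le_bracket (k : ℤ) : |(k : ℝ)| ≤ bracket k := by
  apply Real.le_sqrt_of_sq_le; rw [sq_abs]; linarith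

lemma bracket_sub_le (m n : ℤ) : |bracket m - bracket n| ≤ |(m : ℝ) - n| := by
  have h1 := bracket_sq m
  have h2 := bracket_sq n
  have p1 := abs_le_bracket m
  have p2 := abs_le_bracket n
  have q1 := bracket_pos m
  have q2 := bracket_pos n
  have e : (bracket m - bracket n) * (bracket m + bracket n) = ((m : ℝ) - n) * (m + n) := by
    nlinarith
  have e2 := congrArg abs e
  rw [abs_mul, abs_mul, abs_of_pos (by linarith : 0 < bracket m + bracket n)] at e2
  have h3 : |(m : ℝ) + n| ≤ bracket m + bracket n := (abs_add_le _ _).trans (by linarith)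
  have h4 : |bracket m - bracket n| * (bracket m + bracket n)
      ≤ |(m : ℝ) - n| * (bracket m + bracket n) := by
    rw [e2]; gcongr
  exact le_of_mul_le_mul_right h4 (by linarith)

lemma bracket_mono {m n : ℕ} (h : m ≤ n) : bracket m ≤ bracket n := by
  unfold bracket; gcongr

lemma th_cube (n : ℕ) : th n ^ 3 = bracket n := by
  rw [th, ← Real.rpow_natCast, ← Real.rpow_mul (bracket_pos _).le]; norm_num

lemma one_le_th (n : ℕ) : 1 ≤ th n := Real.one_le_rpow (one_le_bracket _) (by norm_num)

lemma th_pos (n : ℕ) : 0 < th n := by linarith [one_le_th n]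

lemma gw_pos (τ : ℝ) (n : ℕ) : 0 < gw τ n := by
  have := th_pos n; unfold gw; positivity

lemma th_mono {m n : ℕ} (h : m ≤ n) : th m ≤ th n :=
  Real.rpow_le_rpow (bracket_pos _).le (bracket_mono h) (by norm_num)

lemma th_sq (n : ℕ) : th n ^ 2 = bracket n ^ (2 / 3 : ℝ) := by
  rw [th, ← Real.rpow_natCast, ← Real.rpow_mul (bracket_pos _).le]; norm_num

/-- The frequency `|k|`, truncated at `N`. It is `1`-Lipschitz in `k`. -/
def tr (N : ℕ) (k : ℤ) : ℕ := min k.natAbs N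

lemma th_tr_sub_le (N : ℕ) (k l : ℤ) :
    |th (tr N k) ^ 3 - th (tr N l) ^ 3| ≤ th (k - l).natAbs ^ 3 := by
  rw [th_cube, th_cube, th_cube, bracket_natAbs]
  refine (bracket_sub_le _ _).trans (le_trans ?_ (abs_le_bracket _))
  have : |((tr N k : ℤ)) - (tr N l : ℤ)| ≤ |k - l| := by
    simp only [tr, Int.abs_eq_natAbs]; omega
  exact_mod_cast this

/-- Where the truncated frequencies differ, one of them is below the truncation, so that `|l|` is
controlled by the truncated frequency. Where they agree, the symbol of a commutator vanishes. -/
lemma abs_le_of_tr_ne {N : ℕ} {k l : ℤ} (h : tr N k ≠ tr N l) :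
    |(l : ℝ)| ≤ th (tr N l) ^ 3 + th (k - l).natAbs ^ 3 := by
  rw [th_cube, th_cube, bracket_natAbs]
  have h1 : |l| ≤ (tr N l : ℤ) + |k - l| := by
    simp only [tr, Int.abs_eq_natAbs] at *; omega
  have h2 : |(l : ℝ)| ≤ ((tr N l : ℤ) : ℝ) + |((k - l : ℤ) : ℝ)| := by exact_mod_cast h1
  have h3 := abs_le_bracket (tr N l)
  have h4 := abs_le_bracket (k - l)
  have h5 := le_abs_self ((tr N l : ℤ) : ℝ)
  linarith

section Real
variable {X Y J τ : ℝ}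

lemma cube_le_of_abs_sub (hY : 1 ≤ Y) (hJ : 1 ≤ J) (h : |X ^ 3 - Y ^ 3| ≤ J ^ 3) :
    X ^ 3 ≤ 2 * Y ^ 3 * J ^ 3 := by
  have h1 := (abs_le.1 h).2
  have h2 : 1 ≤ Y ^ 3 := one_le_pow₀ hY
  have h3 : 1 ≤ J ^ 3 := one_le_pow₀ hJ
  nlinarith

lemma le_of_abs_cube_sub (hY : 1 ≤ Y) (hJ : 1 ≤ J) (h : |X ^ 3 - Y ^ 3| ≤ J ^ 3) :
    X ≤ 2 * Y * J := by
  refine le_of_pow_le_pow_left₀ (n := 3) (by norm_num) (by positivity) ?_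
  have := cube_le_of_abs_sub hY hJ h
  have : 0 ≤ Y ^ 3 * J ^ 3 := by positivity
  nlinarith

/-- Subadditivity of `⟨k⟩ ↦ ⟨k⟩^{2/3}`, for `X`, `Y`, `J` the cube roots. -/
lemma sq_le_of_abs_cube_sub (hY : 1 ≤ Y) (hJ : 1 ≤ J)
    (h : |X ^ 3 - Y ^ 3| ≤ J ^ 3) (hX : 1 ≤ X) : X ^ 2 ≤ Y ^ 2 + J ^ 2 := by
  refine le_of_pow_le_pow_left₀ (n := 3) (by norm_num) (by positivity) ?_
  have h1 : X ^ 3 ≤ Y ^ 3 + J ^ 3 := by linarith [(abs_le.1 h).2]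
  have h2 : (X ^ 3) ^ 2 ≤ (Y ^ 3 + J ^ 3) ^ 2 := by gcongr
  have h3 : 0 ≤ Y ^ 2 * J ^ 2 * (Y ^ 2 + J ^ 2 - 2 / 3 * (Y * J)) := by
    apply mul_nonneg (by positivity)
    nlinarith [sq_nonneg (Y - J), mul_nonneg (by linarith : (0 : ℝ) ≤ Y) (by linarith : (0 : ℝ) ≤ J)]
  nlinarith

lemma abs_sub_le_cube (hX : 1 ≤ X) (hY : 1 ≤ Y) (h : |X ^ 3 - Y ^ 3| ≤ J ^ 3) :
    |X - Y| ≤ J ^ 3 := by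
  have e : X ^ 3 - Y ^ 3 = (X - Y) * (X ^ 2 + X * Y + Y ^ 2) := by ring
  have h1 : 1 ≤ X ^ 2 + X * Y + Y ^ 2 := by nlinarith
  rw [e, abs_mul, abs_of_pos (by linarith : 0 < X ^ 2 + X * Y + Y ^ 2)] at h
  nlinarith [abs_nonneg (X - Y)]

lemma abs_sq_sub_mul_le (hX : 1 ≤ X) (hY : 1 ≤ Y) (h : |X ^ 3 - Y ^ 3| ≤ J ^ 3) :
    |X ^ 2 - Y ^ 2| * Y ≤ J ^ 3 := by
  have e : X ^ 3 - Y ^ 3 = (X - Y) * (X ^ 2 + X * Y + Y ^ 2) := by ring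
  rw [e, abs_mul, abs_of_pos (by nlinarith : 0 < X ^ 2 + X * Y + Y ^ 2)] at h
  have e2 : X ^ 2 - Y ^ 2 = (X - Y) * (X + Y) := by ring
  rw [e2, abs_mul, abs_of_pos (by linarith : 0 < X + Y), mul_assoc]
  refine le_trans ?_ h
  gcongr
  nlinarith

lemma exp_sq_le (hτ0 : 0 ≤ τ) (hY : 1 ≤ Y) (hJ : 1 ≤ J) (hX : 1 ≤ X)
    (h : |X ^ 3 - Y ^ 3| ≤ J ^ 3) :
    Real.exp (τ * X ^ 2) ≤ Real.exp (τ * J ^ 2) * Real.exp (τ * Y ^ 2) := by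
  rw [← Real.exp_add, Real.exp_le_exp]
  nlinarith [sq_le_of_abs_cube_sub hY hJ h hX]

lemma abs_exp_sub_exp_le (p q : ℝ) :
    |Real.exp p - Real.exp q| ≤ |p - q| * max (Real.exp p) (Real.exp q) := by
  wlog hpq : q ≤ p generalizing p q
  · rw [abs_sub_comm, abs_sub_comm p, max_comm]; exact this q p (by linarith)
  have h1 := Real.add_one_le_exp (q - p)
  have h2 : Real.exp q = Real.exp (q - p) * Real.exp p := by rw [← Real.exp_add]; ring_nf
  have h3 := Real.exp_le_exp.2 hpq
  rw [max_eq_left h3, abs_of_nonneg (by linarith), abs_of_nonneg (by linarith)]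
  nlinarith [Real.exp_pos p]

/-- The weight is submultiplicative up to powers of the frequency difference. -/
lemma weight_le (hτ0 : 0 ≤ τ) (hX : 1 ≤ X) (hY : 1 ≤ Y) (hJ : 1 ≤ J)
    (h : |X ^ 3 - Y ^ 3| ≤ J ^ 3) :
    X ^ 6 * Real.exp (τ * X ^ 2)
      ≤ 4 * J ^ 9 * Real.exp (τ * J ^ 2) * (Y ^ 6 * Real.exp (τ * Y ^ 2)) := by
  have h1 := cube_le_of_abs_sub hY hJ h
  have h2 := exp_sq_le hτ0 hY hJ hX h
  have h3 : X ^ 6 ≤ 4 * J ^ 9 * Y ^ 6 := by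
    have : (X ^ 3) ^ 2 ≤ (2 * Y ^ 3 * J ^ 3) ^ 2 := by gcongr
    have h4 : J ^ 6 ≤ J ^ 9 := pow_le_pow_right₀ hJ (by norm_num)
    have h5 : Y ^ 6 * J ^ 6 ≤ Y ^ 6 * J ^ 9 := by gcongr
    nlinarith
  calc _ ≤ (4 * J ^ 9 * Y ^ 6) * (Real.exp (τ * J ^ 2) * Real.exp (τ * Y ^ 2)) := by gcongr
    _ = _ := by ring

/-- The symbol of a commutator of the Gevrey weight with a product, composed with a derivative,
loses `2/3` of a derivative, split evenly between the two frequencies. -/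
lemma weight_sub_mul_le {l : ℝ} (hτ0 : 0 ≤ τ) (hτ1 : τ ≤ 1) (hX : 1 ≤ X) (hY : 1 ≤ Y) (hJ : 1 ≤ J)
    (h : |X ^ 3 - Y ^ 3| ≤ J ^ 3) (hl : |l| ≤ Y ^ 3 + J ^ 3) :
    |X ^ 6 * Real.exp (τ * X ^ 2) - Y ^ 6 * Real.exp (τ * Y ^ 2)| * |l|
      ≤ 10 * J ^ 9 * Real.exp (τ * J ^ 2) * (X * (Y * (Y ^ 6 * Real.exp (τ * Y ^ 2)))) := by
  have c1 := cube_le_of_abs_sub hY hJ h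
  have c2 := exp_sq_le hτ0 hY hJ hX h
  have h' : |Y ^ 3 - X ^ 3| ≤ J ^ 3 := by rwa [abs_sub_comm]
  have c3 := le_of_abs_cube_sub hX hJ h'
  have Y3 : 1 ≤ Y ^ 3 := one_le_pow₀ hY
  have J3 : 1 ≤ J ^ 3 := one_le_pow₀ hJ
  have hl2 : |l| ≤ 2 * Y ^ 3 * J ^ 3 := by nlinarith
  set E := Real.exp (τ * J ^ 2) * Real.exp (τ * Y ^ 2) with hE
  have E0 : 0 < E := by positivity
  have eJ : 1 ≤ Real.exp (τ * J ^ 2) := Real.one_le_exp (by positivity)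
  have eY : Real.exp (τ * Y ^ 2) ≤ E := le_mul_of_one_le_left (Real.exp_pos _).le eJ
  have t1 : |X ^ 6 - Y ^ 6| ≤ 3 * J ^ 6 * Y ^ 3 := by
    rw [show X ^ 6 - Y ^ 6 = (X ^ 3 - Y ^ 3) * (X ^ 3 + Y ^ 3) by ring, abs_mul,
      abs_of_pos (by positivity : 0 < X ^ 3 + Y ^ 3)]
    calc _ ≤ J ^ 3 * (3 * (Y ^ 3 * J ^ 3)) := by gcongr; nlinarith
      _ = _ := by ring
  have t2 : |Real.exp (τ * X ^ 2) - Real.exp (τ * Y ^ 2)| * Y ≤ J ^ 3 * E := by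
    have a1 := abs_exp_sub_exp_le (τ * X ^ 2) (τ * Y ^ 2)
    rw [← mul_sub, abs_mul, abs_of_nonneg hτ0] at a1
    have a2 : max (Real.exp (τ * X ^ 2)) (Real.exp (τ * Y ^ 2)) ≤ E := max_le c2 eY
    have a3 := abs_sq_sub_mul_le hX hY h
    calc _ ≤ (τ * |X ^ 2 - Y ^ 2| * E) * Y := by
          gcongr; exact a1.trans (by gcongr)
      _ ≤ (1 * |X ^ 2 - Y ^ 2| * E) * Y := by gcongr
      _ = (|X ^ 2 - Y ^ 2| * Y) * E := by ring
      _ ≤ _ := by gcongr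
  have J69 : J ^ 7 ≤ J ^ 9 := pow_le_pow_right₀ hJ (by norm_num)
  calc |X ^ 6 * Real.exp (τ * X ^ 2) - Y ^ 6 * Real.exp (τ * Y ^ 2)| * |l|
      ≤ (|X ^ 6 - Y ^ 6| * E
        + Y ^ 6 * |Real.exp (τ * X ^ 2) - Real.exp (τ * Y ^ 2)|) * |l| := by
        gcongr
        calc _ = |(X ^ 6 - Y ^ 6) * Real.exp (τ * X ^ 2)
              + Y ^ 6 * (Real.exp (τ * X ^ 2) - Real.exp (τ * Y ^ 2))| := by ring_nf
          _ ≤ _ := by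
            refine (abs_add_le _ _).trans ?_
            rw [abs_mul, abs_mul, abs_of_pos (Real.exp_pos _),
              abs_of_pos (by positivity : 0 < Y ^ 6)]
            gcongr
    _ ≤ (3 * J ^ 6 * Y ^ 3 * E) * (2 * Y ^ 3 * J ^ 3)
        + Y ^ 5 * (J ^ 3 * E) * (2 * Y ^ 3 * J ^ 3) := by
        rw [add_mul]
        have : Y ^ 6 * |Real.exp (τ * X ^ 2) - Real.exp (τ * Y ^ 2)|
            ≤ Y ^ 5 * (J ^ 3 * E) := by
          calc _ = Y ^ 5 * (|Real.exp (τ * X ^ 2) - Real.exp (τ * Y ^ 2)| * Y) := by ring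
            _ ≤ _ := by gcongr
        gcongr
    _ = 6 * J ^ 9 * E * (1 * (1 * Y ^ 6)) + 2 * J ^ 6 * E * Y ^ 7 * Y := by ring
    _ ≤ 6 * J ^ 9 * E * (X * (Y * Y ^ 6)) + 2 * J ^ 6 * E * Y ^ 7 * (2 * X * J) := by gcongr
    _ = 6 * J ^ 9 * E * (X * (Y * Y ^ 6)) + 4 * J ^ 7 * E * (X * (Y * Y ^ 6)) := by ring
    _ ≤ 6 * J ^ 9 * E * (X * (Y * Y ^ 6)) + 4 * J ^ 9 * E * (X * (Y * Y ^ 6)) := by gcongr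
    _ = _ := by rw [hE]; ring
end Real

/-- The growth `⟨j⟩³ e^{τ⟨j⟩^{2/3}}` in the frequency difference that the regularity of the
coefficients allows. The power `3` covers all the symbol estimates. -/
def gw9 (τ : ℝ) (j : ℤ) : ℝ := th j.natAbs ^ 9 * Real.exp (τ * th j.natAbs ^ 2)

lemma gw9_pos (τ : ℝ) (j : ℤ) : 0 < gw9 τ j := by
  have := th_pos j.natAbs; unfold gw9; positivity

lemma th_pow_le_gw9 {τ : ℝ} (hτ : 0 ≤ τ) (j : ℤ) {p : ℕ} (hp : p ≤ 9) :
    th j.natAbs ^ p ≤ gw9 τ j := by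
  have h1 : 1 ≤ Real.exp (τ * th j.natAbs ^ 2) := Real.one_le_exp (by positivity)
  have h2 : th j.natAbs ^ p ≤ th j.natAbs ^ 9 := pow_le_pow_right₀ (one_le_th _) hp
  have h3 := th_pos j.natAbs
  unfold gw9
  nlinarith [pow_pos h3 9]

variable {τ : ℝ} (N : ℕ) (k l : ℤ)

lemma gw_tr_le (h0 : 0 ≤ τ) : gw τ (tr N k) ≤ 4 * gw9 τ (k - l) * gw τ (tr N l) := by
  have := weight_le h0 (one_le_th _) (one_le_th _) (one_le_th _) (th_tr_sub_le N k l)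
  unfold gw gw9
  linarith

lemma gw_tr_sub_mul_le (h0 : 0 ≤ τ) (h1 : τ ≤ 1) :
    |gw τ (tr N k) - gw τ (tr N l)| * |(l : ℝ)|
      ≤ 10 * gw9 τ (k - l) * (th (tr N k) * (th (tr N l) * gw τ (tr N l))) := by
  by_cases h : tr N k = tr N l
  · rw [h, sub_self, abs_zero, zero_mul]
    have := gw9_pos τ (k - l); have := gw_pos τ (tr N l); have := th_pos (tr N l)
    positivity
  · have := weight_sub_mul_le h0 h1 (one_le_th _) (one_le_th _) (one_le_th _) (th_tr_sub_le N k l)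
      (abs_le_of_tr_ne h)
    unfold gw gw9
    linarith

lemma th_tr_le (h0 : 0 ≤ τ) : th (tr N k) ≤ 2 * gw9 τ (k - l) * th (tr N l) := by
  have := le_of_abs_cube_sub (one_le_th _) (one_le_th _) (th_tr_sub_le N k l)
  have h2 := th_pow_le_gw9 h0 (k - l) (p := 1) (by norm_num)
  have := th_pos (tr N l)
  nlinarith

lemma abs_th_tr_sub_le (h0 : 0 ≤ τ) : |th (tr N k) - th (tr N l)| ≤ gw9 τ (k - l) :=
  (abs_sub_le_cube (one_le_th _) (one_le_th _) (th_tr_sub_le N k l)).trans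
    (th_pow_le_gw9 h0 (k - l) (by norm_num))

end

section

/-! ### Truncated Fourier multipliers -/

lemma hasSum_of_eq {f g : ℤ → ℂ} {a : ℂ} (e : ∀ i, g i = f i) (h : HasSum f a) : HasSum g a :=
  (funext e) ▸ h

/-- Continuous functions of period `2π`. -/
structure PC (f : ℝ → ℝ) : Prop where
  cont : Continuous f
  per : Function.Periodic f (2 * Real.pi)

/-- The cosine coefficient on one period. -/
def cs (f : ℝ → ℝ) (k : ℤ) : ℝ := ∫ x in 0..2 * Real.pi, f x * Real.cos (k * x)

/-- The sine coefficient on one period. -/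
def sn (f : ℝ → ℝ) (k : ℤ) : ℝ := ∫ x in 0..2 * Real.pi, f x * Real.sin (k * x)

lemma fc_eq_cs_sn {f : ℝ → ℝ} (hf : Continuous f) (k : ℤ) :
    fc f k = (1 / (2 * Real.pi) : ℝ) * (cs f k - sn f k * Complex.I) := by
  rw [fc, cfc_eq_integral, Complex.real_smul, cs, sn]
  congr 1
  rw [← intervalIntegral.integral_ofReal, ← intervalIntegral.integral_ofReal,
    ← intervalIntegral.integral_mul_const, ← intervalIntegral.integral_sub]
  · apply intervalIntegral.integral_congr
    intro x _
    simp only [char_eq, Int.cast_neg, neg_mul, Real.cos_neg, Real.sin_neg]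
    push_cast; ring
  · exact Continuous.intervalIntegrable (by fun_prop) _ _
  · exact Continuous.intervalIntegrable (by fun_prop) _ _

lemma norm_fc_sq {f : ℝ → ℝ} (hf : Continuous f) (k : ℤ) :
    ‖fc f k‖ ^ 2 = (1 / (2 * Real.pi)) ^ 2 * (cs f k ^ 2 + sn f k ^ 2) := by
  rw [fc_eq_cs_sn hf, norm_mul, mul_pow, Complex.norm_real, Real.norm_eq_abs, sq_abs]
  congr 1
  rw [← Complex.normSq_eq_norm_sq, Complex.normSq_apply]
  simp; ring

lemma fc_add {f g : ℝ → ℝ} (hf : Continuous f) (hg : Continuous g) (k : ℤ) :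
    fc (fun x => f x + g x) k = fc f k + fc g k := by
  simp only [fc, cfc_eq_integral, Complex.ofReal_add, mul_add]
  rw [intervalIntegral.integral_add, smul_add]
  · exact Continuous.intervalIntegrable (by fun_prop) _ _
  · exact Continuous.intervalIntegrable (by fun_prop) _ _

lemma fc_const_mul (c : ℝ) (f : ℝ → ℝ) (k : ℤ) : fc (fun x => c * f x) k = c * fc f k := by
  simp only [fc, cfc_eq_integral, Complex.ofReal_mul, Complex.real_smul]
  rw [mul_left_comm]
  congr 1
  rw [← intervalIntegral.integral_const_mul]
  apply intervalIntegral.integral_congr; intro x _; simp only; ring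

lemma fc_sub {f g : ℝ → ℝ} (hf : Continuous f) (hg : Continuous g) (k : ℤ) :
    fc (fun x => f x - g x) k = fc f k - fc g k := by
  have := fc_add hf (g := fun x => (-1) * g x) (by fun_prop) k
  rw [fc_const_mul] at this
  simp only [neg_mul, one_mul, ← sub_eq_add_neg] at this
  rw [this]; push_cast; ring

lemma fc_sum {ι : Type*} (s : Finset ι) {f : ι → ℝ → ℝ} (hf : ∀ i, Continuous (f i)) (k : ℤ) :
    fc (fun x => ∑ i ∈ s, f i x) k = ∑ i ∈ s, fc (f i) k := by
  classical
  induction s using Finset.induction_on with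
  | empty => simp [fc, cfc_eq_integral]
  | insert a s ha ih =>
    simp only [Finset.sum_insert ha]
    rw [fc_add (hf a) (by fun_prop), ih]

lemma cfc_char (m j : ℤ) : cfc (char m) j = if j = m then 1 else 0 := by
  have e : ∀ x, char (-j) x * char m x = char (m - j) x := fun x => by
    rw [char_mul]; congr 1; ring
  simp only [cfc_eq_integral, e]
  have hpi : (Real.pi : ℂ) ≠ 0 := by exact_mod_cast Real.pi_ne_zero
  split_ifs with h
  · subst h
    simp [char]
    field_simp
  · have hn : Complex.I * ((m - j : ℤ) : ℂ) ≠ 0 := by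
      apply mul_ne_zero Complex.I_ne_zero
      exact_mod_cast sub_ne_zero.2 (Ne.symm h)
    have := integral_exp_mul_complex (a := 0) (b := 2 * Real.pi) hn
    simp only [char]
    rw [this]
    have h2 := Complex.exp_int_mul_two_pi_mul_I (m - j)
    have : Complex.exp (Complex.I * ((m - j : ℤ) : ℂ) * ((2 * Real.pi : ℝ) : ℂ)) = 1 := by
      rw [← h2]; congr 1; push_cast; ring
    rw [this]; simp

/-- The part of `f` of frequencies `k` and `-k`. -/
def mode (k : ℕ) (f : ℝ → ℝ) (x : ℝ) : ℝ :=
  (if k = 0 then 1 else 2) / (2 * Real.pi) *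
    (Real.cos (k * x) * cs f k + Real.sin (k * x) * sn f k)

@[fun_prop] lemma continuous_mode (k : ℕ) (f : ℝ → ℝ) : Continuous (mode k f) := by
  unfold mode; fun_prop

lemma fc_mode (k : ℕ) {f : ℝ → ℝ} (hf : Continuous f) (j : ℤ) :
    fc (mode k f) j = if j.natAbs = k then fc f j else 0 := by
  have hpi : (Real.pi : ℂ) ≠ 0 := by exact_mod_cast Real.pi_ne_zero
  have e : ∀ x, ((mode k f x : ℝ) : ℂ) = (if k = 0 then 1 / 2 else 1) *
      (fc f k * char k x + fc f (-k) * char (-k) x) := by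
    intro x
    have hc : cs f (-k) = cs f k := by simp [cs]
    have hs : sn f (-k) = - sn f k := by simp [sn]
    rw [mode, fc_eq_cs_sn hf, fc_eq_cs_sn hf, char_eq, char_eq, hc, hs]
    simp only [Int.cast_neg, neg_mul, Real.cos_neg, Real.sin_neg]
    have hI : Complex.I * Complex.I = -1 := Complex.I_mul_I
    split_ifs <;> push_cast <;> field_simp <;> ring_nf <;> simp
  have : fc (mode k f) j = (if k = 0 then 1 / 2 else 1) *
      (fc f k * cfc (char k) j + fc f (-k) * cfc (char (-k)) j) := by
    simp only [fc] at e ⊢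
    simp only [e]
    simp only [cfc_eq_integral (fun x => _ * _), cfc_eq_integral (char _), Complex.real_smul]
    simp only [mul_add, mul_left_comm (char (-j) _)]
    rw [intervalIntegral.integral_add]
    · simp only [intervalIntegral.integral_const_mul]
      ring
    · exact Continuous.intervalIntegrable (by fun_prop) _ _
    · exact Continuous.intervalIntegrable (by fun_prop) _ _
  rw [this, cfc_char, cfc_char]
  by_cases h1 : k = 0
  · subst h1
    by_cases h2 : j = 0
    · subst h2; simp; ring
    · simp [h2]
  · rcases Int.natAbs_eq j with h | h
    · by_cases h2 : j.natAbs = k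
      · subst h2
        rw [if_neg h1, if_pos h, if_neg (by omega), if_pos rfl, ← h]; ring
      · rw [if_neg (show ¬ j = (k : ℤ) by omega), if_neg (show ¬ j = -(k : ℤ) by omega),
          if_neg h2]; ring
    · by_cases h2 : j.natAbs = k
      · subst h2
        rw [if_neg h1, if_neg (by omega), if_pos h, if_pos rfl, ← h]; ring
      · rw [if_neg (show ¬ j = (k : ℤ) by omega), if_neg (show ¬ j = -(k : ℤ) by omega),
          if_neg h2]; ring

/-- The Fourier multiplier with symbol `w (min |k| N)`. It is `w N` times the identity plus a
finite sum of projections, so that it acts on merely continuous functions and commutes with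
differentiation on functions of class `C¹`. -/
def mult (w : ℕ → ℝ) (N : ℕ) (f : ℝ → ℝ) (x : ℝ) : ℝ :=
  w N * f x + ∑ k ∈ Finset.range N, (w k - w N) * mode k f x

variable {w : ℕ → ℝ} {N : ℕ} {f g h : ℝ → ℝ}

lemma mode_periodic (k : ℕ) (f : ℝ → ℝ) : Function.Periodic (mode k f) (2 * Real.pi) := by
  intro x
  have e : (k : ℝ) * (x + 2 * Real.pi) = k * x + k * (2 * Real.pi) := by ring
  simp only [mode, e, Real.cos_add_nat_mul_two_pi, Real.sin_add_nat_mul_two_pi]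

lemma PC.mult (hf : PC f) : PC (mult w N f) := by
  refine ⟨?_, fun x => ?_⟩
  · have := hf.cont
    unfold HydroNS.mult; fun_prop
  · simp only [HydroNS.mult, hf.per x, mode_periodic _ f x]

lemma PC.mul (hf : PC f) (hg : PC g) : PC (fun x => f x * g x) :=
  ⟨hf.cont.mul hg.cont, hf.per.mul hg.per⟩

lemma PC.sub (hf : PC f) (hg : PC g) : PC (fun x => f x - g x) :=
  ⟨hf.cont.sub hg.cont, hf.per.sub hg.per⟩

lemma fc_mult (hf : Continuous f) (j : ℤ) : fc (mult w N f) j = w (tr N j) * fc f j := by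
  unfold mult
  rw [fc_add (by fun_prop) (by fun_prop), fc_sum _ (by fun_prop)]
  simp only [fc_const_mul, fc_mode _ hf, mul_ite, mul_zero]
  rw [Finset.sum_ite_eq]
  unfold tr
  split_ifs with h
  · rw [Finset.mem_range] at h
    rw [min_eq_left h.le]; push_cast; ring
  · rw [Finset.mem_range, not_lt] at h
    rw [min_eq_right h]; ring

lemma mult_hasDerivAt {f' : ℝ → ℝ} (hf : ∀ x, HasDerivAt f (f' x) x) (hf' : Continuous f')
    (pf : Function.Periodic f (2 * Real.pi)) (x : ℝ) :
    HasDerivAt (mult w N f) (mult w N f' x) x := by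
  have hc : Continuous f := continuous_iff_continuousAt.2 fun x => (hf x).continuousAt
  have hm : ∀ k : ℕ, HasDerivAt (mode k f) (mode k f' x) x := by
    intro k
    have e := fc_deriv hf hf' pf k
    rw [fc_eq_cs_sn hc, fc_eq_cs_sn hf'] at e
    have hp := Real.pi_pos
    have e1 := congrArg Complex.re e
    have e2 := congrArg Complex.im e
    simp at e1 e2
    have c1 : cs f' k = k * sn f k := by field_simp at e1; linarith
    have c2 : sn f' k = -(k * cs f k) := by field_simp at e2; linarith
    have d0 : HasDerivAt (fun x : ℝ => (k : ℝ) * x) k x := by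
      simpa using (hasDerivAt_id x).const_mul (k : ℝ)
    have := ((d0.cos.mul_const (cs f k)).add (d0.sin.mul_const (sn f k))).const_mul
      ((if k = 0 then 1 else 2) / (2 * Real.pi))
    refine this.congr_deriv ?_
    rw [mode, c1, c2]; ring
  exact ((hf x).const_mul _).add (HasDerivAt.fun_sum fun k _ => (hm k).const_mul _)

lemma mult_comp {v : ℕ → ℝ} (hf : PC f) :
    mult w N (mult v N f) = mult (fun n => w n * v n) N f := by
  apply eq_of_fc_eq hf.mult.mult.cont hf.mult.cont hf.mult.mult.per hf.mult.per
  intro k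
  rw [fc_mult hf.mult.cont, fc_mult hf.cont, fc_mult hf.cont]; push_cast; ring

lemma mult_one (hf : PC f) : mult (fun _ => 1) N f = f := by
  apply eq_of_fc_eq hf.mult.cont hf.cont hf.mult.per hf.per
  intro k
  rw [fc_mult hf.cont]; simp

lemma integral_mult_mul (hf : PC f) (hg : PC g) :
    ∫ x in 0..2 * Real.pi, mult w N f x * g x = ∫ x in 0..2 * Real.pi, f x * mult w N g x := by
  have h1 := hasSum_conj_fc_mul_fc (hf.mult (w := w) (N := N)).cont hg.cont
  have h2 := hasSum_conj_fc_mul_fc hf.cont (hg.mult (w := w) (N := N)).cont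
  have e : ∀ k, (starRingEnd ℂ) (fc (mult w N f) k) * fc g k
      = (starRingEnd ℂ) (fc f k) * fc (mult w N g) k := fun k => by
    rw [fc_mult hf.cont, fc_mult hg.cont, map_mul, Complex.conj_ofReal]; ring
  simp only [e] at h1
  have h3 := h1.unique h2
  have hp := Real.pi_pos
  have h4 : (1 / (2 * Real.pi)) * ∫ x in 0..2 * Real.pi, mult w N f x * g x
    = (1 / (2 * Real.pi)) * ∫ x in 0..2 * Real.pi, f x * mult w N g x := by exact_mod_cast h3
  field_simp at h4
  exact h4

/-- Comparison of `L²` norms of functions with comparable Fourier coefficients. -/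
lemma integral_sq_le_of_norm_fc_le {C : ℝ} (hf : Continuous f) (hg : Continuous g)
    (h : ∀ k, ‖fc f k‖ ≤ C * ‖fc g k‖) :
    ∫ x in 0..2 * Real.pi, f x ^ 2 ≤ C ^ 2 * ∫ x in 0..2 * Real.pi, g x ^ 2 := by
  have h1 := hasSum_sq_fc hf
  have h2 := (hasSum_sq_fc hg).mul_left (C ^ 2)
  have h3 := hasSum_le (fun k => by
    rw [← mul_pow]; exact pow_le_pow_left₀ (norm_nonneg _) (h k) 2) h1 h2
  have hp := Real.pi_pos
  rw [mul_left_comm] at h3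
  exact le_of_mul_le_mul_left h3 (by positivity)

/-! ### Products and commutators -/

/-- Gevrey regularity of a coefficient, with enough decay left for its Fourier coefficients,
weighted by `gw9`, to be summable. -/
def GB (R τ : ℝ) (b : ℝ → ℝ) : Prop := ∀ j, gw9 τ j * bracket j ^ 2 * ‖fc b j‖ ≤ R

/-- The constant `∑ ⟨j⟩⁻²`. -/
def ZZ : ℝ := ∑' j : ℤ, 1 / bracket j ^ 2

lemma summable_bracket : Summable fun j : ℤ => 1 / bracket j ^ 2 := by
  have h : Summable fun j : ℤ => 1 / (j : ℝ) ^ 2 := Real.summable_one_div_int_pow.2 (by norm_num)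
  refine Summable.of_norm_bounded_eventually (g := fun j : ℤ => 1 / (j : ℝ) ^ 2) h ?_
  have : ∀ᶠ j : ℤ in cofinite, j ≠ 0 := by
    rw [Filter.eventually_cofinite]; simp
  filter_upwards [this] with j hj
  have hj' : (0 : ℝ) < (j : ℝ) ^ 2 := by positivity
  rw [bracket_sq, Real.norm_of_nonneg (by positivity)]
  gcongr; linarith

lemma ZZ_nonneg : 0 ≤ ZZ := tsum_nonneg fun _ => by positivity

lemma GB.nonneg {R τ : ℝ} {b : ℝ → ℝ} (hb : GB R τ b) : 0 ≤ R :=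
  le_trans (by have := gw9_pos τ 0; positivity) (hb 0)

lemma GB.norm_fc_le {R τ : ℝ} {b : ℝ → ℝ} (hb : GB R τ b) (j : ℤ) :
    gw9 τ j * ‖fc b j‖ ≤ R * (1 / bracket j ^ 2) := by
  have := hb j
  have hp := bracket_pos j
  rw [mul_one_div, le_div_iff₀ (by positivity)]
  linarith

/-- If the Fourier coefficients of `G` are sums of products of those of `b` and `f` with a symbol
that grows at most like `gw9` in the frequency difference, then `G` is bounded in `L²`. -/
lemma conv_bound {R τ C : ℝ} (hC : 0 ≤ C) {b G f₂ : ℝ → ℝ} (hG : Continuous G)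
    (hf₂ : Continuous f₂) (hb : GB R τ b) (c : ℤ → ℤ → ℂ)
    (hs : ∀ k, HasSum (fun l => fc b (k - l) * c k l) (fc G k))
    (hc : ∀ k l, ‖c k l‖ ≤ C * gw9 τ (k - l) * ‖fc f₂ l‖) :
    ∫ x in 0..2 * Real.pi, G x ^ 2 ≤ (C * R * ZZ) ^ 2 * ∫ x in 0..2 * Real.pi, f₂ x ^ 2 := by
  have hR := hb.nonneg
  have hZ := ZZ_nonneg
  let κ : ℤ → ℝ≥0∞ := fun j => ENNReal.ofReal (C * R * (1 / bracket j ^ 2))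
  let x : ℤ → ℝ≥0∞ := fun l => ENNReal.ofReal ‖fc f₂ l‖
  have hκ : ∑' j, κ j = ENNReal.ofReal (C * R * ZZ) := by
    rw [ZZ, ← tsum_mul_left, ENNReal.ofReal_tsum_of_nonneg (fun j => by positivity)]
    exact summable_bracket.mul_left _
  have h1 : ∀ k, ENNReal.ofReal ‖fc G k‖ ≤ ∑' l, κ (k - l) * x l := by
    intro k
    have hsum := (hs k).summable.norm
    calc ENNReal.ofReal ‖fc G k‖ ≤ ENNReal.ofReal (∑' l, ‖fc b (k - l) * c k l‖) := by
          apply ENNReal.ofReal_le_ofReal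
          rw [← (hs k).tsum_eq]
          exact norm_tsum_le_tsum_norm hsum
      _ = ∑' l, ENNReal.ofReal ‖fc b (k - l) * c k l‖ :=
          ENNReal.ofReal_tsum_of_nonneg (fun _ => norm_nonneg _) hsum
      _ ≤ _ := by
          refine ENNReal.tsum_le_tsum fun l => ?_
          rw [← ENNReal.ofReal_mul (by positivity)]
          apply ENNReal.ofReal_le_ofReal
          rw [norm_mul]
          have e1 := mul_le_mul_of_nonneg_left (hc k l) (norm_nonneg (fc b (k - l)))
          have e2 := mul_le_mul_of_nonneg_right (hb.norm_fc_le (k - l))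
            (mul_nonneg hC (norm_nonneg (fc f₂ l)))
          linarith
  have h2 : ENNReal.ofReal (∫ x in 0..2 * Real.pi, G x ^ 2)
      ≤ ENNReal.ofReal ((C * R * ZZ) ^ 2 * ∫ x in 0..2 * Real.pi, f₂ x ^ 2) := by
    have e1 : ∀ k, ENNReal.ofReal (‖fc G k‖ ^ 2) ≤ (∑' l, κ (k - l) * x l) ^ 2 := fun k => by
      rw [ENNReal.ofReal_pow (norm_nonneg _)]
      exact pow_le_pow_left₀ (by positivity) (h1 k) 2
    have e2 : ∀ l, x l ^ 2 = ENNReal.ofReal (‖fc f₂ l‖ ^ 2) := fun l =>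
      (ENNReal.ofReal_pow (norm_nonneg _) 2).symm
    have e3 := (ENNReal.tsum_le_tsum e1).trans (tsum_sq_conv_le κ x)
    rw [hκ, tsum_congr e2] at e3
    have e4 := mul_le_mul_right e3 (ENNReal.ofReal (2 * Real.pi))
    rw [tsum_ofReal_sq_fc hG, mul_left_comm, tsum_ofReal_sq_fc hf₂,
      ← ENNReal.ofReal_pow (by positivity), ← ENNReal.ofReal_mul (by positivity)] at e4
    exact e4
  refine (ENNReal.ofReal_le_ofReal_iff ?_).1 h2
  have : 0 ≤ ∫ x in 0..2 * Real.pi, f₂ x ^ 2 :=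
    intervalIntegral.integral_nonneg Real.two_pi_pos.le fun _ _ => sq_nonneg _
  positivity

section Products
variable {R τ : ℝ} {b : ℝ → ℝ}

/-- Multiplication by a Gevrey function is bounded on the truncated Gevrey space. -/
lemma mult_mul_bound (h0 : 0 ≤ τ) (hb : PC b) (hB : GB R τ b) (hf : PC f) :
    ∫ x in 0..2 * Real.pi, mult (gw τ) N (fun x => b x * f x) x ^ 2
      ≤ (4 * R * ZZ) ^ 2 * ∫ x in 0..2 * Real.pi, mult (gw τ) N f x ^ 2 := by
  refine conv_bound (by norm_num) (hb.mul hf).mult.cont hf.mult.cont hB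
    (fun k l => gw τ (tr N k) * fc f l) (fun k => ?_) fun k l => ?_
  · rw [fc_mult (hb.mul hf).cont]
    refine hasSum_of_eq (fun l => ?_)
      ((hasSum_fc_mul hb.cont hf.cont k).mul_left (gw τ (tr N k) : ℂ))
    ring
  · rw [fc_mult hf.cont, norm_mul, norm_mul, Complex.norm_real, Complex.norm_real,
      Real.norm_of_nonneg (gw_pos _ _).le, Real.norm_of_nonneg (gw_pos _ _).le, ← mul_assoc]
    gcongr
    exact gw_tr_le N k l h0

/-- Multiplication by a Gevrey function is bounded on `H^{1/3}`. -/
lemma mult_th_mul_bound (h0 : 0 ≤ τ) (hb : PC b) (hB : GB R τ b) (hf : PC f) :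
    ∫ x in 0..2 * Real.pi, mult th N (fun x => b x * f x) x ^ 2
      ≤ (2 * R * ZZ) ^ 2 * ∫ x in 0..2 * Real.pi, mult th N f x ^ 2 := by
  refine conv_bound (by norm_num) (hb.mul hf).mult.cont hf.mult.cont hB
    (fun k l => th (tr N k) * fc f l) (fun k => ?_) fun k l => ?_
  · rw [fc_mult (hb.mul hf).cont]
    refine hasSum_of_eq (fun l => ?_)
      ((hasSum_fc_mul hb.cont hf.cont k).mul_left (th (tr N k) : ℂ))
    ring
  · rw [fc_mult hf.cont, norm_mul, norm_mul, Complex.norm_real, Complex.norm_real,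
      Real.norm_of_nonneg (th_pos _).le, Real.norm_of_nonneg (th_pos _).le, ← mul_assoc]
    gcongr
    exact th_tr_le N k l h0

lemma hasSum_commutator (hb : PC b) (hf : PC f) (k : ℤ) :
    HasSum (fun l => fc b (k - l) * (((w (tr N k) - w (tr N l) : ℝ) : ℂ) * fc f l))
      (fc (fun x => mult w N (fun x => b x * f x) x - b x * mult w N f x) k) := by
  rw [fc_sub (hb.mul hf).mult.cont (hb.mul hf.mult).cont, fc_mult (hb.mul hf).cont]
  refine hasSum_of_eq (fun l => ?_)
    (((hasSum_fc_mul hb.cont hf.cont k).mul_left (w (tr N k) : ℂ)).sub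
      (hasSum_fc_mul hb.cont (hf.mult (w := w) (N := N)).cont k))
  rw [fc_mult hf.cont]; push_cast; ring

/-- The commutator of `⟨D⟩^{1/3}` with a product is bounded on `L²`. -/
lemma commutator_th_bound (h0 : 0 ≤ τ) (hb : PC b) (hB : GB R τ b) (hf : PC f) :
    ∫ x in 0..2 * Real.pi, (mult th N (fun x => b x * f x) x - b x * mult th N f x) ^ 2
      ≤ (1 * R * ZZ) ^ 2 * ∫ x in 0..2 * Real.pi, f x ^ 2 := by
  refine conv_bound (by norm_num) ((hb.mul hf).mult.sub (hb.mul hf.mult)).cont hf.cont hB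
    (fun k l => ((th (tr N k) - th (tr N l) : ℝ) : ℂ) * fc f l) (fun k => hasSum_commutator hb hf k)
    fun k l => ?_
  rw [norm_mul, Complex.norm_real, Real.norm_eq_abs, one_mul]
  gcongr
  exact abs_th_tr_sub_le N k l h0

lemma integral_mul_eq_th (hf : PC f) (hg : PC g) :
    ∫ x in 0..2 * Real.pi, f x * g x
      = ∫ x in 0..2 * Real.pi, mult (fun n => (th n)⁻¹) N f x * mult th N g x := by
  rw [integral_mult_mul hf hg.mult, mult_comp hg]
  have : (fun n => (th n)⁻¹ * th n) = fun _ => (1 : ℝ) := by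
    ext n; exact inv_mul_cancel₀ (th_pos n).ne'
  rw [this, mult_one hg]

/-- Young's inequality for the duality pairing of `H^{1/3}` and `H^{-1/3}`. -/
lemma abs_integral_mul_le_th (hf : PC f) (hg : PC g) {δ : ℝ} (hδ : 0 < δ) :
    |∫ x in 0..2 * Real.pi, f x * g x|
      ≤ δ⁻¹ / 2 * (∫ x in 0..2 * Real.pi, mult (fun n => (th n)⁻¹) N f x ^ 2)
        + δ / 2 * ∫ x in 0..2 * Real.pi, mult th N g x ^ 2 := by
  have c1 := (hf.mult (w := fun n => (th n)⁻¹) (N := N)).cont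
  have c2 := (hg.mult (w := th) (N := N)).cont
  rw [integral_mul_eq_th hf hg (N := N), ← intervalIntegral.integral_const_mul,
    ← intervalIntegral.integral_const_mul, ← intervalIntegral.integral_add
      (Continuous.intervalIntegrable (by fun_prop) _ _)
      (Continuous.intervalIntegrable (by fun_prop) _ _)]
  refine (intervalIntegral.abs_integral_le_integral_abs Real.two_pi_pos.le).trans ?_
  refine intervalIntegral.integral_mono_on Real.two_pi_pos.le
    (Continuous.intervalIntegrable (by fun_prop) _ _)
    (Continuous.intervalIntegrable (by fun_prop) _ _) fun x _ => ?_
  set p := mult (fun n => (th n)⁻¹) N f x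
  set q := mult th N g x
  have e : δ⁻¹ / 2 * p ^ 2 + δ / 2 * q ^ 2 - p * q = δ⁻¹ / 2 * (p - δ * q) ^ 2 := by
    field_simp; ring
  have e2 : δ⁻¹ / 2 * p ^ 2 + δ / 2 * q ^ 2 + p * q = δ⁻¹ / 2 * (p + δ * q) ^ 2 := by
    field_simp; ring
  have := inv_pos.2 hδ
  have p1 : 0 ≤ δ⁻¹ / 2 * (p - δ * q) ^ 2 := by positivity
  have p2 : 0 ≤ δ⁻¹ / 2 * (p + δ * q) ^ 2 := by positivity
  rw [abs_le]; constructor <;> linarith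

/-- The commutator of the Gevrey multiplier with `b ∂ₓ` loses `1/3` of a derivative on each side. -/
lemma commutator_deriv_bound (h0 : 0 ≤ τ) (h1 : τ ≤ 1) (hb : PC b) (hB : GB R τ b) (hf : PC f)
    {f' : ℝ → ℝ} (hd : ∀ x, HasDerivAt f (f' x) x) (hf' : PC f') (hh : PC h) :
    |∫ x in 0..2 * Real.pi,
      (mult (gw τ) N (fun x => b x * f' x) x - b x * mult (gw τ) N f' x) * h x|
      ≤ ((10 * R * ZZ) ^ 2 * (∫ x in 0..2 * Real.pi, mult th N (mult (gw τ) N f) x ^ 2)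
        + ∫ x in 0..2 * Real.pi, mult th N h x ^ 2) / 2 := by
  have hF := (hb.mul hf').mult (w := gw τ) (N := N) |>.sub (hb.mul (hf'.mult (w := gw τ) (N := N)))
  have key := abs_integral_mul_le_th (N := N) hF hh one_pos
  have := conv_bound (C := 10) (R := R) (τ := τ) (b := b) (by norm_num)
    (hF.mult (w := fun n => (th n)⁻¹) (N := N)).cont
    ((hf.mult (w := gw τ) (N := N)).mult (w := th) (N := N)).cont hB
    (fun k l => (((th (tr N k))⁻¹ : ℝ) : ℂ) *
      (((gw τ (tr N k) - gw τ (tr N l) : ℝ) : ℂ) * fc f' l)) (fun k => ?_) fun k l => ?_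
  · simp only [inv_one] at key
    linarith
  · rw [fc_mult hF.cont]
    refine hasSum_of_eq (fun l => ?_)
      ((hasSum_commutator hb hf' k (w := gw τ) (N := N)).mul_left (((th (tr N k))⁻¹ : ℝ) : ℂ))
    ring
  · rw [fc_deriv hd hf'.cont hf.per, fc_mult hf.mult.cont, fc_mult hf.cont]
    have hk := th_pos (tr N k)
    have hl := th_pos (tr N l)
    have hg := gw_pos τ (tr N l)
    simp only [norm_mul, Complex.norm_real, Complex.norm_I, one_mul, Real.norm_eq_abs, abs_inv,
      abs_of_pos hk, abs_of_pos hl, abs_of_pos hg, Complex.norm_intCast]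
    have := gw_tr_sub_mul_le N k l h0 h1
    calc _ = (th (tr N k))⁻¹ * (|gw τ (tr N k) - gw τ (tr N l)| * |(l : ℝ)|) * ‖fc f l‖ := by ring
      _ ≤ (th (tr N k))⁻¹ * (10 * gw9 τ (k - l) * (th (tr N k) * (th (tr N l) * gw τ (tr N l))))
          * ‖fc f l‖ := by gcongr
      _ = _ := by field_simp

/-- Coercivity of the gain of regularity, tested against `h` when the multiplier acts on `b h`: with
half of the multiplier moved to `h`, the product `⟨D⟩^{1/3}(b h) ⟨D⟩^{1/3} h` is
`b (⟨D⟩^{1/3} h)²` up to a commutator. -/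
lemma gain_coercive {c₀ : ℝ} (hc₀ : 0 < c₀) (h0 : 0 ≤ τ) (hb : PC b) (hB : GB R τ b)
    (hbc : ∀ x, c₀ ≤ b x) (hh : PC h) :
    c₀ / 2 * (∫ x in 0..2 * Real.pi, mult th N h x ^ 2)
      - (1 * R * ZZ) ^ 2 / (2 * c₀) * (∫ x in 0..2 * Real.pi, h x ^ 2)
      ≤ ∫ x in 0..2 * Real.pi, mult (fun n => th n ^ 2) N (fun x => b x * h x) x * h x := by
  have e1 : mult (fun n => th n ^ 2) N (fun x => b x * h x)
      = mult th N (mult th N (fun x => b x * h x)) := by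
    rw [mult_comp (hb.mul hh)]; simp only [pow_two]
  rw [e1, integral_mult_mul (hb.mul hh).mult hh]
  have com := commutator_th_bound (N := N) h0 hb hB hh
  set s := mult th N h
  set q := mult th N (fun x => b x * h x)
  have cb := hb.cont
  have hsc : Continuous s := hh.mult.cont
  have hqc : Continuous q := (hb.mul hh).mult.cont
  have k1 : c₀ / 2 * (∫ x in 0..2 * Real.pi, s x ^ 2)
      - 1 / (2 * c₀) * (∫ x in 0..2 * Real.pi, (q x - b x * s x) ^ 2)
      ≤ ∫ x in 0..2 * Real.pi, q x * s x := by
    rw [← intervalIntegral.integral_const_mul, ← intervalIntegral.integral_const_mul,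
      ← intervalIntegral.integral_sub (Continuous.intervalIntegrable (by fun_prop) _ _)
        (Continuous.intervalIntegrable (by fun_prop) _ _)]
    refine intervalIntegral.integral_mono_on Real.two_pi_pos.le
      (Continuous.intervalIntegrable (by fun_prop) _ _)
      (Continuous.intervalIntegrable (by fun_prop) _ _) fun x _ => ?_
    have h2 := hbc x
    have h3 : 0 ≤ (b x - c₀) * s x ^ 2 := mul_nonneg (by linarith) (sq_nonneg _)
    have h4 : q x * s x - (c₀ / 2 * s x ^ 2 - 1 / (2 * c₀) * (q x - b x * s x) ^ 2)
        = (b x - c₀) * s x ^ 2 + 1 / (2 * c₀) * ((q x - b x * s x) + c₀ * s x) ^ 2 := by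
      field_simp; ring
    have h5 : 0 ≤ 1 / (2 * c₀) * ((q x - b x * s x) + c₀ * s x) ^ 2 := by positivity
    linarith
  have k2 : 1 / (2 * c₀) * (∫ x in 0..2 * Real.pi, (q x - b x * s x) ^ 2)
      ≤ 1 / (2 * c₀) * ((1 * R * ZZ) ^ 2 * ∫ x in 0..2 * Real.pi, h x ^ 2) := by gcongr
  have k3 : (1 * R * ZZ) ^ 2 / (2 * c₀) * (∫ x in 0..2 * Real.pi, h x ^ 2)
    = 1 / (2 * c₀) * ((1 * R * ZZ) ^ 2 * ∫ x in 0..2 * Real.pi, h x ^ 2) := by ring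
  linarith

end Products

end

section

/-! ### Calculus on the strip -/

/-- Continuous functions on the plane, of period `2π` in the first variable. Functions on the
strip are extended to the plane by constants in `y` beyond the walls. -/
structure PF (F : ℝ → ℝ → ℝ) : Prop where
  cont : Continuous fun p : ℝ × ℝ => F p.1 p.2
  per : ∀ x y, F (x + 2 * Real.pi) y = F x y

/-- `F'` is the derivative of `F` in `x`. -/
def HasX (F F' : ℝ → ℝ → ℝ) : Prop := ∀ x y, HasDerivAt (fun z => F z y) (F' x y) x

/-- `F'` is the derivative of `F` in `y` inside the strip. -/
def HasY (F F' : ℝ → ℝ → ℝ) : Prop := ∀ x, ∀ y ∈ Ioo (0 : ℝ) 1, HasDerivAt (F x) (F' x y) y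

/-- The integral over one period of the strip. -/
def I2 (F : ℝ → ℝ → ℝ) : ℝ := ∫ y in 0..1, ∫ x in 0..2 * Real.pi, F x y

section Basic
variable {F G F' G' : ℝ → ℝ → ℝ}

lemma PF.cx (h : PF F) (y : ℝ) : Continuous fun x => F x y :=
  h.cont.comp (by fun_prop : Continuous fun x : ℝ => (x, y))

lemma PF.cy (h : PF F) (x : ℝ) : Continuous (F x) :=
  h.cont.comp (by fun_prop : Continuous fun y : ℝ => (x, y))

lemma PF.pc (h : PF F) (y : ℝ) : PC fun x => F x y := ⟨h.cx y, fun x => h.per x y⟩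

lemma PF.add (hF : PF F) (hG : PF G) : PF fun x y => F x y + G x y :=
  ⟨hF.cont.add hG.cont, fun x y => by rw [hF.per, hG.per]⟩
lemma PF.sub (hF : PF F) (hG : PF G) : PF fun x y => F x y - G x y :=
  ⟨hF.cont.sub hG.cont, fun x y => by rw [hF.per, hG.per]⟩
lemma PF.mul (hF : PF F) (hG : PF G) : PF fun x y => F x y * G x y :=
  ⟨hF.cont.mul hG.cont, fun x y => by rw [hF.per, hG.per]⟩
lemma PF.neg (hF : PF F) : PF fun x y => - F x y :=
  ⟨hF.cont.neg, fun x y => by rw [hF.per]⟩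
lemma PF.pow (hF : PF F) (n : ℕ) : PF fun x y => F x y ^ n :=
  ⟨hF.cont.pow n, fun x y => by rw [hF.per]⟩
lemma PF.const_mul (hF : PF F) (c : ℝ) : PF fun x y => c * F x y :=
  ⟨continuous_const.mul hF.cont, fun x y => by rw [hF.per]⟩
lemma PF.div (hF : PF F) (hG : PF G) (h0 : ∀ x y, G x y ≠ 0) : PF fun x y => F x y / G x y :=
  ⟨hF.cont.div hG.cont fun p => h0 p.1 p.2, fun x y => by rw [hF.per, hG.per]⟩
lemma PF.of_y {q : ℝ → ℝ} (hq : Continuous q) : PF fun _ y => q y :=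
  ⟨hq.comp continuous_snd, fun _ _ => rfl⟩

lemma HasX.mul (hF : HasX F F') (hG : HasX G G') :
    HasX (fun x y => F x y * G x y) (fun x y => F' x y * G x y + F x y * G' x y) :=
  fun x y => (hF x y).mul (hG x y)
lemma HasY.mul (hF : HasY F F') (hG : HasY G G') :
    HasY (fun x y => F x y * G x y) (fun x y => F' x y * G x y + F x y * G' x y) :=
  fun x y hy => (hF x y hy).mul (hG x y hy)
lemma HasX.div (hF : HasX F F') (hG : HasX G G') (h0 : ∀ x y, G x y ≠ 0) :
    HasX (fun x y => F x y / G x y)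
      (fun x y => (F' x y - G' x y * (F x y / G x y)) / G x y) :=
  fun x y => ((hF x y).div (hG x y) (h0 x y)).congr_deriv (by have := h0 x y; field_simp)
lemma HasY.div (hF : HasY F F') (hG : HasY G G') (h0 : ∀ x y, G x y ≠ 0) :
    HasY (fun x y => F x y / G x y)
      (fun x y => (F' x y - G' x y * (F x y / G x y)) / G x y) :=
  fun x y hy =>
    ((hF x y hy).div (hG x y hy) (h0 x y)).congr_deriv (by have := h0 x y; field_simp)

lemma continuous_inner (hF : Continuous fun p : ℝ × ℝ => F p.1 p.2) (a b : ℝ) :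
    Continuous fun y => ∫ x in a..b, F x y :=
  intervalIntegral.continuous_parametric_intervalIntegral_of_continuous'
    (f := fun y x => F x y) (hF.comp continuous_swap) a b

lemma PF.inner (h : PF F) : Continuous fun y => ∫ x in 0..2 * Real.pi, F x y :=
  continuous_inner h.cont 0 _

lemma I2_add (hF : PF F) (hG : PF G) : I2 (fun x y => F x y + G x y) = I2 F + I2 G := by
  unfold I2
  rw [← intervalIntegral.integral_add (hF.inner.intervalIntegrable _ _)
    (hG.inner.intervalIntegrable _ _)]
  congr 1; ext y
  exact intervalIntegral.integral_add ((hF.cx y).intervalIntegrable _ _)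
    ((hG.cx y).intervalIntegrable _ _)

lemma I2_const_mul (c : ℝ) (F : ℝ → ℝ → ℝ) : I2 (fun x y => c * F x y) = c * I2 F := by
  simp only [I2, intervalIntegral.integral_const_mul]

lemma I2_neg (F : ℝ → ℝ → ℝ) : I2 (fun x y => - F x y) = - I2 F := by
  simp only [I2, intervalIntegral.integral_neg]

lemma I2_sub (hF : PF F) (hG : PF G) : I2 (fun x y => F x y - G x y) = I2 F - I2 G := by
  have := I2_add hF hG.neg
  rw [I2_neg] at this
  simpa only [sub_eq_add_neg] using this

lemma I2_mono (hF : PF F) (hG : PF G) (h : ∀ x, ∀ y ∈ Ioo (0 : ℝ) 1, F x y ≤ G x y) :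
    I2 F ≤ I2 G := by
  refine intervalIntegral.integral_mono_on_of_le_Ioo zero_le_one
    (hF.inner.intervalIntegrable _ _) (hG.inner.intervalIntegrable _ _) fun y hy => ?_
  exact intervalIntegral.integral_mono Real.two_pi_pos.le ((hF.cx y).intervalIntegrable _ _)
    ((hG.cx y).intervalIntegrable _ _) fun x => h x y hy

lemma I2_congr (h : ∀ x, ∀ y ∈ Ioo (0 : ℝ) 1, F x y = G x y) : I2 F = I2 G := by
  refine intervalIntegral.integral_congr_Ioo_of_le zero_le_one fun y hy => ?_
  simp only [fun x => h x y hy]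

lemma I2_nonneg (h : ∀ x, ∀ y ∈ Ioo (0 : ℝ) 1, 0 ≤ F x y) (hF : PF F) : 0 ≤ I2 F := by
  have := I2_mono (F := fun _ _ => 0) ⟨continuous_const, fun _ _ => rfl⟩ hF h
  simpa [I2] using this

lemma I2_sq_nonneg (hF : PF F) : 0 ≤ I2 fun x y => F x y ^ 2 :=
  I2_nonneg (fun _ _ _ => sq_nonneg _) (hF.pow 2)

lemma abs_I2_le (hF : PF F) (hG : PF G) (h : ∀ x, ∀ y ∈ Ioo (0 : ℝ) 1, |F x y| ≤ G x y) :
    |I2 F| ≤ I2 G := by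
  rw [abs_le]; constructor
  · rw [← I2_neg]
    exact I2_mono hG.neg hF fun x y hy => (abs_le.1 (h x y hy)).1
  · exact I2_mono hF hG fun x y hy => (abs_le.1 (h x y hy)).2

lemma I2_swap (hF : PF F) : I2 F = ∫ x in 0..2 * Real.pi, ∫ y in 0..1, F x y := by
  unfold I2
  refine intervalIntegral_intervalIntegral_swap (F := fun y x => F x y) ?_
  have hc : Continuous (Function.uncurry fun y x => F x y) := hF.cont.comp continuous_swap
  exact (hc.continuousOn.integrableOn_compact (isCompact_uIcc.prod isCompact_uIcc)).mono_set
    (prod_mono uIoc_subset_uIcc uIoc_subset_uIcc)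

/-- Young's inequality. -/
lemma abs_I2_mul_le (hF : PF F) (hG : PF G) {δ : ℝ} (hδ : 0 < δ) :
    |I2 fun x y => F x y * G x y|
      ≤ δ⁻¹ / 2 * (I2 fun x y => F x y ^ 2) + δ / 2 * I2 fun x y => G x y ^ 2 := by
  rw [← I2_const_mul, ← I2_const_mul, ← I2_add ((hF.pow 2).const_mul _) ((hG.pow 2).const_mul _)]
  refine abs_I2_le (hF.mul hG) (((hF.pow 2).const_mul _).add ((hG.pow 2).const_mul _))
    fun x y _ => ?_
  set p := F x y
  set q := G x y
  have e : δ⁻¹ / 2 * p ^ 2 + δ / 2 * q ^ 2 - p * q = δ⁻¹ / 2 * (p - δ * q) ^ 2 := by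
    field_simp; ring
  have e2 : δ⁻¹ / 2 * p ^ 2 + δ / 2 * q ^ 2 + p * q = δ⁻¹ / 2 * (p + δ * q) ^ 2 := by
    field_simp; ring
  have := inv_pos.2 hδ
  have p1 : 0 ≤ δ⁻¹ / 2 * (p - δ * q) ^ 2 := by positivity
  have p2 : 0 ≤ δ⁻¹ / 2 * (p + δ * q) ^ 2 := by positivity
  rw [abs_le]; constructor <;> linarith

lemma I2_hasX (hF : PF F) (hF' : PF F') (h : HasX F F') : I2 F' = 0 := by
  unfold I2
  have : ∀ y, ∫ x in 0..2 * Real.pi, F' x y = 0 := fun y => by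
    rw [intervalIntegral.integral_eq_sub_of_hasDerivAt (f := fun x => F x y)
      (fun x _ => h x y) ((hF'.cx y).intervalIntegrable _ _)]
    have := hF.per 0 y
    rw [zero_add] at this
    rw [this, sub_self]
  simp [this]

lemma I2_hasY (hF : PF F) (hF' : PF F') (h : HasY F F') :
    I2 F' = ∫ x in 0..2 * Real.pi, (F x 1 - F x 0) := by
  rw [I2_swap hF']
  congr 1; ext x
  exact intervalIntegral.integral_eq_sub_of_hasDerivAt_of_le zero_le_one (hF.cy x).continuousOn
    (fun y hy => h x y hy) ((hF'.cy x).intervalIntegrable _ _)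

lemma I2_hasY_zero (hF : PF F) (hF' : PF F') (h : HasY F F') (h0 : ∀ x, F x 0 = 0)
    (h1 : ∀ x, F x 1 = 0) : I2 F' = 0 := by
  rw [I2_hasY hF hF' h]; simp [h0, h1]

/-- Integration by parts in `x`. -/
lemma I2_ibp_x (hF : PF F) (hG : PF G) (hF' : PF F') (hG' : PF G') (h1 : HasX F F')
    (h2 : HasX G G') : I2 (fun x y => F' x y * G x y) = - I2 fun x y => F x y * G' x y := by
  have := I2_hasX (hF.mul hG) ((hF'.mul hG).add (hF.mul hG')) (h1.mul h2)
  rw [I2_add (hF'.mul hG) (hF.mul hG')] at this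
  linarith

/-- Integration by parts in `y`. -/
lemma I2_ibp_y (hF : PF F) (hG : PF G) (hF' : PF F') (hG' : PF G') (h1 : HasY F F')
    (h2 : HasY G G') (w0 : ∀ x, F x 0 * G x 0 = 0) (w1 : ∀ x, F x 1 * G x 1 = 0) :
    I2 (fun x y => F' x y * G x y) = - I2 fun x y => F x y * G' x y := by
  have := I2_hasY_zero (hF.mul hG) ((hF'.mul hG).add (hF.mul hG')) (h1.mul h2) w0 w1
  rw [I2_add (hF'.mul hG) (hF.mul hG')] at this
  linarith

/-- A function vanishing at the wall is bounded in `y` with values in `L²(dx)`; the free parameter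
`δ` makes the share of the normal derivative small. -/
lemma integral_sq_slice_le (hF : PF F) (hF' : PF F') (h : HasY F F') (h0 : ∀ x, F x 0 = 0)
    {δ : ℝ} (hδ : 0 < δ) {y : ℝ} (hy : y ∈ Icc (0 : ℝ) 1) :
    ∫ x in 0..2 * Real.pi, F x y ^ 2
      ≤ δ * (I2 fun x y => F' x y ^ 2) + δ⁻¹ * I2 fun x y => F x y ^ 2 := by
  rw [← I2_const_mul, ← I2_const_mul, ← I2_add ((hF'.pow 2).const_mul _) ((hF.pow 2).const_mul _),
    I2_swap (((hF'.pow 2).const_mul _).add ((hF.pow 2).const_mul _))]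
  refine intervalIntegral.integral_mono Real.two_pi_pos.le
    (((hF.pow 2).cx y).intervalIntegrable _ _) (Continuous.intervalIntegrable ?_ _ _) fun x => ?_
  · exact intervalIntegral.continuous_parametric_intervalIntegral_of_continuous'
      (f := fun x y => δ * F' x y ^ 2 + δ⁻¹ * F x y ^ 2)
      (((hF'.pow 2).const_mul _).add ((hF.pow 2).const_mul _)).cont 0 1
  · have c1 := hF.cy x
    have c2 := hF'.cy x
    have e : ∫ z in 0..y, 2 * F x z * F' x z = F x y ^ 2 := by
      rw [intervalIntegral.integral_eq_sub_of_hasDerivAt_of_le (f := fun z => F x z ^ 2) hy.1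
        (by fun_prop)
        (fun z hz => ((h x z ⟨hz.1, hz.2.trans_le hy.2⟩).pow 2).congr_deriv (by ring))
        (Continuous.intervalIntegrable (by fun_prop) _ _), h0]
      ring
    simp only
    rw [← e]
    calc ∫ z in 0..y, 2 * F x z * F' x z ≤ ∫ z in 0..y, (δ * F' x z ^ 2 + δ⁻¹ * F x z ^ 2) := by
          refine intervalIntegral.integral_mono hy.1
            (Continuous.intervalIntegrable (by fun_prop) _ _)
            (Continuous.intervalIntegrable (by fun_prop) _ _) fun z => ?_
          have e : δ * F' x z ^ 2 + δ⁻¹ * F x z ^ 2 - 2 * F x z * F' x z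
            = δ * (F' x z - δ⁻¹ * F x z) ^ 2 := by field_simp; ring
          have : 0 ≤ δ * (F' x z - δ⁻¹ * F x z) ^ 2 := by positivity
          simp only; linarith
      _ ≤ ∫ z in 0..1, (δ * F' x z ^ 2 + δ⁻¹ * F x z ^ 2) := by
          have hδ' := inv_pos.2 hδ
          refine intervalIntegral.integral_mono_interval le_rfl hy.1 hy.2
            (Eventually.of_forall fun z => ?_) (Continuous.intervalIntegrable (by fun_prop) _ _)
          simp only [Pi.zero_apply]
          positivity

/-- Product with a coefficient that is only square integrable in `y`. -/
lemma I2_sq_mul_sq_le {r : ℝ → ℝ → ℝ} {ρ : ℝ → ℝ} {A : ℝ} (hr : PF r) (hρ : Continuous ρ)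
    (hrρ : ∀ x, ∀ y ∈ Ioo (0 : ℝ) 1, r x y ^ 2 ≤ ρ y) (hA : ∫ y in 0..1, ρ y ≤ A)
    (hF : PF F) (hF' : PF F') (h : HasY F F') (h0 : ∀ x, F x 0 = 0) {δ : ℝ} (hδ : 0 < δ) :
    I2 (fun x y => (r x y * F x y) ^ 2)
      ≤ A * (δ * (I2 fun x y => F' x y ^ 2) + δ⁻¹ * I2 fun x y => F x y ^ 2) := by
  set Q := δ * (I2 fun x y => F' x y ^ 2) + δ⁻¹ * I2 fun x y => F x y ^ 2 with hQ
  have hQ0 : 0 ≤ Q := by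
    have := I2_sq_nonneg hF; have := I2_sq_nonneg hF'; have := inv_pos.2 hδ; positivity
  calc I2 (fun x y => (r x y * F x y) ^ 2) ≤ I2 fun x y => ρ y * F x y ^ 2 :=
        I2_mono ((hr.mul hF).pow 2) ((PF.of_y hρ).mul (hF.pow 2)) fun x y hy => by
          rw [mul_pow]; exact mul_le_mul_of_nonneg_right (hrρ x y hy) (sq_nonneg _)
    _ ≤ ∫ y in 0..1, ρ y * Q := by
        refine intervalIntegral.integral_mono_on_of_le_Ioo zero_le_one
          (((PF.of_y hρ).mul (hF.pow 2)).inner.intervalIntegrable _ _)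
          (Continuous.intervalIntegrable (by fun_prop) _ _) fun y hy => ?_
        rw [intervalIntegral.integral_const_mul]
        exact mul_le_mul_of_nonneg_left
          (integral_sq_slice_le hF hF' h h0 hδ (Ioo_subset_Icc_self hy))
          ((sq_nonneg _).trans (hrρ 0 y hy))
    _ = (∫ y in 0..1, ρ y) * Q := intervalIntegral.integral_mul_const _ _
    _ ≤ A * Q := by gcongr

lemma poincare (hF : PF F) (hF' : PF F') (h : HasY F F') (h0 : ∀ x, F x 0 = 0) :
    (I2 fun x y => F x y ^ 2) ≤ 4 * I2 fun x y => F' x y ^ 2 := by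
  have key : ∀ y ∈ Ioo (0 : ℝ) 1, ∫ x in 0..2 * Real.pi, F x y ^ 2
      ≤ 2 * (I2 fun x y => F' x y ^ 2) + 2⁻¹ * I2 fun x y => F x y ^ 2 := fun y hy =>
    integral_sq_slice_le hF hF' h h0 two_pos (Ioo_subset_Icc_self hy)
  have : (I2 fun x y => F x y ^ 2) ≤ ∫ y in (0 : ℝ)..1,
      (2 * (I2 fun x y => F' x y ^ 2) + 2⁻¹ * I2 fun x y => F x y ^ 2) :=
    intervalIntegral.integral_mono_on_of_le_Ioo zero_le_one
      ((hF.pow 2).inner.intervalIntegrable _ _) (by simp) key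
  simp only [intervalIntegral.integral_const, sub_zero, one_smul] at this
  linarith

end Basic

/-! ### Differentiation under the integral sign -/

lemma hasDerivAt_integral_param {f f' : ℝ → ℝ → ℝ} {a b c d : ℝ}
    (hf : Continuous fun p : ℝ × ℝ => f p.1 p.2) (hf' : Continuous fun p : ℝ × ℝ => f' p.1 p.2)
    (h : ∀ x, ∀ s ∈ Ioo a b, HasDerivAt (fun s => f s x) (f' s x) s) {s : ℝ} (hs : s ∈ Ioo a b) :
    HasDerivAt (fun s => ∫ x in c..d, f s x) (∫ x in c..d, f' s x) s := by
  obtain ⟨r, hr, hball⟩ := Metric.isOpen_iff.1 (isOpen_Ioo (a := a) (b := b)) s hs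
  obtain ⟨B, hB⟩ := ((isCompact_closedBall s r).prod (isCompact_uIcc (a := c) (b := d))
    ).exists_bound_of_continuousOn hf'.continuousOn
  have cf : ∀ s, Continuous (f s) := fun s =>
    hf.comp (by fun_prop : Continuous fun x : ℝ => (s, x))
  have cf' : ∀ s, Continuous (f' s) := fun s =>
    hf'.comp (by fun_prop : Continuous fun x : ℝ => (s, x))
  refine (intervalIntegral.hasDerivAt_integral_of_dominated_loc_of_deriv_le
    (F := f) (F' := f') (x₀ := s) (bound := fun _ => B) (Metric.ball_mem_nhds s hr)
    (Eventually.of_forall fun s => (cf s).aestronglyMeasurable)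
    ((cf s).intervalIntegrable _ _) (cf' s).aestronglyMeasurable ?_ (by simp) ?_).2
  · refine Eventually.of_forall fun x hx y hy => ?_
    exact hB (y, x) ⟨Metric.ball_subset_closedBall hy, uIoc_subset_uIcc hx⟩
  · exact Eventually.of_forall fun x _ y hy => h x y (hball hy)

/-! ### Multipliers on the strip -/

/-- The truncated multiplier acting in `x`. -/
def MM (w : ℕ → ℝ) (N : ℕ) (F : ℝ → ℝ → ℝ) (x y : ℝ) : ℝ := mult w N (fun z => F z y) x

section MM
variable {w : ℕ → ℝ} {N : ℕ} {F G F' G' : ℝ → ℝ → ℝ}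

lemma PF.MM (hF : PF F) : PF (MM w N F) := by
  refine ⟨?_, fun x y => (hF.pc y).mult.per x⟩
  have h1 : ∀ k : ℤ, Continuous fun y => cs (fun z => F z y) k := fun k =>
    continuous_inner (F := fun x y => F x y * Real.cos (k * x)) (hF.cont.mul (by fun_prop)) _ _
  have h2 : ∀ k : ℤ, Continuous fun y => sn (fun z => F z y) k := fun k =>
    continuous_inner (F := fun x y => F x y * Real.sin (k * x)) (hF.cont.mul (by fun_prop)) _ _
  have h3 := hF.cont
  have e : (fun p : ℝ × ℝ => HydroNS.MM w N F p.1 p.2) = fun p : ℝ × ℝ =>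
      w N * F p.1 p.2 + ∑ k ∈ Finset.range N, (w k - w N) *
        ((if k = 0 then 1 else 2) / (2 * Real.pi) *
          (Real.cos (k * p.1) * cs (fun z => F z p.2) k
            + Real.sin (k * p.1) * sn (fun z => F z p.2) k)) := rfl
  rw [e]
  refine (h3.const_mul _).add (continuous_finsetSum _ fun k _ => continuous_const.mul
    (continuous_const.mul (Continuous.add ?_ ?_)))
  · exact Continuous.mul (by fun_prop) ((h1 k).comp continuous_snd)
  · exact Continuous.mul (by fun_prop) ((h2 k).comp continuous_snd)

lemma HasX.MM (h : HasX F F') (hF : PF F) (hF' : PF F') : HasX (MM w N F) (MM w N F') :=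
  fun x y => mult_hasDerivAt (fun x => h x y) (hF'.cx y) (fun x => hF.per x y) x

lemma HasY.MM (h : HasY F F') (hF : PF F) (hF' : PF F') : HasY (MM w N F) (MM w N F') := by
  intro x y hy
  have h1 : ∀ k : ℤ, HasDerivAt (fun y => cs (fun z => F z y) k) (cs (fun z => F' z y) k) y :=
    fun k => hasDerivAt_integral_param (a := 0) (b := 1)
      (f := fun y x => F x y * Real.cos (k * x)) (f' := fun y x => F' x y * Real.cos (k * x))
      ((hF.cont.comp continuous_swap).mul (by fun_prop))
      ((hF'.cont.comp continuous_swap).mul (by fun_prop))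
      (fun x y hy => (h x y hy).mul_const _) hy
  have h2 : ∀ k : ℤ, HasDerivAt (fun y => sn (fun z => F z y) k) (sn (fun z => F' z y) k) y :=
    fun k => hasDerivAt_integral_param (a := 0) (b := 1)
      (f := fun y x => F x y * Real.sin (k * x)) (f' := fun y x => F' x y * Real.sin (k * x))
      ((hF.cont.comp continuous_swap).mul (by fun_prop))
      ((hF'.cont.comp continuous_swap).mul (by fun_prop))
      (fun x y hy => (h x y hy).mul_const _) hy
  exact ((h x y hy).const_mul _).add (HasDerivAt.fun_sum fun k _ =>
    ((((h1 k).const_mul _).add ((h2 k).const_mul _)).const_mul _).const_mul _)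

lemma mult_add {f g : ℝ → ℝ} (hf : PC f) (hg : PC g) (x : ℝ) :
    mult w N (fun x => f x + g x) x = mult w N f x + mult w N g x := by
  have e : mult w N (fun x => f x + g x) = fun x => mult w N f x + mult w N g x := by
    have hfg : PC fun x => f x + g x := ⟨hf.cont.add hg.cont, hf.per.add hg.per⟩
    apply eq_of_fc_eq hfg.mult.cont (hf.mult.cont.add hg.mult.cont) hfg.mult.per
      (hf.mult.per.add hg.mult.per)
    intro k
    change fc (mult w N fun x => f x + g x) k = fc (fun x => mult w N f x + mult w N g x) k
    rw [fc_add hf.mult.cont hg.mult.cont, fc_mult hfg.cont, fc_mult hf.cont, fc_mult hg.cont,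
      fc_add hf.cont hg.cont, mul_add]
  rw [e]

lemma mult_const_mul (c : ℝ) (f : ℝ → ℝ) (x : ℝ) :
    mult w N (fun x => c * f x) x = c * mult w N f x := by
  have h1 : ∀ k, cs (fun x => c * f x) k = c * cs f k := fun k => by
    simp only [cs, mul_assoc, intervalIntegral.integral_const_mul]
  have h2 : ∀ k, sn (fun x => c * f x) k = c * sn f k := fun k => by
    simp only [sn, mul_assoc, intervalIntegral.integral_const_mul]
  simp only [mult, mode, h1, h2, mul_add, Finset.mul_sum]
  congr 1
  · ring
  · refine Finset.sum_congr rfl fun k _ => ?_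
    ring

lemma MM_add (hF : PF F) (hG : PF G) (x y : ℝ) :
    MM w N (fun x y => F x y + G x y) x y = MM w N F x y + MM w N G x y :=
  mult_add (hF.pc y) (hG.pc y) x

lemma MM_const_mul (c : ℝ) (F : ℝ → ℝ → ℝ) (x y : ℝ) :
    MM w N (fun x y => c * F x y) x y = c * MM w N F x y := mult_const_mul c _ x

lemma MM_wall {b : ℝ} (h : ∀ x, F x b = 0) (x : ℝ) : MM w N F x b = 0 := by
  have : (fun z => F z b) = fun z => 0 * F z b := by ext z; rw [h, zero_mul]
  rw [MM, this, mult_const_mul, zero_mul]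

end MM

/-! ### The stream function -/

/-- A stream function vanishing on the walls, with its derivatives, and its vorticity. -/
structure Stream (ε : ℝ) (φ φx φy φxx φxy φyy ω : ℝ → ℝ → ℝ) : Prop where
  pf : PF φ
  pfx : PF φx
  pfy : PF φy
  pfxx : PF φxx
  pfxy : PF φxy
  pfyy : PF φyy
  pfω : PF ω
  dx : HasX φ φx
  dxx : HasX φx φxx
  dxy : HasX φy φxy
  dy : HasY φ φy
  dyy : HasY φy φyy
  dyx : HasY φx φxy
  wall0 : ∀ x, φ x 0 = 0
  wall1 : ∀ x, φ x 1 = 0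
  vort : ∀ x, ∀ y ∈ Ioo (0 : ℝ) 1, ω x y = ε ^ 2 * φxx x y + φyy x y

namespace Stream
variable {ε : ℝ} {φ φx φy φxx φxy φyy ω : ℝ → ℝ → ℝ}

lemma MM (h : Stream ε φ φx φy φxx φxy φyy ω) (w : ℕ → ℝ) (N : ℕ) :
    Stream ε (MM w N φ) (MM w N φx) (MM w N φy) (MM w N φxx) (MM w N φxy) (MM w N φyy)
      (MM w N ω) where
  pf := h.pf.MM
  pfx := h.pfx.MM
  pfy := h.pfy.MM
  pfxx := h.pfxx.MM
  pfxy := h.pfxy.MM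
  pfyy := h.pfyy.MM
  pfω := h.pfω.MM
  dx := h.dx.MM h.pf h.pfx
  dxx := h.dxx.MM h.pfx h.pfxx
  dxy := h.dxy.MM h.pfy h.pfxy
  dy := h.dy.MM h.pf h.pfy
  dyy := h.dyy.MM h.pfy h.pfyy
  dyx := h.dyx.MM h.pfx h.pfxy
  wall0 := MM_wall h.wall0
  wall1 := MM_wall h.wall1
  vort := fun x y hy => by
    have e : (fun z => ω z y) = fun z => ε ^ 2 * φxx z y + φyy z y := by
      ext z; exact h.vort z y hy
    rw [HydroNS.MM, e, HydroNS.mult_add ((h.pfxx.const_mul _).pc y) (h.pfyy.pc y),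
      mult_const_mul]
    rfl

lemma wall_x {b : ℝ} (h : HasX φ φx) (h0 : ∀ x, φ x b = 0) (x : ℝ) : φx x b = 0 := by
  have h1 := h x b
  simp only [h0] at h1
  exact h1.unique (hasDerivAt_const x 0)

/-- The hydrostatic cancellation: `∂ₓφ` is orthogonal to the vorticity of `φ`, because
`∂ₓφ ∂ᵧ²φ` and `∂ₓφ ∂ₓ²φ` integrate to zero by parts. -/
lemma I2_dx_mul_vort (h : Stream ε φ φx φy φxx φxy φyy ω) :
    I2 (fun x y => φx x y * ω x y) = 0 := by
  have e : I2 (fun x y => φx x y * ω x y)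
      = ε ^ 2 * I2 (fun x y => φxx x y * φx x y) + I2 fun x y => φyy x y * φx x y := by
    rw [← I2_const_mul, ← I2_add ((h.pfxx.mul h.pfx).const_mul _) (h.pfyy.mul h.pfx)]
    refine I2_congr fun x y hy => ?_
    rw [h.vort x y hy]; ring
  have e1 := I2_ibp_x h.pfx h.pfx h.pfxx h.pfxx h.dxx h.dxx
  have e2 := I2_ibp_y h.pfy h.pfx h.pfyy h.pfxy h.dyy h.dyx
    (fun x => by rw [wall_x h.dx h.wall0, mul_zero]) (fun x => by rw [wall_x h.dx h.wall1, mul_zero])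
  have e3 := I2_ibp_x h.pfy h.pfy h.pfxy h.pfxy h.dxy h.dxy
  have c1 : I2 (fun x y => φx x y * φxx x y) = I2 fun x y => φxx x y * φx x y := by
    simp only [mul_comm]
  have c2 : I2 (fun x y => φy x y * φxy x y) = I2 fun x y => φxy x y * φy x y := by
    simp only [mul_comm]
  rw [e, e2]
  have z1 : I2 (fun x y => φxx x y * φx x y) = 0 := by linarith
  have z2 : I2 (fun x y => φy x y * φxy x y) = 0 := by linarith
  rw [z1, z2]; ring

lemma energy (h : Stream ε φ φx φy φxx φxy φyy ω) :
    ε ^ 2 * I2 (fun x y => φx x y ^ 2) + I2 (fun x y => φy x y ^ 2)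
      = - I2 fun x y => φ x y * ω x y := by
  have e : I2 (fun x y => φ x y * ω x y)
      = ε ^ 2 * I2 (fun x y => φxx x y * φ x y) + I2 fun x y => φyy x y * φ x y := by
    rw [← I2_const_mul, ← I2_add ((h.pfxx.mul h.pf).const_mul _) (h.pfyy.mul h.pf)]
    refine I2_congr fun x y hy => ?_
    rw [h.vort x y hy]; ring
  have e1 := I2_ibp_x h.pfx h.pf h.pfxx h.pfx h.dxx h.dx
  have e2 := I2_ibp_y h.pfy h.pf h.pfyy h.pfy h.dyy h.dy
    (fun x => by rw [h.wall0, mul_zero]) (fun x => by rw [h.wall1, mul_zero])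
  rw [e, e1, e2]
  simp only [pow_two]
  ring

/-- Elliptic estimate for the velocity. -/
lemma grad_le (h : Stream ε φ φx φy φxx φxy φyy ω) :
    ε ^ 2 * I2 (fun x y => φx x y ^ 2) + I2 (fun x y => φy x y ^ 2)
      ≤ 4 * I2 fun x y => ω x y ^ 2 := by
  have h1 := h.energy
  have h2 := abs_I2_mul_le h.pf h.pfω (δ := 4) (by norm_num)
  have h3 := poincare h.pf h.pfy h.dy h.wall0
  have h4 := (abs_le.1 h2).1
  have h5 := mul_nonneg (sq_nonneg ε) (I2_sq_nonneg h.pfx)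
  linarith

lemma sq_le (h : Stream ε φ φx φy φxx φxy φyy ω) :
    I2 (fun x y => φ x y ^ 2) ≤ 16 * I2 fun x y => ω x y ^ 2 := by
  have h1 := h.grad_le
  have h3 := poincare h.pf h.pfy h.dy h.wall0
  have h5 := mul_nonneg (sq_nonneg ε) (I2_sq_nonneg h.pfx)
  linarith

/-- Elliptic estimate for the velocity at the walls, from the multiplier `(2 y - 1) ∂ᵧ φ`. -/
lemma trace_le (h : Stream ε φ φx φy φxx φxy φyy ω) :
    (∫ x in 0..2 * Real.pi, (φy x 1 ^ 2 + φy x 0 ^ 2)) ≤ 13 * I2 fun x y => ω x y ^ 2 := by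
  have pq : PF fun _ y => 2 * y - 1 := PF.of_y (by fun_prop)
  have hq : HasY (fun _ y => 2 * y - 1) fun _ _ => 2 := fun x y _ => by
    simpa using ((hasDerivAt_id y).const_mul 2).sub_const 1
  have hqx : HasX (fun _ y => 2 * y - 1) fun _ _ => 0 := fun x y => hasDerivAt_const x _
  have p2 : PF fun _ _ => (2 : ℝ) := PF.of_y (by fun_prop)
  have p0 : PF fun _ _ => (0 : ℝ) := PF.of_y (by fun_prop)
  have e1 := I2_hasY (pq.mul (h.pfy.mul h.pfy))
    ((p2.mul (h.pfy.mul h.pfy)).add (pq.mul ((h.pfyy.mul h.pfy).add (h.pfy.mul h.pfyy))))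
    (hq.mul (h.dyy.mul h.dyy))
  have e2 := I2_hasY_zero (pq.mul (h.pfx.mul h.pfx))
    ((p2.mul (h.pfx.mul h.pfx)).add (pq.mul ((h.pfxy.mul h.pfx).add (h.pfx.mul h.pfxy))))
    (hq.mul (h.dyx.mul h.dyx)) (fun x => by simp [wall_x h.dx h.wall0])
    (fun x => by simp [wall_x h.dx h.wall1])
  have e3 := I2_ibp_x h.pfx (pq.mul h.pfy) h.pfxx ((p0.mul h.pfy).add (pq.mul h.pfxy))
    h.dxx (hqx.mul h.dxy)
  have f1 : I2 (fun x y => 2 * (φy x y * φy x y) + (2 * y - 1) *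
      (φyy x y * φy x y + φy x y * φyy x y))
      = 2 * I2 (fun x y => φy x y ^ 2) + 2 * I2 (fun x y => ((2 * y - 1) * φy x y) * ω x y)
        - 2 * ε ^ 2 * I2 (fun x y => φxx x y * ((2 * y - 1) * φy x y)) := by
    rw [← I2_const_mul, ← I2_const_mul, ← I2_const_mul,
      ← I2_add ((h.pfy.pow 2).const_mul _) (((pq.mul h.pfy).mul h.pfω).const_mul _),
      ← I2_sub (((h.pfy.pow 2).const_mul _).add (((pq.mul h.pfy).mul h.pfω).const_mul _))
        ((h.pfxx.mul (pq.mul h.pfy)).const_mul _)]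
    refine I2_congr fun x y hy => ?_
    rw [h.vort x y hy]; ring
  have f2 : I2 (fun x y => 2 * (φx x y * φx x y) + (2 * y - 1) *
      (φxy x y * φx x y + φx x y * φxy x y))
      = 2 * I2 (fun x y => φx x y ^ 2)
        + 2 * I2 (fun x y => φx x y * (0 * φy x y + (2 * y - 1) * φxy x y)) := by
    rw [← I2_const_mul, ← I2_const_mul, ← I2_add ((h.pfx.pow 2).const_mul _)
      ((h.pfx.mul ((p0.mul h.pfy).add (pq.mul h.pfxy))).const_mul _)]
    refine I2_congr fun x y hy => ?_
    ring
  have f3 : (∫ x in 0..2 * Real.pi, (φy x 1 ^ 2 + φy x 0 ^ 2))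
      = ∫ x in 0..2 * Real.pi, ((2 * 1 - 1) * (φy x 1 * φy x 1)
        - (2 * 0 - 1) * (φy x 0 * φy x 0)) := by
    congr 1; ext x; ring
  have g1 := abs_I2_mul_le (pq.mul h.pfy) h.pfω (δ := 1) one_pos
  have g2 : I2 (fun x y => ((2 * y - 1) * φy x y) ^ 2) ≤ I2 fun x y => φy x y ^ 2 :=
    I2_mono ((pq.mul h.pfy).pow 2) (h.pfy.pow 2) fun x y hy => by
      have : (2 * y - 1) ^ 2 ≤ 1 := by nlinarith [hy.1, hy.2]
      rw [mul_pow]; nlinarith [sq_nonneg (φy x y)]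
  have g3 := (abs_le.1 g1).2
  have g4 := h.grad_le
  have h5 := mul_nonneg (sq_nonneg ε) (I2_sq_nonneg h.pfx)
  rw [f3, ← e1, f1]
  rw [f2] at e2
  rw [e3]
  have e4 : I2 (fun x y => φx x y * (0 * φy x y + (2 * y - 1) * φxy x y))
    = - I2 (fun x y => φx x y ^ 2) := by linarith
  rw [e4]
  simp only [inv_one] at g3
  nlinarith

end Stream

end

section

/-! ### The energy estimate at a fixed time -/

/-- Inequalities between integrals in `x`, for each `y`, can be integrated in `y`. -/
lemma I2_le_of_slice {F G₁ G₂ : ℝ → ℝ → ℝ} {a c : ℝ} (hF : PF F) (h₁ : PF G₁) (h₂ : PF G₂)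
    (h : ∀ y ∈ Ioo (0 : ℝ) 1, ∫ x in 0..2 * Real.pi, F x y
      ≤ a * (∫ x in 0..2 * Real.pi, G₁ x y) + c * ∫ x in 0..2 * Real.pi, G₂ x y) :
    I2 F ≤ a * I2 G₁ + c * I2 G₂ := by
  have c1 := h₁.inner
  have c2 := h₂.inner
  rw [I2, I2, I2, ← intervalIntegral.integral_const_mul, ← intervalIntegral.integral_const_mul,
    ← intervalIntegral.integral_add (Continuous.intervalIntegrable (by fun_prop) _ _)
      (Continuous.intervalIntegrable (by fun_prop) _ _)]
  exact intervalIntegral.integral_mono_on_of_le_Ioo zero_le_one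
    (hF.inner.intervalIntegrable _ _) (Continuous.intervalIntegrable (by fun_prop) _ _) h

lemma abs_I2_le_of_slice {F G₁ G₂ : ℝ → ℝ → ℝ} {a c : ℝ} (hF : PF F) (h₁ : PF G₁) (h₂ : PF G₂)
    (h : ∀ y ∈ Ioo (0 : ℝ) 1, |∫ x in 0..2 * Real.pi, F x y|
      ≤ a * (∫ x in 0..2 * Real.pi, G₁ x y) + c * ∫ x in 0..2 * Real.pi, G₂ x y) :
    |I2 F| ≤ a * I2 G₁ + c * I2 G₂ := by
  rw [abs_le']; constructor
  · exact I2_le_of_slice hF h₁ h₂ fun y hy => (le_abs_self _).trans (h y hy)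
  · rw [← I2_neg]
    refine I2_le_of_slice hF.neg h₁ h₂ fun y hy => ?_
    rw [intervalIntegral.integral_neg]
    exact (neg_le_abs _).trans (h y hy)

/-- The data of the linearised vorticity problem at a fixed time: the profile `u`, `v`, with
`b = ∂ᵧω^p`, `η = ∂ₓω^p`, `q = ∂ₜω^p`, and the solution, all with the derivatives that occur
(the letter `z` stands for a normal derivative of a coefficient). The derivatives are data, related
to the functions by `HasX` and `HasY`, so that everything can be extended continuously beyond the
walls. `R` bounds the profile; `∂ᵧb` and `q` are bounded only by an integrable function `ρ` of `y`. -/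
structure Slice (c₀ R τ ε : ℝ) where
  (u ux v b bx bz η q qz : ℝ → ℝ → ℝ)
  (ρ : ℝ → ℝ)
  (φ φx φy φxx φxy φyy ω ωx ωy ωxx ωyy ωt : ℝ → ℝ → ℝ)
  (Nu Nuy Nv Nvx f₁ f₂ : ℝ → ℝ → ℝ)
  C : ℝ
  hc₀ : 0 < c₀
  hR : 1 ≤ R
  hτ0 : 0 ≤ τ
  hτ1 : τ ≤ 1
  hε0 : 0 < ε
  hε1 : ε ≤ 1
  pu : PF u
  pux : PF ux
  pv : PF v
  pb : PF b
  pbx : PF bx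
  pbz : PF bz
  pη : PF η
  pq : PF q
  pqz : PF qz
  cρ : Continuous ρ
  dux : HasX u ux
  dbx : HasX b bx
  dbz : HasY b bz
  dqz : HasY q qz
  gu : ∀ y ∈ Ioo (0 : ℝ) 1, GB R τ fun x => u x y
  gv : ∀ y ∈ Ioo (0 : ℝ) 1, GB R τ fun x => v x y
  gb : ∀ y ∈ Ioo (0 : ℝ) 1, GB R τ fun x => b x y
  gη : ∀ y ∈ Ioo (0 : ℝ) 1, GB R τ fun x => η x y
  su : ∀ x, ∀ y ∈ Ioo (0 : ℝ) 1, |u x y| ≤ R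
  sux : ∀ x, ∀ y ∈ Ioo (0 : ℝ) 1, |ux x y| ≤ R
  sb : ∀ x, ∀ y ∈ Ioo (0 : ℝ) 1, |b x y| ≤ R
  sbx : ∀ x, ∀ y ∈ Ioo (0 : ℝ) 1, |bx x y| ≤ R
  sbz : ∀ x, ∀ y ∈ Ioo (0 : ℝ) 1, bz x y ^ 2 ≤ ρ y
  sq : ∀ x, ∀ y ∈ Ioo (0 : ℝ) 1, q x y ^ 2 ≤ ρ y
  sρ : ∫ y in 0..1, ρ y ≤ R
  b_ge : ∀ x y, c₀ ≤ b x y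
  st : Stream ε φ φx φy φxx φxy φyy ω
  pωx : PF ωx
  pωy : PF ωy
  pωxx : PF ωxx
  pωyy : PF ωyy
  dωx : HasX ω ωx
  dωxx : HasX ωx ωxx
  dωy : HasY ω ωy
  dωyy : HasY ωy ωyy
  ω0 : ∀ x, ω x 0 = 0
  ω1 : ∀ x, ω x 1 = 0
  pNu : PF Nu
  pNuy : PF Nuy
  pNv : PF Nv
  pNvx : PF Nvx
  pf₁ : PF f₁
  pf₂ : PF f₂
  dNu : HasY Nu Nuy
  dNv : HasX Nv Nvx
  eqn : ∀ x, ∀ y ∈ Ioo (0 : ℝ) 1,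
    ωt x y - (ε ^ 2 * ωxx x y + ωyy x y) + u x y * ωx x y + v x y * ωy x y + φy x y * η x y
      - φx x y * b x y = Nuy x y - ε ^ 2 * Nvx x y + ε ^ 2 * f₁ x y + f₂ x y - C * η x y

namespace Slice
variable {c₀ R τ ε : ℝ} (s : Slice c₀ R τ ε) (N : ℕ)

/-- The weighted vorticity. -/
def g : ℝ → ℝ → ℝ := MM (gw τ) N s.ω
/-- Its `x` derivative. -/
def gx : ℝ → ℝ → ℝ := MM (gw τ) N s.ωx
/-- Its `y` derivative. -/
def gy : ℝ → ℝ → ℝ := MM (gw τ) N s.ωy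
/-- The weighted vorticity divided by `∂ᵧω^p`: the test function of the hydrostatic energy. -/
def h (x y : ℝ) : ℝ := s.g N x y / s.b x y
/-- Its `x` derivative. -/
def hx (x y : ℝ) : ℝ := (s.gx N x y - s.bx x y * s.h N x y) / s.b x y
/-- Its `y` derivative. -/
def hy (x y : ℝ) : ℝ := (s.gy N x y - s.bz x y * s.h N x y) / s.b x y
/-- The time derivative of the weighted vorticity, when the radius decreases at speed `lam`. -/
def gt (lam : ℝ) (x y : ℝ) : ℝ :=
  MM (gw τ) N s.ωt x y - lam * MM (fun n => th n ^ 2) N (s.g N) x y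

/-- The `L²` energy of the test function. -/
def H : ℝ := I2 fun x y => s.h N x y ^ 2
/-- The gain of `1/3` of a derivative. -/
def S : ℝ := I2 fun x y => MM th N (s.h N) x y ^ 2
/-- The dissipation. -/
def D : ℝ := ε ^ 2 * (I2 fun x y => s.hx N x y ^ 2) + I2 fun x y => s.hy N x y ^ 2

lemma b_pos (x y : ℝ) : 0 < s.b x y := s.hc₀.trans_le (s.b_ge x y)
lemma b_ne (x y : ℝ) : s.b x y ≠ 0 := (s.b_pos x y).ne'
lemma pg : PF (s.g N) := s.st.pfω.MM
lemma pgx : PF (s.gx N) := s.pωx.MM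
lemma pgy : PF (s.gy N) := s.pωy.MM
lemma ph : PF (s.h N) := (s.pg N).div s.pb s.b_ne
lemma phx : PF (s.hx N) := ((s.pgx N).sub (s.pbx.mul (s.ph N))).div s.pb s.b_ne
lemma phy : PF (s.hy N) := ((s.pgy N).sub (s.pbz.mul (s.ph N))).div s.pb s.b_ne
lemma dgx : HasX (s.g N) (s.gx N) := s.dωx.MM s.st.pfω s.pωx
lemma dgy : HasY (s.g N) (s.gy N) := s.dωy.MM s.st.pfω s.pωy
lemma dhx : HasX (s.h N) (s.hx N) := (s.dgx N).div s.dbx s.b_ne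
lemma dhy : HasY (s.h N) (s.hy N) := (s.dgy N).div s.dbz s.b_ne

lemma g_eq (x y : ℝ) : s.g N x y = s.b x y * s.h N x y := by
  have := s.b_ne x y; unfold h; field_simp
lemma gx_eq (x y : ℝ) : s.gx N x y = s.b x y * s.hx N x y + s.bx x y * s.h N x y := by
  have := s.b_ne x y; unfold hx; field_simp; ring
lemma gy_eq (x y : ℝ) : s.gy N x y = s.b x y * s.hy N x y + s.bz x y * s.h N x y := by
  have := s.b_ne x y; unfold hy; field_simp; ring
lemma h0 (x : ℝ) : s.h N x 0 = 0 := by rw [h, g, MM_wall s.ω0, zero_div]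
lemma h1 (x : ℝ) : s.h N x 1 = 0 := by rw [h, g, MM_wall s.ω1, zero_div]

lemma H_nonneg : 0 ≤ s.H N := I2_sq_nonneg (s.ph N)
lemma S_nonneg : 0 ≤ s.S N := I2_sq_nonneg (s.ph N).MM

lemma H_le_S : s.H N ≤ s.S N := by
  have := I2_le_of_slice (a := 1) (c := 0) ((s.ph N).pow 2) (((s.ph N).MM (w := th) (N := N)).pow 2)
    ((s.ph N).pow 2) fun y _ => by
      have := integral_sq_le_of_norm_fc_le (C := 1) ((s.ph N).cx y)
        (((s.ph N).pc y).mult (w := th) (N := N)).cont fun k => by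
          rw [fc_mult ((s.ph N).cx y), norm_mul, Complex.norm_real,
            Real.norm_of_nonneg (th_pos _).le]
          nlinarith [one_le_th (tr N k), norm_nonneg (fc (fun x => s.h N x y) k)]
      rw [one_pow] at this
      rw [zero_mul, add_zero]
      exact this
  simpa [H, S] using this

lemma hx_le : ε ^ 2 * (I2 fun x y => s.hx N x y ^ 2) ≤ s.D N := by
  have := I2_sq_nonneg (s.phy N); unfold D; linarith
lemma hy_le : (I2 fun x y => s.hy N x y ^ 2) ≤ s.D N := by
  have := mul_nonneg (sq_nonneg ε) (I2_sq_nonneg (s.phx N)); unfold D; linarith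
lemma D_nonneg : 0 ≤ s.D N := (I2_sq_nonneg (s.phy N)).trans (s.hy_le N)
lemma R_pos (s : Slice c₀ R τ ε) : 0 < R := by linarith [s.hR]

/-- The weighted vorticity `g = b h` in `H^{1/3}`, by the test function `h` in `H^{1/3}`. -/
lemma gain_g_le : I2 (fun x y => MM th N (s.g N) x y ^ 2) ≤ (2 * R * ZZ) ^ 2 * s.S N := by
  have := I2_le_of_slice (a := (2 * R * ZZ) ^ 2) (c := 0)
    (((s.pg N).MM (w := th) (N := N)).pow 2) (((s.ph N).MM (w := th) (N := N)).pow 2)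
    ((s.ph N).pow 2) fun y hy => by
      have := mult_th_mul_bound (N := N) s.hτ0 (s.pb.pc y) (s.gb y hy) ((s.ph N).pc y)
      simp only [← s.g_eq] at this
      rw [zero_mul, add_zero]
      exact this
  simpa [S] using this

lemma g_sq_le : I2 (fun x y => s.g N x y ^ 2) ≤ R ^ 2 * s.H N := by
  rw [H, ← I2_const_mul]
  refine I2_mono ((s.pg N).pow 2) (((s.ph N).pow 2).const_mul _) fun x y hy => ?_
  rw [s.g_eq, mul_pow, ← sq_abs (s.b x y)]
  have := s.sb x y hy
  gcongr

/-- Terms in which a coefficient is only square integrable in `y`: the factor `h`, which vanishes at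
the wall, is bounded in `y` at the expense of a part of the dissipation. -/
lemma abs_weak_le {r : ℝ → ℝ → ℝ} (hr : PF r) (hρ : ∀ x, ∀ y ∈ Ioo (0 : ℝ) 1, r x y ^ 2 ≤ s.ρ y)
    {δ : ℝ} (hδ : 0 < δ) :
    |I2 fun x y => r x y * s.h N x y * s.hy N x y| ≤ δ * s.D N + R ^ 2 / (2 * δ ^ 3) * s.H N := by
  have hR := s.R_pos
  have k1 := abs_I2_mul_le (hr.mul (s.ph N)) (s.phy N) hδ
  have k2 := I2_sq_mul_sq_le hr s.cρ hρ s.sρ (s.ph N) (s.phy N) (s.dhy N) (s.h0 N)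
    (δ := δ ^ 2 / R) (by positivity)
  have k3 := s.hy_le N
  have k4 : δ⁻¹ / 2 * I2 (fun x y => (r x y * s.h N x y) ^ 2)
      ≤ δ⁻¹ / 2 * (R * (δ ^ 2 / R * (I2 fun x y => s.hy N x y ^ 2)
        + (δ ^ 2 / R)⁻¹ * I2 fun x y => s.h N x y ^ 2)) := by gcongr
  have k5 : δ⁻¹ / 2 * (R * (δ ^ 2 / R * (I2 fun x y => s.hy N x y ^ 2)
        + (δ ^ 2 / R)⁻¹ * I2 fun x y => s.h N x y ^ 2))
      = δ / 2 * (I2 fun x y => s.hy N x y ^ 2) + R ^ 2 / (2 * δ ^ 3) * s.H N := by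
    unfold H; field_simp
  have k6 : δ * (I2 fun x y => s.hy N x y ^ 2) ≤ δ * s.D N := by gcongr
  linarith

lemma gy_sq_le : I2 (fun x y => s.gy N x y ^ 2) ≤ 4 * R ^ 2 * s.D N + 2 * R ^ 2 * s.H N := by
  have hR := s.hR
  have k2 := I2_sq_mul_sq_le s.pbz s.cρ s.sbz s.sρ (s.ph N) (s.phy N) (s.dhy N) (s.h0 N)
    (δ := 1) one_pos
  have k3 := s.hy_le N
  have k1 : I2 (fun x y => s.gy N x y ^ 2) ≤ 2 * R ^ 2 * I2 (fun x y => s.hy N x y ^ 2)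
      + 2 * I2 fun x y => (s.bz x y * s.h N x y) ^ 2 := by
    rw [← I2_const_mul, ← I2_const_mul, ← I2_add (((s.phy N).pow 2).const_mul _)
      (((s.pbz.mul (s.ph N)).pow 2).const_mul _)]
    refine I2_mono ((s.pgy N).pow 2) ((((s.phy N).pow 2).const_mul _).add
      (((s.pbz.mul (s.ph N)).pow 2).const_mul _)) fun x y hy => ?_
    rw [s.gy_eq]
    have h1 : (s.b x y * s.hy N x y) ^ 2 ≤ R ^ 2 * s.hy N x y ^ 2 := by
      rw [mul_pow, ← sq_abs (s.b x y)]
      have := s.sb x y hy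
      gcongr
    nlinarith [sq_nonneg (s.b x y * s.hy N x y - s.bz x y * s.h N x y)]
  have k4 : 0 ≤ s.H N := s.H_nonneg N
  have k5 : 0 ≤ s.D N := s.D_nonneg N
  have k6 : (I2 fun x y => s.h N x y ^ 2) = s.H N := rfl
  rw [k6] at k2
  have k7 : 2 * R ^ 2 * I2 (fun x y => s.hy N x y ^ 2) ≤ 2 * R ^ 2 * s.D N := by gcongr
  have k8 : R * I2 (fun x y => s.hy N x y ^ 2) ≤ R ^ 2 * s.D N := by
    have : R ≤ R ^ 2 := by nlinarith
    gcongr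
    exact I2_sq_nonneg (s.phy N)
  have k9 : R * s.H N ≤ R ^ 2 * s.H N := by
    have : R ≤ R ^ 2 := by nlinarith
    gcongr
  simp only [inv_one, one_mul] at k2
  linarith

lemma gx_sq_le : ε ^ 2 * I2 (fun x y => s.gx N x y ^ 2)
    ≤ 4 * R ^ 2 * s.D N + 2 * R ^ 2 * s.H N := by
  have hR := s.hR
  have k1 : I2 (fun x y => s.gx N x y ^ 2) ≤ 2 * R ^ 2 * I2 (fun x y => s.hx N x y ^ 2)
      + 2 * R ^ 2 * s.H N := by
    rw [H, ← I2_const_mul, ← I2_const_mul, ← I2_add (((s.phx N).pow 2).const_mul _)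
      (((s.ph N).pow 2).const_mul _)]
    refine I2_mono ((s.pgx N).pow 2) ((((s.phx N).pow 2).const_mul _).add
      (((s.ph N).pow 2).const_mul _)) fun x y hy => ?_
    rw [s.gx_eq]
    have h1 : (s.b x y * s.hx N x y) ^ 2 ≤ R ^ 2 * s.hx N x y ^ 2 := by
      rw [mul_pow, ← sq_abs (s.b x y)]
      have := s.sb x y hy
      gcongr
    have h2 : (s.bx x y * s.h N x y) ^ 2 ≤ R ^ 2 * s.h N x y ^ 2 := by
      rw [mul_pow, ← sq_abs (s.bx x y)]
      have := s.sbx x y hy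
      gcongr
    nlinarith [sq_nonneg (s.b x y * s.hx N x y - s.bx x y * s.h N x y)]
  have k2 := s.hx_le N
  have k3 : ε ^ 2 ≤ 1 := pow_le_one₀ s.hε0.le s.hε1
  have k4 := s.H_nonneg N
  have k5 := s.D_nonneg N
  calc _ ≤ ε ^ 2 * (2 * R ^ 2 * I2 (fun x y => s.hx N x y ^ 2) + 2 * R ^ 2 * s.H N) := by gcongr
    _ = 2 * R ^ 2 * (ε ^ 2 * I2 (fun x y => s.hx N x y ^ 2)) + 2 * R ^ 2 * (ε ^ 2 * s.H N) := by
      ring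
    _ ≤ 2 * R ^ 2 * s.D N + 2 * R ^ 2 * (1 * s.H N) := by gcongr
    _ ≤ _ := by nlinarith [mul_nonneg (sq_nonneg R) k5]

/-! #### The terms of the energy identity -/

/-- The decay of the radius gains `1/3` of a derivative. -/
lemma gain_term : c₀ / 2 * s.S N - (1 * R * ZZ) ^ 2 / (2 * c₀) * s.H N
    ≤ I2 fun x y => MM (fun n => th n ^ 2) N (s.g N) x y * s.h N x y := by
  have pm := ((s.pg N).MM (w := fun n => th n ^ 2) (N := N)).mul (s.ph N)
  have := I2_le_of_slice (F := fun x y => c₀ / 2 * MM th N (s.h N) x y ^ 2)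
    (a := 1) (c := (1 * R * ZZ) ^ 2 / (2 * c₀))
    ((((s.ph N).MM (w := th) (N := N)).pow 2).const_mul _) pm ((s.ph N).pow 2) fun y hy => by
      have := gain_coercive (N := N) s.hc₀ s.hτ0 (s.pb.pc y) (s.gb y hy)
        (fun x => s.b_ge x y) ((s.ph N).pc y)
      simp only [← s.g_eq] at this
      rw [intervalIntegral.integral_const_mul]
      simp only [MM]
      linarith
  rw [I2_const_mul] at this
  unfold S H
  linarith

/-- The diffusion gives the dissipation. There are no boundary terms, as `h` vanishes on the walls.
-/
lemma diffusion_term {δ : ℝ} (hδ : 0 < δ) :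
    I2 (fun x y => MM (gw τ) N (fun x y => ε ^ 2 * s.ωxx x y + s.ωyy x y) x y * s.h N x y)
      ≤ -c₀ * s.D N + 2 * δ * s.D N + (R ^ 2 / (2 * δ) + R ^ 2 / (2 * δ ^ 3)) * s.H N := by
  have pxx := s.pωxx.MM (w := gw τ) (N := N)
  have pyy := s.pωyy.MM (w := gw τ) (N := N)
  have e : I2 (fun x y => MM (gw τ) N (fun x y => ε ^ 2 * s.ωxx x y + s.ωyy x y) x y * s.h N x y)
      = ε ^ 2 * I2 (fun x y => MM (gw τ) N s.ωxx x y * s.h N x y)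
        + I2 fun x y => MM (gw τ) N s.ωyy x y * s.h N x y := by
    rw [← I2_const_mul, ← I2_add ((pxx.mul (s.ph N)).const_mul _) (pyy.mul (s.ph N))]
    refine I2_congr fun x y _ => ?_
    rw [MM_add (s.pωxx.const_mul _) s.pωyy, MM_const_mul]; ring
  have e1 := I2_ibp_x (s.pgx N) (s.ph N) pxx (s.phx N) (s.dωxx.MM s.pωx s.pωxx) (s.dhx N)
  have e2 := I2_ibp_y (s.pgy N) (s.ph N) pyy (s.phy N) (s.dωyy.MM s.pωy s.pωyy) (s.dhy N)
    (fun x => by rw [s.h0, mul_zero]) (fun x => by rw [s.h1, mul_zero])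
  have e3 : I2 (fun x y => s.gx N x y * s.hx N x y)
      = I2 (fun x y => s.b x y * s.hx N x y ^ 2)
        + I2 fun x y => s.bx x y * s.h N x y * s.hx N x y := by
    rw [← I2_add (s.pb.mul ((s.phx N).pow 2)) ((s.pbx.mul (s.ph N)).mul (s.phx N))]
    refine I2_congr fun x y _ => ?_
    rw [s.gx_eq]; ring
  have e4 : I2 (fun x y => s.gy N x y * s.hy N x y)
      = I2 (fun x y => s.b x y * s.hy N x y ^ 2)
        + I2 fun x y => s.bz x y * s.h N x y * s.hy N x y := by
    rw [← I2_add (s.pb.mul ((s.phy N).pow 2)) ((s.pbz.mul (s.ph N)).mul (s.phy N))]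
    refine I2_congr fun x y _ => ?_
    rw [s.gy_eq]; ring
  have c1 : c₀ * I2 (fun x y => s.hx N x y ^ 2) ≤ I2 fun x y => s.b x y * s.hx N x y ^ 2 := by
    rw [← I2_const_mul]
    refine I2_mono (((s.phx N).pow 2).const_mul _) (s.pb.mul ((s.phx N).pow 2)) fun x y _ => ?_
    exact mul_le_mul_of_nonneg_right (s.b_ge x y) (sq_nonneg _)
  have c2 : c₀ * I2 (fun x y => s.hy N x y ^ 2) ≤ I2 fun x y => s.b x y * s.hy N x y ^ 2 := by
    rw [← I2_const_mul]
    refine I2_mono (((s.phy N).pow 2).const_mul _) (s.pb.mul ((s.phy N).pow 2)) fun x y _ => ?_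
    exact mul_le_mul_of_nonneg_right (s.b_ge x y) (sq_nonneg _)
  have w1 := (abs_le.1 (s.abs_weak_le N s.pbz s.sbz hδ)).1
  have w2 := (abs_le.1 (abs_I2_mul_le (s.pbx.mul (s.ph N)) (s.phx N) (δ := 2 * δ)
    (by positivity))).1
  have w3 : I2 (fun x y => (s.bx x y * s.h N x y) ^ 2) ≤ R ^ 2 * s.H N := by
    rw [H, ← I2_const_mul]
    refine I2_mono ((s.pbx.mul (s.ph N)).pow 2) (((s.ph N).pow 2).const_mul _) fun x y hy => ?_
    rw [mul_pow, ← sq_abs (s.bx x y)]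
    have := s.sbx x y hy
    gcongr
  have k3 : ε ^ 2 ≤ 1 := pow_le_one₀ s.hε0.le s.hε1
  have k0 : 0 ≤ ε ^ 2 := sq_nonneg _
  have w4 : (2 * δ)⁻¹ / 2 * I2 (fun x y => (s.bx x y * s.h N x y) ^ 2)
      ≤ R ^ 2 / (2 * δ) * s.H N := by
    calc _ ≤ (2 * δ)⁻¹ / 2 * (R ^ 2 * s.H N) := by gcongr
      _ = (R ^ 2 / (2 * δ) * s.H N) / 2 := by field_simp
      _ ≤ _ := by
        have : 0 ≤ R ^ 2 / (2 * δ) * s.H N := mul_nonneg (by positivity) (s.H_nonneg N)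
        linarith
  have w5 : -(R ^ 2 / (2 * δ) * s.H N) - δ * (ε ^ 2 * I2 (fun x y => s.hx N x y ^ 2))
      ≤ ε ^ 2 * I2 (fun x y => s.bx x y * s.h N x y * s.hx N x y) := by
    have t1 : ε ^ 2 * (-(R ^ 2 / (2 * δ) * s.H N + δ * I2 (fun x y => s.hx N x y ^ 2)))
        ≤ ε ^ 2 * I2 (fun x y => s.bx x y * s.h N x y * s.hx N x y) := by
      refine mul_le_mul_of_nonneg_left ?_ k0
      linarith
    have t2 : ε ^ 2 * (R ^ 2 / (2 * δ) * s.H N) ≤ 1 * (R ^ 2 / (2 * δ) * s.H N) :=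
      mul_le_mul_of_nonneg_right k3 (mul_nonneg (by positivity) (s.H_nonneg N))
    linarith
  have k6 : δ * (ε ^ 2 * I2 (fun x y => s.hx N x y ^ 2)) ≤ δ * s.D N :=
    mul_le_mul_of_nonneg_left (s.hx_le N) hδ.le
  have k7 := mul_le_mul_of_nonneg_left c1 k0
  have k8 : c₀ * s.D N = ε ^ 2 * (c₀ * I2 (fun x y => s.hx N x y ^ 2))
    + c₀ * I2 (fun x y => s.hy N x y ^ 2) := by unfold D; ring
  have e1' : I2 (fun x y => MM (gw τ) N s.ωxx x y * s.h N x y)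
    = - I2 (fun x y => s.gx N x y * s.hx N x y) := e1
  have e2' : I2 (fun x y => MM (gw τ) N s.ωyy x y * s.h N x y)
    = - I2 (fun x y => s.gy N x y * s.hy N x y) := e2
  rw [e, e1', e2', e3, e4]
  linarith

lemma commutator_u : |I2 fun x y =>
      (MM (gw τ) N (fun x y => s.u x y * s.ωx x y) x y - s.u x y * s.gx N x y) * s.h N x y|
      ≤ ((10 * R * ZZ) ^ 2 * (2 * R * ZZ) ^ 2 + 1) / 2 * s.S N := by
  have := abs_I2_le_of_slice (a := (10 * R * ZZ) ^ 2 / 2) (c := 1 / 2)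
    ((((s.pu.mul s.pωx).MM (w := gw τ) (N := N)).sub (s.pu.mul (s.pgx N))).mul (s.ph N))
    (((s.pg N).MM (w := th) (N := N)).pow 2) (((s.ph N).MM (w := th) (N := N)).pow 2)
    fun y hy => by
      have := commutator_deriv_bound (N := N) s.hτ0 s.hτ1 (s.pu.pc y) (s.gu y hy) (s.st.pfω.pc y)
        (fun x => s.dωx x y) (s.pωx.pc y) ((s.ph N).pc y)
      refine this.trans (le_of_eq ?_)
      rw [add_div, div_mul_eq_mul_div, one_div_mul_eq_div]
      rfl
  have h2 : (10 * R * ZZ) ^ 2 / 2 * I2 (fun x y => MM th N (s.g N) x y ^ 2)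
    ≤ (10 * R * ZZ) ^ 2 / 2 * ((2 * R * ZZ) ^ 2 * s.S N) := by
    gcongr; exact s.gain_g_le N
  refine this.trans ?_
  have : (I2 fun x y => MM th N (s.h N) x y ^ 2) = s.S N := rfl
  rw [this]
  linarith

/-- The transport by `u` is antisymmetric up to a commutator and terms without derivatives of `h`.
-/
lemma transport_u : |I2 fun x y => MM (gw τ) N (fun x y => s.u x y * s.ωx x y) x y * s.h N x y|
      ≤ (((10 * R * ZZ) ^ 2 * (2 * R * ZZ) ^ 2 + 1) / 2 + 2 * R ^ 2) * s.S N := by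
  have k1 := s.commutator_u N
  have pU := (s.pu.mul s.pωx).MM (w := gw τ) (N := N)
  have e : I2 (fun x y => MM (gw τ) N (fun x y => s.u x y * s.ωx x y) x y * s.h N x y)
      = I2 (fun x y =>
      (MM (gw τ) N (fun x y => s.u x y * s.ωx x y) x y - s.u x y * s.gx N x y) * s.h N x y)
      + I2 (fun x y => s.u x y * s.gx N x y * s.h N x y) := by
    rw [← I2_add ((pU.sub (s.pu.mul (s.pgx N))).mul (s.ph N)) ((s.pu.mul (s.pgx N)).mul (s.ph N))]
    refine I2_congr fun x y _ => ?_
    ring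
  have ph2 := (s.ph N).mul (s.ph N)
  have pub := s.pu.mul s.pb
  have z := I2_hasX (pub.mul ph2) ((((s.pux.mul s.pb).add (s.pu.mul s.pbx)).mul ph2).add
      (pub.mul (((s.phx N).mul (s.ph N)).add ((s.ph N).mul (s.phx N)))))
    ((s.dux.mul s.dbx).mul ((s.dhx N).mul (s.dhx N)))
  have e2 : I2 (fun x y => s.u x y * s.gx N x y * s.h N x y)
      = I2 (fun x y => (1 / 2) * (s.u x y * s.bx x y - s.ux x y * s.b x y)
        * s.h N x y ^ 2) := by
    have : I2 (fun x y => (1 / 2) * (s.u x y * s.bx x y - s.ux x y * s.b x y)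
        * s.h N x y ^ 2) = I2 (fun x y => s.u x y * s.gx N x y * s.h N x y)
        - (1 / 2) * I2 (fun x y => (s.ux x y * s.b x y + s.u x y * s.bx x y)
          * (s.h N x y * s.h N x y) + s.u x y * s.b x y
          * (s.hx N x y * s.h N x y + s.h N x y * s.hx N x y)) := by
      rw [← I2_const_mul, ← I2_sub ((s.pu.mul (s.pgx N)).mul (s.ph N))
        ((((((s.pux.mul s.pb).add (s.pu.mul s.pbx)).mul ph2).add
      (pub.mul (((s.phx N).mul (s.ph N)).add ((s.ph N).mul (s.phx N))))).const_mul _))]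
      refine I2_congr fun x y _ => ?_
      rw [s.gx_eq]; ring
    rw [this, z]; ring
  have k2 : |I2 (fun x y => (1 / 2) * (s.u x y * s.bx x y - s.ux x y * s.b x y)
        * s.h N x y ^ 2)| ≤ R ^ 2 * s.H N := by
    rw [H, ← I2_const_mul]
    refine abs_I2_le (((((s.pu.mul s.pbx).sub (s.pux.mul s.pb)).const_mul _)).mul ((s.ph N).pow 2))
      (((s.ph N).pow 2).const_mul _) fun x y hy => ?_
    rw [abs_mul, abs_of_nonneg (sq_nonneg (s.h N x y))]
    refine mul_le_mul_of_nonneg_right ?_ (sq_nonneg _)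
    rw [abs_mul, abs_of_pos (by norm_num : (0 : ℝ) < 1 / 2)]
    have hR := s.R_pos
    have a1 : |s.u x y * s.bx x y| ≤ R * R := by
      rw [abs_mul]; exact mul_le_mul (s.su x y hy) (s.sbx x y hy) (abs_nonneg _) hR.le
    have a2 : |s.ux x y * s.b x y| ≤ R * R := by
      rw [abs_mul]; exact mul_le_mul (s.sux x y hy) (s.sb x y hy) (abs_nonneg _) hR.le
    have := abs_sub (s.u x y * s.bx x y) (s.ux x y * s.b x y)
    nlinarith
  rw [e, e2]
  have k3 := s.H_le_S N
  have k4 : R ^ 2 * s.H N ≤ R ^ 2 * s.S N := by gcongr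
  have k5 := mul_nonneg (sq_nonneg R) (s.S_nonneg N)
  refine (abs_add_le _ _).trans ?_
  linarith

lemma I2_mult_mul_le (s : Slice c₀ R τ ε) (N : ℕ) {p F : ℝ → ℝ → ℝ} (hp : PF p) (hF : PF F)
    (hB : ∀ y ∈ Ioo (0 : ℝ) 1, GB R τ fun x => p x y) :
    I2 (fun x y => MM (gw τ) N (fun x y => p x y * F x y) x y ^ 2)
      ≤ (4 * R * ZZ) ^ 2 * I2 fun x y => MM (gw τ) N F x y ^ 2 := by
  have := I2_le_of_slice (a := (4 * R * ZZ) ^ 2) (c := 0)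
    (((hp.mul hF).MM (w := gw τ) (N := N)).pow 2) ((hF.MM (w := gw τ) (N := N)).pow 2)
    (hF.pow 2) fun y hy => by
      have := mult_mul_bound (N := N) s.hτ0 (hp.pc y) (hB y hy) (hF.pc y)
      rw [zero_mul, add_zero]
      exact this
  simpa using this

/-- The transport by `v`, which is controlled by the dissipation. -/
lemma transport_v {δ : ℝ} (hδ : 0 < δ) :
    |I2 fun x y => MM (gw τ) N (fun x y => s.v x y * s.ωy x y) x y * s.h N x y|
      ≤ δ * s.D N + (δ + (32 * R ^ 4 * ZZ ^ 2 + 1) / (2 * δ)) * s.H N := by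
  set A := 32 * R ^ 4 * ZZ ^ 2 with hA
  have hA0 : 0 ≤ A := by positivity
  have pV := (s.pv.mul s.pωy).MM (w := gw τ) (N := N)
  have k1 := abs_I2_mul_le (s.ph N) pV (δ := δ / (A + 1)) (by positivity)
  have k2 := s.I2_mult_mul_le N s.pv s.pωy s.gv
  have k3 := s.gy_sq_le N
  have k4 : I2 (fun x y => MM (gw τ) N s.ωy x y ^ 2) = I2 (fun x y => s.gy N x y ^ 2) := rfl
  rw [k4] at k2
  have k5 : δ / (A + 1) / 2 * I2 (fun x y => MM (gw τ) N (fun x y => s.v x y * s.ωy x y) x y ^ 2)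
      ≤ δ / (A + 1) / 2 * ((4 * R * ZZ) ^ 2 * (4 * R ^ 2 * s.D N + 2 * R ^ 2 * s.H N)) := by
    have := k2.trans (mul_le_mul_of_nonneg_left k3 (sq_nonneg (4 * R * ZZ)))
    gcongr
  have k6 : δ / (A + 1) / 2 * ((4 * R * ZZ) ^ 2 * (4 * R ^ 2 * s.D N + 2 * R ^ 2 * s.H N))
      = A / (A + 1) * (δ * (s.D N + s.H N / 2)) := by
    rw [hA]; field_simp; ring
  have k7 : A / (A + 1) ≤ 1 := by rw [div_le_one (by positivity)]; linarith
  have hH := s.H_nonneg N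
  have hD := s.D_nonneg N
  have k8 : A / (A + 1) * (δ * (s.D N + s.H N / 2)) ≤ 1 * (δ * (s.D N + s.H N / 2)) := by gcongr
  have k9 : (δ / (A + 1))⁻¹ / 2 * (I2 fun x y => s.h N x y ^ 2) = (A + 1) / (2 * δ) * s.H N := by
    unfold H; field_simp
  have e : I2 (fun x y => MM (gw τ) N (fun x y => s.v x y * s.ωy x y) x y * s.h N x y)
    = I2 (fun x y => s.h N x y * MM (gw τ) N (fun x y => s.v x y * s.ωy x y) x y) := by
    simp only [mul_comm]
  rw [e]
  have k10 : 0 ≤ δ * s.H N := by positivity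
  linarith

lemma stretching_term :
    |I2 fun x y => MM (gw τ) N (fun x y => s.η x y * s.φy x y) x y * s.h N x y|
      ≤ ((4 * R * ZZ) ^ 2 * (2 * R ^ 2) + 1) * s.S N := by
  have k1 := abs_I2_mul_le ((s.pη.mul s.st.pfy).MM (w := gw τ) (N := N)) (s.ph N) one_pos
  have k2 := s.I2_mult_mul_le N s.pη s.st.pfy s.gη
  have k3 := (s.st.MM (gw τ) N).grad_le
  have k4 := s.g_sq_le N
  have k5 := mul_nonneg (sq_nonneg ε) (I2_sq_nonneg (s.st.MM (gw τ) N).pfx)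
  have k6 : I2 (fun x y => MM (gw τ) N s.φy x y ^ 2) ≤ 4 * (R ^ 2 * s.H N) := by
    have : (I2 fun x y => MM (gw τ) N s.ω x y ^ 2) = I2 fun x y => s.g N x y ^ 2 := rfl
    rw [this] at k3
    linarith
  have k7 := mul_le_mul_of_nonneg_left k6 (sq_nonneg (4 * R * ZZ))
  have k8 : (4 * R * ZZ) ^ 2 * (2 * R ^ 2) * s.H N ≤ (4 * R * ZZ) ^ 2 * (2 * R ^ 2) * s.S N := by
    have := s.H_le_S N; gcongr
  have k9 := s.H_le_S N
  have k10 := s.H_nonneg N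
  have k11 : (I2 fun x y => s.h N x y ^ 2) = s.H N := rfl
  rw [k11] at k1
  simp only [inv_one] at k1
  linarith

/-- The term `∂ₓφ ∂ᵧω^p` with the loss of a derivative. Tested with `h = g / b`, it is the integral
of `∂ₓΦ g`, which vanishes, for `Φ` the weighted stream function, up to a commutator. -/
lemma hydrostatic_term :
    |I2 fun x y => MM (gw τ) N (fun x y => s.b x y * s.φx x y) x y * s.h N x y|
      ≤ ((10 * R * ZZ) ^ 2 * (16 * (2 * R * ZZ) ^ 2) + 1) / 2 * s.S N := by
  have pB := (s.pb.mul s.st.pfx).MM (w := gw τ) (N := N)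
  have pφ := s.st.pfx.MM (w := gw τ) (N := N)
  have e : I2 (fun x y => MM (gw τ) N (fun x y => s.b x y * s.φx x y) x y * s.h N x y)
      = I2 (fun x y => (MM (gw τ) N (fun x y => s.b x y * s.φx x y) x y
        - s.b x y * MM (gw τ) N s.φx x y) * s.h N x y)
      + I2 (fun x y => MM (gw τ) N s.φx x y * s.g N x y) := by
    rw [← I2_add ((pB.sub (s.pb.mul pφ)).mul (s.ph N)) (pφ.mul (s.pg N))]
    refine I2_congr fun x y _ => ?_
    rw [s.g_eq]; ring
  have z : I2 (fun x y => MM (gw τ) N s.φx x y * s.g N x y) = 0 :=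
    (s.st.MM (gw τ) N).I2_dx_mul_vort
  rw [e, z, add_zero]
  have := abs_I2_le_of_slice (a := (10 * R * ZZ) ^ 2 / 2) (c := 1 / 2)
    ((pB.sub (s.pb.mul pφ)).mul (s.ph N))
    (((s.st.pf.MM (w := gw τ) (N := N)).MM (w := th) (N := N)).pow 2)
    (((s.ph N).MM (w := th) (N := N)).pow 2)
    fun y hy => by
      have := commutator_deriv_bound (N := N) s.hτ0 s.hτ1 (s.pb.pc y) (s.gb y hy) (s.st.pf.pc y)
        (fun x => s.st.dx x y) (s.st.pfx.pc y) ((s.ph N).pc y)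
      refine this.trans (le_of_eq ?_)
      rw [add_div, div_mul_eq_mul_div, one_div_mul_eq_div]
      rfl
  have k1 := ((s.st.MM (gw τ) N).MM th N).sq_le
  have k2 : I2 (fun x y => MM th N (MM (gw τ) N s.φ) x y ^ 2)
      ≤ 16 * ((2 * R * ZZ) ^ 2 * s.S N) := by
    have := s.gain_g_le N
    have e : (I2 fun x y => MM th N (MM (gw τ) N s.ω) x y ^ 2)
      = I2 (fun x y => MM th N (s.g N) x y ^ 2) := rfl
    rw [e] at k1
    linarith
  have k3 := mul_le_mul_of_nonneg_left k2 (by positivity : 0 ≤ (10 * R * ZZ) ^ 2 / 2)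
  have k4 : (I2 fun x y => MM th N (s.h N) x y ^ 2) = s.S N := rfl
  rw [k4] at this
  linarith

/-- The time derivative of the weight `1 / b`. The integration by parts in `y` replaces `∂ₜ∂ᵧω^p`,
on which there is no bound, by `∂ₜω^p`. -/
lemma weight_term {δ : ℝ} (hδ : 0 < δ) :
    |I2 fun x y => (1 / 2) * (s.qz x y * s.h N x y ^ 2)|
      ≤ δ * s.D N + R ^ 2 / (2 * δ ^ 3) * s.H N := by
  have ph2 := (s.ph N).mul (s.ph N)
  have e := I2_ibp_y s.pq ph2 s.pqz (((s.phy N).mul (s.ph N)).add ((s.ph N).mul (s.phy N)))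
    s.dqz ((s.dhy N).mul (s.dhy N)) (fun x => by simp [s.h0]) (fun x => by simp [s.h1])
  have e1 : I2 (fun x y => (1 / 2) * (s.qz x y * s.h N x y ^ 2))
      = - I2 fun x y => s.q x y * s.h N x y * s.hy N x y := by
    rw [I2_const_mul]
    simp only [pow_two]
    rw [e]
    have : (fun x y => s.q x y * (s.hy N x y * s.h N x y + s.h N x y * s.hy N x y))
      = fun x y => 2 * (s.q x y * s.h N x y * s.hy N x y) := by ext x y; ring
    rw [this, I2_const_mul]; ring
  rw [e1, abs_neg]
  exact s.abs_weak_le N s.pq s.sq hδ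

lemma source_Nu {δ : ℝ} (hδ : 0 < δ) :
    |I2 fun x y => MM (gw τ) N s.Nuy x y * s.h N x y|
      ≤ δ / 2 * s.D N + 1 / (2 * δ) * I2 fun x y => MM (gw τ) N s.Nu x y ^ 2 := by
  have e := I2_ibp_y (s.pNu.MM (w := gw τ) (N := N)) (s.ph N) (s.pNuy.MM (w := gw τ) (N := N))
    (s.phy N) (s.dNu.MM s.pNu s.pNuy) (s.dhy N)
    (fun x => by rw [s.h0, mul_zero]) (fun x => by rw [s.h1, mul_zero])
  rw [e, abs_neg]
  refine (abs_I2_mul_le (s.pNu.MM (w := gw τ) (N := N)) (s.phy N) hδ).trans ?_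
  have := mul_le_mul_of_nonneg_left (s.hy_le N) (by positivity : 0 ≤ δ / 2)
  have e2 : δ⁻¹ / 2 = 1 / (2 * δ) := by field_simp
  rw [e2]; linarith

lemma source_Nv {δ : ℝ} (hδ : 0 < δ) :
    |I2 fun x y => ε ^ 2 * (MM (gw τ) N s.Nvx x y * s.h N x y)|
      ≤ δ / 2 * s.D N + 1 / (2 * δ) * I2 fun x y => MM (gw τ) N (fun x y => ε * s.Nv x y) x y ^ 2 := by
  have e := I2_ibp_x (s.pNv.MM (w := gw τ) (N := N)) (s.ph N) (s.pNvx.MM (w := gw τ) (N := N))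
    (s.phx N) (s.dNv.MM s.pNv s.pNvx) (s.dhx N)
  rw [I2_const_mul, e, abs_mul, abs_neg, abs_of_nonneg (sq_nonneg ε)]
  have k := mul_le_mul_of_nonneg_left
    (abs_I2_mul_le (s.pNv.MM (w := gw τ) (N := N)) (s.phx N) hδ) (sq_nonneg ε)
  have := mul_le_mul_of_nonneg_left (s.hx_le N) (by positivity : 0 ≤ δ / 2)
  have e2 : δ⁻¹ / 2 = 1 / (2 * δ) := by field_simp
  have e3 : I2 (fun x y => MM (gw τ) N (fun x y => ε * s.Nv x y) x y ^ 2)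
      = ε ^ 2 * I2 (fun x y => MM (gw τ) N s.Nv x y ^ 2) := by
    rw [← I2_const_mul]
    refine I2_congr fun x y _ => ?_
    rw [MM_const_mul, mul_pow]
  rw [e3]
  rw [e2] at k
  linarith

/-- A source without derivative is paid for by the gain of `1/3` of a derivative. -/
lemma source_f {F : ℝ → ℝ → ℝ} (hF : PF F) {δ : ℝ} (hδ : 0 < δ) :
    |I2 fun x y => MM (gw τ) N F x y * s.h N x y|
      ≤ 1 / (2 * δ) * I2 (fun x y => MM (fun n => (th n)⁻¹) N (MM (gw τ) N F) x y ^ 2)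
        + δ / 2 * s.S N := by
  refine abs_I2_le_of_slice ((hF.MM (w := gw τ) (N := N)).mul (s.ph N))
    (((hF.MM (w := gw τ) (N := N)).MM (w := fun n => (th n)⁻¹) (N := N)).pow 2)
    (((s.ph N).MM (w := th) (N := N)).pow 2) fun y _ => ?_
  have e2 : δ⁻¹ / 2 = 1 / (2 * δ) := by field_simp
  rw [← e2]
  exact abs_integral_mul_le_th ((hF.MM (w := gw τ) (N := N)).pc y) ((s.ph N).pc y) hδ

lemma gw_tr_le_gw9 (s : Slice c₀ R τ ε) (N : ℕ) (j : ℤ) : gw τ (tr N j) ≤ gw9 τ j := by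
  have h := th_mono (min_le_left j.natAbs N)
  have h1 := one_le_th (tr N j)
  have h2 : th (tr N j) ≤ th j.natAbs := h
  have hτ := s.hτ0
  unfold gw gw9
  have h3 : th (tr N j) ^ 6 ≤ th j.natAbs ^ 9 :=
    (pow_le_pow_left₀ (by linarith) h2 6).trans (pow_le_pow_right₀ (one_le_th _) (by norm_num))
  have h4 := th_pos j.natAbs
  gcongr

lemma mult_η_le : I2 (fun x y => MM (gw τ) N s.η x y ^ 2) ≤ 2 * Real.pi * R ^ 2 * ZZ := by
  have hp := Real.pi_pos
  have : ∀ y ∈ Ioo (0 : ℝ) 1, ∫ x in 0..2 * Real.pi, MM (gw τ) N s.η x y ^ 2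
      ≤ 2 * Real.pi * R ^ 2 * ZZ := by
    intro y hy
    have h1 := hasSum_sq_fc ((s.pη.pc y).mult (w := gw τ) (N := N)).cont
    have h2 := (summable_bracket.hasSum).mul_left (R ^ 2)
    have h3 := hasSum_le (fun k => ?_) h1 h2
    · change (1 / (2 * Real.pi)) * (∫ x in 0..2 * Real.pi, MM (gw τ) N s.η x y ^ 2)
        ≤ R ^ 2 * ZZ at h3
      rw [one_div_mul_eq_div, div_le_iff₀ (by positivity)] at h3
      linarith
    · rw [fc_mult (s.pη.cx y), norm_mul, Complex.norm_real, Real.norm_of_nonneg (gw_pos _ _).le]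
      have k1 : gw τ (tr N k) * ‖fc (fun x => s.η x y) k‖ ≤ R * (1 / bracket k ^ 2) :=
        (mul_le_mul_of_nonneg_right (s.gw_tr_le_gw9 N k) (norm_nonneg _)).trans
          ((s.gη y hy).norm_fc_le k)
      have k2 : (gw τ (tr N k) * ‖fc (fun x => s.η x y) k‖) ^ 2 ≤ (R * (1 / bracket k ^ 2)) ^ 2 :=
        pow_le_pow_left₀ (mul_nonneg (gw_pos _ _).le (norm_nonneg _)) k1 2
      refine k2.trans ?_
      rw [mul_pow]
      have k3 : 1 / bracket k ^ 2 ≤ 1 := by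
        rw [div_le_one (by have := bracket_pos k; positivity)]
        exact one_le_pow₀ (one_le_bracket k)
      have k4 : 0 ≤ 1 / bracket k ^ 2 := by have := bracket_pos k; positivity
      have : (1 / bracket k ^ 2) ^ 2 ≤ 1 / bracket k ^ 2 := by nlinarith
      gcongr
  have h2 : I2 (fun x y => MM (gw τ) N s.η x y ^ 2) ≤ ∫ y in (0 : ℝ)..1, 2 * Real.pi * R ^ 2 * ZZ :=
    intervalIntegral.integral_mono_on_of_le_Ioo zero_le_one
      ((s.pη.MM.pow 2).inner.intervalIntegrable _ _) (by simp) this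
  simpa using h2

lemma source_C {δ : ℝ} (hδ : 0 < δ) :
    |I2 fun x y => s.C * (MM (gw τ) N s.η x y * s.h N x y)|
      ≤ 1 / (2 * δ) * (s.C ^ 2 * (2 * Real.pi * R ^ 2 * ZZ)) + δ / 2 * s.S N := by
  have pη' := s.pη.MM (w := gw τ) (N := N)
  have k := abs_I2_mul_le (pη'.const_mul s.C) (s.ph N) hδ
  have e1 : I2 (fun x y => (s.C * MM (gw τ) N s.η x y) ^ 2)
      = s.C ^ 2 * I2 (fun x y => MM (gw τ) N s.η x y ^ 2) := by
    rw [← I2_const_mul]; simp only [mul_pow]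
  have e2 : δ⁻¹ / 2 = 1 / (2 * δ) := by field_simp
  have k2 := s.mult_η_le N
  have k3 := s.H_le_S N
  rw [e1, e2] at k
  simp only [mul_assoc] at k ⊢
  refine k.trans ?_
  have k4 : (I2 fun x y => s.h N x y ^ 2) = s.H N := rfl
  rw [k4]
  simp only [mul_assoc] at k2
  gcongr

end Slice

end

section

/-! ### The energy production -/

lemma MM_sub {w : ℕ → ℝ} {N : ℕ} {F G : ℝ → ℝ → ℝ} (hF : PF F) (hG : PF G) (x y : ℝ) :
    MM w N (fun x y => F x y - G x y) x y = MM w N F x y - MM w N G x y := by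
  have h1 := MM_add (w := w) (N := N) hF (hG.const_mul (-1)) x y
  rw [MM_const_mul] at h1
  simpa only [neg_one_mul, ← sub_eq_add_neg] using h1

lemma MM_congr {w : ℕ → ℝ} {N : ℕ} {F G : ℝ → ℝ → ℝ} {y : ℝ} (h : ∀ x, F x y = G x y) (x : ℝ) :
    MM w N F x y = MM w N G x y := by
  have : (fun z => F z y) = fun z => G z y := funext h
  rw [MM, MM, this]

namespace Slice
variable {c₀ R τ ε : ℝ} (s : Slice c₀ R τ ε) (N : ℕ)

/-- The truncated multiplier applied to the equation. -/
lemma mult_eqn (x : ℝ) {y : ℝ} (hy : y ∈ Ioo (0 : ℝ) 1) :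
    MM (gw τ) N s.ωt x y
      = MM (gw τ) N (fun x y => ε ^ 2 * s.ωxx x y + s.ωyy x y) x y
        - MM (gw τ) N (fun x y => s.u x y * s.ωx x y) x y
        - MM (gw τ) N (fun x y => s.v x y * s.ωy x y) x y
        - MM (gw τ) N (fun x y => s.η x y * s.φy x y) x y
        + MM (gw τ) N (fun x y => s.b x y * s.φx x y) x y
        + MM (gw τ) N s.Nuy x y - ε ^ 2 * MM (gw τ) N s.Nvx x y
        + MM (gw τ) N (fun x y => ε ^ 2 * s.f₁ x y) x y + MM (gw τ) N s.f₂ x y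
        - s.C * MM (gw τ) N s.η x y := by
  have p1 := (s.pωxx.const_mul (ε ^ 2)).add s.pωyy
  have p2 := s.pu.mul s.pωx
  have p3 := s.pv.mul s.pωy
  have p4 := s.pη.mul s.st.pfy
  have p5 := s.pb.mul s.st.pfx
  have p6 := s.pNvx.const_mul (ε ^ 2)
  have p7 := s.pf₁.const_mul (ε ^ 2)
  have p8 := s.pη.const_mul s.C
  have p9 := s.pNuy
  have p10 := s.pf₂
  have q1 := ((p1.sub p2).sub p3).sub p4
  have q2 := ((q1.add p5).add p9).sub p6
  rw [MM_congr (F := s.ωt) (G := fun x y => (ε ^ 2 * s.ωxx x y + s.ωyy x y) - s.u x y * s.ωx x y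
    - s.v x y * s.ωy x y - s.η x y * s.φy x y + s.b x y * s.φx x y + s.Nuy x y
    - ε ^ 2 * s.Nvx x y + ε ^ 2 * s.f₁ x y + s.f₂ x y - s.C * s.η x y)
    (fun x => by linarith [s.eqn x y hy])]
  rw [MM_sub ((q2.add p7).add p10) p8, MM_add (q2.add p7) p10, MM_add q2 p7,
    MM_sub ((q1.add p5).add p9) p6, MM_add (q1.add p5) p9, MM_add q1 p5,
    MM_sub ((p1.sub p2).sub p3) p4, MM_sub (p1.sub p2) p3, MM_sub p1 p2,
    MM_const_mul (ε ^ 2) s.Nvx, MM_const_mul s.C]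

/-- The rate of change of half the energy, as the sum of its terms. -/
lemma I2_production (lam : ℝ) :
    I2 (fun x y => s.gt N lam x y * s.h N x y - (1 / 2) * (s.qz x y * s.h N x y ^ 2))
      = I2 (fun x y => MM (gw τ) N (fun x y => ε ^ 2 * s.ωxx x y + s.ωyy x y) x y * s.h N x y)
        - I2 (fun x y => MM (gw τ) N (fun x y => s.u x y * s.ωx x y) x y * s.h N x y)
        - I2 (fun x y => MM (gw τ) N (fun x y => s.v x y * s.ωy x y) x y * s.h N x y)
        - I2 (fun x y => MM (gw τ) N (fun x y => s.η x y * s.φy x y) x y * s.h N x y)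
        + I2 (fun x y => MM (gw τ) N (fun x y => s.b x y * s.φx x y) x y * s.h N x y)
        + I2 (fun x y => MM (gw τ) N s.Nuy x y * s.h N x y)
        - I2 (fun x y => ε ^ 2 * (MM (gw τ) N s.Nvx x y * s.h N x y))
        + I2 (fun x y => MM (gw τ) N (fun x y => ε ^ 2 * s.f₁ x y) x y * s.h N x y)
        + I2 (fun x y => MM (gw τ) N s.f₂ x y * s.h N x y)
        - I2 (fun x y => s.C * (MM (gw τ) N s.η x y * s.h N x y))
        - lam * I2 (fun x y => MM (fun n => th n ^ 2) N (s.g N) x y * s.h N x y)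
        - I2 (fun x y => (1 / 2) * (s.qz x y * s.h N x y ^ 2)) := by
  have ph := s.ph N
  have p1 := (((s.pωxx.const_mul (ε ^ 2)).add s.pωyy).MM (w := gw τ) (N := N)).mul ph
  have p2 := ((s.pu.mul s.pωx).MM (w := gw τ) (N := N)).mul ph
  have p3 := ((s.pv.mul s.pωy).MM (w := gw τ) (N := N)).mul ph
  have p4 := ((s.pη.mul s.st.pfy).MM (w := gw τ) (N := N)).mul ph
  have p5 := ((s.pb.mul s.st.pfx).MM (w := gw τ) (N := N)).mul ph
  have p6 := ((s.pNvx.MM (w := gw τ) (N := N)).mul ph).const_mul (ε ^ 2)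
  have p7 := ((s.pf₁.const_mul (ε ^ 2)).MM (w := gw τ) (N := N)).mul ph
  have p8 := ((s.pη.MM (w := gw τ) (N := N)).mul ph).const_mul s.C
  have p9 := (s.pNuy.MM (w := gw τ) (N := N)).mul ph
  have p10 := (s.pf₂.MM (w := gw τ) (N := N)).mul ph
  have p11 := (((s.pg N).MM (w := fun n => th n ^ 2) (N := N)).mul ph).const_mul lam
  have p12 := (s.pqz.mul (ph.pow 2)).const_mul (1 / 2)
  have q1 := ((p1.sub p2).sub p3).sub p4
  have q2 := ((q1.add p5).add p9).sub p6
  have q3 := (((q2.add p7).add p10).sub p8)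
  rw [← I2_const_mul lam, ← I2_sub p1 p2, ← I2_sub (p1.sub p2) p3, ← I2_sub ((p1.sub p2).sub p3) p4,
    ← I2_add q1 p5, ← I2_add (q1.add p5) p9, ← I2_sub ((q1.add p5).add p9) p6, ← I2_add q2 p7,
    ← I2_add (q2.add p7) p10, ← I2_sub ((q2.add p7).add p10) p8, ← I2_sub q3 p11,
    ← I2_sub (q3.sub p11) p12]
  refine I2_congr fun x y hy => ?_
  rw [gt, s.mult_eqn N x hy]
  ring

/-- The squared norms of the sources in divergence form. -/
def srcN : ℝ := (I2 fun x y => MM (gw τ) N s.Nu x y ^ 2)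
  + I2 fun x y => MM (gw τ) N (fun x y => ε * s.Nv x y) x y ^ 2

/-- The squared norms of the remaining sources, in a space weaker by `1/3` of a derivative. -/
def srcF : ℝ := s.C ^ 2
  + (I2 fun x y => MM (fun n => (th n)⁻¹) N (MM (gw τ) N fun x y => ε ^ 2 * s.f₁ x y) x y ^ 2)
  + I2 fun x y => MM (fun n => (th n)⁻¹) N (MM (gw τ) N s.f₂) x y ^ 2

/-- The hydrostatic energy inequality, with a constant depending only on `c₀` and `R`, and in
particular not on the truncation `N`. The term `λ K H` is not absorbed: it is the commutator in the
gain, and is harmless in Gronwall's inequality as the length of the time interval is of order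
`1 / λ`. -/
theorem production_le (c₀ R : ℝ) (hc₀ : 0 < c₀) (hR : 1 ≤ R) :
    ∃ K : ℝ, 0 < K ∧ ∀ (τ ε : ℝ) (s : Slice c₀ R τ ε) (N : ℕ) (lam : ℝ), 0 < lam →
      I2 (fun x y => s.gt N lam x y * s.h N x y - (1 / 2) * (s.qz x y * s.h N x y ^ 2))
        ≤ -(lam * (c₀ / 4)) * s.S N - c₀ / 2 * s.D N + K * s.S N + lam * K * s.H N
          + K * s.srcN N + K / lam * s.srcF N := by
  -- `δ` is so small that the four terms with a share of the dissipation use at most half of it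
  obtain ⟨δ, hδ⟩ : ∃ δ, δ = c₀ / 16 := ⟨_, rfl⟩
  have hδ0 : 0 < δ := by rw [hδ]; positivity
  have hZ := ZZ_nonneg
  obtain ⟨A1, hA1⟩ : ∃ A, A = R ^ 2 / (2 * δ) + R ^ 2 / (2 * δ ^ 3) := ⟨_, rfl⟩
  obtain ⟨A2, hA2⟩ : ∃ A, A = ((10 * R * ZZ) ^ 2 * (2 * R * ZZ) ^ 2 + 1) / 2 + 2 * R ^ 2 :=
    ⟨_, rfl⟩
  obtain ⟨A3, hA3⟩ : ∃ A, A = δ + (32 * R ^ 4 * ZZ ^ 2 + 1) / (2 * δ) := ⟨_, rfl⟩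
  obtain ⟨A4, hA4⟩ : ∃ A, A = (4 * R * ZZ) ^ 2 * (2 * R ^ 2) + 1 := ⟨_, rfl⟩
  obtain ⟨A5, hA5⟩ : ∃ A, A = ((10 * R * ZZ) ^ 2 * (16 * (2 * R * ZZ) ^ 2) + 1) / 2 := ⟨_, rfl⟩
  obtain ⟨A6, hA6⟩ : ∃ A, A = R ^ 2 / (2 * δ ^ 3) := ⟨_, rfl⟩
  obtain ⟨A7, hA7⟩ : ∃ A, A = (1 * R * ZZ) ^ 2 / (2 * c₀) := ⟨_, rfl⟩
  obtain ⟨A8, hA8⟩ : ∃ A, A = 1 / (2 * δ) := ⟨_, rfl⟩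
  obtain ⟨A9, hA9⟩ : ∃ A, A = 3 / c₀ := ⟨_, rfl⟩
  obtain ⟨A10, hA10⟩ : ∃ A, A = 2 * Real.pi * R ^ 2 * ZZ := ⟨_, rfl⟩
  have hR0 : 0 < R := by linarith
  have hp := Real.pi_pos
  have B1 : 0 ≤ A1 := by rw [hA1]; positivity
  have B2 : 0 ≤ A2 := by rw [hA2]; positivity
  have B3 : 0 ≤ A3 := by rw [hA3]; positivity
  have B4 : 0 ≤ A4 := by rw [hA4]; positivity
  have B5 : 0 ≤ A5 := by rw [hA5]; positivity
  have B6 : 0 ≤ A6 := by rw [hA6]; positivity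
  have B7 : 0 ≤ A7 := by rw [hA7]; positivity
  have B8 : 0 ≤ A8 := by rw [hA8]; positivity
  have B9 : 0 < A9 := by rw [hA9]; positivity
  have B10 : 0 ≤ A10 := by rw [hA10]; positivity
  have B11 : 0 ≤ A9 * A10 := by positivity
  obtain ⟨K, hK⟩ : ∃ K, K = A1 + A2 + A3 + A4 + A5 + A6 + A7 + A8 + A9 + A9 * A10 := ⟨_, rfl⟩
  refine ⟨K, by rw [hK]; positivity, fun τ ε s N lam hlam => ?_⟩
  -- the three sources without derivative use a twelfth of `lam * c₀` each, half of the gain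
  have hδf : 0 < lam * c₀ / 6 := by positivity
  have t0 := s.gain_term N
  have t1 := s.diffusion_term N hδ0
  have t2 := (abs_le.1 (s.transport_u N)).1
  have t3 := (abs_le.1 (s.transport_v N hδ0)).1
  have t4 := (abs_le.1 (s.stretching_term N)).1
  have t5 := (abs_le.1 (s.hydrostatic_term N)).2
  have t6 := (abs_le.1 (s.weight_term N hδ0)).1
  have t7 := (abs_le.1 (s.source_Nu N hδ0)).2
  have t8 := (abs_le.1 (s.source_Nv N hδ0)).1
  have t9 := (abs_le.1 (s.source_f N (s.pf₁.const_mul (ε ^ 2)) hδf)).2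
  have t10 := (abs_le.1 (s.source_f N s.pf₂ hδf)).2
  have t11 := (abs_le.1 (s.source_C N hδf)).1
  have e9 : 1 / (2 * (lam * c₀ / 6)) = A9 / lam := by rw [hA9]; field_simp; norm_num
  rw [e9] at t9 t10 t11
  rw [← hA1] at t1
  rw [← hA2] at t2
  rw [← hA3] at t3
  rw [← hA4] at t4
  rw [← hA5] at t5
  rw [← hA6] at t6
  rw [← hA7] at t0
  rw [← hA8] at t7 t8
  rw [← hA10] at t11
  have t0' := mul_le_mul_of_nonneg_left t0 hlam.le
  rw [s.I2_production N lam]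
  have hH := s.H_nonneg N
  have hS := s.S_nonneg N
  have hD := s.D_nonneg N
  have hHS := s.H_le_S N
  have u1 : (A1 + A3 + A6) * s.H N ≤ (A1 + A3 + A6) * s.S N := by gcongr
  have u2 : (A1 + A2 + A3 + A4 + A5 + A6) * s.S N ≤ K * s.S N := by
    refine mul_le_mul_of_nonneg_right ?_ hS
    rw [hK]; linarith
  have u3 : lam * (A7 * s.H N) ≤ lam * K * s.H N := by
    have : A7 ≤ K := by rw [hK]; linarith
    rw [mul_assoc]; gcongr
  have n1 := I2_sq_nonneg (s.pNu.MM (w := gw τ) (N := N))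
  have n2 := I2_sq_nonneg ((s.pNv.const_mul ε).MM (w := gw τ) (N := N))
  have n3 := I2_sq_nonneg (((s.pf₁.const_mul (ε ^ 2)).MM (w := gw τ) (N := N)).MM
    (w := fun n => (th n)⁻¹) (N := N))
  have n4 := I2_sq_nonneg ((s.pf₂.MM (w := gw τ) (N := N)).MM
    (w := fun n => (th n)⁻¹) (N := N))
  have hsN : 0 ≤ s.srcN N := add_nonneg n1 n2
  have u4 : A8 * s.srcN N ≤ K * s.srcN N := by
    refine mul_le_mul_of_nonneg_right ?_ hsN
    rw [hK]; linarith
  have u5 : A9 / lam * (I2 fun x y => MM (fun n => (th n)⁻¹) N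
      (MM (gw τ) N fun x y => ε ^ 2 * s.f₁ x y) x y ^ 2)
      + A9 / lam * (I2 fun x y => MM (fun n => (th n)⁻¹) N (MM (gw τ) N s.f₂) x y ^ 2)
      + A9 / lam * (s.C ^ 2 * A10) ≤ K / lam * s.srcF N := by
    have k1 : A9 ≤ K := by rw [hK]; linarith
    have k2 : A9 * A10 ≤ K := by rw [hK]; linarith
    have k3 : A9 / lam ≤ K / lam := by gcongr
    have k4 : A9 * A10 / lam ≤ K / lam := by gcongr
    have m1 := mul_le_mul_of_nonneg_right k3 n3
    have m2 := mul_le_mul_of_nonneg_right k3 n4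
    have m3 := mul_le_mul_of_nonneg_right k4 (sq_nonneg s.C)
    have m4 : A9 / lam * (s.C ^ 2 * A10) = A9 * A10 / lam * s.C ^ 2 := by ring
    unfold srcF
    rw [m4]
    linarith
  have u6 : δ * s.D N = c₀ / 16 * s.D N := by rw [hδ]
  have u7 : 0 ≤ c₀ * s.D N := by positivity
  unfold srcN at u4
  simp only [srcN]
  linarith

lemma energy_ge : c₀ * s.H N ≤ I2 fun x y => s.g N x y * s.h N x y := by
  rw [H, ← I2_const_mul]
  refine I2_mono (((s.ph N).pow 2).const_mul _) ((s.pg N).mul (s.ph N)) fun x y _ => ?_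
  rw [s.g_eq]
  nlinarith [s.b_ge x y, sq_nonneg (s.h N x y)]

lemma energy_le : (I2 fun x y => s.g N x y * s.h N x y) ≤ c₀⁻¹ * I2 fun x y => s.g N x y ^ 2 := by
  rw [← I2_const_mul]
  refine I2_mono ((s.pg N).mul (s.ph N)) (((s.pg N).pow 2).const_mul _) fun x y _ => ?_
  have hb := s.b_pos x y
  have hc := s.hc₀
  rw [h, mul_div_assoc', ← pow_two, div_eq_inv_mul]
  exact mul_le_mul_of_nonneg_right (inv_anti₀ hc (s.b_ge x y)) (sq_nonneg _)

end Slice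

end

section

/-! ### Integration in time -/

/-- Continuous functions of `t`, `x`, `y`. -/
def C3 (F : ℝ → ℝ → ℝ → ℝ) : Prop := Continuous fun p : ℝ × ℝ × ℝ => F p.1 p.2.1 p.2.2

section C3
variable {F G F' : ℝ → ℝ → ℝ → ℝ}

lemma C3.inner (h : C3 F) (a b : ℝ) : Continuous fun p : ℝ × ℝ => ∫ x in a..b, F p.1 x p.2 :=
  intervalIntegral.continuous_parametric_intervalIntegral_of_continuous'
    (f := fun (p : ℝ × ℝ) x => F p.1 x p.2)
    (h.comp (by fun_prop : Continuous fun q : (ℝ × ℝ) × ℝ => (q.1.1, q.2, q.1.2))) a b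

lemma C3.I2 (h : C3 F) : Continuous fun r => I2 (F r) :=
  intervalIntegral.continuous_parametric_intervalIntegral_of_continuous'
    (f := fun r y => ∫ x in 0..2 * Real.pi, F r x y) (h.inner 0 (2 * Real.pi)) 0 1

lemma C3.pow (h : C3 F) (n : ℕ) : C3 fun r x y => F r x y ^ n := Continuous.pow h n
lemma C3.mul (h : C3 F) (h' : C3 G) : C3 fun r x y => F r x y * G r x y := Continuous.mul h h'
lemma C3.sub (h : C3 F) (h' : C3 G) : C3 fun r x y => F r x y - G r x y := Continuous.sub h h'
lemma C3.const_mul (h : C3 F) (c : ℝ) : C3 fun r x y => c * F r x y := Continuous.mul continuous_const h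
lemma C3.div (h : C3 F) (h' : C3 G) (h0 : ∀ r x y, G r x y ≠ 0) : C3 fun r x y => F r x y / G r x y :=
  Continuous.div h h' fun p => h0 p.1 p.2.1 p.2.2

lemma C3.MM (h : C3 F) {w : ℝ → ℕ → ℝ} (hw : ∀ n, Continuous fun r => w r n) (N : ℕ) :
    C3 fun r => MM (w r) N (F r) := by
  have h1 : ∀ k : ℤ, Continuous fun p : ℝ × ℝ => cs (fun z => F p.1 z p.2) k := fun k =>
    C3.inner (F := fun r x y => F r x y * Real.cos (k * x))
      (Continuous.mul h (by fun_prop)) _ _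
  have h2 : ∀ k : ℤ, Continuous fun p : ℝ × ℝ => sn (fun z => F p.1 z p.2) k := fun k =>
    C3.inner (F := fun r x y => F r x y * Real.sin (k * x))
      (Continuous.mul h (by fun_prop)) _ _
  have e : (fun p : ℝ × ℝ × ℝ => HydroNS.MM (w p.1) N (F p.1) p.2.1 p.2.2)
      = fun p : ℝ × ℝ × ℝ =>
      w p.1 N * F p.1 p.2.1 p.2.2 + ∑ k ∈ Finset.range N, (w p.1 k - w p.1 N) *
        ((if k = 0 then 1 else 2) / (2 * Real.pi) *
          (Real.cos (k * p.2.1) * cs (fun z => F p.1 z p.2.2) k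
            + Real.sin (k * p.2.1) * sn (fun z => F p.1 z p.2.2) k)) := rfl
  rw [C3, e]
  have hw' : ∀ n, Continuous fun p : ℝ × ℝ × ℝ => w p.1 n := fun n => (hw n).comp continuous_fst
  refine ((hw' N).mul h).add (continuous_finsetSum _ fun k _ => ((hw' k).sub (hw' N)).mul
    (continuous_const.mul (Continuous.add ?_ ?_)))
  · exact Continuous.mul (by fun_prop)
      ((h1 k).comp (by fun_prop : Continuous fun p : ℝ × ℝ × ℝ => (p.1, p.2.2)))
  · exact Continuous.mul (by fun_prop)
      ((h2 k).comp (by fun_prop : Continuous fun p : ℝ × ℝ × ℝ => (p.1, p.2.2)))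

/-- `F'` is the derivative of `F` in time, for times between `a` and `b`. -/
def HasT (a b : ℝ) (F F' : ℝ → ℝ → ℝ → ℝ) : Prop :=
  ∀ x y, ∀ r ∈ Ioo a b, HasDerivAt (fun r => F r x y) (F' r x y) r

lemma HasT.I2 {a b : ℝ} (h : HasT a b F F') (hF : C3 F) (hF' : C3 F') {r : ℝ} (hr : r ∈ Ioo a b) :
    HasDerivAt (fun r => I2 (F r)) (I2 (F' r)) r :=
  hasDerivAt_integral_param (f := fun r y => ∫ x in 0..2 * Real.pi, F r x y)
    (f' := fun r y => ∫ x in 0..2 * Real.pi, F' r x y) (hF.inner 0 (2 * Real.pi)) (hF'.inner 0 (2 * Real.pi))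
    (fun y s hs => hasDerivAt_integral_param (f := fun r x => F r x y) (f' := fun r x => F' r x y)
      (hF.comp (by fun_prop : Continuous fun p : ℝ × ℝ => (p.1, p.2, y)))
      (hF'.comp (by fun_prop : Continuous fun p : ℝ × ℝ => (p.1, p.2, y)))
      (fun x s hs => h x y s hs) hs) hr

lemma HasT.MM {a b : ℝ} (h : HasT a b F F') (hF : C3 F) (hF' : C3 F') {w w' : ℝ → ℕ → ℝ}
    (hw : ∀ n, ∀ r ∈ Ioo a b, HasDerivAt (fun r => w r n) (w' r n) r) (N : ℕ) :
    HasT a b (fun r => MM (w r) N (F r))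
      (fun r x y => MM (w' r) N (F r) x y + MM (w r) N (F' r) x y) := by
  intro x y r hr
  have h1 : ∀ k : ℤ, HasDerivAt (fun r => cs (fun z => F r z y) k) (cs (fun z => F' r z y) k) r :=
    fun k => hasDerivAt_integral_param (a := a) (b := b)
      (f := fun r x => F r x y * Real.cos (k * x)) (f' := fun r x => F' r x y * Real.cos (k * x))
      ((hF.comp (by fun_prop : Continuous fun p : ℝ × ℝ => (p.1, p.2, y))).mul (by fun_prop))
      ((hF'.comp (by fun_prop : Continuous fun p : ℝ × ℝ => (p.1, p.2, y))).mul (by fun_prop))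
      (fun x s hs => (h x y s hs).mul_const _) hr
  have h2 : ∀ k : ℤ, HasDerivAt (fun r => sn (fun z => F r z y) k) (sn (fun z => F' r z y) k) r :=
    fun k => hasDerivAt_integral_param (a := a) (b := b)
      (f := fun r x => F r x y * Real.sin (k * x)) (f' := fun r x => F' r x y * Real.sin (k * x))
      ((hF.comp (by fun_prop : Continuous fun p : ℝ × ℝ => (p.1, p.2, y))).mul (by fun_prop))
      ((hF'.comp (by fun_prop : Continuous fun p : ℝ × ℝ => (p.1, p.2, y))).mul (by fun_prop))
      (fun x s hs => (h x y s hs).mul_const _) hr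
  have := ((hw N r hr).fun_mul (h x y r hr)).fun_add (HasDerivAt.fun_sum (u := Finset.range N) fun k _ =>
    (((hw k r hr).fun_sub (hw N r hr)).fun_mul
    ((((h1 k).const_mul (Real.cos (k * x))).fun_add ((h2 k).const_mul (Real.sin (k * x)))).const_mul
      ((if k = 0 then 1 else 2) / (2 * Real.pi)))))
  refine this.congr_deriv ?_
  simp only [HydroNS.MM, mult, mode]
  rw [show ∀ p q s s' : ℝ, p * F r x y + s + (q * F' r x y + s')
    = p * F r x y + q * F' r x y + (s + s') by intros; ring, ← Finset.sum_add_distrib]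

end C3

/-- The nearest point of the interval from `a` to `b`, if `a ≤ b`. Composition with it extends a
function by constants beyond the interval. -/
def cl (a b z : ℝ) : ℝ := max a (min b z)

@[fun_prop] lemma continuous_cl (a b : ℝ) : Continuous (cl a b) := by unfold cl; fun_prop
lemma cl_of_mem {a b z : ℝ} (h : z ∈ Icc a b) : cl a b z = z := by
  rw [cl, min_eq_right h.2, max_eq_right h.1]
lemma cl_mem {a b : ℝ} (hab : a ≤ b) (z : ℝ) : cl a b z ∈ Icc a b := by
  rw [cl]; exact ⟨le_max_left _ _, max_le hab (min_le_left _ _)⟩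
lemma cl_eventually {a b z : ℝ} (h : z ∈ Ioo a b) : ∀ᶠ s in 𝓝 z, cl a b s = s := by
  filter_upwards [isOpen_Ioo.mem_nhds h] with s hs
  exact cl_of_mem (Ioo_subset_Icc_self hs)

lemma mult_const_mul_weight {w : ℕ → ℝ} {N : ℕ} (c : ℝ) (f : ℝ → ℝ) (x : ℝ) :
    mult (fun n => c * w n) N f x = c * mult w N f x := by
  simp only [mult, mul_add, Finset.mul_sum]
  congr 1
  · ring
  · refine Finset.sum_congr rfl fun k _ => ?_
    ring

lemma integral_combination {A B C D : ℝ → ℝ} (hA : Continuous A) (hB : Continuous B)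
    (hC : Continuous C) (hD : Continuous D) (c₁ c₂ c₃ c₄ a b : ℝ) :
    ∫ r in a..b, (c₁ * (c₂ * A r + B r) + (c₃ * C r + c₄ * D r))
      = c₁ * (c₂ * (∫ r in a..b, A r) + ∫ r in a..b, B r)
        + (c₃ * (∫ r in a..b, C r) + c₄ * ∫ r in a..b, D r) := by
  rw [intervalIntegral.integral_add
        (Continuous.intervalIntegrable (by fun_prop) _ _)
        (Continuous.intervalIntegrable (by fun_prop) _ _),
      intervalIntegral.integral_const_mul, intervalIntegral.integral_add
        (Continuous.intervalIntegrable (by fun_prop) _ _)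
        (Continuous.intervalIntegrable (by fun_prop) _ _),
      intervalIntegral.integral_add
        (Continuous.intervalIntegrable (by fun_prop) _ _)
        (Continuous.intervalIntegrable (by fun_prop) _ _), intervalIntegral.integral_const_mul,
      intervalIntegral.integral_const_mul, intervalIntegral.integral_const_mul]

/-- A solution on the time interval from `a` to `b`, extended by constants to all times, so that the
continuity in time needs no restriction. -/
structure Evolution (c₀ R lam ε a b : ℝ) where
  sl : ∀ r : ℝ, Slice c₀ R (radius lam (cl a b r)) ε
  cω : C3 fun r => (sl r).ω
  cωx : C3 fun r => (sl r).ωx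
  cωy : C3 fun r => (sl r).ωy
  cωt : C3 fun r => (sl r).ωt
  cb : C3 fun r => (sl r).b
  cqz : C3 fun r => (sl r).qz
  cNu : C3 fun r => (sl r).Nu
  cNv : C3 fun r => (sl r).Nv
  cf₁ : C3 fun r => (sl r).f₁
  cf₂ : C3 fun r => (sl r).f₂
  cC : Continuous fun r => (sl r).C
  dω : HasT a b (fun r => (sl r).ω) (fun r => (sl r).ωt)
  db : HasT a b (fun r => (sl r).b) (fun r => (sl r).qz)

namespace Evolution
variable {c₀ R lam ε a b : ℝ} (E : Evolution c₀ R lam ε a b) (N : ℕ)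

lemma continuous_gw (n : ℕ) : Continuous fun r => gw (radius lam (cl a b r)) n := by
  unfold gw radius; fun_prop

lemma cg : C3 fun r => (E.sl r).g N := E.cω.MM continuous_gw N
lemma ch : C3 fun r => (E.sl r).h N := (E.cg N).div E.cb fun r => (E.sl r).b_ne
lemma cgt : C3 fun r => (E.sl r).gt N lam :=
  (E.cωt.MM continuous_gw N).sub
    (((E.cg N).MM (w := fun _ n => th n ^ 2) (fun _ => continuous_const) N).const_mul _)

/-- The time derivative of the weighted vorticity; the weight contributes `-lam ⟨D⟩^{2/3} g`. -/
lemma dg : HasT a b (fun r => (E.sl r).g N) (fun r => (E.sl r).gt N lam) := by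
  have hw : ∀ n, ∀ r ∈ Ioo a b, HasDerivAt (fun r => gw (radius lam (cl a b r)) n)
      (-lam * (th n ^ 2 * gw (radius lam (cl a b r)) n)) r := by
    intro n r hr
    have h1 : HasDerivAt (fun r => radius lam r) (-lam) r := by
      simpa [radius] using ((hasDerivAt_id r).const_mul lam).const_sub 1
    have h2 : HasDerivAt (fun r => gw (radius lam r) n)
        (-lam * (th n ^ 2 * gw (radius lam r) n)) r :=
      ((h1.mul_const (th n ^ 2)).exp.const_mul (th n ^ 6)).congr_deriv (by unfold gw; ring)
    rw [cl_of_mem (Ioo_subset_Icc_self hr)]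
    refine h2.congr_of_eventuallyEq ?_
    filter_upwards [cl_eventually hr] with s hs
    rw [hs]
  intro x y r hr
  refine (E.dω.MM E.cω E.cωt hw N x y r hr).congr_deriv ?_
  have : MM (fun n => th n ^ 2) N ((E.sl r).g N) x y = MM (fun n => th n ^ 2 *
      gw (radius lam (cl a b r)) n) N (E.sl r).ω x y :=
    congrFun (mult_comp ((E.sl r).st.pfω.pc y)) x
  simp only [Slice.gt]
  rw [this]
  simp only [MM]
  rw [mult_const_mul_weight]
  ring

/-- The time derivative of the energy density `g h = g² / b`. -/
lemma denergy : HasT a b (fun r x y => (E.sl r).g N x y * (E.sl r).h N x y)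
    (fun r x y => 2 * ((E.sl r).gt N lam x y * (E.sl r).h N x y
      - (1 / 2) * ((E.sl r).qz x y * (E.sl r).h N x y ^ 2))) := by
  intro x y r hr
  have hb := (E.sl r).b_ne x y
  have := (E.dg N x y r hr).mul ((E.dg N x y r hr).div (E.db x y r hr) hb)
  refine this.congr_deriv ?_
  have hg := (E.sl r).g_eq N x y
  simp only [Slice.h, Pi.div_apply]
  field_simp
  ring

/-- The integrated energy inequality for a truncated multiplier, uniform in the truncation. -/
theorem integrated (c₀ R : ℝ) (hc₀ : 0 < c₀) (hR : 1 ≤ R) :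
    ∃ lam₀ K : ℝ, 1 < lam₀ ∧ 0 < K ∧ ∀ (lam ε a b : ℝ) (E : Evolution c₀ R lam ε a b) (N : ℕ),
      lam₀ ≤ lam → 0 ≤ a → a ≤ b → b ≤ 1 / (2 * lam) →
      (I2 fun x y => (E.sl b).g N x y ^ 2)
        + (lam * (∫ r in a..b, I2 fun x y => MM th N ((E.sl r).g N) x y ^ 2)
          + ∫ r in a..b, (ε ^ 2 * (I2 fun x y => (E.sl r).gx N x y ^ 2)
            + I2 fun x y => (E.sl r).gy N x y ^ 2))
        ≤ K * (I2 fun x y => (E.sl a).g N x y ^ 2)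
          + (K * (∫ r in a..b, (E.sl r).srcN N) + K / lam * ∫ r in a..b, (E.sl r).srcF N) := by
  obtain ⟨K, hK, main⟩ := Slice.production_le c₀ R hc₀ hR
  have hR0 : 0 < R := by linarith
  have hZ := ZZ_nonneg
  set m := Real.exp (-(K / c₀)) with hm
  have hm0 : 0 < m := Real.exp_pos _
  have hm1 : m ≤ 1 := by rw [hm, Real.exp_le_one_iff]; have : 0 ≤ K / c₀ := by positivity
                         linarith
  -- the quantities of the statement are bounded by the energy, the gain and the dissipation
  obtain ⟨L, hL⟩ : ∃ L, L = R ^ 2 / c₀ + 4 * (2 * R * ZZ) ^ 2 / c₀ + 16 * R ^ 2 / c₀ := ⟨_, rfl⟩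
  have hL0 : 0 < L := by rw [hL]; positivity
  have hKc : 0 < 8 * K / c₀ := by positivity
  refine ⟨2 + 8 * K / c₀, L / m * (c₀⁻¹ + 2 * K), by linarith, by positivity, ?_⟩
  intro lam ε a b E N hlam ha hab hb
  have hlam8 : 8 * K / c₀ ≤ lam := by linarith
  have hlam1 : 1 ≤ lam := by linarith
  have hlam0 : 0 < lam := by linarith
  have hlamK : 2 * K ≤ lam * c₀ / 4 := by
    rw [div_le_iff₀ hc₀] at hlam8; linarith
  -- the rate in Gronwall's inequality; `m` bounds `exp (-μ r)` from below for `r ≤ 1 / (2 * lam)`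
  set μ := 2 * K * lam / c₀ with hμ
  have hμ0 : 0 ≤ μ := by positivity
  have cth : ∀ n : ℕ, Continuous fun _ : ℝ => th n := fun _ => continuous_const
  have cthi : ∀ n : ℕ, Continuous fun _ : ℝ => (th n)⁻¹ := fun _ => continuous_const
  have cG7 := (((E.cg N).MM cth N).pow 2).I2
  have cGx := ((E.cωx.MM (continuous_gw (lam := lam) (a := a) (b := b)) N).pow 2).I2
  have cGy := ((E.cωy.MM (continuous_gw (lam := lam) (a := a) (b := b)) N).pow 2).I2
  have cN1 := ((E.cNu.MM (continuous_gw (lam := lam) (a := a) (b := b)) N).pow 2).I2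
  have cN2 := (((E.cNv.const_mul ε).MM (continuous_gw (lam := lam) (a := a) (b := b)) N).pow 2).I2
  have cF1 := ((((E.cf₁.const_mul (ε ^ 2)).MM
    (continuous_gw (lam := lam) (a := a) (b := b)) N).MM cthi N).pow 2).I2
  have cF2 := (((E.cf₂.MM (continuous_gw (lam := lam) (a := a) (b := b)) N).MM cthi N).pow 2).I2
  have cC := E.cC
  have csN : Continuous fun r => (E.sl r).srcN N := cN1.add cN2
  have csF : Continuous fun r => (E.sl r).srcF N := ((cC.pow 2).add cF1).add cF2
  set G7 : ℝ → ℝ := fun r => I2 fun x y => MM th N ((E.sl r).g N) x y ^ 2 with hG7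
  set Gd : ℝ → ℝ := fun r => ε ^ 2 * (I2 fun x y => (E.sl r).gx N x y ^ 2)
            + I2 fun x y => (E.sl r).gy N x y ^ 2 with hGd
  have cGd : Continuous Gd := (continuous_const.mul cGx).add cGy
  set e : ℝ → ℝ := fun r => I2 fun x y => (E.sl r).g N x y * (E.sl r).h N x y with he
  have ce : Continuous e := ((E.cg N).mul (E.ch N)).I2
  -- bound of the dissipated quantities
  have low : ∀ r, lam * G7 r + Gd r
      ≤ L * (lam * (c₀ / 4) * (E.sl r).S N + c₀ * (E.sl r).D N) := by
    intro r
    have k1 := (E.sl r).gain_g_le N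
    have k2 := (E.sl r).gx_sq_le N
    have k3 := (E.sl r).gy_sq_le N
    have hS := (E.sl r).S_nonneg N
    have hD := (E.sl r).D_nonneg N
    have hHS := (E.sl r).H_le_S N
    have k4 : lam * G7 r ≤ lam * ((2 * R * ZZ) ^ 2 * (E.sl r).S N) := by gcongr
    have k5 : R ^ 2 * (E.sl r).H N ≤ R ^ 2 * (lam * (E.sl r).S N) := by
      gcongr; nlinarith
    have e1 : L * (lam * (c₀ / 4) * (E.sl r).S N + c₀ * (E.sl r).D N)
        = (R ^ 2 / 4 + (2 * R * ZZ) ^ 2 + 4 * R ^ 2) * (lam * (E.sl r).S N)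
          + (R ^ 2 + 4 * (2 * R * ZZ) ^ 2 + 16 * R ^ 2) * (E.sl r).D N := by
      rw [hL]; field_simp; ring
    have k6 : 0 ≤ R ^ 2 * (lam * (E.sl r).S N) := by positivity
    have k7 : 0 ≤ R ^ 2 * (E.sl r).D N := by positivity
    have k8 : 0 ≤ (2 * R * ZZ) ^ 2 * (E.sl r).D N := by positivity
    rw [e1]
    simp only [hGd]
    linarith
  -- the differential inequality
  have key : ∀ r ∈ Ioo a b, HasDerivAt (fun r => Real.exp (-μ * r) * e r)
      (Real.exp (-μ * r) * (2 * I2 (fun x y => (E.sl r).gt N lam x y * (E.sl r).h N x y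
      - (1 / 2) * ((E.sl r).qz x y * (E.sl r).h N x y ^ 2)) - μ * e r)) r := by
    intro r hr
    have h1 := (E.denergy N).I2 ((E.cg N).mul (E.ch N))
      ((((E.cgt N).mul (E.ch N)).sub ((E.cqz.mul ((E.ch N).pow 2)).const_mul _)).const_mul 2) hr
    rw [I2_const_mul] at h1
    have h2 : HasDerivAt (fun r => Real.exp (-μ * r)) (Real.exp (-μ * r) * (-μ)) r := by
      simpa using ((hasDerivAt_id r).const_mul (-μ)).exp
    exact (h2.mul h1).congr_deriv (by ring)
  have expb : ∀ r ∈ Icc a b, m ≤ Real.exp (-μ * r) := by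
    intro r hr
    rw [hm, Real.exp_le_exp]
    have : μ * r ≤ μ * (1 / (2 * lam)) := by gcongr; exact hr.2.trans hb
    have e1 : μ * (1 / (2 * lam)) = K / c₀ := by rw [hμ]; field_simp
    linarith
  have exp1 : ∀ r ∈ Icc a b, Real.exp (-μ * r) ≤ 1 := by
    intro r hr
    rw [Real.exp_le_one_iff]
    have := mul_nonneg hμ0 (ha.trans hr.1)
    linarith
  set Φ : ℝ → ℝ := fun r => -(m / L) * (lam * G7 r + Gd r)
    + (2 * K * (E.sl r).srcN N + 2 * K / lam * (E.sl r).srcF N) with hΦ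
  have cΦ : Continuous Φ :=
    (continuous_const.mul ((continuous_const.mul cG7).add cGd)).add
      ((continuous_const.mul csN).add (continuous_const.mul csF))
  have est := intervalIntegral.sub_le_integral_of_hasDeriv_right_of_le hab
    (g := fun r => Real.exp (-μ * r) * e r)
    ((Continuous.mul (by fun_prop) ce).continuousOn) (fun r hr => (key r hr).hasDerivWithinAt)
    (cΦ.continuousOn.integrableOn_Icc) (fun r hr => by
      have hr' := Ioo_subset_Icc_self hr
      have p := main _ ε (E.sl r) N lam hlam0
      have q := (E.sl r).energy_ge N
      have hS := (E.sl r).S_nonneg N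
      have hD := (E.sl r).D_nonneg N
      have hN : 0 ≤ (E.sl r).srcN N := add_nonneg (I2_sq_nonneg (E.sl r).pNu.MM)
        (I2_sq_nonneg ((E.sl r).pNv.const_mul ε).MM)
      have hF : 0 ≤ (E.sl r).srcF N := add_nonneg (add_nonneg (sq_nonneg _)
        (I2_sq_nonneg ((E.sl r).pf₁.const_mul (ε ^ 2)).MM.MM))
        (I2_sq_nonneg (E.sl r).pf₂.MM.MM)
      have s1 : 2 * (lam * K * (E.sl r).H N) ≤ μ * e r := by
        have : μ * (c₀ * (E.sl r).H N) ≤ μ * e r := by gcongr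
        have e1 : μ * (c₀ * (E.sl r).H N) = 2 * (lam * K * (E.sl r).H N) := by
          rw [hμ]; field_simp
        linarith
      have s2 : 2 * K * (E.sl r).S N ≤ lam * c₀ / 4 * (E.sl r).S N := by gcongr
      have s3 : 2 * I2 (fun x y => (E.sl r).gt N lam x y * (E.sl r).h N x y
          - (1 / 2) * ((E.sl r).qz x y * (E.sl r).h N x y ^ 2)) - μ * e r
          ≤ -(lam * (c₀ / 4) * (E.sl r).S N + c₀ * (E.sl r).D N)
            + (2 * K * (E.sl r).srcN N + 2 * K / lam * (E.sl r).srcF N) := by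
        have : 2 * (K / lam * (E.sl r).srcF N) = 2 * K / lam * (E.sl r).srcF N := by ring
        linarith
      have s4 : 0 ≤ 2 * K * (E.sl r).srcN N + 2 * K / lam * (E.sl r).srcF N := by positivity
      have s5 : 0 ≤ lam * (c₀ / 4) * (E.sl r).S N + c₀ * (E.sl r).D N := by positivity
      have w1 := expb r hr'
      have w2 := exp1 r hr'
      have s6 : (m / L) * (lam * G7 r + Gd r)
          ≤ m * (lam * (c₀ / 4) * (E.sl r).S N + c₀ * (E.sl r).D N) := by
        have := mul_le_mul_of_nonneg_left (low r) (by positivity : 0 ≤ m / L)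
        have e1 : m / L * (L * (lam * (c₀ / 4) * (E.sl r).S N + c₀ * (E.sl r).D N))
          = m * (lam * (c₀ / 4) * (E.sl r).S N + c₀ * (E.sl r).D N) := by field_simp
        linarith
      have s7 := mul_le_mul_of_nonneg_left s3 (Real.exp_pos (-μ * r)).le
      have s8 := mul_le_mul_of_nonneg_right w1 s5
      have s9 := mul_le_mul_of_nonneg_right w2 s4
      simp only [hΦ]
      linarith)
  have intΦ : ∫ r in a..b, Φ r = -(m / L) * (lam * (∫ r in a..b, G7 r) + ∫ r in a..b, Gd r)
      + (2 * K * (∫ r in a..b, (E.sl r).srcN N) + 2 * K / lam * ∫ r in a..b, (E.sl r).srcF N) := by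
    exact integral_combination cG7 cGd csN csF _ _ _ _ _ _
  rw [intΦ] at est
  -- the energy at the two ends
  have end1 : (m / L) * (I2 fun x y => (E.sl b).g N x y ^ 2) ≤ Real.exp (-μ * b) * e b := by
    have q1 := (E.sl b).g_sq_le N
    have q2 := (E.sl b).energy_ge N
    have q3 := (E.sl b).H_nonneg N
    have q4 : R ^ 2 / c₀ ≤ L := by
      rw [hL]
      have : 0 ≤ 4 * (2 * R * ZZ) ^ 2 / c₀ := by positivity
      have : 0 ≤ 16 * R ^ 2 / c₀ := by positivity
      linarith
    have q5 : R ^ 2 * (E.sl b).H N ≤ L * e b := by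
      have e1 : R ^ 2 * (E.sl b).H N = R ^ 2 / c₀ * (c₀ * (E.sl b).H N) := by field_simp
      rw [e1]
      exact mul_le_mul q4 q2 (by positivity) hL0.le
    have q6 : (m / L) * (I2 fun x y => (E.sl b).g N x y ^ 2) ≤ (m / L) * (L * e b) := by
      gcongr; exact q1.trans q5
    have e2 : (m / L) * (L * e b) = m * e b := by field_simp
    have q7 : 0 ≤ e b := le_trans (by positivity) q2
    have := mul_le_mul_of_nonneg_right (expb b ⟨hab, le_rfl⟩) q7
    linarith
  have end2 : Real.exp (-μ * a) * e a ≤ c₀⁻¹ * I2 fun x y => (E.sl a).g N x y ^ 2 := by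
    have q1 := (E.sl a).energy_le N
    have q2 := (E.sl a).energy_ge N
    have q3 := (E.sl a).H_nonneg N
    have q7 : 0 ≤ e a := le_trans (by positivity) q2
    have := mul_le_mul_of_nonneg_right (exp1 a ⟨le_rfl, hab⟩) q7
    linarith
  have fin : (m / L) * ((I2 fun x y => (E.sl b).g N x y ^ 2)
        + (lam * (∫ r in a..b, G7 r) + ∫ r in a..b, Gd r))
      ≤ c₀⁻¹ * (I2 fun x y => (E.sl a).g N x y ^ 2)
        + (2 * K * (∫ r in a..b, (E.sl r).srcN N) + 2 * K / lam * ∫ r in a..b, (E.sl r).srcF N) := by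
    linarith
  have iN : 0 ≤ ∫ r in a..b, (E.sl r).srcN N :=
    intervalIntegral.integral_nonneg hab fun r _ => add_nonneg (I2_sq_nonneg (E.sl r).pNu.MM)
        (I2_sq_nonneg ((E.sl r).pNv.const_mul ε).MM)
  have iF : 0 ≤ ∫ r in a..b, (E.sl r).srcF N :=
    intervalIntegral.integral_nonneg hab fun r _ => add_nonneg (add_nonneg (sq_nonneg _)
        (I2_sq_nonneg ((E.sl r).pf₁.const_mul (ε ^ 2)).MM.MM))
        (I2_sq_nonneg (E.sl r).pf₂.MM.MM)
  have ia := I2_sq_nonneg ((E.sl a).pg N)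
  have fin2 := mul_le_mul_of_nonneg_left fin (by positivity : 0 ≤ L / m)
  rw [← mul_assoc, show L / m * (m / L) = 1 by field_simp, one_mul] at fin2
  refine fin2.trans ?_
  have c1 : 0 ≤ c₀⁻¹ := by positivity
  have z1 : c₀⁻¹ * (I2 fun x y => (E.sl a).g N x y ^ 2)
      ≤ (c₀⁻¹ + 2 * K) * (I2 fun x y => (E.sl a).g N x y ^ 2) := by gcongr; linarith
  have z2 : 2 * K * (∫ r in a..b, (E.sl r).srcN N)
      ≤ (c₀⁻¹ + 2 * K) * (∫ r in a..b, (E.sl r).srcN N) := by gcongr; linarith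
  have z3 : 2 * K / lam * (∫ r in a..b, (E.sl r).srcF N)
      ≤ (c₀⁻¹ + 2 * K) / lam * (∫ r in a..b, (E.sl r).srcF N) := by gcongr; linarith
  calc _ ≤ L / m * ((c₀⁻¹ + 2 * K) * (I2 fun x y => (E.sl a).g N x y ^ 2)
        + ((c₀⁻¹ + 2 * K) * (∫ r in a..b, (E.sl r).srcN N)
          + (c₀⁻¹ + 2 * K) / lam * (∫ r in a..b, (E.sl r).srcF N))) := by gcongr
    _ = _ := by ring

end Evolution

end

section

/-! ### One-dimensional Sobolev inequalities -/

lemma sub_sq_le_integral {c c' : ℝ → ℝ} {a b : ℝ} (hc : Continuous c) (hc' : Continuous c')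
    (h : ∀ y ∈ Ioo a b, HasDerivAt c (c' y) y) {y z : ℝ} (hy : y ∈ Icc a b) (hz : z ∈ Icc a b) :
    (c y - c z) ^ 2 ≤ (b - a) * ∫ s in a..b, c' s ^ 2 := by
  wlog hzy : z ≤ y generalizing y z
  · rw [← neg_sub, neg_sq]; exact this hz hy (by linarith)
  obtain hab | hab := (hy.1.trans hy.2).eq_or_lt
  · have : y = z := by linarith [hy.1, hy.2, hz.1, hz.2]
    simp [this, hab]
  set m := c y - c z with hm
  set L := b - a with hL
  have hL0 : 0 < L := by linarith
  have e : ∫ s in z..y, c' s = m :=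
    intervalIntegral.integral_eq_sub_of_hasDerivAt_of_le hzy hc.continuousOn
      (fun s hs => h s ⟨hz.1.trans_lt hs.1, hs.2.trans_le hy.2⟩) (hc'.intervalIntegrable _ _)
  have h1 : ∫ s in z..y, 2 * m * c' s ≤ ∫ s in z..y, (m ^ 2 / L + L * c' s ^ 2) := by
    refine intervalIntegral.integral_mono hzy (Continuous.intervalIntegrable (by fun_prop) _ _)
      (Continuous.intervalIntegrable (by fun_prop) _ _) fun s => ?_
    have e2 : m ^ 2 / L + L * c' s ^ 2 - 2 * m * c' s = (m - L * c' s) ^ 2 / L := by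
      field_simp; ring
    have : 0 ≤ (m - L * c' s) ^ 2 / L := by positivity
    change 2 * m * c' s ≤ m ^ 2 / L + L * c' s ^ 2
    linarith
  rw [intervalIntegral.integral_const_mul, e, intervalIntegral.integral_add
    (Continuous.intervalIntegrable (by fun_prop) _ _)
    (Continuous.intervalIntegrable (by fun_prop) _ _), intervalIntegral.integral_const_mul,
    intervalIntegral.integral_const, smul_eq_mul] at h1
  have h2 : ∫ s in z..y, c' s ^ 2 ≤ ∫ s in a..b, c' s ^ 2 :=
    intervalIntegral.integral_mono_interval hz.1 hzy hy.2
      (Filter.Eventually.of_forall fun s => sq_nonneg _)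
      (Continuous.intervalIntegrable (by fun_prop) _ _)
  have h3 : (y - z) * (m ^ 2 / L) ≤ m ^ 2 := by
    have : (y - z) * (m ^ 2 / L) ≤ L * (m ^ 2 / L) := by
      gcongr; linarith [hy.2, hz.1]
    rwa [mul_div_cancel₀ _ hL0.ne'] at this
  have h4 := mul_le_mul_of_nonneg_left h2 hL0.le
  nlinarith

lemma sq_le_integral_add {c c' : ℝ → ℝ} {a b : ℝ} (hab : a ≤ b) (hc : Continuous c)
    (hc' : Continuous c') (h : ∀ y ∈ Ioo a b, HasDerivAt c (c' y) y) {y : ℝ} (hy : y ∈ Icc a b) :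
    (b - a) * c y ^ 2
      ≤ 2 * (∫ s in a..b, c s ^ 2) + 2 * (b - a) ^ 2 * ∫ s in a..b, c' s ^ 2 := by
  have h1 : ∫ _ in a..b, c y ^ 2
      ≤ ∫ z in a..b, (2 * c z ^ 2 + 2 * ((b - a) * ∫ s in a..b, c' s ^ 2)) := by
    refine intervalIntegral.integral_mono_on hab (Continuous.intervalIntegrable (by fun_prop) _ _)
      (Continuous.intervalIntegrable (by fun_prop) _ _) fun z hz => ?_
    have := sub_sq_le_integral hc hc' h hy hz
    nlinarith [sq_nonneg (c y - 2 * c z)]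
  rw [intervalIntegral.integral_const, intervalIntegral.integral_add
    (Continuous.intervalIntegrable (by fun_prop) _ _)
    (Continuous.intervalIntegrable (by fun_prop) _ _), intervalIntegral.integral_const_mul,
    intervalIntegral.integral_const, smul_eq_mul, smul_eq_mul] at h1
  linarith

section Unit
variable {c c' c'' : ℝ → ℝ} (hc : Continuous c) (hc' : Continuous c') (hc'' : Continuous c'')
  (h : ∀ y ∈ Ioo (0 : ℝ) 1, HasDerivAt c (c' y) y)
  (h' : ∀ y ∈ Ioo (0 : ℝ) 1, HasDerivAt c' (c'' y) y) {y : ℝ} (hy : y ∈ Icc (0 : ℝ) 1)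
include hc hc' h hy

lemma sq_le_unit : c y ^ 2 ≤ 2 * (∫ s in 0..1, c s ^ 2) + 2 * ∫ s in 0..1, c' s ^ 2 := by
  have := sq_le_integral_add zero_le_one hc hc' h hy
  norm_num at this
  linarith

include hc'' h'

/-- The first derivative is controlled by the function and the second derivative: by the mean value
theorem it is bounded somewhere by the values of the function near the two ends. -/
lemma deriv_sq_le_unit :
    c' y ^ 2 ≤ 32 * (∫ s in 0..1, c s ^ 2) + 2 * ∫ s in 0..1, c'' s ^ 2 := by
  set J := ∫ s in 0..1, c'' s ^ 2 with hJ
  have h1 : ∀ z ∈ Icc (0 : ℝ) (1 / 4), c' y ^ 2 ≤ 2 * J + 8 * (c z ^ 2 + c (z + 3 / 4) ^ 2) := by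
    intro z hz
    obtain ⟨ξ, hξ, e⟩ := exists_hasDerivAt_eq_slope c c' (by linarith : z < z + 3 / 4)
      hc.continuousOn fun s hs => h s ⟨by linarith [hs.1, hz.1], by linarith [hs.2, hz.2]⟩
    have hξ' : ξ ∈ Icc (0 : ℝ) 1 := ⟨by linarith [hξ.1, hz.1], by linarith [hξ.2, hz.2]⟩
    have h2 := sub_sq_le_integral hc' hc'' h' hy hξ'
    rw [← hJ] at h2
    have h3 : c' ξ = 4 / 3 * (c (z + 3 / 4) - c z) := by rw [e]; ring
    have h4 : c' ξ ^ 2 ≤ 4 * (c z ^ 2 + c (z + 3 / 4) ^ 2) := by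
      rw [h3]; nlinarith [sq_nonneg (c (z + 3 / 4) + c z), sq_nonneg (c z), sq_nonneg (c (z + 3 / 4))]
    nlinarith [sq_nonneg (c' y - 2 * c' ξ)]
  have h5 : ∫ _ in (0 : ℝ)..(1 / 4), c' y ^ 2
      ≤ ∫ z in (0 : ℝ)..(1 / 4), (2 * J + (8 * c z ^ 2 + 8 * c (z + 3 / 4) ^ 2)) :=
    intervalIntegral.integral_mono_on (by norm_num)
      (Continuous.intervalIntegrable (by fun_prop) _ _)
      (Continuous.intervalIntegrable (by fun_prop) _ _) fun z hz => (h1 z hz).trans (by linarith)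
  rw [intervalIntegral.integral_const, intervalIntegral.integral_add
    (Continuous.intervalIntegrable (by fun_prop) _ _)
    (Continuous.intervalIntegrable (by fun_prop) _ _), intervalIntegral.integral_add
    (Continuous.intervalIntegrable (by fun_prop) _ _)
    (Continuous.intervalIntegrable (by fun_prop) _ _), intervalIntegral.integral_const_mul,
    intervalIntegral.integral_const_mul, intervalIntegral.integral_const_mul,
    intervalIntegral.integral_comp_add_right (fun z => c z ^ 2),
    intervalIntegral.integral_const, smul_eq_mul, smul_eq_mul] at h5
  norm_num at h5
  have hi : ∀ a b, IntervalIntegrable (fun z => c z ^ 2) volume a b := fun a b =>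
    Continuous.intervalIntegrable (by fun_prop) _ _
  have h6 : ∫ s in 0..1, c s ^ 2 = (∫ s in (0 : ℝ)..(1 / 4), c s ^ 2)
      + (∫ s in (1 / 4 : ℝ)..(3 / 4), c s ^ 2) + ∫ s in (3 / 4 : ℝ)..1, c s ^ 2 := by
    rw [intervalIntegral.integral_add_adjacent_intervals (hi _ _) (hi _ _),
      intervalIntegral.integral_add_adjacent_intervals (hi _ _) (hi _ _)]
  have h7 : 0 ≤ ∫ s in (1 / 4 : ℝ)..(3 / 4), c s ^ 2 :=
    intervalIntegral.integral_nonneg (by norm_num) fun _ _ => sq_nonneg _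
  linarith

lemma sq_le_unit_two :
    c y ^ 2 ≤ 66 * (∫ s in 0..1, c s ^ 2) + 4 * ∫ s in 0..1, c'' s ^ 2 := by
  have h1 := sq_le_unit hc hc' h hy
  have h2 : ∫ s in 0..1, c' s ^ 2 ≤ ∫ _ in (0 : ℝ)..1,
      (32 * (∫ s in 0..1, c s ^ 2) + 2 * ∫ s in 0..1, c'' s ^ 2) :=
    intervalIntegral.integral_mono_on zero_le_one (Continuous.intervalIntegrable (by fun_prop) _ _)
      (Continuous.intervalIntegrable (by fun_prop) _ _) fun z hz =>
        deriv_sq_le_unit hc hc' hc'' h h' hz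
  rw [intervalIntegral.integral_const] at h2
  norm_num at h2
  linarith

end Unit

/-- The Sobolev inequality on one period. -/
lemma PC.sq_le {f f' : ℝ → ℝ} (hf : PC f) (hf' : PC f') (h : ∀ x, HasDerivAt f (f' x) x) (x : ℝ) :
    f x ^ 2 ≤ 13 * ((∫ z in 0..2 * Real.pi, f z ^ 2) + ∫ z in 0..2 * Real.pi, f' z ^ 2) := by
  have hp := Real.two_pi_pos
  have h1 := sq_le_integral_add (a := x) (b := x + 2 * Real.pi) (by linarith) hf.cont hf'.cont
    (fun y _ => h y) ⟨le_rfl, by linarith⟩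
  have e : ∀ {g : ℝ → ℝ}, PC g → ∫ z in x..x + 2 * Real.pi, g z ^ 2
      = ∫ z in 0..2 * Real.pi, g z ^ 2 := fun {g} hg => by
    have : Function.Periodic (fun z => g z ^ 2) (2 * Real.pi) := fun z => by
      simp only [hg.per z]
    simpa using this.intervalIntegral_add_eq x 0
  rw [e hf, e hf', add_sub_cancel_left] at h1
  set P := ∫ z in 0..2 * Real.pi, f z ^ 2
  set Q := ∫ z in 0..2 * Real.pi, f' z ^ 2
  have hP : 0 ≤ P := intervalIntegral.integral_nonneg hp.le fun _ _ => sq_nonneg _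
  have hQ : 0 ≤ Q := intervalIntegral.integral_nonneg hp.le fun _ _ => sq_nonneg _
  have p1 := Real.pi_gt_three
  have p2 := Real.pi_lt_d2
  have k1 : 2 * Real.pi * f x ^ 2 ≤ 2 * Real.pi * (13 * (P + Q)) := by
    have k2 : Real.pi * (Real.pi * Q) ≤ 3.15 * (Real.pi * Q) := by gcongr
    have k3 : 3 * P ≤ Real.pi * P := by gcongr
    have k4 : 3 * Q ≤ Real.pi * Q := by gcongr
    linarith
  exact le_of_mul_le_mul_left k1 hp

/-! ### Decay of Fourier coefficients -/

lemma continuous_cs {F : ℝ → ℝ → ℝ} (hF : PF F) (k : ℤ) : Continuous fun y => cs (fun z => F z y) k :=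
  continuous_inner (F := fun x y => F x y * Real.cos (k * x)) (hF.cont.mul (by fun_prop)) _ _

lemma continuous_sn {F : ℝ → ℝ → ℝ} (hF : PF F) (k : ℤ) : Continuous fun y => sn (fun z => F z y) k :=
  continuous_inner (F := fun x y => F x y * Real.sin (k * x)) (hF.cont.mul (by fun_prop)) _ _

lemma HasY.cs {F F' : ℝ → ℝ → ℝ} (h : HasY F F') (hF : PF F) (hF' : PF F') (k : ℤ) :
    ∀ y ∈ Ioo (0 : ℝ) 1, HasDerivAt (fun y => cs (fun z => F z y) k) (cs (fun z => F' z y) k) y :=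
  fun _ hy => hasDerivAt_integral_param (a := 0) (b := 1)
    (f := fun y x => F x y * Real.cos (k * x)) (f' := fun y x => F' x y * Real.cos (k * x))
    ((hF.cont.comp continuous_swap).mul (by fun_prop))
    ((hF'.cont.comp continuous_swap).mul (by fun_prop)) (fun x s hs => (h x s hs).mul_const _) hy

lemma HasY.sn {F F' : ℝ → ℝ → ℝ} (h : HasY F F') (hF : PF F) (hF' : PF F') (k : ℤ) :
    ∀ y ∈ Ioo (0 : ℝ) 1, HasDerivAt (fun y => sn (fun z => F z y) k) (sn (fun z => F' z y) k) y :=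
  fun _ hy => hasDerivAt_integral_param (a := 0) (b := 1)
    (f := fun y x => F x y * Real.sin (k * x)) (f' := fun y x => F' x y * Real.sin (k * x))
    ((hF.cont.comp continuous_swap).mul (by fun_prop))
    ((hF'.cont.comp continuous_swap).mul (by fun_prop)) (fun x s hs => (h x s hs).mul_const _) hy

/-- The squared `L²` norm in `y` of the Fourier coefficient of index `k`. -/
def modeSq (F : ℝ → ℝ → ℝ) (k : ℤ) : ℝ := ∫ y in 0..1, ‖fc (fun z => F z y) k‖ ^ 2

lemma continuous_norm_fc_sq {F : ℝ → ℝ → ℝ} (hF : PF F) (k : ℤ) :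
    Continuous fun y => ‖fc (fun z => F z y) k‖ ^ 2 := by
  simp only [fun y => norm_fc_sq (hF.cx y) k]
  have := continuous_cs hF k
  have := continuous_sn hF k
  fun_prop

lemma modeSq_eq {F : ℝ → ℝ → ℝ} (hF : PF F) (k : ℤ) :
    modeSq F k = (1 / (2 * Real.pi)) ^ 2 * ((∫ y in 0..1, cs (fun z => F z y) k ^ 2)
      + ∫ y in 0..1, sn (fun z => F z y) k ^ 2) := by
  have := continuous_cs hF k
  have := continuous_sn hF k
  simp only [modeSq, fun y => norm_fc_sq (hF.cx y) k]
  rw [intervalIntegral.integral_const_mul, intervalIntegral.integral_add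
    (Continuous.intervalIntegrable (by fun_prop) _ _)
    (Continuous.intervalIntegrable (by fun_prop) _ _)]

lemma modeSq_nonneg (F : ℝ → ℝ → ℝ) (k : ℤ) : 0 ≤ modeSq F k :=
  intervalIntegral.integral_nonneg zero_le_one fun _ _ => sq_nonneg _

section Modes
variable {F F' F'' : ℝ → ℝ → ℝ} (hF : PF F) (hF' : PF F') (hF'' : PF F'') (h : HasY F F')
  (h' : HasY F' F'') (k : ℤ) {y : ℝ} (hy : y ∈ Icc (0 : ℝ) 1)
include hF hF' h hy

lemma norm_fc_sq_le_modeSq :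
    ‖fc (fun z => F z y) k‖ ^ 2 ≤ 2 * modeSq F k + 2 * modeSq F' k := by
  rw [norm_fc_sq (hF.cx y), modeSq_eq hF, modeSq_eq hF']
  have h1 := sq_le_unit (continuous_cs hF k) (continuous_cs hF' k) (h.cs hF hF' k) hy
  have h2 := sq_le_unit (continuous_sn hF k) (continuous_sn hF' k) (h.sn hF hF' k) hy
  have := mul_le_mul_of_nonneg_left (add_le_add h1 h2) (sq_nonneg (1 / (2 * Real.pi)))
  linarith

lemma norm_fc_sq_le_of_wall (h0 : ∀ x, F x 0 = 0) :
    ‖fc (fun z => F z y) k‖ ^ 2 ≤ modeSq F' k := by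
  rw [norm_fc_sq (hF.cx y), modeSq_eq hF']
  have h1 := sub_sq_le_integral (continuous_cs hF k) (continuous_cs hF' k) (h.cs hF hF' k) hy
    (left_mem_Icc.2 zero_le_one)
  have h2 := sub_sq_le_integral (continuous_sn hF k) (continuous_sn hF' k) (h.sn hF hF' k) hy
    (left_mem_Icc.2 zero_le_one)
  have e1 : HydroNS.cs (fun z => F z 0) k = 0 := by simp [HydroNS.cs, h0]
  have e2 : HydroNS.sn (fun z => F z 0) k = 0 := by simp [HydroNS.sn, h0]
  rw [e1, sub_zero, sub_zero, one_mul] at h1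
  rw [e2, sub_zero, sub_zero, one_mul] at h2
  exact mul_le_mul_of_nonneg_left (add_le_add h1 h2) (sq_nonneg (1 / (2 * Real.pi)))

include hF'' h'

/-- The normal derivative is bounded, mode by mode, by the function and its second derivative. -/
lemma norm_fc_deriv_sq_le_modeSq :
    ‖fc (fun z => F' z y) k‖ ^ 2 ≤ 32 * modeSq F k + 2 * modeSq F'' k := by
  rw [norm_fc_sq (hF'.cx y), modeSq_eq hF, modeSq_eq hF'']
  have h1 := deriv_sq_le_unit (continuous_cs hF k) (continuous_cs hF' k) (continuous_cs hF'' k)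
    (h.cs hF hF' k) (h'.cs hF' hF'' k) hy
  have h2 := deriv_sq_le_unit (continuous_sn hF k) (continuous_sn hF' k) (continuous_sn hF'' k)
    (h.sn hF hF' k) (h'.sn hF' hF'' k) hy
  have := mul_le_mul_of_nonneg_left (add_le_add h1 h2) (sq_nonneg (1 / (2 * Real.pi)))
  linarith

lemma norm_fc_sq_le_modeSq_two :
    ‖fc (fun z => F z y) k‖ ^ 2 ≤ 66 * modeSq F k + 4 * modeSq F'' k := by
  rw [norm_fc_sq (hF.cx y), modeSq_eq hF, modeSq_eq hF'']
  have h1 := sq_le_unit_two (continuous_cs hF k) (continuous_cs hF' k) (continuous_cs hF'' k)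
    (h.cs hF hF' k) (h'.cs hF' hF'' k) hy
  have h2 := sq_le_unit_two (continuous_sn hF k) (continuous_sn hF' k) (continuous_sn hF'' k)
    (h.sn hF hF' k) (h'.sn hF' hF'' k) hy
  have := mul_le_mul_of_nonneg_left (add_le_add h1 h2) (sq_nonneg (1 / (2 * Real.pi)))
  linarith

end Modes

lemma modeSq_hasX {F F' : ℝ → ℝ → ℝ} (hF : PF F) (hF' : PF F') (h : HasX F F') (k : ℤ) :
    modeSq F' k ≤ bracket k ^ 2 * modeSq F k := by
  rw [modeSq, modeSq, ← intervalIntegral.integral_const_mul]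
  refine intervalIntegral.integral_mono_on zero_le_one
    ((continuous_norm_fc_sq hF' k).intervalIntegrable _ _)
    ((continuous_const.mul (continuous_norm_fc_sq hF k)).intervalIntegrable _ _) fun y _ => ?_
  rw [fc_deriv (fun x => h x y) (hF'.cx y) (fun x => hF.per x y), norm_mul, mul_pow]
  gcongr
  simpa using abs_le_bracket k

/-- The Fourier coefficients decay like `⟨j⟩^{-3-p} e^{-τ⟨j⟩^(2/3)}`. For `p = 2` this is `GB`. -/
def GD (p : ℕ) (R τ : ℝ) (f : ℝ → ℝ) : Prop := ∀ j, gw9 τ j * bracket j ^ p * ‖fc f j‖ ≤ R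

section GD
variable {p : ℕ} {R S τ : ℝ} {f f' : ℝ → ℝ}

lemma GD.mono {q : ℕ} (h : GD p R τ f) (hq : q ≤ p) (hS : R ≤ S) : GD q S τ f := fun j => by
  have h1 := pow_le_pow_right₀ (one_le_bracket j) hq
  have h2 := (gw9_pos τ j).le
  refine le_trans ?_ ((h j).trans hS)
  gcongr

lemma GD.deriv (h : GD (p + 1) R τ f) (hf : PC f) (hf' : Continuous f')
    (hd : ∀ x, HasDerivAt f (f' x) x) : GD p R τ f' := fun j => by
  rw [fc_deriv hd hf' hf.per, norm_mul, norm_mul, Complex.norm_I, one_mul]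
  refine le_trans ?_ (h j)
  have h1 : ‖(j : ℂ)‖ ≤ bracket j := by simpa using abs_le_bracket j
  have h2 := (gw9_pos τ j).le
  have h3 := (bracket_pos j).le
  calc gw9 τ j * bracket j ^ p * (‖(j : ℂ)‖ * ‖fc f j‖)
      ≤ gw9 τ j * bracket j ^ p * (bracket j * ‖fc f j‖) := by gcongr
    _ = _ := by ring

lemma GD.add {g : ℝ → ℝ} (h : GD p R τ f) (h' : GD p S τ g) (hf : Continuous f)
    (hg : Continuous g) : GD p (R + S) τ fun x => f x + g x := fun j => by
  rw [fc_add hf hg]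
  have h1 := h j
  have h2 := h' j
  have h3 : 0 ≤ gw9 τ j * bracket j ^ p := by
    have := gw9_pos τ j; have := bracket_pos j; positivity
  nlinarith [norm_add_le (fc f j) (fc g j)]

lemma GD.const_mul (h : GD p R τ f) {c : ℝ} (h0 : 0 ≤ c) (h1 : c ≤ 1) :
    GD p R τ fun x => c * f x := fun j => by
  rw [fc_const_mul, norm_mul, Complex.norm_real, Real.norm_of_nonneg h0]
  have h3 : 0 ≤ gw9 τ j * bracket j ^ p * ‖fc f j‖ := by
    have := gw9_pos τ j; have := bracket_pos j; positivity
  have := h j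
  nlinarith

/-- Decay of the Fourier coefficients bounds the maximum norm. -/
lemma GD.abs_le (h : GD p R τ f) (hτ : 0 ≤ τ) (hf : PC f) (x : ℝ) : |f x| ≤ ZZ * R := by
  have h1 : ∀ j, ‖fc f j‖ ≤ 1 / bracket j ^ 2 * R := fun j => by
    have h2 := h j
    have h3 := th_pow_le_gw9 hτ j (p := 6) (by norm_num)
    have h4 : th j.natAbs ^ 6 = bracket j ^ 2 := by
      rw [show 6 = 3 * 2 by norm_num, pow_mul, th_cube, bracket_natAbs]
    have h5 : 1 ≤ bracket j ^ p := one_le_pow₀ (one_le_bracket j)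
    have h6 := bracket_pos j
    have h7 : bracket j ^ 2 * 1 * ‖fc f j‖ ≤ gw9 τ j * bracket j ^ p * ‖fc f j‖ := by
      rw [← h4]; have := gw9_pos τ j; gcongr
    rw [one_div, inv_mul_eq_div, le_div_iff₀ (by positivity)]
    linarith
  have h2 : Summable fun j => ‖fc f j‖ :=
    Summable.of_nonneg_of_le (fun _ => norm_nonneg _) h1 (summable_bracket.mul_right R)
  refine (abs_le_tsum_norm_fc hf.cont hf.per h2 x).trans ?_
  rw [ZZ, ← tsum_mul_right]
  exact h2.tsum_le_tsum h1 (summable_bracket.mul_right R)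

end GD

/-! ### The norms of the statement -/

lemma gw9_eq (τ : ℝ) (j : ℤ) :
    gw9 τ j = bracket j ^ 3 * Real.exp (τ * bracket j ^ (2 / 3 : ℝ)) := by
  rw [gw9, th_sq, show 9 = 3 * 3 by norm_num, pow_mul, th_cube, bracket_natAbs]

lemma ofReal_I2 {F : ℝ → ℝ → ℝ} (hF : PF F) (h0 : ∀ x y, 0 ≤ F x y) :
    ENNReal.ofReal (I2 F)
      = ∫⁻ y in Ioo (0 : ℝ) 1, ENNReal.ofReal (∫ x in 0..2 * Real.pi, F x y) := by
  rw [I2, intervalIntegral.integral_of_le zero_le_one, integral_Ioc_eq_integral_Ioo,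
    ofReal_integral_eq_lintegral_ofReal]
  · exact (hF.inner.continuousOn.integrableOn_compact isCompact_Icc).mono_set Ioo_subset_Icc_self
  · exact Filter.Eventually.of_forall fun y =>
      intervalIntegral.integral_nonneg Real.two_pi_pos.le fun x _ => h0 x y

lemma ofReal_I2_sq {F : ℝ → ℝ → ℝ} (hF : PF F) :
    ENNReal.ofReal (I2 fun x y => F x y ^ 2) = ∫⁻ y in Ioo (0 : ℝ) 1, ENNReal.ofReal (2 * Real.pi)
      * ∑' k, ENNReal.ofReal (‖fc (fun x => F x y) k‖ ^ 2) := by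
  rw [ofReal_I2 (hF.pow 2) fun _ _ => sq_nonneg _]
  refine lintegral_congr fun y => ?_
  rw [tsum_ofReal_sq_fc (hF.cx y)]

/-- The weight of the `X^r_τ` norm. -/
def wt (r τ : ℝ) (k : ℤ) : ℝ := bracket k ^ r * Real.exp (τ * bracket k ^ (2 / 3 : ℝ))

lemma traceNormSq_eq (r τ : ℝ) (g : ℝ → ℝ) : traceNormSq r τ g = ENNReal.ofReal (2 * Real.pi)
    * ∑' k, ENNReal.ofReal ((wt r τ k * ‖fc g k‖) ^ 2) := rfl

lemma ofReal_I2_sq_le {F G : ℝ → ℝ → ℝ} (hF : PF F) {r τ : ℝ}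
    (h : ∀ y ∈ Ioo (0 : ℝ) 1, ∀ k, ‖fc (fun x => F x y) k‖ ≤ wt r τ k * ‖fc (fun x => G x y) k‖) :
    ENNReal.ofReal (I2 fun x y => F x y ^ 2) ≤ normSq r τ G := by
  rw [ofReal_I2_sq hF]
  refine setLIntegral_mono' measurableSet_Ioo fun y hy => ?_
  rw [traceNormSq_eq]
  gcongr with k
  exact h y hy k

lemma normSq_mono {r r' τ : ℝ} (h : r ≤ r') (F : ℝ → ℝ → ℝ) : normSq r τ F ≤ normSq r' τ F := by
  refine lintegral_mono fun y => ?_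
  simp only [traceNormSq]
  gcongr with k
  · have := bracket_pos k; positivity
  · exact one_le_bracket k

lemma modeSq_le_of_normSq_le {F : ℝ → ℝ → ℝ} (hF : PF F) {r τ M : ℝ}
    (h : normSq r τ F ≤ ENNReal.ofReal (M ^ 2)) (k : ℤ) : wt r τ k ^ 2 * modeSq F k ≤ M ^ 2 := by
  have hc := continuous_norm_fc_sq hF k
  have e : ENNReal.ofReal (wt r τ k ^ 2 * modeSq F k)
      = ∫⁻ y in Ioo (0 : ℝ) 1, ENNReal.ofReal ((wt r τ k * ‖fc (fun x => F x y) k‖) ^ 2) := by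
    simp only [mul_pow]
    rw [modeSq, ← intervalIntegral.integral_const_mul,
      intervalIntegral.integral_of_le zero_le_one, integral_Ioc_eq_integral_Ioo,
      ofReal_integral_eq_lintegral_ofReal]
    · exact ((continuous_const.mul hc).continuousOn.integrableOn_compact isCompact_Icc).mono_set
        Ioo_subset_Icc_self
    · exact Filter.Eventually.of_forall fun y => by positivity
  rw [← ENNReal.ofReal_le_ofReal_iff (by positivity), e]
  refine le_trans (lintegral_mono fun y => ?_) h
  rw [traceNormSq_eq]
  calc _ = 1 * ENNReal.ofReal ((wt r τ k * ‖fc (fun x => F x y) k‖) ^ 2) := (one_mul _).symm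
    _ ≤ _ := by
      gcongr
      · rw [← ENNReal.ofReal_one]
        exact ENNReal.ofReal_le_ofReal (by linarith [Real.pi_gt_three])
      · exact ENNReal.le_tsum (f := fun k => ENNReal.ofReal
          ((wt r τ k * ‖fc (fun x => F x y) k‖) ^ 2)) k

/-- The weight of the `X^{p+3}` norm is that of `GD p`. -/
lemma wt_natCast (p : ℕ) (τ : ℝ) (k : ℤ) : wt ((p + 3 : ℕ) : ℝ) τ k = gw9 τ k * bracket k ^ p := by
  rw [wt, gw9_eq, Real.rpow_natCast, pow_add]; ring

end

section

/-! ### Partial derivatives up to the walls -/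

/-- The closed strip at the times of `I`. -/
def dom (I : Set ℝ) : Set (ℝ × ℝ × ℝ) := I ×ˢ univ ×ˢ Icc 0 1

/-- A function of `t`, `x`, `y` as a function of a triple. -/
def unc (f : ℝ → ℝ → ℝ → ℝ) (z : ℝ × ℝ × ℝ) : ℝ := f z.1 z.2.1 z.2.2

/-- The derivative in the direction `v`, one-sided on the boundary of the domain. -/
def dv (I : Set ℝ) (v : ℝ × ℝ × ℝ) (f : ℝ → ℝ → ℝ → ℝ) (t x y : ℝ) : ℝ :=
  fderivWithin ℝ (unc f) (dom I) (t, x, y) v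

section Smooth
variable {I J : Set ℝ} {f g : ℝ → ℝ → ℝ → ℝ} {n : ℕ} {t x y : ℝ}

lemma mem_dom : (t, x, y) ∈ dom I ↔ t ∈ I ∧ y ∈ Icc (0 : ℝ) 1 := by simp [dom]

lemma uniqueDiffOn_dom (hI : UniqueDiffOn ℝ I) : UniqueDiffOn ℝ (dom I) :=
  hI.prod (uniqueDiffOn_univ.prod (uniqueDiffOn_Icc one_pos))

lemma SmoothOn.mono {n : WithTop ℕ∞} (h : SmoothOn n I f) (hJ : J ⊆ I) : SmoothOn n J f :=
  ContDiffOn.mono h (prod_mono hJ Subset.rfl)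

lemma SmoothOn.of_le {m n : WithTop ℕ∞} (h : SmoothOn n I f) (hm : m ≤ n) : SmoothOn m I f :=
  ContDiffOn.of_le h hm

lemma SmoothOn.congr {n : WithTop ℕ∞} (h : SmoothOn n I f)
    (e : ∀ t ∈ I, ∀ x, ∀ y ∈ Icc (0 : ℝ) 1, g t x y = f t x y) : SmoothOn n I g :=
  ContDiffOn.congr h fun z hz => e z.1 hz.1 z.2.1 z.2.2 hz.2.2

lemma SmoothOn.hasFDeriv (h : SmoothOn 1 I f) (ht : t ∈ I) (hy : y ∈ Icc (0 : ℝ) 1) :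
    HasFDerivWithinAt (unc f) (fderivWithin ℝ (unc f) (dom I) (t, x, y)) (dom I) (t, x, y) :=
  (ContDiffOn.differentiableOn h one_ne_zero (t, x, y) (mem_dom.2 ⟨ht, hy⟩)).hasFDerivWithinAt

lemma SmoothOn.hasDerivAt_x' (h : SmoothOn 1 I f) (ht : t ∈ I) (hy : y ∈ Icc (0 : ℝ) 1) :
    HasDerivAt (fun z => f t z y) (dv I (0, 1, 0) f t x y) x := by
  have h1 : HasDerivWithinAt (fun z : ℝ => (t, z, y)) (0, 1, 0) univ x :=
    (hasDerivWithinAt_const _ _ _).prodMk ((hasDerivWithinAt_id _ _).prodMk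
      (hasDerivWithinAt_const _ _ _))
  exact ((h.hasFDeriv ht hy).comp_hasDerivWithinAt x h1
    fun z _ => mem_dom.2 ⟨ht, hy⟩).hasDerivAt univ_mem

lemma SmoothOn.hasDerivWithinAt_y' (h : SmoothOn 1 I f) (ht : t ∈ I) (hy : y ∈ Icc (0 : ℝ) 1) :
    HasDerivWithinAt (f t x) (dv I (0, 0, 1) f t x y) (Icc 0 1) y := by
  have h1 : HasDerivWithinAt (fun z : ℝ => (t, x, z)) (0, 0, 1) (Icc 0 1) y :=
    (hasDerivWithinAt_const _ _ _).prodMk ((hasDerivWithinAt_const _ _ _).prodMk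
      (hasDerivWithinAt_id _ _))
  exact (h.hasFDeriv ht hy).comp_hasDerivWithinAt y h1 fun z hz => mem_dom.2 ⟨ht, hz⟩

lemma SmoothOn.hasDerivAt_t' (h : SmoothOn 1 I f) (hI : IsOpen I) (ht : t ∈ I)
    (hy : y ∈ Icc (0 : ℝ) 1) : HasDerivAt (fun s => f s x y) (dv I (1, 0, 0) f t x y) t := by
  have h1 : HasDerivWithinAt (fun z : ℝ => (z, x, y)) (1, 0, 0) I t :=
    (hasDerivWithinAt_id _ _).prodMk ((hasDerivWithinAt_const _ _ _).prodMk
      (hasDerivWithinAt_const _ _ _))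
  exact ((h.hasFDeriv ht hy).comp_hasDerivWithinAt t h1
    fun z hz => mem_dom.2 ⟨hz, hy⟩).hasDerivAt (hI.mem_nhds ht)

lemma dx_eq (h : SmoothOn 1 I f) (ht : t ∈ I) (hy : y ∈ Icc (0 : ℝ) 1) :
    dx f t x y = dv I (0, 1, 0) f t x y := (h.hasDerivAt_x' ht hy).deriv

lemma dy_eq (h : SmoothOn 1 I f) (ht : t ∈ I) (hy : y ∈ Icc (0 : ℝ) 1) :
    dy f t x y = dv I (0, 0, 1) f t x y :=
  (h.hasDerivWithinAt_y' ht hy).derivWithin (uniqueDiffOn_Icc one_pos y hy)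

lemma dt_eq (h : SmoothOn 1 I f) (hI : IsOpen I) (ht : t ∈ I) (hy : y ∈ Icc (0 : ℝ) 1) :
    dt f t x y = dv I (1, 0, 0) f t x y := (h.hasDerivAt_t' hI ht hy).deriv

lemma SmoothOn.hasDerivAt_x (h : SmoothOn 1 I f) (ht : t ∈ I) (hy : y ∈ Icc (0 : ℝ) 1) :
    HasDerivAt (fun z => f t z y) (dx f t x y) x := by
  rw [dx_eq h ht hy]; exact h.hasDerivAt_x' ht hy

lemma SmoothOn.hasDerivAt_y (h : SmoothOn 1 I f) (ht : t ∈ I) (hy : y ∈ Ioo (0 : ℝ) 1) :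
    HasDerivAt (f t x) (dy f t x y) y := by
  rw [dy_eq h ht (Ioo_subset_Icc_self hy)]
  exact (h.hasDerivWithinAt_y' ht (Ioo_subset_Icc_self hy)).hasDerivAt
    (Icc_mem_nhds hy.1 hy.2)

lemma SmoothOn.hasDerivAt_t (h : SmoothOn 1 I f) (hI : IsOpen I) (ht : t ∈ I)
    (hy : y ∈ Icc (0 : ℝ) 1) : HasDerivAt (fun s => f s x y) (dt f t x y) t := by
  rw [dt_eq h hI ht hy]; exact h.hasDerivAt_t' hI ht hy

lemma SmoothOn.dv (h : SmoothOn (n + 1 : ℕ) I f) (hI : UniqueDiffOn ℝ I) (v : ℝ × ℝ × ℝ) :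
    SmoothOn n I (dv I v f) := by
  have h1 : ContDiffOn ℝ n (fderivWithin ℝ (unc f) (dom I)) (dom I) :=
    ContDiffOn.fderivWithin (n := (n + 1 : ℕ)) h (uniqueDiffOn_dom hI) (by norm_cast)
  exact h1.clm_apply contDiffOn_const

lemma SmoothOn.one (h : SmoothOn (n + 1 : ℕ) I f) : SmoothOn 1 I f :=
  h.of_le (by norm_cast; omega)

lemma SmoothOn.dx (h : SmoothOn (n + 1 : ℕ) I f) (hI : UniqueDiffOn ℝ I) : SmoothOn n I (dx f) :=
  (h.dv hI _).congr fun _ ht _ _ hy => dx_eq h.one ht hy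

lemma SmoothOn.dy (h : SmoothOn (n + 1 : ℕ) I f) (hI : UniqueDiffOn ℝ I) : SmoothOn n I (dy f) :=
  (h.dv hI _).congr fun _ ht _ _ hy => dy_eq h.one ht hy

lemma SmoothOn.dt (h : SmoothOn (n + 1 : ℕ) I f) (hI : IsOpen I) : SmoothOn n I (dt f) :=
  (h.dv hI.uniqueDiffOn _).congr fun _ ht _ _ hy => dt_eq h.one hI ht hy

lemma dv_congr {v : ℝ × ℝ × ℝ} (e : ∀ t ∈ I, ∀ x, ∀ y ∈ Icc (0 : ℝ) 1, g t x y = f t x y)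
    (ht : t ∈ I) (hy : y ∈ Icc (0 : ℝ) 1) : dv I v g t x y = dv I v f t x y := by
  unfold HydroNS.dv
  have h1 : ∀ z ∈ dom I, unc g z = unc f z := fun z hz => e z.1 hz.1 z.2.1 z.2.2 hz.2.2
  rw [fderivWithin_congr h1 (h1 _ (mem_dom.2 ⟨ht, hy⟩))]

lemma mem_closure_interior_dom (hI : IsOpen I) (ht : t ∈ I) (hy : y ∈ Icc (0 : ℝ) 1) :
    (t, x, y) ∈ closure (interior (dom I)) := by
  rw [dom, interior_prod_eq, interior_prod_eq, closure_prod_eq, closure_prod_eq, interior_univ,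
    closure_univ, hI.interior_eq, interior_Icc, closure_Ioo zero_ne_one]
  exact ⟨subset_closure ht, mem_univ _, hy⟩

/-- Symmetry of the second derivatives up to the walls. It holds on the boundary as well because the
closed strip is the closure of its interior. -/
lemma dv_dv_comm (h : SmoothOn 2 I f) (hI : IsOpen I) (ht : t ∈ I) (hy : y ∈ Icc (0 : ℝ) 1)
    (v w : ℝ × ℝ × ℝ) : dv I v (dv I w f) t x y = dv I w (dv I v f) t x y := by
  have hz : (t, x, y) ∈ dom I := mem_dom.2 ⟨ht, hy⟩
  have hu := uniqueDiffOn_dom hI.uniqueDiffOn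
  have h1 : DifferentiableWithinAt ℝ (fderivWithin ℝ (unc f) (dom I)) (dom I) (t, x, y) :=
    (ContDiffOn.fderivWithin (m := 1) (n := 2) h hu (by norm_num)).differentiableOn one_ne_zero _ hz
  have e : ∀ v w, dv I v (dv I w f) t x y
      = fderivWithin ℝ (fderivWithin ℝ (unc f) (dom I)) (dom I) (t, x, y) v w := by
    intro v w
    have : fderivWithin ℝ (unc (dv I w f)) (dom I) (t, x, y)
        = (fderivWithin ℝ (fderivWithin ℝ (unc f) (dom I)) (dom I) (t, x, y)).flip w := by
      have := fderivWithin_clm_apply (hu _ hz) h1 (differentiableWithinAt_const w)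
      simp only [fderivWithin_fun_const, Pi.zero_apply, ContinuousLinearMap.comp_zero, zero_add] at this
      exact this
    rw [HydroNS.dv, this]; rfl
  rw [e, e]
  exact ContDiffWithinAt.isSymmSndFDerivWithinAt (n := 2) (h _ hz) (by simp) hu
    (mem_closure_interior_dom hI ht hy) hz v w

lemma dx_dy_comm (h : SmoothOn 2 I f) (hI : IsOpen I) (ht : t ∈ I) (hy : y ∈ Icc (0 : ℝ) 1) :
    dx (dy f) t x y = dy (dx f) t x y := by
  have h1 : SmoothOn 1 I f := h.of_le (by norm_num)
  rw [dx_eq (SmoothOn.dy (n := 1) h hI.uniqueDiffOn) ht hy,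
    dy_eq (SmoothOn.dx (n := 1) h hI.uniqueDiffOn) ht hy,
    dv_congr (fun _ ht _ _ hy => dy_eq h1 ht hy) ht hy,
    dv_congr (g := dx f) (fun _ ht _ _ hy => dx_eq h1 ht hy) ht hy, dv_dv_comm h hI ht hy]

lemma dt_dx_comm (h : SmoothOn 2 I f) (hI : IsOpen I) (ht : t ∈ I) (hy : y ∈ Icc (0 : ℝ) 1) :
    dt (dx f) t x y = dx (dt f) t x y := by
  have h1 : SmoothOn 1 I f := h.of_le (by norm_num)
  rw [dt_eq (SmoothOn.dx (n := 1) h hI.uniqueDiffOn) hI ht hy,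
    dx_eq (SmoothOn.dt (n := 1) h hI) ht hy,
    dv_congr (fun _ ht _ _ hy => dx_eq h1 ht hy) ht hy,
    dv_congr (g := dt f) (fun _ ht _ _ hy => dt_eq h1 hI ht hy) ht hy, dv_dv_comm h hI ht hy]

lemma dt_dy_comm (h : SmoothOn 2 I f) (hI : IsOpen I) (ht : t ∈ I) (hy : y ∈ Icc (0 : ℝ) 1) :
    dt (dy f) t x y = dy (dt f) t x y := by
  have h1 : SmoothOn 1 I f := h.of_le (by norm_num)
  rw [dt_eq (SmoothOn.dy (n := 1) h hI.uniqueDiffOn) hI ht hy,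
    dy_eq (SmoothOn.dt (n := 1) h hI) ht hy,
    dv_congr (fun _ ht _ _ hy => dy_eq h1 ht hy) ht hy,
    dv_congr (g := dt f) (fun _ ht _ _ hy => dt_eq h1 hI ht hy) ht hy, dv_dv_comm h hI ht hy]

lemma PeriodicX.dx (h : PeriodicX f) : PeriodicX (dx f) := fun t x y => by
  have := deriv_comp_add_const (fun z => f t z y) (2 * Real.pi) x
  simp only [h t _ y] at this
  exact this.symm

lemma PeriodicX.dy (h : PeriodicX f) : PeriodicX (dy f) := fun t x y => by
  simp only [HydroNS.dy, h t x]

lemma PeriodicX.dt (h : PeriodicX f) : PeriodicX (dt f) := fun t x y => by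
  simp only [HydroNS.dt, fun s => h s x y]

/-- The extension of a function on the strip that is constant in `y` beyond the walls. -/
def ex (F : ℝ → ℝ → ℝ) (x y : ℝ) : ℝ := F x (cl 0 1 y)

lemma cl_unit (y : ℝ) : cl 0 1 y ∈ Icc (0 : ℝ) 1 := cl_mem zero_le_one y

lemma ex_eq {F : ℝ → ℝ → ℝ} (hy : y ∈ Icc (0 : ℝ) 1) : ex F x y = F x y := by
  rw [ex, cl_of_mem hy]

lemma SmoothOn.continuousOn {n : WithTop ℕ∞} (h : SmoothOn n I f) :
    ContinuousOn (unc f) (dom I) := ContDiffOn.continuousOn h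

lemma SmoothOn.c3 {n : WithTop ℕ∞} (h : SmoothOn n I f) {a b : ℝ} (hab : a ≤ b) (hI : Icc a b ⊆ I) :
    C3 fun r => ex (f (cl a b r)) :=
  h.continuousOn.comp_continuous
    (f := fun p : ℝ × ℝ × ℝ => (cl a b p.1, p.2.1, cl 0 1 p.2.2)) (by fun_prop)
    fun p => mem_dom.2 ⟨hI (cl_mem hab _), cl_unit _⟩

lemma SmoothOn.pf {n : WithTop ℕ∞} (h : SmoothOn n I f) (hp : PeriodicX f) (ht : t ∈ I) :
    PF (ex (f t)) where
  cont := h.continuousOn.comp_continuous (f := fun p : ℝ × ℝ => (t, p.1, cl 0 1 p.2))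
    (by fun_prop) fun p => mem_dom.2 ⟨ht, cl_unit _⟩
  per x y := hp t x _

lemma SmoothOn.hasX (h : SmoothOn 1 I f) (ht : t ∈ I) : HasX (ex (f t)) (ex (HydroNS.dx f t)) :=
  fun _ y => h.hasDerivAt_x ht (cl_unit y)

lemma SmoothOn.hasY (h : SmoothOn 1 I f) (ht : t ∈ I) : HasY (ex (f t)) (ex (HydroNS.dy f t)) := by
  intro x y hy
  rw [ex_eq (Ioo_subset_Icc_self hy)]
  refine (h.hasDerivAt_y ht hy).congr_of_eventuallyEq ?_
  filter_upwards [cl_eventually hy] with z hz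
  rw [ex, hz]

lemma SmoothOn.hasT (h : SmoothOn 1 I f) (hI : IsOpen I) {a b : ℝ} (hab : Icc a b ⊆ I) :
    HasT a b (fun r => ex (f (cl a b r))) (fun r => ex (HydroNS.dt f (cl a b r))) := by
  intro x y r hr
  have hr' := Ioo_subset_Icc_self hr
  simp only [cl_of_mem hr']
  refine (h.hasDerivAt_t hI (hab hr') (cl_unit y)).congr_of_eventuallyEq ?_
  filter_upwards [cl_eventually hr] with s hs
  rw [hs, ex]

end Smooth

end

section

/-! ### Bounds on the profiles -/

/-- Decay of the Fourier coefficients, uniformly in `y`. -/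
def UGD (p : ℕ) (R τ : ℝ) (F : ℝ → ℝ → ℝ) : Prop :=
  ∀ y ∈ Icc (0 : ℝ) 1, GD p R τ fun x => F x y

section Smooth
variable {I : Set ℝ} {f g u v : ℝ → ℝ → ℝ → ℝ} {p n : ℕ} {t x y R τ M : ℝ}

lemma SmoothOn.pc {n : WithTop ℕ∞} (h : SmoothOn n I f) (hp : PeriodicX f) (ht : t ∈ I)
    (hy : y ∈ Icc (0 : ℝ) 1) : PC fun x => f t x y := by
  have := (h.pf hp ht).pc y
  simpa only [ex_eq hy] using this

lemma UGD.dx (H : UGD (p + 1) R τ (f t)) (h : SmoothOn (n + 1 : ℕ) I f) (hI : IsOpen I)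
    (hp : PeriodicX f) (ht : t ∈ I) : UGD p R τ (dx f t) := fun y hy =>
  (H y hy).deriv (h.pc hp ht hy) ((h.dx hI.uniqueDiffOn).pc hp.dx ht hy).cont
    fun _ => h.one.hasDerivAt_x ht hy

lemma UGD.abs_le {n : WithTop ℕ∞} (H : UGD p R τ (f t)) (h : SmoothOn n I f) (hp : PeriodicX f)
    (ht : t ∈ I) (hτ : 0 ≤ τ) (x : ℝ) (hy : y ∈ Icc (0 : ℝ) 1) : |f t x y| ≤ ZZ * R :=
  (H y hy).abs_le hτ (h.pc hp ht hy) x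

/-- A divergence free flow with impermeable walls, for the times in `I`. -/
structure Flow (I : Set ℝ) (u v : ℝ → ℝ → ℝ → ℝ) : Prop where
  isOpen : IsOpen I
  su : SmoothOn (4 : ℕ) I u
  sv : SmoothOn (3 : ℕ) I v
  pu : PeriodicX u
  pv : PeriodicX v
  divFree : ∀ t ∈ I, ∀ x, ∀ y ∈ Ioo (0 : ℝ) 1, HydroNS.dx u t x y + HydroNS.dy v t x y = 0
  wall0 : ∀ t ∈ I, ∀ x, v t x 0 = 0
  wall1 : ∀ t ∈ I, ∀ x, v t x 1 = 0

/-- Bound on `Φ = ∂ₓ²(u ∂ₓu + v ∂ᵧu - ∂ᵧ²u)`. -/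
lemma abs_forcing_le {B : ℝ} {Φ : ℝ}
    (hΦ : Φ = u t x y * dx (dx (dx u)) t x y + 3 * (dx u t x y * dx (dx u) t x y)
      + (dx (dx v) t x y * dy u t x y + 2 * (dx v t x y * dx (dy u) t x y)
        + v t x y * dx (dx (dy u)) t x y) - dx (dx (dy (dy u))) t x y)
    (b1 : |u t x y| ≤ B) (b2 : |dx u t x y| ≤ B) (b3 : |dx (dx u) t x y| ≤ B)
    (b4 : |dx (dx (dx u)) t x y| ≤ B) (b5 : |dy u t x y| ≤ B) (b6 : |dx (dy u) t x y| ≤ B)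
    (b7 : |dx (dx (dy u)) t x y| ≤ B) (b8 : |dx (dx (dy (dy u))) t x y| ≤ B)
    (b9 : |v t x y| ≤ B) (b10 : |dx v t x y| ≤ B) (b11 : |dx (dx v) t x y| ≤ B) :
    |Φ| ≤ 8 * B ^ 2 + B := by
  have m : ∀ {p q : ℝ}, |p| ≤ B → |q| ≤ B → |p * q| ≤ B ^ 2 := fun {p q} hp hq => by
    rw [abs_mul, sq]; exact mul_le_mul hp hq (abs_nonneg _) ((abs_nonneg _).trans hp)
  have k1 := abs_le.1 (m b1 b4)
  have k2 := abs_le.1 (m b2 b3)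
  have k3 := abs_le.1 (m b11 b5)
  have k4 := abs_le.1 (m b10 b6)
  have k5 := abs_le.1 (m b9 b7)
  have k6 := abs_le.1 b8
  rw [hΦ, abs_le]
  constructor <;> linarith

namespace Flow
variable (h : Flow I u v)
include h

lemma sux : SmoothOn (3 : ℕ) I (dx u) := h.su.dx h.isOpen.uniqueDiffOn
lemma suy : SmoothOn (3 : ℕ) I (dy u) := h.su.dy h.isOpen.uniqueDiffOn
lemma sut : SmoothOn (3 : ℕ) I (dt u) := h.su.dt h.isOpen
lemma suxx : SmoothOn (2 : ℕ) I (dx (dx u)) := h.sux.dx h.isOpen.uniqueDiffOn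
lemma suxy : SmoothOn (2 : ℕ) I (dx (dy u)) := h.suy.dx h.isOpen.uniqueDiffOn
lemma suyt : SmoothOn (2 : ℕ) I (dt (dy u)) := h.suy.dt h.isOpen
lemma sb : SmoothOn (2 : ℕ) I (dy (dy u)) := h.suy.dy h.isOpen.uniqueDiffOn
lemma suxxx : SmoothOn (1 : ℕ) I (dx (dx (dx u))) := h.suxx.dx h.isOpen.uniqueDiffOn
lemma suxxy : SmoothOn (1 : ℕ) I (dx (dx (dy u))) := h.suxy.dx h.isOpen.uniqueDiffOn
lemma sutx : SmoothOn (2 : ℕ) I (dx (dt u)) := h.sut.dx h.isOpen.uniqueDiffOn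
lemma sbx : SmoothOn (1 : ℕ) I (dx (dy (dy u))) := h.sb.dx h.isOpen.uniqueDiffOn
lemma sbz : SmoothOn (1 : ℕ) I (dy (dy (dy u))) := h.sb.dy h.isOpen.uniqueDiffOn
lemma sbt : SmoothOn (1 : ℕ) I (dt (dy (dy u))) := h.sb.dt h.isOpen
lemma sbxx : SmoothOn (0 : ℕ) I (dx (dx (dy (dy u)))) := h.sbx.dx h.isOpen.uniqueDiffOn
lemma sbzx : SmoothOn (0 : ℕ) I (dx (dy (dy (dy u)))) := h.sbz.dx h.isOpen.uniqueDiffOn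
lemma svx : SmoothOn (2 : ℕ) I (dx v) := h.sv.dx h.isOpen.uniqueDiffOn
lemma svy : SmoothOn (2 : ℕ) I (dy v) := h.sv.dy h.isOpen.uniqueDiffOn
lemma svt : SmoothOn (2 : ℕ) I (dt v) := h.sv.dt h.isOpen
lemma svxx : SmoothOn (1 : ℕ) I (dx (dx v)) := h.svx.dx h.isOpen.uniqueDiffOn
lemma svyy : SmoothOn (1 : ℕ) I (dy (dy v)) := h.svy.dy h.isOpen.uniqueDiffOn
lemma svtx : SmoothOn (1 : ℕ) I (dx (dt v)) := h.svt.dx h.isOpen.uniqueDiffOn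

variable (ht : t ∈ I)
include ht

lemma vy_eq (hy : y ∈ Ioo (0 : ℝ) 1) : dy v t x y = - dx u t x y := by
  linarith [h.divFree t ht x y hy]

lemma vxy_eq (hy : y ∈ Ioo (0 : ℝ) 1) : dx (dy v) t x y = - dx (dx u) t x y := by
  have e : (fun z => dy v t z y) = fun z => - dx u t z y := by
    ext z; exact h.vy_eq ht hy
  rw [dx, e]
  exact (h.sux.one.hasDerivAt_x ht (Ioo_subset_Icc_self hy)).neg.deriv

lemma vyy_eq (hy : y ∈ Ioo (0 : ℝ) 1) : dy (dy v) t x y = - dx (dy u) t x y := by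
  have h1 := h.svy.one.hasDerivAt_y (x := x) ht hy
  have h2 := (h.sux.one.hasDerivAt_y (x := x) ht hy).neg
  rw [dx_dy_comm (h.su.of_le (by norm_num)) h.isOpen ht (Ioo_subset_Icc_self hy)]
  refine (h1.congr_of_eventuallyEq ?_).unique h2
  filter_upwards [isOpen_Ioo.mem_nhds hy] with z hz
  simp [h.vy_eq ht hz]

lemma vxyy_eq (hy : y ∈ Ioo (0 : ℝ) 1) : dx (dy (dy v)) t x y = - dx (dx (dy u)) t x y := by
  have e : (fun z => dy (dy v) t z y) = fun z => - dx (dy u) t z y := by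
    ext z; exact h.vyy_eq ht hy
  rw [dx, e]
  exact (h.suxy.one.hasDerivAt_x ht (Ioo_subset_Icc_self hy)).neg.deriv

lemma vtxy_eq (hy : y ∈ Ioo (0 : ℝ) 1) : dy (dx (dt v)) t x y = - dx (dx (dt u)) t x y := by
  have hy' := Ioo_subset_Icc_self hy
  rw [← dx_dy_comm h.svt h.isOpen ht hy']
  have e : (fun z => dy (dt v) t z y) = fun z => - dx (dt u) t z y := by
    ext z
    rw [← dt_dy_comm (h.sv.of_le (by norm_num)) h.isOpen ht hy',
      ← dt_dx_comm (h.su.of_le (by norm_num)) h.isOpen ht hy']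
    have h1 := h.svy.one.hasDerivAt_t (x := z) h.isOpen ht hy'
    have h2 := (h.sux.one.hasDerivAt_t (x := z) h.isOpen ht hy').neg
    refine (h1.congr_of_eventuallyEq ?_).unique h2
    filter_upwards [h.isOpen.mem_nhds ht] with s hs
    simp [h.vy_eq hs hy]
  rw [dx, e]
  exact (h.sutx.one.hasDerivAt_x ht hy').neg.deriv

lemma vtx_wall {c : ℝ} (hc : c = 0 ∨ c = 1) : dx (dt v) t x c = 0 := by
  have e : (fun z => dt v t z c) = fun _ => 0 := by
    ext z
    have hcm : c ∈ Icc (0 : ℝ) 1 := by rcases hc with rfl | rfl <;> simp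
    refine ((h.sv.one.hasDerivAt_t (x := z) h.isOpen ht hcm).congr_of_eventuallyEq ?_).unique
      (hasDerivAt_const t (0 : ℝ))
    filter_upwards [h.isOpen.mem_nhds ht] with s hs
    rcases hc with rfl | rfl
    · rw [h.wall0 s hs]
    · rw [h.wall1 s hs]
  rw [dx, e, deriv_const]

end Flow
end Smooth

/-- The decay of the Fourier coefficients of the flow, its vorticity and the normal derivative of
the vorticity at one time. The exponent `3` leaves room for one derivative in `x` in `GB`. -/
structure Prof (u v : ℝ → ℝ → ℝ → ℝ) (t R τ : ℝ) : Prop where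
  gu : UGD 3 R τ (u t)
  guy : UGD 3 R τ (dy u t)
  gb : UGD 3 R τ (dy (dy u) t)
  gv : UGD 3 R τ (v t)

section Prof
variable {I : Set ℝ} {u v : ℝ → ℝ → ℝ → ℝ} {t x y R τ M : ℝ}

lemma ugd_of_sq_le {F : ℝ → ℝ → ℝ} {p : ℕ} {R τ : ℝ} (hR : 0 ≤ R)
    (H : ∀ y ∈ Icc (0 : ℝ) 1, ∀ k,
      (gw9 τ k * bracket k ^ p) ^ 2 * ‖fc (fun x => F x y) k‖ ^ 2 ≤ R ^ 2) : UGD p R τ F :=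
  fun y hy k => abs_le_of_sq_le_sq' (by rw [mul_pow]; exact H y hy k) hR |>.2

lemma normSq_ex (r τ : ℝ) (F : ℝ → ℝ → ℝ) : normSq r τ (ex F) = normSq r τ F := by
  refine setLIntegral_congr_fun measurableSet_Ioo fun y hy => ?_
  simp only [ex_eq (Ioo_subset_Icc_self hy)]

/-- The Gevrey bounds, which are integrals over `y`, give decay uniform in `y`: the Sobolev
inequality in `y` bounds each mode of `u`, `∂ᵧu` and `∂ᵧ²u` in terms of those of `u`, `∂ᵧu` and
`∂ᵧ³u`, and `v` is the integral of `-∂ₓu`. -/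
lemma Flow.prof (h : Flow I u v) (ht : t ∈ I) (hM : 0 ≤ M)
    (h1 : normSq 7 τ (u t) ≤ ENNReal.ofReal (M ^ 2))
    (h2 : normSq 7 τ (dy u t) ≤ ENNReal.ofReal (M ^ 2))
    (h3 : normSq 6 τ (dy (dy (dy u)) t) ≤ ENNReal.ofReal (M ^ 2)) : Prof u v t (12 * M) τ := by
  have pu := h.su.pf h.pu ht
  have pux := h.sux.pf h.pu.dx ht
  have puy := h.suy.pf h.pu.dy ht
  have pb := h.sb.pf h.pu.dy.dy ht
  have pbz := h.sbz.pf h.pu.dy.dy.dy ht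
  have pv := h.sv.pf h.pv ht
  have e7 : ∀ k, wt 7 τ k = gw9 τ k * bracket k ^ 4 := fun k => by
    have := wt_natCast 4 τ k; norm_num at this; exact this
  have e6 : ∀ k, wt 6 τ k = gw9 τ k * bracket k ^ 3 := fun k => by
    have := wt_natCast 3 τ k; norm_num at this; exact this
  have m1 : ∀ k, (gw9 τ k * bracket k ^ 4) ^ 2 * modeSq (ex (u t)) k ≤ M ^ 2 := fun k => by
    rw [← e7]; exact modeSq_le_of_normSq_le pu (by rwa [normSq_ex]) k
  have m2 : ∀ k, (gw9 τ k * bracket k ^ 4) ^ 2 * modeSq (ex (dy u t)) k ≤ M ^ 2 := fun k => by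
    rw [← e7]; exact modeSq_le_of_normSq_le puy (by rwa [normSq_ex]) k
  have m3 : ∀ k, (gw9 τ k * bracket k ^ 3) ^ 2 * modeSq (ex (dy (dy (dy u)) t)) k ≤ M ^ 2 :=
    fun k => by rw [← e6]; exact modeSq_le_of_normSq_le pbz (by rwa [normSq_ex]) k
  have w34 : ∀ k, (gw9 τ k * bracket k ^ 3) ^ 2 ≤ (gw9 τ k * bracket k ^ 4) ^ 2 := fun k => by
    have := (gw9_pos τ k).le
    have := (bracket_pos k).le
    gcongr
    · exact one_le_bracket k
    · norm_num
  have n1 : ∀ k, (gw9 τ k * bracket k ^ 3) ^ 2 * modeSq (ex (u t)) k ≤ M ^ 2 := fun k =>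
    (mul_le_mul_of_nonneg_right (w34 k) (modeSq_nonneg _ k)).trans (m1 k)
  have n2 : ∀ k, (gw9 τ k * bracket k ^ 3) ^ 2 * modeSq (ex (dy u t)) k ≤ M ^ 2 := fun k =>
    (mul_le_mul_of_nonneg_right (w34 k) (modeSq_nonneg _ k)).trans (m2 k)
  have hux := h.su.one.hasX ht
  have huy := h.su.one.hasY ht
  have hb := h.suy.one.hasY ht
  have hbz := h.sb.one.hasY ht
  have hM2 := sq_nonneg M
  refine ⟨ugd_of_sq_le (by linarith) fun y hy k => ?_, ugd_of_sq_le (by linarith) fun y hy k => ?_,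
    ugd_of_sq_le (by linarith) fun y hy k => ?_, ugd_of_sq_le (by linarith) fun y hy k => ?_⟩
  · have := norm_fc_sq_le_modeSq pu puy huy k hy
    simp only [ex_eq hy] at this
    have := mul_le_mul_of_nonneg_left this (sq_nonneg (gw9 τ k * bracket k ^ 3))
    nlinarith [n1 k, n2 k]
  · have := norm_fc_sq_le_modeSq_two puy pb pbz hb hbz k hy
    simp only [ex_eq hy] at this
    have := mul_le_mul_of_nonneg_left this (sq_nonneg (gw9 τ k * bracket k ^ 3))
    nlinarith [n2 k, m3 k]
  · have := norm_fc_deriv_sq_le_modeSq puy pb pbz hb hbz k hy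
    simp only [ex_eq hy] at this
    have := mul_le_mul_of_nonneg_left this (sq_nonneg (gw9 τ k * bracket k ^ 3))
    nlinarith [n2 k, m3 k]
  · have hv : HasY (ex (v t)) fun x y => - ex (dx u t) x y := by
      intro x y hy
      have := h.sv.one.hasY ht x y hy
      rwa [ex_eq (Ioo_subset_Icc_self hy), h.vy_eq ht hy,
        ← ex_eq (F := dx u t) (Ioo_subset_Icc_self hy)] at this
    have := norm_fc_sq_le_of_wall pv pux.neg hv k hy fun x => by
      rw [ex_eq (left_mem_Icc.2 zero_le_one), h.wall0 t ht]
    simp only [ex_eq hy] at this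
    have e : modeSq (fun x y => - ex (dx u t) x y) k = modeSq (ex (dx u t)) k := by
      refine intervalIntegral.integral_congr fun y _ => ?_
      have := fc_const_mul (-1) (fun z => ex (dx u t) z y) k
      simp only [neg_mul, one_mul] at this
      simp only [this]
      simp
    rw [e] at this
    have h5 := this.trans (modeSq_hasX pu pux hux k)
    have := mul_le_mul_of_nonneg_left h5 (sq_nonneg (gw9 τ k * bracket k ^ 3))
    have e2 : (gw9 τ k * bracket k ^ 3) ^ 2 * (bracket k ^ 2 * modeSq (ex (u t)) k)
      = (gw9 τ k * bracket k ^ 4) ^ 2 * modeSq (ex (u t)) k := by ring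
    nlinarith [m1 k]

/-- Bounds in the maximum norm on the flow and the derivatives that occur in the equations. -/
structure Sup (u v : ℝ → ℝ → ℝ → ℝ) (t B : ℝ) : Prop where
  u0 : ∀ x, ∀ y ∈ Icc (0 : ℝ) 1, |u t x y| ≤ B
  ux : ∀ x, ∀ y ∈ Icc (0 : ℝ) 1, |dx u t x y| ≤ B
  uxx : ∀ x, ∀ y ∈ Icc (0 : ℝ) 1, |dx (dx u) t x y| ≤ B
  uxxx : ∀ x, ∀ y ∈ Icc (0 : ℝ) 1, |dx (dx (dx u)) t x y| ≤ B
  uy : ∀ x, ∀ y ∈ Icc (0 : ℝ) 1, |dy u t x y| ≤ B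
  uxy : ∀ x, ∀ y ∈ Icc (0 : ℝ) 1, |dx (dy u) t x y| ≤ B
  uxxy : ∀ x, ∀ y ∈ Icc (0 : ℝ) 1, |dx (dx (dy u)) t x y| ≤ B
  b : ∀ x, ∀ y ∈ Icc (0 : ℝ) 1, |dy (dy u) t x y| ≤ B
  bx : ∀ x, ∀ y ∈ Icc (0 : ℝ) 1, |dx (dy (dy u)) t x y| ≤ B
  bxx : ∀ x, ∀ y ∈ Icc (0 : ℝ) 1, |dx (dx (dy (dy u))) t x y| ≤ B
  v0 : ∀ x, ∀ y ∈ Icc (0 : ℝ) 1, |v t x y| ≤ B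
  vx : ∀ x, ∀ y ∈ Icc (0 : ℝ) 1, |dx v t x y| ≤ B
  vxx : ∀ x, ∀ y ∈ Icc (0 : ℝ) 1, |dx (dx v) t x y| ≤ B

lemma Prof.sup (P : Prof u v t R τ) (h : Flow I u v) (ht : t ∈ I) (hτ : 0 ≤ τ) :
    Sup u v t (ZZ * R) := by
  have o := h.isOpen
  have gux := P.gu.dx h.su o h.pu ht
  have guxx := gux.dx h.sux o h.pu.dx ht
  have guxxx := guxx.dx h.suxx o h.pu.dx.dx ht
  have guxy := P.guy.dx h.suy o h.pu.dy ht
  have guxxy := guxy.dx h.suxy o h.pu.dy.dx ht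
  have gbx := P.gb.dx h.sb o h.pu.dy.dy ht
  have gbxx := gbx.dx h.sbx o h.pu.dy.dy.dx ht
  have gvx := P.gv.dx h.sv o h.pv ht
  have gvxx := gvx.dx h.svx o h.pv.dx ht
  exact ⟨fun x y hy => P.gu.abs_le h.su h.pu ht hτ x hy,
    fun x y hy => gux.abs_le h.sux h.pu.dx ht hτ x hy,
    fun x y hy => guxx.abs_le h.suxx h.pu.dx.dx ht hτ x hy,
    fun x y hy => guxxx.abs_le h.suxxx h.pu.dx.dx.dx ht hτ x hy,
    fun x y hy => P.guy.abs_le h.suy h.pu.dy ht hτ x hy,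
    fun x y hy => guxy.abs_le h.suxy h.pu.dy.dx ht hτ x hy,
    fun x y hy => guxxy.abs_le h.suxxy h.pu.dy.dx.dx ht hτ x hy,
    fun x y hy => P.gb.abs_le h.sb h.pu.dy.dy ht hτ x hy,
    fun x y hy => gbx.abs_le h.sbx h.pu.dy.dy.dx ht hτ x hy,
    fun x y hy => gbxx.abs_le h.sbxx h.pu.dy.dy.dx.dx ht hτ x hy,
    fun x y hy => P.gv.abs_le h.sv h.pv ht hτ x hy,
    fun x y hy => gvx.abs_le h.svx h.pv.dx ht hτ x hy,
    fun x y hy => gvxx.abs_le h.svxx h.pv.dx.dx ht hτ x hy⟩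

/-- The pointwise bound, by a function of `y`, on the third normal derivative. -/
lemma Flow.bz_sq_le (h : Flow I u v) (ht : t ∈ I) (x : ℝ) (hy : y ∈ Icc (0 : ℝ) 1) :
    dy (dy (dy u)) t x y ^ 2 ≤ 13 * ((∫ z in 0..2 * Real.pi, ex (dy (dy (dy u)) t) z y ^ 2)
      + ∫ z in 0..2 * Real.pi, ex (dx (dy (dy (dy u))) t) z y ^ 2) := by
  have := ((h.sbz.pf h.pu.dy.dy.dy ht).pc y).sq_le ((h.sbzx.pf h.pu.dy.dy.dy.dx ht).pc y)
    (fun x => h.sbz.one.hasX ht x y) x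
  rwa [ex_eq hy] at this

/-- `∂ᵧ³u`, on which no further normal derivative is controlled, is bounded in `L²` together with
its `x` derivative. -/
lemma Flow.I2_bz_le (h : Flow I u v) (ht : t ∈ I) (hτ : 0 ≤ τ)
    (h3 : normSq 6 τ (dy (dy (dy u)) t) ≤ ENNReal.ofReal (M ^ 2)) :
    (I2 fun x y => ex (dy (dy (dy u)) t) x y ^ 2) ≤ M ^ 2 ∧
      (I2 fun x y => ex (dx (dy (dy (dy u))) t) x y ^ 2) ≤ M ^ 2 := by
  have p1 := h.sbz.pf h.pu.dy.dy.dy ht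
  have p2 := h.sbzx.pf h.pu.dy.dy.dy.dx ht
  have hw : ∀ k, bracket k ≤ wt 6 τ k := fun k => by
    have a1 := one_le_bracket k
    have a2 : 1 ≤ Real.exp (τ * bracket k ^ (2 / 3 : ℝ)) := Real.one_le_exp (by positivity)
    have a3 : bracket k ^ (1 : ℝ) ≤ bracket k ^ (6 : ℝ) :=
      Real.rpow_le_rpow_of_exponent_le a1 (by norm_num)
    rw [Real.rpow_one] at a3
    unfold wt
    nlinarith
  rw [← normSq_ex] at h3
  constructor <;> rw [← ENNReal.ofReal_le_ofReal_iff (sq_nonneg _)]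
  · refine (ofReal_I2_sq_le p1 fun y _ k => ?_).trans h3
    exact le_mul_of_one_le_left (norm_nonneg _) ((one_le_bracket k).trans (hw k))
  · refine (ofReal_I2_sq_le p2 fun y _ k => ?_).trans h3
    rw [fc_deriv (fun x => h.sbz.one.hasX ht x y) (p2.cx y) (fun x => p1.per x y), norm_mul]
    gcongr
    simpa using (abs_le_bracket k).trans (hw k)

end Prof

end

section

/-! ### The time derivative of the vorticity of the profiles -/

section
variable {T ε : ℝ} {u₀ v₀ p₀ u₂ v₂ p₂ : ℝ → ℝ → ℝ → ℝ} {t x y : ℝ}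

lemma IsHydrostatic.flow (h : IsHydrostatic T u₀ v₀ p₀) : Flow (Ioo 0 T) u₀ v₀ where
  isOpen := isOpen_Ioo
  su := h.smooth_u
  sv := h.smooth_v
  pu := h.periodic_u
  pv := h.periodic_v
  divFree := h.divFree
  wall0 t ht x := (h.noSlip t ht x 0 (by simp)).2
  wall1 t ht x := (h.noSlip t ht x 1 (by simp)).2

lemma IsCorrector.flow (h : IsCorrector T u₀ v₀ u₂ v₂ p₂) : Flow (Ioo 0 T) u₂ v₂ where
  isOpen := isOpen_Ioo
  su := h.smooth_u
  sv := h.smooth_v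
  pu := h.periodic_u
  pv := h.periodic_v
  divFree := h.divFree
  wall0 t ht x := (h.noSlip t ht x 0 (by simp)).2
  wall1 t ht x := (h.noSlip t ht x 1 (by simp)).2

lemma hasDerivAt_of_eqOn_zero {f : ℝ → ℝ} {d : ℝ} (hy : y ∈ Ioo (0 : ℝ) 1)
    (hf : ∀ z ∈ Ioo (0 : ℝ) 1, f z = 0) (hd : HasDerivAt f d y) : d = 0 := by
  refine hd.unique ((hasDerivAt_const y (0 : ℝ)).congr_of_eventuallyEq ?_)
  filter_upwards [isOpen_Ioo.mem_nhds hy] with z hz using hf z hz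

/-- The tangential pressure gradient does not depend on `y`. -/
lemma IsHydrostatic.dy_dx_p (h : IsHydrostatic T u₀ v₀ p₀) (ht : t ∈ Ioo 0 T)
    (hy : y ∈ Ioo (0 : ℝ) 1) : dy (dx p₀) t x y = 0 := by
  rw [← dx_dy_comm h.smooth_p isOpen_Ioo ht (Ioo_subset_Icc_self hy)]
  have e : (fun z => dy p₀ t z y) = fun _ => 0 := by ext z; exact h.hydrostatic t ht z y hy
  rw [dx, e, deriv_const]

/-- The vorticity equation of the hydrostatic flow. -/
lemma IsHydrostatic.vorticity (h : IsHydrostatic T u₀ v₀ p₀) (ht : t ∈ Ioo 0 T)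
    (hy : y ∈ Ioo (0 : ℝ) 1) : dt (dy u₀) t x y = dy (dy (dy u₀)) t x y
      - u₀ t x y * dx (dy u₀) t x y - v₀ t x y * dy (dy u₀) t x y := by
  have hy' := Ioo_subset_Icc_self hy
  have F := h.flow
  have d1 := F.sut.one.hasDerivAt_y (x := x) ht hy
  have d2 := F.su.one.hasDerivAt_y (x := x) ht hy
  have d3 := F.sux.one.hasDerivAt_y (x := x) ht hy
  have d4 := F.sv.one.hasDerivAt_y (x := x) ht hy
  have d5 := F.suy.one.hasDerivAt_y (x := x) ht hy
  have d6 := F.sb.one.hasDerivAt_y (x := x) ht hy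
  have d7 := (SmoothOn.dx (n := 1) h.smooth_p isOpen_Ioo.uniqueDiffOn).hasDerivAt_y (x := x) ht hy
  have := hasDerivAt_of_eqOn_zero hy (fun z hz => h.momentum t ht x z hz)
    ((((d1.fun_add (d2.fun_mul d3)).fun_add (d4.fun_mul d5)).fun_sub d6).fun_add d7)
  rw [h.dy_dx_p ht hy, ← dt_dy_comm (F.su.of_le (by norm_num)) isOpen_Ioo ht hy',
    ← dx_dy_comm (F.su.of_le (by norm_num)) isOpen_Ioo ht hy', F.vy_eq ht hy] at this
  linarith

/-- The tangential momentum equation differentiated twice: as the pressure gradient does not depend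
on `y`, neither do the other terms together. -/
lemma IsHydrostatic.forcing_const (h : IsHydrostatic T u₀ v₀ p₀) (ht : t ∈ Ioo 0 T) {z : ℝ}
    (hy : y ∈ Ioo (0 : ℝ) 1) (hz : z ∈ Ioo (0 : ℝ) 1) {Φ : ℝ → ℝ}
    (hΦ : ∀ y, Φ y = u₀ t x y * dx (dx (dx u₀)) t x y + 3 * (dx u₀ t x y * dx (dx u₀) t x y)
      + (dx (dx v₀) t x y * dy u₀ t x y + 2 * (dx v₀ t x y * dx (dy u₀) t x y)
        + v₀ t x y * dx (dx (dy u₀)) t x y) - dx (dx (dy (dy u₀))) t x y) :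
    dx (dx (dt u₀)) t x y + Φ y = dx (dx (dt u₀)) t x z + Φ z := by
  have F := h.flow
  have hp : SmoothOn (1 : ℕ) (Ioo 0 T) (dx p₀) :=
    SmoothOn.dx (n := 1) h.smooth_p isOpen_Ioo.uniqueDiffOn
  -- the pressure gradient at two heights
  have hpc : ∀ x, ∀ {y z : ℝ}, y ∈ Ioo (0 : ℝ) 1 → z ∈ Ioo (0 : ℝ) 1 → y < z →
      dx p₀ t x y = dx p₀ t x z := by
    intro x y z hy hz hyz
    obtain ⟨ξ, hξ, e⟩ := exists_hasDerivAt_eq_slope (dx p₀ t x) (dy (dx p₀) t x) hyz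
      (fun s hs => (hp.one.hasDerivAt_y (x := x) ht ⟨hy.1.trans_le hs.1,
        hs.2.trans_lt hz.2⟩).continuousAt.continuousWithinAt)
      (fun s hs => hp.one.hasDerivAt_y ht ⟨hy.1.trans hs.1, hs.2.trans hz.2⟩)
    rw [h.dy_dx_p ht ⟨hy.1.trans hξ.1, hξ.2.trans hz.2⟩, eq_comm,
      div_eq_zero_iff] at e
    rcases e with e | e <;> linarith
  have hpc' : ∀ x, dx p₀ t x y = dx p₀ t x z := by
    intro x
    rcases lt_trichotomy y z with hlt | rfl | hlt
    · exact hpc x hy hz hlt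
    · rfl
    · exact (hpc x hz hy hlt).symm
  -- derivatives in `x` of the other terms
  have d1 : ∀ x, ∀ {y : ℝ}, y ∈ Ioo (0 : ℝ) 1 → HasDerivAt (fun x => - dx p₀ t x y)
      (dx (dt u₀) t x y + (dx u₀ t x y * dx u₀ t x y + u₀ t x y * dx (dx u₀) t x y)
        + (dx v₀ t x y * dy u₀ t x y + v₀ t x y * dx (dy u₀) t x y)
        - dx (dy (dy u₀)) t x y) x := by
    intro x y hy
    have hy' := Ioo_subset_Icc_self hy
    have e : (fun x => - dx p₀ t x y) = fun x => dt u₀ t x y + u₀ t x y * dx u₀ t x y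
        + v₀ t x y * dy u₀ t x y - dy (dy u₀) t x y := by
      ext x; linarith [h.momentum t ht x y hy]
    rw [e]
    exact (((F.sut.one.hasDerivAt_x ht hy').fun_add ((F.su.one.hasDerivAt_x ht hy').fun_mul
      (F.sux.one.hasDerivAt_x ht hy'))).fun_add ((F.sv.one.hasDerivAt_x ht hy').fun_mul
      (F.suy.one.hasDerivAt_x ht hy'))).fun_sub (F.sb.one.hasDerivAt_x ht hy')
  have d2 : ∀ {y : ℝ}, y ∈ Ioo (0 : ℝ) 1 → HasDerivAt (fun x =>
      dx (dt u₀) t x y + (dx u₀ t x y * dx u₀ t x y + u₀ t x y * dx (dx u₀) t x y)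
        + (dx v₀ t x y * dy u₀ t x y + v₀ t x y * dx (dy u₀) t x y)
        - dx (dy (dy u₀)) t x y) (dx (dx (dt u₀)) t x y + Φ y) x := by
    intro y hy
    have hy' := Ioo_subset_Icc_self hy
    have k1 := F.sux.one.hasDerivAt_x (x := x) ht hy'
    have := (((F.sutx.one.hasDerivAt_x (x := x) ht hy').fun_add ((k1.fun_mul k1).fun_add
      ((F.su.one.hasDerivAt_x (x := x) ht hy').fun_mul
        (F.suxx.one.hasDerivAt_x (x := x) ht hy')))).fun_add
      (((F.svx.one.hasDerivAt_x (x := x) ht hy').fun_mul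
        (F.suy.one.hasDerivAt_x (x := x) ht hy')).fun_add
      ((F.sv.one.hasDerivAt_x (x := x) ht hy').fun_mul
        (F.suxy.one.hasDerivAt_x (x := x) ht hy')))).fun_sub (F.sbx.one.hasDerivAt_x (x := x) ht hy')
    exact this.congr_deriv (by rw [hΦ]; ring)
  have e1 := fun x => ((d1 x hy).congr_of_eventuallyEq
    (Filter.Eventually.of_forall fun x => by simp only [hpc' x])).unique (d1 x hz)
  exact ((d2 hy).congr_of_eventuallyEq
    (Filter.Eventually.of_forall fun x => (e1 x).symm)).unique (d2 hz)

/-- Bound on `∂ₜ∂ₓv` without any assumption on time derivatives. As `∂ₓ²∂ₜu` plus the known terms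
`Φ` is independent of `y`, and `∂ₓ²∂ₜu = -∂ᵧ∂ₓ∂ₜv` vanishes at some height by Rolle's theorem,
`∂ₓ²∂ₜu` is a difference of two values of `Φ`. The bound follows by integration from the wall. -/
lemma IsHydrostatic.abs_dx_dt_v_le (h : IsHydrostatic T u₀ v₀ p₀) (ht : t ∈ Ioo 0 T) {B : ℝ}
    (hB : Sup u₀ v₀ t B) (hy : y ∈ Ioo (0 : ℝ) 1) :
    |dx (dt v₀) t x y| ≤ 2 * (8 * B ^ 2 + B) := by
  have F := h.flow
  obtain ⟨Φ, hΦ⟩ : ∃ Φ : ℝ → ℝ, ∀ y, Φ y = u₀ t x y * dx (dx (dx u₀)) t x y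
      + 3 * (dx u₀ t x y * dx (dx u₀) t x y)
      + (dx (dx v₀) t x y * dy u₀ t x y + 2 * (dx v₀ t x y * dx (dy u₀) t x y)
        + v₀ t x y * dx (dx (dy u₀)) t x y) - dx (dx (dy (dy u₀))) t x y := ⟨_, fun _ => rfl⟩
  have bΦ : ∀ y ∈ Icc (0 : ℝ) 1, |Φ y| ≤ 8 * B ^ 2 + B := fun y hy =>
    abs_forcing_le (hΦ y) (hB.u0 x y hy) (hB.ux x y hy) (hB.uxx x y hy) (hB.uxxx x y hy)
      (hB.uy x y hy) (hB.uxy x y hy) (hB.uxxy x y hy) (hB.bxx x y hy) (hB.v0 x y hy) (hB.vx x y hy)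
      (hB.vxx x y hy)
  have hd := F.svtx.one.hasY ht
  have hc := (F.svtx.pf F.pv.dt.dx ht).cy x
  have w0 : ex (dx (dt v₀) t) x 0 = 0 := by
    rw [ex_eq (left_mem_Icc.2 zero_le_one), F.vtx_wall ht (Or.inl rfl)]
  have w1 : ex (dx (dt v₀) t) x 1 = 0 := by
    rw [ex_eq (right_mem_Icc.2 zero_le_one), F.vtx_wall ht (Or.inr rfl)]
  obtain ⟨ξ, hξ, e⟩ := exists_hasDerivAt_eq_zero zero_lt_one hc.continuousOn (w0.trans w1.symm)
    (fun s hs => hd x s hs)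
  rw [ex_eq (Ioo_subset_Icc_self hξ), F.vtxy_eq ht hξ] at e
  obtain ⟨ζ, hζ, e2⟩ := exists_hasDerivAt_eq_slope _ _ hy.1 hc.continuousOn
    (fun s hs => hd x s ⟨hs.1, hs.2.trans hy.2⟩)
  have hζ' : ζ ∈ Ioo (0 : ℝ) 1 := ⟨hζ.1, hζ.2.trans hy.2⟩
  rw [ex_eq (Ioo_subset_Icc_self hζ'), F.vtxy_eq ht hζ', w0, ex_eq (Ioo_subset_Icc_self hy), sub_zero,
    sub_zero, eq_div_iff hy.1.ne'] at e2
  have e3 := h.forcing_const (x := x) ht hζ' hξ hΦ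
  have b1 := abs_le.1 (bΦ ζ (Ioo_subset_Icc_self hζ'))
  have b2 := abs_le.1 (bΦ ξ (Ioo_subset_Icc_self hξ))
  have e4 : - dx (dx (dt u₀)) t x ζ = Φ ζ - Φ ξ := by linarith
  rw [← e2, e4, abs_mul, abs_of_pos hy.1]
  have e5 : |Φ ζ - Φ ξ| ≤ 2 * (8 * B ^ 2 + B) := by rw [abs_le]; constructor <;> linarith
  nlinarith [abs_nonneg (Φ ζ - Φ ξ), hy.1, hy.2]

/-- The vorticity equation of the corrector. -/
lemma IsCorrector.vorticity (h : IsCorrector T u₀ v₀ u₂ v₂ p₂) (h₀ : IsHydrostatic T u₀ v₀ p₀)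
    (ht : t ∈ Ioo 0 T) (hy : y ∈ Ioo (0 : ℝ) 1) :
    dt (dy u₂) t x y = dy (dy (dy u₂)) t x y
      - (u₀ t x y * dx (dy u₂) t x y + v₀ t x y * dy (dy u₂) t x y
        + u₂ t x y * dx (dy u₀) t x y + v₂ t x y * dy (dy u₀) t x y)
      + (dx (dt v₀) t x y + u₀ t x y * dx (dx v₀) t x y - v₀ t x y * dx (dx u₀) t x y) := by
  have hy' := Ioo_subset_Icc_self hy
  have F := h.flow
  have F₀ := h₀.flow
  have o : IsOpen (Ioo (0 : ℝ) T) := isOpen_Ioo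
  have d1 := F.sut.one.hasDerivAt_y (x := x) ht hy
  have d2 := F₀.su.one.hasDerivAt_y (x := x) ht hy
  have d3 := F.sux.one.hasDerivAt_y (x := x) ht hy
  have d4 := F₀.sv.one.hasDerivAt_y (x := x) ht hy
  have d5 := F.suy.one.hasDerivAt_y (x := x) ht hy
  have d6 := F.su.one.hasDerivAt_y (x := x) ht hy
  have d7 := F₀.sux.one.hasDerivAt_y (x := x) ht hy
  have d8 := F.sv.one.hasDerivAt_y (x := x) ht hy
  have d9 := F₀.suy.one.hasDerivAt_y (x := x) ht hy
  have d10 := (SmoothOn.dx (n := 1) h.smooth_p isOpen_Ioo.uniqueDiffOn).hasDerivAt_y (x := x) ht hy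
  have d11 := F.sb.one.hasDerivAt_y (x := x) ht hy
  have d12 := F₀.suxx.one.hasDerivAt_y (x := x) ht hy
  have key := hasDerivAt_of_eqOn_zero hy (fun z hz => by
    have := h.momentum t ht x z hz
    show _ + _ = (0 : ℝ)
    linarith)
    ((((((d1.fun_add (d2.fun_mul d3)).fun_add (d4.fun_mul d5)).fun_add
      (d6.fun_mul d7)).fun_add (d8.fun_mul d9)).fun_add d10).fun_sub d11 |>.fun_add d12)
  -- the normal momentum equation gives the pressure
  have hq : dy (dx p₂) t x y = -(dx (dt v₀) t x y
      + (dx u₀ t x y * dx v₀ t x y + u₀ t x y * dx (dx v₀) t x y)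
      + (dx v₀ t x y * dy v₀ t x y + v₀ t x y * dx (dy v₀) t x y) - dx (dy (dy v₀)) t x y) := by
    rw [← dx_dy_comm h.smooth_p o ht hy']
    have e : (fun z => dy p₂ t z y) = fun z => -(dt v₀ t z y + u₀ t z y * dx v₀ t z y
        + v₀ t z y * dy v₀ t z y - dy (dy v₀) t z y) := by
      ext z; exact h.normal t ht z y hy
    rw [dx, e]
    exact ((((F₀.svt.one.hasDerivAt_x ht hy').fun_add ((F₀.su.one.hasDerivAt_x ht hy').fun_mul
      (F₀.svx.one.hasDerivAt_x ht hy'))).fun_add ((F₀.sv.one.hasDerivAt_x ht hy').fun_mul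
      (F₀.svy.one.hasDerivAt_x ht hy'))).fun_sub (F₀.svyy.one.hasDerivAt_x ht hy')).fun_neg.deriv
  have hxx : dy (dx (dx u₀)) t x y = dx (dx (dy u₀)) t x y := by
    rw [← dx_dy_comm (F₀.sux.of_le (by norm_num)) o ht hy']
    have e : (fun z => dy (dx u₀) t z y) = fun z => dx (dy u₀) t z y := by
      ext z; rw [dx_dy_comm (F₀.su.of_le (by norm_num)) o ht hy']
    rw [dx, e]; rfl
  rw [hq, F₀.vxyy_eq ht hy, F₀.vxy_eq ht hy, hxx,
    ← dt_dy_comm (F.su.of_le (by norm_num)) o ht hy',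
    ← dx_dy_comm (F.su.of_le (by norm_num)) o ht hy',
    ← dx_dy_comm (F₀.su.of_le (by norm_num)) o ht hy', F₀.vy_eq ht hy, F.vy_eq ht hy] at key
  linarith

lemma abs_mul_le_sq {B p q : ℝ} (hp : |p| ≤ B) (hq : |q| ≤ B) : |p * q| ≤ B ^ 2 := by
  rw [abs_mul, sq]; exact mul_le_mul hp hq (abs_nonneg _) ((abs_nonneg _).trans hp)

/-- The time derivatives of the two vorticities are `∂ᵧ³u₀`, `∂ᵧ³u₂` and bounded terms. -/
lemma abs_dt_vorticity_le (h : IsCorrector T u₀ v₀ u₂ v₂ p₂) (h₀ : IsHydrostatic T u₀ v₀ p₀)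
    (ht : t ∈ Ioo 0 T) (hy : y ∈ Ioo (0 : ℝ) 1) {B : ℝ} (B₀ : Sup u₀ v₀ t B) (B₂ : Sup u₂ v₂ t B) :
    |dt (dy u₀) t x y| + |dt (dy u₂) t x y|
      ≤ |dy (dy (dy u₀)) t x y| + |dy (dy (dy u₂)) t x y| + (24 * B ^ 2 + 2 * B) := by
  have hy' := Ioo_subset_Icc_self hy
  rw [h₀.vorticity ht hy, h.vorticity h₀ ht hy]
  have k0 := h₀.abs_dx_dt_v_le (x := x) ht B₀ hy
  have k1 := abs_mul_le_sq (B₀.u0 x y hy') (B₀.uxy x y hy')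
  have k2 := abs_mul_le_sq (B₀.v0 x y hy') (B₀.b x y hy')
  have k3 := abs_mul_le_sq (B₀.u0 x y hy') (B₂.uxy x y hy')
  have k4 := abs_mul_le_sq (B₀.v0 x y hy') (B₂.b x y hy')
  have k5 := abs_mul_le_sq (B₂.u0 x y hy') (B₀.uxy x y hy')
  have k6 := abs_mul_le_sq (B₂.v0 x y hy') (B₀.b x y hy')
  have k7 := abs_mul_le_sq (B₀.u0 x y hy') (B₀.vxx x y hy')
  have k8 := abs_mul_le_sq (B₀.v0 x y hy') (B₀.uxx x y hy')
  set P₀ := dy (dy (dy u₀)) t x y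
  set P₂ := dy (dy (dy u₂)) t x y
  have e1 : ∀ p q r : ℝ, |p - q - r| ≤ |p| + |q| + |r| := fun p q r =>
    (abs_sub _ _).trans (add_le_add_left (abs_sub _ _) _)
  have e2 : ∀ p a b c d k l m : ℝ, |p - (a + b + c + d) + (k + l - m)|
      ≤ |p| + (|a| + |b| + |c| + |d|) + (|k| + |l| + |m|) := by
    intro p a b c d k l m
    rw [abs_le]
    constructor <;> linarith [neg_abs_le p, neg_abs_le a, neg_abs_le b, neg_abs_le c, neg_abs_le d,
      neg_abs_le k, neg_abs_le l, neg_abs_le m, le_abs_self p, le_abs_self a, le_abs_self b,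
      le_abs_self c, le_abs_self d, le_abs_self k, le_abs_self l, le_abs_self m]
  refine (add_le_add (e1 _ _ _) (e2 _ _ _ _ _ _ _ _)).trans ?_
  linarith

end

end

section

/-! ### The composite profile -/

section Composite
variable {I : Set ℝ} {f g f' g' u₀ v₀ u₂ v₂ : ℝ → ℝ → ℝ → ℝ} {ε t x y R τ : ℝ}

lemma SmoothOn.composite {n : WithTop ℕ∞} (hf : SmoothOn n I f) (hg : SmoothOn n I g) :
    SmoothOn n I (composite ε f g) :=
  ContDiffOn.add hf (contDiffOn_const.mul hg)

lemma PeriodicX.composite (hf : PeriodicX f) (hg : PeriodicX g) : PeriodicX (composite ε f g) :=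
  fun t x y => by simp only [HydroNS.composite, hf t, hg t]

lemma dx_composite (hf : SmoothOn 1 I f) (hg : SmoothOn 1 I g) (ht : t ∈ I)
    (hy : y ∈ Icc (0 : ℝ) 1) :
    dx (composite ε f g) t x y = composite ε (dx f) (dx g) t x y :=
  ((hf.hasDerivAt_x ht hy).add ((hg.hasDerivAt_x ht hy).const_mul (ε ^ 2))).deriv

lemma dt_composite (hf : SmoothOn 1 I f) (hg : SmoothOn 1 I g) (hI : IsOpen I) (ht : t ∈ I)
    (hy : y ∈ Icc (0 : ℝ) 1) :
    dt (composite ε f g) t x y = composite ε (dt f) (dt g) t x y :=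
  ((hf.hasDerivAt_t hI ht hy).add ((hg.hasDerivAt_t hI ht hy).const_mul (ε ^ 2))).deriv

lemma SmoothOn.hasDerivWithinAt_y (h : SmoothOn 1 I f) (ht : t ∈ I) (hy : y ∈ Icc (0 : ℝ) 1) :
    HasDerivWithinAt (f t x) (HydroNS.dy f t x y) (Icc 0 1) y := by
  rw [dy_eq h ht hy]; exact h.hasDerivWithinAt_y' ht hy

lemma dy_composite (hf : SmoothOn 1 I f) (hg : SmoothOn 1 I g) (ht : t ∈ I)
    (hy : y ∈ Icc (0 : ℝ) 1) :
    dy (composite ε f g) t x y = composite ε (dy f) (dy g) t x y :=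
  ((hf.hasDerivWithinAt_y ht hy).add ((hg.hasDerivWithinAt_y ht hy).const_mul (ε ^ 2))).derivWithin
    (uniqueDiffOn_Icc one_pos y hy)

lemma dy_congr (e : ∀ y ∈ Icc (0 : ℝ) 1, f t x y = g t x y) (hy : y ∈ Icc (0 : ℝ) 1) :
    dy f t x y = dy g t x y := derivWithin_congr e (e y hy)

lemma dt_congr (hI : IsOpen I) (e : ∀ t ∈ I, f t x y = g t x y) (ht : t ∈ I) :
    dt f t x y = dt g t x y := by
  refine Filter.EventuallyEq.deriv_eq ?_
  filter_upwards [hI.mem_nhds ht] with s hs using e s hs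

section Flow
variable (h₀ : Flow I u₀ v₀) (h₂ : Flow I u₂ v₂)
include h₀ h₂

lemma Flow.composite (ε : ℝ) : Flow I (composite ε u₀ u₂) (composite ε v₀ v₂) where
  isOpen := h₀.isOpen
  su := h₀.su.composite h₂.su
  sv := h₀.sv.composite h₂.sv
  pu := h₀.pu.composite h₂.pu
  pv := h₀.pv.composite h₂.pv
  divFree t ht x y hy := by
    rw [dx_composite h₀.su.one h₂.su.one ht (Ioo_subset_Icc_self hy),
      dy_composite h₀.sv.one h₂.sv.one ht (Ioo_subset_Icc_self hy), HydroNS.composite,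
      HydroNS.composite, h₀.vy_eq ht hy, h₂.vy_eq ht hy]
    ring
  wall0 t ht x := by rw [HydroNS.composite, h₀.wall0 t ht, h₂.wall0 t ht]; ring
  wall1 t ht x := by rw [HydroNS.composite, h₀.wall1 t ht, h₂.wall1 t ht]; ring

variable (ht : t ∈ I) (hy : y ∈ Icc (0 : ℝ) 1)
include ht hy

lemma dyy_composite : dy (dy (composite ε u₀ u₂)) t x y
    = composite ε (dy (dy u₀)) (dy (dy u₂)) t x y := by
  rw [← dy_composite h₀.suy.one h₂.suy.one ht hy]
  exact dy_congr (fun y hy => dy_composite h₀.su.one h₂.su.one ht hy) hy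

lemma dyyy_composite : dy (dy (dy (composite ε u₀ u₂))) t x y
    = composite ε (dy (dy (dy u₀))) (dy (dy (dy u₂))) t x y := by
  rw [← dy_composite h₀.sb.one h₂.sb.one ht hy]
  exact dy_congr (fun y hy => dyy_composite h₀ h₂ ht hy) hy

lemma dty_composite : dt (dy (composite ε u₀ u₂)) t x y
    = composite ε (dt (dy u₀)) (dt (dy u₂)) t x y := by
  rw [← dt_composite h₀.suy.one h₂.suy.one h₀.isOpen ht hy]
  exact dt_congr h₀.isOpen (fun t ht => dy_composite h₀.su.one h₂.su.one ht hy) ht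

omit hy

lemma Prof.composite (P₀ : Prof u₀ v₀ t R τ) (P₂ : Prof u₂ v₂ t R τ) (hε0 : 0 ≤ ε) (hε1 : ε ≤ 1) :
    Prof (composite ε u₀ u₂) (composite ε v₀ v₂) t (R + R) τ := by
  have e1 : ε ^ 2 ≤ 1 := pow_le_one₀ hε0 hε1
  have key : ∀ {f g w : ℝ → ℝ → ℝ → ℝ} {y : ℝ}, SmoothOn 1 I f → SmoothOn 1 I g → PeriodicX f →
      PeriodicX g → y ∈ Icc (0 : ℝ) 1 → (∀ x, w t x y = HydroNS.composite ε f g t x y) →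
      GD 3 R τ (fun x => f t x y) → GD 3 R τ (fun x => g t x y) →
      GD 3 (R + R) τ fun x => w t x y := by
    intro f g w y hf hg pf pg hy e Hf Hg
    simp only [e]
    exact Hf.add (Hg.const_mul (sq_nonneg ε) e1) (hf.pc pf ht hy).cont
      (continuous_const.mul (hg.pc pg ht hy).cont)
  exact ⟨fun y hy => key h₀.su.one h₂.su.one h₀.pu h₂.pu hy (fun _ => rfl) (P₀.gu y hy)
      (P₂.gu y hy),
    fun y hy => key h₀.suy.one h₂.suy.one h₀.pu.dy h₂.pu.dy hy
      (fun _ => dy_composite h₀.su.one h₂.su.one ht hy) (P₀.guy y hy) (P₂.guy y hy),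
    fun y hy => key h₀.sb.one h₂.sb.one h₀.pu.dy.dy h₂.pu.dy.dy hy
      (fun _ => dyy_composite h₀ h₂ ht hy) (P₀.gb y hy) (P₂.gb y hy),
    fun y hy => key h₀.sv.one h₂.sv.one h₀.pv h₂.pv hy (fun _ => rfl) (P₀.gv y hy) (P₂.gv y hy)⟩

end Flow
end Composite

/-! ### The solution as an evolution -/

section Lap
variable {I : Set ℝ} {f : ℝ → ℝ → ℝ → ℝ} {ε : ℝ} {n : ℕ}

lemma SmoothOn.lap (h : SmoothOn (n + 1 + 1 : ℕ) I f) (hI : UniqueDiffOn ℝ I) :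
    SmoothOn n I (lap ε f) :=
  ContDiffOn.add (contDiffOn_const.mul ((h.dx hI).dx hI)) ((h.dy hI).dy hI)

lemma PeriodicX.lap (h : PeriodicX f) : PeriodicX (lap ε f) := fun t x y => by
  simp only [HydroNS.lap, h.dx.dx t, h.dy.dy t]

end Lap

/-- The hypotheses on the approximate solution, the sources and the solution, together. -/
structure Problem (M c₀ lam ε Tp T : ℝ) (u₀ v₀ p₀ u₂ v₂ p₂ Nu Nv f₁ f₂ : ℝ → ℝ → ℝ → ℝ)
    (C : ℝ → ℝ) (φ : ℝ → ℝ → ℝ → ℝ) : Prop where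
  hM : 0 < M
  hc₀ : 0 < c₀
  hlam : 0 < lam
  hε0 : 0 < ε
  hε1 : ε ≤ 1
  hydro : IsHydrostatic Tp u₀ v₀ p₀
  corr : IsCorrector Tp u₀ v₀ u₂ v₂ p₂
  bound₀ : GevreyBound Tp lam M 12 u₀ v₀
  bound₂ : GevreyBound Tp lam M 10 u₂ v₂
  convex : ∀ t ∈ Ioo 0 Tp, ∀ x, ∀ y ∈ Ioo (0 : ℝ) 1, c₀ ≤ dy (dy (composite ε u₀ u₂)) t x y
  hTp : T < Tp
  hTlam : T < 1 / (2 * lam)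
  sNu : SmoothOn 1 (Ioo 0 T) Nu
  sNv : SmoothOn 1 (Ioo 0 T) Nv
  sf₁ : SmoothOn 0 (Ioo 0 T) f₁
  sf₂ : SmoothOn 0 (Ioo 0 T) f₂
  sC : ContinuousOn C (Ioo 0 T)
  pNu : PeriodicX Nu
  pNv : PeriodicX Nv
  pf₁ : PeriodicX f₁
  pf₂ : PeriodicX f₂
  sol : IsSlipSolution ε T (composite ε u₀ u₂) (composite ε v₀ v₂) Nu Nv f₁ f₂ C φ

/-- The constant of the pointwise bounds on each of the two profiles. The factor `12` comes from
the Sobolev inequality in `y`. -/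
def supConst (M : ℝ) : ℝ := ZZ * (12 * M)

/-- A constant that dominates all the bounds on the composite profile. -/
def profileConst (M : ℝ) : ℝ :=
  1 + 24 * M + ZZ * (24 * M) + (156 * M ^ 2 + 3 * (24 * supConst M ^ 2 + 2 * supConst M) ^ 2)

lemma one_le_profileConst {M : ℝ} (hM : 0 < M) : 1 ≤ profileConst M := by
  have h2 : 0 ≤ ZZ * (24 * M) := mul_nonneg ZZ_nonneg (by linarith)
  have h4 := sq_nonneg (24 * supConst M ^ 2 + 2 * supConst M)
  have h3 := sq_nonneg M
  unfold profileConst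
  linarith

lemma GevreyBound.parts {Tp lam M m t : ℝ} {u v : ℝ → ℝ → ℝ → ℝ} (h : GevreyBound Tp lam M m u v)
    (hm : 10 ≤ m) (ht : t ∈ Ioo 0 Tp) :
    normSq 7 (radius lam t) (u t) ≤ ENNReal.ofReal (M ^ 2)
      ∧ normSq 7 (radius lam t) (dy u t) ≤ ENNReal.ofReal (M ^ 2)
      ∧ normSq 6 (radius lam t) (dy (dy (dy u)) t) ≤ ENNReal.ofReal (M ^ 2) := by
  have h1 := h t ht
  refine ⟨(normSq_mono (by linarith) _).trans (le_trans ?_ h1),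
    (normSq_mono (by linarith : 7 ≤ m) _).trans (le_trans ?_ h1),
    (normSq_mono (by linarith : 6 ≤ m - 4) _).trans (le_trans ?_ h1)⟩
  · exact le_add_right (le_add_right le_add_self)
  · exact le_add_right le_add_self
  · exact le_add_self

namespace Problem
variable {M c₀ lam ε Tp T : ℝ} {u₀ v₀ p₀ u₂ v₂ p₂ Nu Nv f₁ f₂ : ℝ → ℝ → ℝ → ℝ}
    {C : ℝ → ℝ} {φ : ℝ → ℝ → ℝ → ℝ} {t : ℝ}
    (P : Problem M c₀ lam ε Tp T u₀ v₀ p₀ u₂ v₂ p₂ Nu Nv f₁ f₂ C φ)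
include P

lemma radius_mem (ht : t ∈ Icc 0 T) : 0 ≤ radius lam t ∧ radius lam t ≤ 1 := by
  have h1 := P.hTlam
  have h2 := P.hlam
  rw [lt_div_iff₀ (by positivity)] at h1
  have h3 : lam * t ≤ lam * T := by gcongr; exact ht.2
  have h4 : 0 ≤ lam * t := mul_nonneg h2.le ht.1
  unfold radius
  constructor <;> linarith

lemma supConst_nonneg : 0 ≤ supConst M := by
  have := P.hM; have := ZZ_nonneg; unfold supConst; positivity

lemma le_profileConst : 24 * M ≤ profileConst M ∧
    ZZ * (24 * M) ≤ profileConst M ∧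
    156 * M ^ 2 + 3 * (24 * supConst M ^ 2 + 2 * supConst M) ^ 2 ≤ profileConst M := by
  have h1 := P.hM
  have h2 : 0 ≤ ZZ * (24 * M) := mul_nonneg ZZ_nonneg (by linarith)
  have h3 := sq_nonneg M
  have h4 := sq_nonneg (24 * supConst M ^ 2 + 2 * supConst M)
  unfold profileConst
  refine ⟨?_, ?_, ?_⟩ <;> linarith

section
variable (ht : t ∈ Ioo 0 T)
include ht

lemma mem_p : t ∈ Ioo 0 Tp := ⟨ht.1, ht.2.trans P.hTp⟩

lemma prof₀ : Prof u₀ v₀ t (12 * M) (radius lam t) := by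
  obtain ⟨h1, h2, h3⟩ := P.bound₀.parts (by norm_num) (P.mem_p ht)
  exact P.hydro.flow.prof (P.mem_p ht) P.hM.le h1 h2 h3

lemma prof₂ : Prof u₂ v₂ t (12 * M) (radius lam t) := by
  obtain ⟨h1, h2, h3⟩ := P.bound₂.parts le_rfl (P.mem_p ht)
  exact P.corr.flow.prof (P.mem_p ht) P.hM.le h1 h2 h3

omit ht in
lemma flow : Flow (Ioo 0 Tp) (composite ε u₀ u₂) (composite ε v₀ v₂) :=
  P.hydro.flow.composite P.corr.flow ε

lemma prof : Prof (composite ε u₀ u₂) (composite ε v₀ v₂) t (24 * M) (radius lam t) := by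
  have := Prof.composite P.hydro.flow P.corr.flow (P.mem_p ht) (P.prof₀ ht) (P.prof₂ ht) P.hε0.le
    P.hε1
  rwa [show 12 * M + 12 * M = 24 * M by ring] at this

lemma sup : Sup (composite ε u₀ u₂) (composite ε v₀ v₂) t (ZZ * (24 * M)) :=
  (P.prof ht).sup P.flow (P.mem_p ht) (P.radius_mem (Ioo_subset_Icc_self ht)).1

omit ht in
/-- The convexity extends to the walls by continuity. -/
lemma convex_ex (ht : t ∈ Ioo 0 T) (x y : ℝ) :
    c₀ ≤ ex (dy (dy (composite ε u₀ u₂)) t) x y := by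
  have hc := ((P.flow.sb.pf P.flow.pu.dy.dy (P.mem_p ht)).cy x)
  have hcl : IsClosed {y | c₀ ≤ ex (dy (dy (composite ε u₀ u₂)) t) x y} :=
    isClosed_le continuous_const hc
  have hs : Ioo (0 : ℝ) 1 ⊆ {y | c₀ ≤ ex (dy (dy (composite ε u₀ u₂)) t) x y} := fun y hy => by
    rw [mem_ofPred_eq, ex_eq (Ioo_subset_Icc_self hy)]
    exact P.convex t (P.mem_p ht) x y hy
  have h1 := hcl.closure_subset_iff.2 hs
  rw [closure_Ioo zero_ne_one] at h1
  have := h1 (cl_unit y)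
  rwa [mem_ofPred_eq, ex_eq (cl_unit y)] at this

end

/-- A bound on `(∂ᵧ²ω^p)²` and `(∂ₜω^p)²` by a function of `y`, from the one-dimensional Sobolev
inequality in `x`. -/
def _root_.HydroNS.rhoBound (M : ℝ) (u₀ u₂ : ℝ → ℝ → ℝ → ℝ) (t y : ℝ) : ℝ :=
  39 * (((∫ z in 0..2 * Real.pi, ex (dy (dy (dy u₀)) t) z y ^ 2)
      + ∫ z in 0..2 * Real.pi, ex (dx (dy (dy (dy u₀))) t) z y ^ 2)
    + ((∫ z in 0..2 * Real.pi, ex (dy (dy (dy u₂)) t) z y ^ 2)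
      + ∫ z in 0..2 * Real.pi, ex (dx (dy (dy (dy u₂))) t) z y ^ 2))
    + 3 * (24 * supConst M ^ 2 + 2 * supConst M) ^ 2

section
variable (ht : t ∈ Ioo 0 T)
include ht

lemma continuous_rhoBound : Continuous (rhoBound M u₀ u₂ t) := by
  have F₀ := P.hydro.flow
  have F₂ := P.corr.flow
  have h1 := ((F₀.sbz.pf F₀.pu.dy.dy.dy (P.mem_p ht)).pow 2).inner
  have h2 := ((F₀.sbzx.pf F₀.pu.dy.dy.dy.dx (P.mem_p ht)).pow 2).inner
  have h3 := ((F₂.sbz.pf F₂.pu.dy.dy.dy (P.mem_p ht)).pow 2).inner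
  have h4 := ((F₂.sbzx.pf F₂.pu.dy.dy.dy.dx (P.mem_p ht)).pow 2).inner
  unfold rhoBound
  fun_prop

lemma integral_rhoBound_le : ∫ y in 0..1, rhoBound M u₀ u₂ t y
    ≤ 156 * M ^ 2 + 3 * (24 * supConst M ^ 2 + 2 * supConst M) ^ 2 := by
  have F₀ := P.hydro.flow
  have F₂ := P.corr.flow
  have h1 := ((F₀.sbz.pf F₀.pu.dy.dy.dy (P.mem_p ht)).pow 2).inner
  have h2 := ((F₀.sbzx.pf F₀.pu.dy.dy.dy.dx (P.mem_p ht)).pow 2).inner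
  have h3 := ((F₂.sbz.pf F₂.pu.dy.dy.dy (P.mem_p ht)).pow 2).inner
  have h4 := ((F₂.sbzx.pf F₂.pu.dy.dy.dy.dx (P.mem_p ht)).pow 2).inner
  have τ0 := (P.radius_mem (Ioo_subset_Icc_self ht)).1
  have k1 := F₀.I2_bz_le (P.mem_p ht) τ0 (P.bound₀.parts (by norm_num) (P.mem_p ht)).2.2
  have k2 := F₂.I2_bz_le (P.mem_p ht) τ0 (P.bound₂.parts le_rfl (P.mem_p ht)).2.2
  unfold I2 at k1 k2
  unfold rhoBound
  rw [intervalIntegral.integral_add (Continuous.intervalIntegrable (by fun_prop) _ _)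
    (Continuous.intervalIntegrable (by fun_prop) _ _), intervalIntegral.integral_const_mul,
    intervalIntegral.integral_add (Continuous.intervalIntegrable (by fun_prop) _ _)
    (Continuous.intervalIntegrable (by fun_prop) _ _),
    intervalIntegral.integral_add (Continuous.intervalIntegrable (by fun_prop) _ _)
    (Continuous.intervalIntegrable (by fun_prop) _ _),
    intervalIntegral.integral_add (Continuous.intervalIntegrable (by fun_prop) _ _)
    (Continuous.intervalIntegrable (by fun_prop) _ _), intervalIntegral.integral_const]
  norm_num
  linarith [k1.1, k1.2, k2.1, k2.2]

lemma sq_le_rhoBound (x : ℝ) {y p : ℝ} (hy : y ∈ Ioo (0 : ℝ) 1)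
    (hp : |p| ≤ |dy (dy (dy u₀)) t x y| + |dy (dy (dy u₂)) t x y|
      + (24 * supConst M ^ 2 + 2 * supConst M)) :
    p ^ 2 ≤ rhoBound M u₀ u₂ t y := by
  have hy' := Ioo_subset_Icc_self hy
  have k1 := P.hydro.flow.bz_sq_le (P.mem_p ht) x hy'
  have k2 := P.corr.flow.bz_sq_le (P.mem_p ht) x hy'
  set D := 24 * supConst M ^ 2 + 2 * supConst M with hD
  rw [← sq_abs] at k1 k2
  set p₀ := |dy (dy (dy u₀)) t x y|
  set p₂ := |dy (dy (dy u₂)) t x y|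
  have k3 : p ^ 2 ≤ 3 * p₀ ^ 2 + 3 * p₂ ^ 2 + 3 * D ^ 2 := by
    have : p ^ 2 ≤ (p₀ + p₂ + D) ^ 2 := by
      rw [← sq_abs]; exact pow_le_pow_left₀ (abs_nonneg _) hp 2
    nlinarith [sq_nonneg (p₀ - p₂), sq_nonneg (p₀ - D), sq_nonneg (p₂ - D)]
  unfold rhoBound
  rw [← hD]
  linarith

lemma dyyy_sq_le (x : ℝ) {y : ℝ} (hy : y ∈ Ioo (0 : ℝ) 1) :
    dy (dy (dy (composite ε u₀ u₂))) t x y ^ 2 ≤ rhoBound M u₀ u₂ t y := by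
  refine P.sq_le_rhoBound ht x hy ?_
  rw [dyyy_composite P.hydro.flow P.corr.flow (P.mem_p ht) (Ioo_subset_Icc_self hy), composite]
  have := P.supConst_nonneg
  have e1 : ε ^ 2 ≤ 1 := pow_le_one₀ P.hε0.le P.hε1
  refine (abs_add_le _ _).trans ?_
  rw [abs_mul, abs_of_nonneg (sq_nonneg ε)]
  have h1 := mul_le_of_le_one_left (abs_nonneg (dy (dy (dy u₂)) t x y)) e1
  have : 0 ≤ 24 * supConst M ^ 2 + 2 * supConst M := by positivity
  linarith

lemma dty_sq_le (x : ℝ) {y : ℝ} (hy : y ∈ Ioo (0 : ℝ) 1) :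
    dt (dy (composite ε u₀ u₂)) t x y ^ 2 ≤ rhoBound M u₀ u₂ t y := by
  refine P.sq_le_rhoBound ht x hy ?_
  rw [dty_composite P.hydro.flow P.corr.flow (P.mem_p ht) (Ioo_subset_Icc_self hy), composite]
  have e1 : ε ^ 2 ≤ 1 := pow_le_one₀ P.hε0.le P.hε1
  have τ0 := (P.radius_mem (Ioo_subset_Icc_self ht)).1
  refine ((abs_add_le _ _).trans ?_).trans (abs_dt_vorticity_le P.corr P.hydro (P.mem_p ht) hy
    ((P.prof₀ ht).sup P.hydro.flow (P.mem_p ht) τ0) ((P.prof₂ ht).sup P.corr.flow (P.mem_p ht) τ0))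
  rw [abs_mul, abs_of_nonneg (sq_nonneg ε)]
  have h1 := mul_le_of_le_one_left (abs_nonneg (dt (dy u₂) t x y)) e1
  linarith

omit ht

lemma sφ : SmoothOn (4 : ℕ) (Ioo 0 T) φ := P.sol.smooth.mono Ioo_subset_Ioc_self
lemma sω : SmoothOn (2 : ℕ) (Ioo 0 T) (lap ε φ) := P.sφ.lap isOpen_Ioo.uniqueDiffOn
lemma pω : PeriodicX (lap ε φ) := P.sol.periodic.lap

include ht

lemma stream : Stream ε (ex (φ t)) (ex (dx φ t)) (ex (dy φ t)) (ex (dx (dx φ) t))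
    (ex (dx (dy φ) t)) (ex (dy (dy φ) t)) (ex (lap ε φ t)) := by
  have o : UniqueDiffOn ℝ (Ioo 0 T) := isOpen_Ioo.uniqueDiffOn
  have s1 := P.sφ.dx o
  have s2 := P.sφ.dy o
  have p := P.sol.periodic
  have ht' := Ioo_subset_Ioc_self ht
  exact {
    pf := P.sφ.pf p ht
    pfx := s1.pf p.dx ht
    pfy := s2.pf p.dy ht
    pfxx := (s1.dx o).pf p.dx.dx ht
    pfxy := (s2.dx o).pf p.dy.dx ht
    pfyy := (s2.dy o).pf p.dy.dy ht
    pfω := P.sω.pf P.pω ht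
    dx := P.sφ.one.hasX ht
    dxx := s1.one.hasX ht
    dxy := s2.one.hasX ht
    dy := P.sφ.one.hasY ht
    dyy := s2.one.hasY ht
    dyx := fun x y hy => by
      have := s1.one.hasY ht x y hy
      rwa [ex_eq (Ioo_subset_Icc_self hy), ← dx_dy_comm (P.sφ.of_le (by norm_num)) isOpen_Ioo ht
        (Ioo_subset_Icc_self hy), ← ex_eq (F := HydroNS.dx (HydroNS.dy φ) t)
        (Ioo_subset_Icc_self hy)] at this
    wall0 := fun x => by
      rw [ex_eq (left_mem_Icc.2 zero_le_one), P.sol.dirichlet t ht' x 0 (by simp)]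
    wall1 := fun x => by
      rw [ex_eq (right_mem_Icc.2 zero_le_one), P.sol.dirichlet t ht' x 1 (by simp)]
    vort := fun x y _ => rfl }

end

omit P

/-- The problem at a fixed time. -/
def slice (P : Problem M c₀ lam ε Tp T u₀ v₀ p₀ u₂ v₂ p₂ Nu Nv f₁ f₂ C φ) (t : ℝ)
    (ht : t ∈ Ioo 0 T) : Slice c₀ (profileConst M) (radius lam t) ε :=
  let U := composite ε u₀ u₂
  let V := composite ε v₀ v₂
  let F : Flow (Ioo 0 Tp) U V := P.flow
  let G : Prof U V t (24 * M) (radius lam t) := P.prof ht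
  let S : Sup U V t (ZZ * (24 * M)) := P.sup ht
  have tp : t ∈ Ioo 0 Tp := P.mem_p ht
  have o : UniqueDiffOn ℝ (Ioo 0 T) := isOpen_Ioo.uniqueDiffOn
  have hR := P.le_profileConst
  have hic : ∀ {y : ℝ}, y ∈ Ioo (0 : ℝ) 1 → y ∈ Icc (0 : ℝ) 1 := fun hy => Ioo_subset_Icc_self hy
  { u := ex (U t)
    ux := ex (dx U t)
    v := ex (V t)
    b := ex (dy (dy U) t)
    bx := ex (dx (dy (dy U)) t)
    bz := ex (dy (dy (dy U)) t)
    η := ex (dx (dy U) t)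
    q := ex (dt (dy U) t)
    qz := ex (dt (dy (dy U)) t)
    ρ := rhoBound M u₀ u₂ t
    φ := ex (φ t)
    φx := ex (dx φ t)
    φy := ex (dy φ t)
    φxx := ex (dx (dx φ) t)
    φxy := ex (dx (dy φ) t)
    φyy := ex (dy (dy φ) t)
    ω := ex (lap ε φ t)
    ωx := ex (dx (lap ε φ) t)
    ωy := ex (dy (lap ε φ) t)
    ωxx := ex (dx (dx (lap ε φ)) t)
    ωyy := ex (dy (dy (lap ε φ)) t)
    ωt := ex (dt (lap ε φ) t)
    Nu := ex (Nu t)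
    Nuy := ex (dy Nu t)
    Nv := ex (Nv t)
    Nvx := ex (dx Nv t)
    f₁ := ex (f₁ t)
    f₂ := ex (f₂ t)
    C := C t
    hc₀ := P.hc₀
    hR := one_le_profileConst P.hM
    hτ0 := (P.radius_mem (Ioo_subset_Icc_self ht)).1
    hτ1 := (P.radius_mem (Ioo_subset_Icc_self ht)).2
    hε0 := P.hε0
    hε1 := P.hε1
    pu := F.su.pf F.pu tp
    pux := F.sux.pf F.pu.dx tp
    pv := F.sv.pf F.pv tp
    pb := F.sb.pf F.pu.dy.dy tp
    pbx := F.sbx.pf F.pu.dy.dy.dx tp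
    pbz := F.sbz.pf F.pu.dy.dy.dy tp
    pη := F.suxy.pf F.pu.dy.dx tp
    pq := F.suyt.pf F.pu.dy.dt tp
    pqz := F.sbt.pf F.pu.dy.dy.dt tp
    cρ := P.continuous_rhoBound ht
    dux := F.su.one.hasX tp
    dbx := F.sb.one.hasX tp
    dbz := F.sb.one.hasY tp
    dqz := fun x y hy => by
      have := F.suyt.one.hasY tp x y hy
      rwa [ex_eq (hic hy), ← dt_dy_comm (F.suy.of_le (by norm_num)) isOpen_Ioo tp (hic hy),
        ← ex_eq (F := dt (dy (dy U)) t) (hic hy)] at this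
    gu := fun y hy => by
      simp only [ex_eq (hic hy)]; exact (G.gu y (hic hy)).mono (by norm_num) hR.1
    gv := fun y hy => by
      simp only [ex_eq (hic hy)]; exact (G.gv y (hic hy)).mono (by norm_num) hR.1
    gb := fun y hy => by
      simp only [ex_eq (hic hy)]; exact (G.gb y (hic hy)).mono (by norm_num) hR.1
    gη := fun y hy => by
      simp only [ex_eq (hic hy)]
      exact ((G.guy.dx F.suy isOpen_Ioo F.pu.dy tp) y (hic hy)).mono le_rfl hR.1
    su := fun x y hy => by rw [ex_eq (hic hy)]; exact (S.u0 x y (hic hy)).trans hR.2.1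
    sux := fun x y hy => by rw [ex_eq (hic hy)]; exact (S.ux x y (hic hy)).trans hR.2.1
    sb := fun x y hy => by rw [ex_eq (hic hy)]; exact (S.b x y (hic hy)).trans hR.2.1
    sbx := fun x y hy => by rw [ex_eq (hic hy)]; exact (S.bx x y (hic hy)).trans hR.2.1
    sbz := fun x y hy => by rw [ex_eq (hic hy)]; exact P.dyyy_sq_le ht x hy
    sq := fun x y hy => by rw [ex_eq (hic hy)]; exact P.dty_sq_le ht x hy
    sρ := (P.integral_rhoBound_le ht).trans hR.2.2
    b_ge := P.convex_ex ht
    st := P.stream ht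
    pωx := (P.sω.dx o).pf P.pω.dx ht
    pωy := (P.sω.dy o).pf P.pω.dy ht
    pωxx := ((P.sω.dx o).dx o).pf P.pω.dx.dx ht
    pωyy := ((P.sω.dy o).dy o).pf P.pω.dy.dy ht
    dωx := P.sω.one.hasX ht
    dωxx := (P.sω.dx o).one.hasX ht
    dωy := P.sω.one.hasY ht
    dωyy := (P.sω.dy o).one.hasY ht
    ω0 := fun x => by
      rw [ex_eq (left_mem_Icc.2 zero_le_one),
        P.sol.slip t (Ioo_subset_Ioc_self ht) x 0 (by simp)]
    ω1 := fun x => by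
      rw [ex_eq (right_mem_Icc.2 zero_le_one),
        P.sol.slip t (Ioo_subset_Ioc_self ht) x 1 (by simp)]
    pNu := P.sNu.pf P.pNu ht
    pNuy := (SmoothOn.dy (n := 0) P.sNu o).pf P.pNu.dy ht
    pNv := P.sNv.pf P.pNv ht
    pNvx := (SmoothOn.dx (n := 0) P.sNv o).pf P.pNv.dx ht
    pf₁ := P.sf₁.pf P.pf₁ ht
    pf₂ := P.sf₂.pf P.pf₂ ht
    dNu := P.sNu.hasY ht
    dNv := P.sNv.hasX ht
    eqn := fun x y hy => by
      simp only [ex_eq (hic hy)]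
      exact P.sol.equation t ht x y hy }

/-- The problem on a closed interval of positive times before `T`. -/
def evolution (P : Problem M c₀ lam ε Tp T u₀ v₀ p₀ u₂ v₂ p₂ Nu Nv f₁ f₂ C φ) (a b : ℝ)
    (ha : 0 < a) (hab : a ≤ b) (hb : b < T) : Evolution c₀ (profileConst M) lam ε a b :=
  have hm : Icc a b ⊆ Ioo 0 T := fun _ hr => ⟨ha.trans_le hr.1, hr.2.trans_lt hb⟩
  have hp : Icc a b ⊆ Ioo 0 Tp := fun _ hr => P.mem_p (hm hr)
  have o : UniqueDiffOn ℝ (Ioo 0 T) := isOpen_Ioo.uniqueDiffOn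
  { sl := fun r => P.slice (cl a b r) (hm (cl_mem hab r))
    cω := P.sω.c3 hab hm
    cωx := (P.sω.dx o).c3 hab hm
    cωy := (P.sω.dy o).c3 hab hm
    cωt := (P.sω.dt isOpen_Ioo).c3 hab hm
    cb := P.flow.sb.c3 hab hp
    cqz := P.flow.sbt.c3 hab hp
    cNu := P.sNu.c3 hab hm
    cNv := P.sNv.c3 hab hm
    cf₁ := P.sf₁.c3 hab hm
    cf₂ := P.sf₂.c3 hab hm
    cC := P.sC.comp_continuous (continuous_cl a b) fun r => hm (cl_mem hab r)
    dω := P.sω.one.hasT isOpen_Ioo hm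
    db := P.flow.sb.one.hasT isOpen_Ioo hp }

end Problem

end

section

/-! ### Truncated norms -/

/-- The weight `⟨n⟩^(p/3) e^{τ⟨n⟩^(2/3)}`. -/
def pw (p : ℕ) (τ : ℝ) (n : ℕ) : ℝ := th n ^ p * Real.exp (τ * th n ^ 2)

section Weights
variable {p : ℕ} {τ : ℝ} {N : ℕ}

lemma pw_pos (n : ℕ) : 0 < pw p τ n := by have := th_pos n; unfold pw; positivity

lemma pw_mono (hτ : 0 ≤ τ) {m n : ℕ} (h : m ≤ n) : pw p τ m ≤ pw p τ n := by
  have h1 := th_mono h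
  have h2 := th_pos m
  have h3 := th_pos n
  unfold pw
  gcongr

lemma pw_natAbs (k : ℤ) : pw p τ k.natAbs = wt (p / 3) τ k := by
  rw [pw, wt, th_sq, bracket_natAbs, th, bracket_natAbs, ← Real.rpow_natCast,
    ← Real.rpow_mul (bracket_pos k).le, one_div_mul_eq_div]

lemma pw_tr_le (hτ : 0 ≤ τ) (k : ℤ) : pw p τ (tr N k) ≤ wt (p / 3) τ k := by
  rw [← pw_natAbs]; exact pw_mono hτ (min_le_left _ _)

lemma th_mul_gw : (fun n => th n * gw τ n) = pw 7 τ := by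
  ext n; unfold gw pw; ring

lemma inv_th_mul_gw : (fun n => (th n)⁻¹ * gw τ n) = pw 5 τ := by
  ext n
  have := (th_pos n).ne'
  unfold gw pw; field_simp

lemma ofReal_integral_mult_sq {f : ℝ → ℝ} (hf : Continuous f) :
    ENNReal.ofReal (∫ x in 0..2 * Real.pi, mult (pw p τ) N f x ^ 2) = ENNReal.ofReal (2 * Real.pi)
      * ∑' k, ENNReal.ofReal ((pw p τ (tr N k) * ‖fc f k‖) ^ 2) := by
  have hm : Continuous (mult (pw p τ) N f) := by
    unfold mult; fun_prop
  rw [← tsum_ofReal_sq_fc hm]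
  simp only [fc_mult hf, norm_mul, Complex.norm_real, Real.norm_eq_abs, abs_of_pos (pw_pos _)]

lemma monotone_integral_mult_sq (hτ : 0 ≤ τ) {f : ℝ → ℝ} (hf : Continuous f) :
    Monotone fun N => ENNReal.ofReal (∫ x in 0..2 * Real.pi, mult (pw p τ) N f x ^ 2) := by
  intro N N' h
  simp only [ofReal_integral_mult_sq hf]
  gcongr with k
  · have := pw_pos (p := p) (τ := τ) (tr N k); positivity
  · exact pw_mono hτ (min_le_min_left _ h)

lemma traceNormSq_eq_iSup (hτ : 0 ≤ τ) {f : ℝ → ℝ} (hf : Continuous f) :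
    traceNormSq (p / 3) τ f
      = ⨆ N, ENNReal.ofReal (∫ x in 0..2 * Real.pi, mult (pw p τ) N f x ^ 2) := by
  simp only [ofReal_integral_mult_sq hf]
  rw [traceNormSq_eq, ← ENNReal.mul_iSup]
  congr 1
  apply le_antisymm
  · rw [ENNReal.tsum_eq_iSup_sum]
    refine iSup_le fun s => le_trans ?_ (le_iSup _ (s.sup Int.natAbs))
    refine le_trans (le_of_eq ?_) (ENNReal.sum_le_tsum s)
    refine Finset.sum_congr rfl fun k hk => ?_
    have : tr (s.sup Int.natAbs) k = k.natAbs := min_eq_left (Finset.le_sup (f := Int.natAbs) hk)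
    rw [this, pw_natAbs]
  · refine iSup_le fun N => ?_
    gcongr with k
    · have := pw_pos (p := p) (τ := τ) (tr N k); positivity
    · exact pw_tr_le hτ k

/-- The squared norm in `X^{p/3}` with the weight truncated at the frequency `N`. -/
def truncSq (p : ℕ) (τ : ℝ) (N : ℕ) (F : ℝ → ℝ → ℝ) : ℝ := I2 fun x y => MM (pw p τ) N F x y ^ 2

variable {F : ℝ → ℝ → ℝ} (hF : PF F)
include hF

lemma truncSq_nonneg : 0 ≤ truncSq p τ N F := I2_sq_nonneg hF.MM

lemma ofReal_truncSq : ENNReal.ofReal (truncSq p τ N F) = ∫⁻ y in Ioo (0 : ℝ) 1,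
    ENNReal.ofReal (∫ x in 0..2 * Real.pi, mult (pw p τ) N (fun x => F x y) x ^ 2) :=
  ofReal_I2 (hF.MM.pow 2) fun _ _ => sq_nonneg _

lemma monotone_truncSq (hτ : 0 ≤ τ) : Monotone fun N => ENNReal.ofReal (truncSq p τ N F) := by
  intro N N' h
  simp only [ofReal_truncSq hF]
  exact lintegral_mono fun y => monotone_integral_mult_sq hτ (hF.cx y) h

/-- Monotone convergence of the truncated norms. -/
lemma normSq_eq_iSup (hτ : 0 ≤ τ) :
    normSq (p / 3) τ F = ⨆ N, ENNReal.ofReal (truncSq p τ N F) := by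
  simp only [ofReal_truncSq hF]
  rw [← lintegral_iSup]
  · exact lintegral_congr fun y => traceNormSq_eq_iSup hτ (hF.cx y)
  · intro N
    exact (ENNReal.continuous_ofReal.comp (hF.MM.pow 2).inner).measurable
  · intro N N' h y
    exact monotone_integral_mult_sq hτ (hF.cx y) h

lemma ofReal_truncSq_le (hτ : 0 ≤ τ) : ENNReal.ofReal (truncSq p τ N F) ≤ normSq (p / 3) τ F := by
  rw [normSq_eq_iSup hF hτ]
  exact le_iSup (fun N => ENNReal.ofReal (truncSq p τ N F)) N

/-- A truncated norm is bounded by the `L²` norm. -/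
lemma ofReal_truncSq_le_zero (hτ1 : τ ≤ 1) : ENNReal.ofReal (truncSq p τ N F)
    ≤ ENNReal.ofReal (pw p 1 N ^ 2) * normSq 0 0 F := by
  have h1 : ∀ k, pw p τ (tr N k) ≤ pw p 1 N := fun k => by
    have a1 : th (tr N k) ≤ th N := th_mono (min_le_right _ _)
    have a2 := th_pos (tr N k)
    have a3 := th_pos N
    unfold pw
    gcongr
  rw [ofReal_truncSq hF, normSq, ← lintegral_const_mul' _ _ ENNReal.ofReal_ne_top]
  refine lintegral_mono fun y => ?_
  rw [ofReal_integral_mult_sq (hF.cx y), traceNormSq_eq,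
    mul_left_comm (ENNReal.ofReal (pw p 1 N ^ 2))]
  refine mul_le_mul_right ?_ _
  rw [← ENNReal.tsum_mul_left]
  refine ENNReal.tsum_le_tsum fun k => ?_
  rw [← ENNReal.ofReal_mul (sq_nonneg _), ← mul_pow]
  have := pw_pos (p := p) (τ := τ) (tr N k)
  refine ENNReal.ofReal_le_ofReal (pow_le_pow_left₀ (by positivity) ?_ 2)
  simpa [wt] using mul_le_mul_of_nonneg_right (h1 k) (norm_nonneg _)

end Weights

lemma truncSq_const_mul {p : ℕ} {τ : ℝ} {N : ℕ} (c : ℝ) (F : ℝ → ℝ → ℝ) :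
    truncSq p τ N (fun x y => c * F x y) = c ^ 2 * truncSq p τ N F := by
  simp only [truncSq, MM_const_mul, mul_pow, I2_const_mul]

lemma sq_le_normSq_const {r τ : ℝ} (hτ : 0 ≤ τ) (c : ℝ) :
    ENNReal.ofReal (c ^ 2) ≤ normSq r τ fun _ _ => c := by
  have h0 : fc (fun _ => c) 0 = c := by
    rw [fc, cfc_eq_integral]
    have : (2 * (Real.pi : ℂ)) ≠ 0 := by exact_mod_cast Real.two_pi_pos.ne'
    simp only [char, neg_zero, Int.cast_zero, mul_zero, zero_mul, Complex.exp_zero, one_mul,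
      intervalIntegral.integral_const, sub_zero, Complex.real_smul]
    push_cast
    field_simp
  have h1 : ∀ y : ℝ, ENNReal.ofReal (c ^ 2) ≤ traceNormSq r τ fun _ => c := fun y => by
    rw [traceNormSq_eq]
    calc ENNReal.ofReal (c ^ 2) = 1 * ENNReal.ofReal (c ^ 2) := (one_mul _).symm
      _ ≤ ENNReal.ofReal (2 * Real.pi) * ENNReal.ofReal ((wt r τ 0 * ‖fc (fun _ => c) 0‖) ^ 2) := by
        have e : wt r τ 0 = Real.exp τ := by simp [wt, bracket]
        have e2 : 1 ≤ Real.exp τ := Real.one_le_exp hτ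
        refine mul_le_mul' ?_ ?_
        · rw [← ENNReal.ofReal_one]
          exact ENNReal.ofReal_le_ofReal (by linarith [Real.pi_gt_three])
        · exact ENNReal.ofReal_le_ofReal (by
            rw [h0, e, Complex.norm_real, Real.norm_eq_abs, mul_pow, sq_abs]
            exact le_mul_of_one_le_left (sq_nonneg c) (one_le_pow₀ e2))
      _ ≤ _ := by
        gcongr
        exact ENNReal.le_tsum (f := fun k => ENNReal.ofReal
          ((wt r τ k * ‖fc (fun _ => c) k‖) ^ 2)) 0
  calc ENNReal.ofReal (c ^ 2) = ∫⁻ _ in Ioo (0 : ℝ) 1, ENNReal.ofReal (c ^ 2) := by simp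
    _ ≤ _ := lintegral_mono h1

lemma ofReal_integral_cl {f : ℝ → ℝ} {a b : ℝ} (hab : a ≤ b) (hc : Continuous fun r => f (cl a b r))
    (h0 : ∀ r ∈ Icc a b, 0 ≤ f r) :
    ENNReal.ofReal (∫ r in a..b, f (cl a b r)) = ∫⁻ r in Ioc a b, ENNReal.ofReal (f r) := by
  rw [intervalIntegral.integral_of_le hab, ofReal_integral_eq_lintegral_ofReal]
  · refine setLIntegral_congr_fun measurableSet_Ioc fun r hr => ?_
    simp only [cl_of_mem (Ioc_subset_Icc_self hr)]
  · exact (hc.continuousOn.integrableOn_compact isCompact_Icc).mono_set Ioc_subset_Icc_self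
  · exact Filter.Eventually.of_forall fun r => h0 _ (cl_mem hab r)

/-! ### The elliptic estimates -/

section Elliptic
variable {ε τ : ℝ} {φ φx φy φxx φxy φyy ω : ℝ → ℝ → ℝ} {p : ℕ}

lemma Stream.normSq_grad_le (h : Stream ε φ φx φy φxx φxy φyy ω) (hτ : 0 ≤ τ) :
    normSq (p / 3) τ (fun x y => ε * φx x y) + normSq (p / 3) τ φy ≤ 4 * normSq (p / 3) τ ω := by
  rw [normSq_eq_iSup (h.pfx.const_mul ε) hτ, normSq_eq_iSup h.pfy hτ,
    ENNReal.iSup_add_iSup_of_monotone (monotone_truncSq (h.pfx.const_mul ε) hτ)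
      (monotone_truncSq h.pfy hτ)]
  refine iSup_le fun N => ?_
  have h1 := (h.MM (pw p τ) N).grad_le
  have h2 := ofReal_truncSq_le (N := N) h.pfω hτ (p := p)
  rw [truncSq_const_mul, ← ENNReal.ofReal_add
    (mul_nonneg (sq_nonneg _) (truncSq_nonneg h.pfx)) (truncSq_nonneg h.pfy)]
  calc _ ≤ ENNReal.ofReal (4 * truncSq p τ N ω) := ENNReal.ofReal_le_ofReal h1
    _ = 4 * ENNReal.ofReal (truncSq p τ N ω) := by
      rw [ENNReal.ofReal_mul (by norm_num)]; norm_num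
    _ ≤ _ := by gcongr

lemma Stream.traceNormSq_le (h : Stream ε φ φx φy φxx φxy φyy ω) (hτ : 0 ≤ τ) :
    traceNormSq (p / 3) τ (fun x => φy x 0) + traceNormSq (p / 3) τ (fun x => φy x 1)
      ≤ 13 * normSq (p / 3) τ ω := by
  rw [traceNormSq_eq_iSup hτ (h.pfy.cx 0), traceNormSq_eq_iSup hτ (h.pfy.cx 1),
    ENNReal.iSup_add_iSup_of_monotone (monotone_integral_mult_sq hτ (h.pfy.cx 0))
      (monotone_integral_mult_sq hτ (h.pfy.cx 1))]
  refine iSup_le fun N => ?_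
  have h1 := (h.MM (pw p τ) N).trace_le
  have h2 := ofReal_truncSq_le (N := N) h.pfω hτ (p := p)
  have c0 := (h.MM (pw p τ) N).pfy.cx 0
  have c1 := (h.MM (pw p τ) N).pfy.cx 1
  rw [intervalIntegral.integral_add (Continuous.intervalIntegrable (by fun_prop) _ _)
    (Continuous.intervalIntegrable (by fun_prop) _ _)] at h1
  rw [← ENNReal.ofReal_add
    (intervalIntegral.integral_nonneg Real.two_pi_pos.le fun _ _ => sq_nonneg _)
    (intervalIntegral.integral_nonneg Real.two_pi_pos.le fun _ _ => sq_nonneg _), add_comm]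
  calc _ ≤ ENNReal.ofReal (13 * truncSq p τ N ω) := ENNReal.ofReal_le_ofReal h1
    _ = 13 * ENNReal.ofReal (truncSq p τ N ω) := by
      rw [ENNReal.ofReal_mul (by norm_num)]; norm_num
    _ ≤ _ := by gcongr

end Elliptic

end

section

/-! ### Passage to the limit in the truncation -/

/-- The truncated gain of `1/3` of a derivative. -/
def gain (lam ε : ℝ) (φ : ℝ → ℝ → ℝ → ℝ) (N : ℕ) (s : ℝ) : ℝ :=
  truncSq 7 (radius lam s) N (ex (lap ε φ s))

/-- The truncated dissipation. -/
def diss (lam ε : ℝ) (φ : ℝ → ℝ → ℝ → ℝ) (N : ℕ) (s : ℝ) : ℝ :=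
  ε ^ 2 * truncSq 6 (radius lam s) N (ex (dx (lap ε φ) s))
    + truncSq 6 (radius lam s) N (ex (dy (lap ε φ) s))

/-- The truncated norms of the sources in divergence form. -/
def srcDiv (lam ε : ℝ) (Nu Nv : ℝ → ℝ → ℝ → ℝ) (N : ℕ) (s : ℝ) : ℝ :=
  truncSq 6 (radius lam s) N (ex (Nu s))
    + truncSq 6 (radius lam s) N (fun x y => ε * ex (Nv s) x y)

/-- The truncated norms of the remaining sources. -/
def srcRem (lam ε : ℝ) (f₁ f₂ : ℝ → ℝ → ℝ → ℝ) (C : ℝ → ℝ) (N : ℕ) (s : ℝ) : ℝ :=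
  C s ^ 2 + truncSq 5 (radius lam s) N (fun x y => ε ^ 2 * ex (f₁ s) x y)
    + truncSq 5 (radius lam s) N (ex (f₂ s))

lemma MM_comp {w v : ℕ → ℝ} {N : ℕ} {F : ℝ → ℝ → ℝ} (hF : PF F) (x y : ℝ) :
    MM w N (MM v N F) x y = MM (fun n => w n * v n) N F x y :=
  congrFun (mult_comp (hF.pc y)) x

lemma continuous_pw {p : ℕ} {lam a b : ℝ} (n : ℕ) :
    Continuous fun r => pw p (radius lam (cl a b r)) n := by
  unfold pw radius; fun_prop

lemma C3.truncSq {F : ℝ → ℝ → ℝ → ℝ} (hF : C3 F) (p : ℕ) (lam a b : ℝ) (N : ℕ) :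
    Continuous fun r => truncSq p (radius lam (cl a b r)) N (F r) :=
  ((hF.MM (continuous_pw (p := p) (lam := lam) (a := a) (b := b)) N).pow 2).I2

namespace Problem
variable {M c₀ lam ε Tp T : ℝ} {u₀ v₀ p₀ u₂ v₂ p₂ Nu Nv f₁ f₂ : ℝ → ℝ → ℝ → ℝ}
    {C : ℝ → ℝ} {φ : ℝ → ℝ → ℝ → ℝ} {t a b K : ℝ}
    (P : Problem M c₀ lam ε Tp T u₀ v₀ p₀ u₂ v₂ p₂ Nu Nv f₁ f₂ C φ)

section Nonneg
variable (ht : t ∈ Ioo 0 T) (N : ℕ)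
include P ht

lemma gain_nonneg : 0 ≤ gain lam ε φ N t := truncSq_nonneg (P.sω.pf P.pω ht)

lemma diss_nonneg : 0 ≤ diss lam ε φ N t :=
  add_nonneg (mul_nonneg (sq_nonneg _)
    (truncSq_nonneg ((P.sω.dx isOpen_Ioo.uniqueDiffOn).pf P.pω.dx ht)))
    (truncSq_nonneg ((P.sω.dy isOpen_Ioo.uniqueDiffOn).pf P.pω.dy ht))

lemma srcDiv_nonneg : 0 ≤ srcDiv lam ε Nu Nv N t :=
  add_nonneg (truncSq_nonneg (P.sNu.pf P.pNu ht))
    (truncSq_nonneg ((P.sNv.pf P.pNv ht).const_mul ε))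

lemma srcRem_nonneg : 0 ≤ srcRem lam ε f₁ f₂ C N t :=
  add_nonneg (add_nonneg (sq_nonneg _) (truncSq_nonneg ((P.sf₁.pf P.pf₁ ht).const_mul _)))
    (truncSq_nonneg (P.sf₂.pf P.pf₂ ht))

lemma ofReal_gain : ⨆ N, ENNReal.ofReal (gain lam ε φ N t)
    = normSq (7 / 3) (radius lam t) (lap ε φ t) := by
  have := normSq_eq_iSup (p := 7) (P.sω.pf P.pω ht) (P.radius_mem (Ioo_subset_Icc_self ht)).1
  rw [normSq_ex] at this
  exact this.symm

lemma diss_eq : ENNReal.ofReal (diss lam ε φ N t)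
    = ENNReal.ofReal (truncSq 6 (radius lam t) N (ex fun x y => ε * dx (lap ε φ) t x y))
      + ENNReal.ofReal (truncSq 6 (radius lam t) N (ex (dy (lap ε φ) t))) := by
  have h1 := (P.sω.dx isOpen_Ioo.uniqueDiffOn).pf P.pω.dx ht
  have h2 := (P.sω.dy isOpen_Ioo.uniqueDiffOn).pf P.pω.dy ht
  rw [diss, ENNReal.ofReal_add (mul_nonneg (sq_nonneg _) (truncSq_nonneg h1)) (truncSq_nonneg h2),
    ← truncSq_const_mul]
  rfl

lemma monotone_diss : Monotone fun N => ENNReal.ofReal (diss lam ε φ N t) := by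
  have h1 := ((P.sω.dx isOpen_Ioo.uniqueDiffOn).pf P.pω.dx ht).const_mul ε
  have h2 := (P.sω.dy isOpen_Ioo.uniqueDiffOn).pf P.pω.dy ht
  have hτ := (P.radius_mem (Ioo_subset_Icc_self ht)).1
  simp only [P.diss_eq ht]
  exact (monotone_truncSq h1 hτ).add (monotone_truncSq h2 hτ)

lemma ofReal_diss : ⨆ N, ENNReal.ofReal (diss lam ε φ N t)
    = gradNormSq ε 2 (radius lam t) (lap ε φ) t := by
  have h1 := ((P.sω.dx isOpen_Ioo.uniqueDiffOn).pf P.pω.dx ht).const_mul ε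
  have h2 := (P.sω.dy isOpen_Ioo.uniqueDiffOn).pf P.pω.dy ht
  have hτ := (P.radius_mem (Ioo_subset_Icc_self ht)).1
  have e1 := normSq_eq_iSup (p := 6) h1 hτ
  have e2 := normSq_eq_iSup (p := 6) h2 hτ
  simp only [P.diss_eq ht]
  have e : ((6 : ℕ) : ℝ) / 3 = 2 := by norm_num
  rw [e] at e1 e2
  rw [← ENNReal.iSup_add_iSup_of_monotone (monotone_truncSq (F := ex fun x y =>
    ε * dx (lap ε φ) t x y) h1 hτ) (monotone_truncSq h2 hτ), gradNormSq, ← normSq_ex,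
    ← normSq_ex _ _ (dy (lap ε φ) t), e2]
  congr 1
  exact e1.symm

lemma ofReal_srcDiv_le : ENNReal.ofReal (srcDiv lam ε Nu Nv N t)
    ≤ normSq 2 (radius lam t) (Nu t) + normSq 2 (radius lam t) (fun x y => ε * Nv t x y) := by
  have h1 := P.sNu.pf P.pNu ht
  have h2 := (P.sNv.pf P.pNv ht).const_mul ε
  have hτ := (P.radius_mem (Ioo_subset_Icc_self ht)).1
  have e : ((6 : ℕ) : ℝ) / 3 = 2 := by norm_num
  have k1 := ofReal_truncSq_le (p := 6) (N := N) h1 hτ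
  have k2 := ofReal_truncSq_le (p := 6) (N := N) h2 hτ
  rw [e] at k1 k2
  rw [srcDiv, ENNReal.ofReal_add (truncSq_nonneg h1) (truncSq_nonneg h2), ← normSq_ex,
    ← normSq_ex _ _ fun x y => ε * Nv t x y]
  exact add_le_add k1 k2

lemma ofReal_srcRem_le : ENNReal.ofReal (srcRem lam ε f₁ f₂ C N t)
    ≤ normSq (5 / 3) (radius lam t) (fun _ _ => C t)
      + normSq (5 / 3) (radius lam t) (fun x y => ε ^ 2 * f₁ t x y)
      + normSq (5 / 3) (radius lam t) (f₂ t) := by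
  have h1 := (P.sf₁.pf P.pf₁ ht).const_mul (ε ^ 2)
  have h2 := P.sf₂.pf P.pf₂ ht
  have hτ := (P.radius_mem (Ioo_subset_Icc_self ht)).1
  have k1 := ofReal_truncSq_le (p := 5) (N := N) h1 hτ
  have k2 := ofReal_truncSq_le (p := 5) (N := N) h2 hτ
  rw [srcRem, ENNReal.ofReal_add (add_nonneg (sq_nonneg _) (truncSq_nonneg h1)) (truncSq_nonneg h2),
    ENNReal.ofReal_add (sq_nonneg _) (truncSq_nonneg h1),
    ← normSq_ex _ _ fun x y => ε ^ 2 * f₁ t x y, ← normSq_ex _ _ (f₂ t)]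
  exact add_le_add (add_le_add (sq_le_normSq_const hτ _) k1) k2

end Nonneg

/-- The sources, with the constants of the estimate. -/
def _root_.HydroNS.rhs (K lam ε : ℝ) (Nu Nv f₁ f₂ : ℝ → ℝ → ℝ → ℝ) (C : ℝ → ℝ) (t : ℝ) : ℝ≥0∞ :=
  ENNReal.ofReal K * (∫⁻ s in Ioc 0 t, (normSq 2 (radius lam s) (Nu s)
      + normSq 2 (radius lam s) (fun x y => ε * Nv s x y)))
    + ENNReal.ofReal (K / lam) * (∫⁻ s in Ioc 0 t, (normSq (5 / 3) (radius lam s) (fun _ _ => C s)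
      + normSq (5 / 3) (radius lam s) (fun x y => ε ^ 2 * f₁ s x y)
      + normSq (5 / 3) (radius lam s) (f₂ s)))

lemma _root_.HydroNS.rhs_mono {s t : ℝ} (h : s ≤ t) :
    rhs K lam ε Nu Nv f₁ f₂ C s ≤ rhs K lam ε Nu Nv f₁ f₂ C t := by
  have : Ioc (0 : ℝ) s ⊆ Ioc 0 t := Ioc_subset_Ioc_right h
  unfold rhs
  gcongr

/-- The conclusion of `Evolution.integrated` for given parameters. -/
def _root_.HydroNS.EnergyBound (K c₀ R lam ε : ℝ) : Prop :=
  ∀ (a b : ℝ) (E : Evolution c₀ R lam ε a b) (N : ℕ), 0 ≤ a → a ≤ b → b ≤ 1 / (2 * lam) →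
    (I2 fun x y => (E.sl b).g N x y ^ 2)
      + (lam * (∫ r in a..b, I2 fun x y => MM th N ((E.sl r).g N) x y ^ 2)
        + ∫ r in a..b, (ε ^ 2 * (I2 fun x y => (E.sl r).gx N x y ^ 2)
          + I2 fun x y => (E.sl r).gy N x y ^ 2))
      ≤ K * (I2 fun x y => (E.sl a).g N x y ^ 2)
        + (K * (∫ r in a..b, (E.sl r).srcN N) + K / lam * ∫ r in a..b, (E.sl r).srcF N)

include P

/-- The integrated energy inequality in terms of the truncated norms. -/
lemma energy_interval (hK : 0 < K) (H : EnergyBound K c₀ (profileConst M) lam ε) (ha : 0 < a)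
    (hab : a ≤ b) (hb : b < T) (N : ℕ) :
    ENNReal.ofReal (truncSq 6 (radius lam b) N (ex (lap ε φ b)))
      + (ENNReal.ofReal lam * (∫⁻ s in Ioc a b, ENNReal.ofReal (gain lam ε φ N s))
        + ∫⁻ s in Ioc a b, ENNReal.ofReal (diss lam ε φ N s))
      ≤ ENNReal.ofReal K * ENNReal.ofReal (truncSq 6 (radius lam a) N (ex (lap ε φ a)))
        + rhs K lam ε Nu Nv f₁ f₂ C b := by
  have hm : ∀ {r}, r ∈ Icc a b → r ∈ Ioo 0 T := fun hr => ⟨ha.trans_le hr.1, hr.2.trans_lt hb⟩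
  have hlam := P.hlam
  set E := P.evolution a b ha hab hb with hE
  have h := H a b E N ha.le hab (hb.trans P.hTlam).le
  have e1 : ∀ r, (I2 fun x y => MM th N ((E.sl r).g N) x y ^ 2) = gain lam ε φ N (cl a b r) := by
    intro r
    have p := P.sω.pf P.pω (hm (cl_mem hab r))
    have : ∀ x y, MM th N ((E.sl r).g N) x y
        = MM (pw 7 (radius lam (cl a b r))) N (ex (lap ε φ (cl a b r))) x y := fun x y => by
      rw [← th_mul_gw]; exact MM_comp p x y
    simp only [this]; rfl
  have e2 : ∀ r, ε ^ 2 * (I2 fun x y => (E.sl r).gx N x y ^ 2)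
      + (I2 fun x y => (E.sl r).gy N x y ^ 2) = diss lam ε φ N (cl a b r) := fun r => rfl
  have e3 : ∀ r, (E.sl r).srcN N = srcDiv lam ε Nu Nv N (cl a b r) := fun r => rfl
  have e4 : ∀ r, (E.sl r).srcF N = srcRem lam ε f₁ f₂ C N (cl a b r) := by
    intro r
    have q1 := (P.sf₁.pf P.pf₁ (hm (cl_mem hab r))).const_mul (ε ^ 2)
    have q2 := P.sf₂.pf P.pf₂ (hm (cl_mem hab r))
    have : (E.sl r).srcF N = C (cl a b r) ^ 2
        + (I2 fun x y => MM (fun n => (th n)⁻¹) N (MM (gw (radius lam (cl a b r))) N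
          fun x y => ε ^ 2 * ex (f₁ (cl a b r)) x y) x y ^ 2)
        + I2 fun x y => MM (fun n => (th n)⁻¹) N (MM (gw (radius lam (cl a b r))) N
          (ex (f₂ (cl a b r)))) x y ^ 2 := rfl
    rw [this]
    simp only [MM_comp q1, MM_comp q2, inv_th_mul_gw]
    rfl
  have e5 : ∀ r, (I2 fun x y => (E.sl r).g N x y ^ 2)
      = truncSq 6 (radius lam (cl a b r)) N (ex (lap ε φ (cl a b r))) := fun r => rfl
  simp only [e1, e2, e3, e4, e5] at h
  rw [cl_of_mem ⟨hab, le_rfl⟩, cl_of_mem ⟨le_rfl, hab⟩] at h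
  have o : UniqueDiffOn ℝ (Ioo 0 T) := isOpen_Ioo.uniqueDiffOn
  have hm' : Icc a b ⊆ Ioo 0 T := fun _ hr => hm hr
  have c1 : Continuous fun r => gain lam ε φ N (cl a b r) := E.cω.truncSq 7 lam a b N
  have c2 : Continuous fun r => diss lam ε φ N (cl a b r) :=
    (continuous_const.mul (E.cωx.truncSq 6 lam a b N)).add (E.cωy.truncSq 6 lam a b N)
  have c3 : Continuous fun r => srcDiv lam ε Nu Nv N (cl a b r) :=
    (E.cNu.truncSq 6 lam a b N).add ((E.cNv.const_mul ε).truncSq 6 lam a b N)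
  have c4 : Continuous fun r => srcRem lam ε f₁ f₂ C N (cl a b r) :=
    ((E.cC.pow 2).add ((E.cf₁.const_mul (ε ^ 2)).truncSq 5 lam a b N)).add
      (E.cf₂.truncSq 5 lam a b N)
  have n1 : ∀ r ∈ Icc a b, 0 ≤ gain lam ε φ N r := fun r hr => P.gain_nonneg (hm hr) N
  have n2 : ∀ r ∈ Icc a b, 0 ≤ diss lam ε φ N r := fun r hr => P.diss_nonneg (hm hr) N
  have n3 : ∀ r ∈ Icc a b, 0 ≤ srcDiv lam ε Nu Nv N r := fun r hr => P.srcDiv_nonneg (hm hr) N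
  have n4 : ∀ r ∈ Icc a b, 0 ≤ srcRem lam ε f₁ f₂ C N r := fun r hr => P.srcRem_nonneg (hm hr) N
  have i1 := intervalIntegral.integral_nonneg (μ := volume) hab fun r _ => n1 _ (cl_mem hab r)
  have i2 := intervalIntegral.integral_nonneg (μ := volume) hab fun r _ => n2 _ (cl_mem hab r)
  have i3 := intervalIntegral.integral_nonneg (μ := volume) hab fun r _ => n3 _ (cl_mem hab r)
  have i4 := intervalIntegral.integral_nonneg (μ := volume) hab fun r _ => n4 _ (cl_mem hab r)
  have hE0 : ∀ r ∈ Icc a b, 0 ≤ truncSq 6 (radius lam r) N (ex (lap ε φ r)) := fun r hr =>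
    truncSq_nonneg (P.sω.pf P.pω (hm hr))
  have h' := ENNReal.ofReal_le_ofReal h
  have hKl : 0 ≤ K / lam := by positivity
  have ha0 := hE0 a ⟨le_rfl, hab⟩
  have hb0 := hE0 b ⟨hab, le_rfl⟩
  rw [ENNReal.ofReal_add hb0 (add_nonneg (mul_nonneg hlam.le i1) i2),
    ENNReal.ofReal_add (mul_nonneg hlam.le i1) i2, ENNReal.ofReal_mul hlam.le,
    ENNReal.ofReal_add (mul_nonneg hK.le ha0) (add_nonneg (mul_nonneg hK.le i3) (mul_nonneg hKl i4)),
    ENNReal.ofReal_add (mul_nonneg hK.le i3) (mul_nonneg hKl i4), ENNReal.ofReal_mul hK.le,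
    ENNReal.ofReal_mul hK.le, ENNReal.ofReal_mul hKl, ofReal_integral_cl hab c1 n1,
    ofReal_integral_cl hab c2 n2, ofReal_integral_cl hab c3 n3, ofReal_integral_cl hab c4 n4] at h'
  refine h'.trans ?_
  have hs : Ioc a b ⊆ Ioc 0 b := Ioc_subset_Ioc_left ha.le
  have g3 : ∫⁻ s in Ioc a b, ENNReal.ofReal (srcDiv lam ε Nu Nv N s)
      ≤ ∫⁻ s in Ioc 0 b, (normSq 2 (radius lam s) (Nu s)
      + normSq 2 (radius lam s) (fun x y => ε * Nv s x y)) :=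
    (setLIntegral_mono' measurableSet_Ioc fun s hs =>
      P.ofReal_srcDiv_le (hm (Ioc_subset_Icc_self hs)) N).trans (lintegral_mono_set hs)
  have g4 : ∫⁻ s in Ioc a b, ENNReal.ofReal (srcRem lam ε f₁ f₂ C N s)
      ≤ ∫⁻ s in Ioc 0 b, (normSq (5 / 3) (radius lam s) (fun _ _ => C s)
      + normSq (5 / 3) (radius lam s) (fun x y => ε ^ 2 * f₁ s x y)
      + normSq (5 / 3) (radius lam s) (f₂ s)) :=
    (setLIntegral_mono' measurableSet_Ioc fun s hs =>
      P.ofReal_srcRem_le (hm (Ioc_subset_Icc_self hs)) N).trans (lintegral_mono_set hs)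
  unfold rhs
  gcongr

/-- The initial energy vanishes in the limit, since a truncated norm is bounded by the `L²` norm. -/
lemma energy_zero (hK : 0 < K) (H : EnergyBound K c₀ (profileConst M) lam ε) (ha : 0 < a)
    (hab : a ≤ b) (hb : b < T) (N : ℕ) :
    ENNReal.ofReal (truncSq 6 (radius lam b) N (ex (lap ε φ b)))
      + (ENNReal.ofReal lam * (∫⁻ s in Ioc a b, ENNReal.ofReal (gain lam ε φ N s))
        + ∫⁻ s in Ioc a b, ENNReal.ofReal (diss lam ε φ N s))
      ≤ rhs K lam ε Nu Nv f₁ f₂ C b := by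
  have lim : Tendsto (fun s => ENNReal.ofReal K * (ENNReal.ofReal (pw 6 1 N ^ 2)
      * normSq 0 0 (lap ε φ s)) + rhs K lam ε Nu Nv f₁ f₂ C b) (𝓝[>] 0)
      (𝓝 (ENNReal.ofReal K * (ENNReal.ofReal (pw 6 1 N ^ 2) * 0) + rhs K lam ε Nu Nv f₁ f₂ C b)) :=
    (ENNReal.Tendsto.const_mul (ENNReal.Tendsto.const_mul P.sol.initial_vorticity
      (Or.inr ENNReal.ofReal_ne_top)) (Or.inr ENNReal.ofReal_ne_top)).add tendsto_const_nhds
  rw [mul_zero, mul_zero, zero_add] at lim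
  refine ge_of_tendsto lim ?_
  filter_upwards [Ioc_mem_nhdsGT ha] with s hs
  have hsT : s ∈ Ioo 0 T := ⟨hs.1, (hs.2.trans hab).trans_lt hb⟩
  have h1 := P.energy_interval hK H hs.1 (hs.2.trans hab) hb N
  have h2 := ofReal_truncSq_le_zero (p := 6) (N := N) (P.sω.pf P.pω hsT) (P.radius_mem (Ioo_subset_Icc_self hsT)).2
  rw [normSq_ex] at h2
  have hsub : Ioc a b ⊆ Ioc s b := Ioc_subset_Ioc_left hs.2
  refine le_trans ?_ (h1.trans ?_) <;> gcongr

/-- The estimate holds up to the final time by continuity. -/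
lemma energy_trunc (hK : 0 < K) (H : EnergyBound K c₀ (profileConst M) lam ε) (ha : 0 < a)
    (hab : a ≤ b) (hbt : b < t) (htT : t ≤ T) (N : ℕ) :
    ENNReal.ofReal (truncSq 6 (radius lam t) N (ex (lap ε φ t)))
      + (ENNReal.ofReal lam * (∫⁻ s in Ioc a b, ENNReal.ofReal (gain lam ε φ N s))
        + ∫⁻ s in Ioc a b, ENNReal.ofReal (diss lam ε φ N s))
      ≤ rhs K lam ε Nu Nv f₁ f₂ C t := by
  have hs : SmoothOn (2 : ℕ) (Ioc 0 T) (lap ε φ) :=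
    SmoothOn.lap (n := 2) P.sol.smooth (uniqueDiffOn_Ioc 0 T)
  have hc : Continuous fun r => truncSq 6 (radius lam (cl b t r)) N (ex (lap ε φ (cl b t r))) :=
    (hs.c3 hbt.le fun r hr => ⟨(ha.trans_le hab).trans_le hr.1, hr.2.trans htT⟩).truncSq 6 lam b t N
  have lim := ((ENNReal.continuous_ofReal.comp hc).tendsto t).mono_left
    (nhdsWithin_le_nhds (s := Iio t))
  simp only [Function.comp_apply] at lim
  rw [cl_of_mem (right_mem_Icc.2 hbt.le)] at lim
  refine le_of_tendsto (lim.add_const _) ?_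
  filter_upwards [Ioo_mem_nhdsLT hbt] with r hr
  simp only [Function.comp_apply]
  rw [cl_of_mem (Ioo_subset_Icc_self hr)]
  have h1 := P.energy_zero hK H ha (hab.trans hr.1.le) (hr.2.trans_le htT) N
  have hsub : Ioc a b ⊆ Ioc a r := Ioc_subset_Ioc_right hr.1.le
  refine le_trans ?_ (h1.trans (rhs_mono hr.2.le))
  gcongr

/-- Monotone convergence in the truncation. -/
lemma energy_full (hK : 0 < K) (H : EnergyBound K c₀ (profileConst M) lam ε) (ha : 0 < a)
    (hab : a ≤ b) (hbt : b < t) (htT : t ≤ T) :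
    normSq 2 (radius lam t) (lap ε φ t)
      + (ENNReal.ofReal lam * (∫⁻ s in Ioc a b, normSq (7 / 3) (radius lam s) (lap ε φ s))
        + ∫⁻ s in Ioc a b, gradNormSq ε 2 (radius lam s) (lap ε φ) s)
      ≤ rhs K lam ε Nu Nv f₁ f₂ C t := by
  have ht : t ∈ Ioc 0 T := ⟨(ha.trans_le hab).trans hbt, htT⟩
  have hτ := (P.radius_mem (Ioc_subset_Icc_self ht)).1
  have hs : SmoothOn (2 : ℕ) (Ioc 0 T) (lap ε φ) :=
    SmoothOn.lap (n := 2) P.sol.smooth (uniqueDiffOn_Ioc 0 T)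
  have hpf := hs.pf P.pω ht
  have hm : ∀ {r}, r ∈ Ioc a b → r ∈ Ioo 0 T := fun hr =>
    ⟨ha.trans hr.1, (hr.2.trans_lt hbt).trans_le htT⟩
  set E := P.evolution a b ha hab (hbt.trans_le htT)
  have c1 : ∀ N, Continuous fun r => gain lam ε φ N (cl a b r) := fun N =>
    E.cω.truncSq 7 lam a b N
  have c2 : ∀ N, Continuous fun r => diss lam ε φ N (cl a b r) := fun N =>
    (continuous_const.mul (E.cωx.truncSq 6 lam a b N)).add (E.cωy.truncSq 6 lam a b N)
  have ae : ∀ {f : ℝ → ℝ}, (Continuous fun r => f (cl a b r)) →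
      AEMeasurable (fun r => ENNReal.ofReal (f r)) (volume.restrict (Ioc a b)) := by
    intro f hf
    refine (ENNReal.continuous_ofReal.comp hf).measurable.aemeasurable.congr ?_
    filter_upwards [ae_restrict_mem measurableSet_Ioc] with r hr
    simp only [Function.comp, cl_of_mem (Ioc_subset_Icc_self hr)]
  have m1 : ∀ r ∈ Ioc a b, Monotone fun N => ENNReal.ofReal (gain lam ε φ N r) := fun r hr =>
    monotone_truncSq (P.sω.pf P.pω (hm hr)) (P.radius_mem (Ioo_subset_Icc_self (hm hr))).1
  have m2 : ∀ r ∈ Ioc a b, Monotone fun N => ENNReal.ofReal (diss lam ε φ N r) := fun r hr =>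
    P.monotone_diss (hm hr)
  have e1 : ∫⁻ s in Ioc a b, normSq (7 / 3) (radius lam s) (lap ε φ s)
      = ⨆ N, ∫⁻ s in Ioc a b, ENNReal.ofReal (gain lam ε φ N s) := by
    rw [← lintegral_iSup' (fun N => ae (c1 N))
      ((ae_restrict_mem measurableSet_Ioc).mono m1)]
    exact setLIntegral_congr_fun measurableSet_Ioc fun r hr => (P.ofReal_gain (hm hr)).symm
  have e2 : ∫⁻ s in Ioc a b, gradNormSq ε 2 (radius lam s) (lap ε φ) s
      = ⨆ N, ∫⁻ s in Ioc a b, ENNReal.ofReal (diss lam ε φ N s) := by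
    rw [← lintegral_iSup' (fun N => ae (c2 N))
      ((ae_restrict_mem measurableSet_Ioc).mono m2)]
    exact setLIntegral_congr_fun measurableSet_Ioc fun r hr => (P.ofReal_diss (hm hr)).symm
  have e3 : normSq 2 (radius lam t) (lap ε φ t)
      = ⨆ N, ENNReal.ofReal (truncSq 6 (radius lam t) N (ex (lap ε φ t))) := by
    rw [← normSq_ex, ← normSq_eq_iSup hpf hτ]; norm_num
  have M1 : Monotone fun N => ∫⁻ s in Ioc a b, ENNReal.ofReal (gain lam ε φ N s) :=
    fun N N' h => setLIntegral_mono' measurableSet_Ioc fun r hr => m1 r hr h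
  have M2 : Monotone fun N => ∫⁻ s in Ioc a b, ENNReal.ofReal (diss lam ε φ N s) :=
    fun N N' h => setLIntegral_mono' measurableSet_Ioc fun r hr => m2 r hr h
  have M1' : Monotone fun N => ENNReal.ofReal lam
      * ∫⁻ s in Ioc a b, ENNReal.ofReal (gain lam ε φ N s) := fun N N' h =>
    mul_le_mul_right (M1 h) _
  rw [e1, e2, e3, ENNReal.mul_iSup, ENNReal.iSup_add_iSup_of_monotone M1' M2,
    ENNReal.iSup_add_iSup_of_monotone (monotone_truncSq hpf hτ) (M1'.add M2)]
  exact iSup_le fun N => P.energy_trunc hK H ha hab hbt htT N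

/-- The estimate for the vorticity up to the initial time, by exhaustion of the time interval. -/
lemma energy_estimate (hK : 0 < K) (H : EnergyBound K c₀ (profileConst M) lam ε)
    (ht : t ∈ Ioc 0 T) :
    normSq 2 (radius lam t) (lap ε φ t)
      + (ENNReal.ofReal lam * (∫⁻ s in Ioc 0 t, normSq (7 / 3) (radius lam s) (lap ε φ s))
        + ∫⁻ s in Ioc 0 t, gradNormSq ε 2 (radius lam s) (lap ε φ) s)
      ≤ rhs K lam ε Nu Nv f₁ f₂ C t := by
  -- intervals that exhaust the open interval of times
  obtain ⟨s, hs⟩ : ∃ s : ℕ → Set ℝ, s = fun n : ℕ => Ioc (t / (n + 3)) (t - t / (n + 3)) :=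
    ⟨_, rfl⟩
  have h3 : ∀ n : ℕ, t / (n + 3) ≤ t / 3 := fun n =>
    div_le_div_of_nonneg_left ht.1.le (by norm_num) (by linarith [Nat.cast_nonneg (α := ℝ) n])
  have hp : ∀ n : ℕ, 0 < t / (n + 3) := fun n => div_pos ht.1 (by positivity)
  have hmono : Monotone s := by
    intro m n hmn
    have : t / (n + 3) ≤ t / (m + 3) := by
      have : (m : ℝ) ≤ n := by exact_mod_cast hmn
      have := ht.1
      gcongr
    rw [hs]
    exact Ioc_subset_Ioc this (by linarith)
  have hU : ⋃ n, s n = Ioo 0 t := by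
    rw [hs]
    ext r
    simp only [mem_iUnion, mem_Ioc, mem_Ioo]
    constructor
    · rintro ⟨n, h1, h2⟩
      exact ⟨(hp n).trans h1, by linarith [hp n]⟩
    · rintro ⟨h1, h2⟩
      have hd : 0 < min r (t - r) := lt_min h1 (by linarith)
      obtain ⟨n, hn⟩ := exists_nat_gt (t / min r (t - r))
      have hn3 : t / (n + 3) < min r (t - r) := by
        rw [div_lt_iff₀ (by positivity)]
        rw [div_lt_iff₀ hd] at hn
        nlinarith
      exact ⟨n, hn3.trans_le (min_le_left _ _), by linarith [min_le_right r (t - r)]⟩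
  have ex : ∀ f : ℝ → ℝ≥0∞, ∫⁻ r in Ioc 0 t, f r = ⨆ n, ∫⁻ r in s n, f r := fun f => by
    rw [← setLIntegral_iUnion_of_directed f hmono.directed_le, hU,
      setLIntegral_congr Ioo_ae_eq_Ioc]
  have mono : ∀ f : ℝ → ℝ≥0∞, Monotone fun n => ∫⁻ r in s n, f r := fun f m n h =>
    lintegral_mono_set (hmono h)
  have M1 : Monotone fun n => ENNReal.ofReal lam
      * ∫⁻ r in s n, normSq (7 / 3) (radius lam r) (lap ε φ r) := fun m n h =>
    mul_le_mul_right (mono _ h) _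
  rw [ex, ex, ENNReal.mul_iSup, ENNReal.iSup_add_iSup_of_monotone M1 (mono _), ENNReal.add_iSup]
  refine iSup_le fun n => ?_
  rw [hs]
  exact P.energy_full hK H (hp n) (by linarith [h3 n, ht.1]) (by linarith [hp n]) ht.2

/-- The stream function and its traces are controlled by the vorticity. -/
lemma elliptic (ht : t ∈ Ioo 0 T) :
    normSq (7 / 3) (radius lam t) (lap ε φ t) + gradNormSq ε (7 / 3) (radius lam t) φ t
      + gradTraceSq ε (7 / 3) (radius lam t) φ t
      ≤ 18 * normSq (7 / 3) (radius lam t) (lap ε φ t) := by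
  have st := P.stream ht
  have hτ := (P.radius_mem (Ioo_subset_Icc_self ht)).1
  have h1 := st.normSq_grad_le (p := 7) hτ
  have h2 := st.traceNormSq_le (p := 7) hτ
  rw [normSq_ex, normSq_ex] at h1
  rw [normSq_ex] at h2
  have z : ∀ c : ℝ, c = 0 ∨ c = 1 → traceNormSq (7 / 3) (radius lam t) (fun x => ε * dx φ t x c) = 0 := by
    intro c hc
    have hcm : c ∈ Icc (0 : ℝ) 1 := by rcases hc with rfl | rfl <;> simp
    have hw : ∀ x, dx φ t x c = 0 := fun x => by
      have : (fun z => φ t z c) = fun _ => 0 := by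
        ext z
        exact P.sol.dirichlet t (Ioo_subset_Ioc_self ht) z c (by simpa using hc)
      rw [dx, this, deriv_const]
    simp only [hw, mul_zero]
    rw [traceNormSq_eq]
    have : fc (fun _ => (0 : ℝ)) = 0 := by
      ext k; simp [fc, cfc_eq_integral]
    simp [this]
  have e : gradTraceSq ε (7 / 3) (radius lam t) φ t
      = traceNormSq (7 / 3) (radius lam t) (fun x => dy φ t x 0)
        + traceNormSq (7 / 3) (radius lam t) (fun x => dy φ t x 1) := by
    rw [gradTraceSq, gradTraceSqAt, gradTraceSqAt, z 0 (Or.inl rfl), z 1 (Or.inr rfl), zero_add,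
      zero_add]
  have e0 : (fun x => ex (dy φ t) x 0) = fun x => dy φ t x 0 := by
    ext x; exact ex_eq (left_mem_Icc.2 zero_le_one)
  have e1 : (fun x => ex (dy φ t) x 1) = fun x => dy φ t x 1 := by
    ext x; exact ex_eq (right_mem_Icc.2 zero_le_one)
  rw [e0, e1] at h2
  have h1' : gradNormSq ε (7 / 3) (radius lam t) φ t
      ≤ 4 * normSq (7 / 3) (radius lam t) (lap ε φ t) := by
    have e3 : normSq (7 / 3) (radius lam t) (fun x y => ε * dx φ t x y)
        = normSq (7 / 3) (radius lam t) (fun x y => ε * ex (dx φ t) x y) :=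
      (normSq_ex _ _ _).symm
    rw [gradNormSq, e3]
    exact_mod_cast h1
  rw [e]
  have h2' : traceNormSq (7 / 3) (radius lam t) (fun x => dy φ t x 0)
        + traceNormSq (7 / 3) (radius lam t) (fun x => dy φ t x 1)
      ≤ 13 * normSq (7 / 3) (radius lam t) (lap ε φ t) := by exact_mod_cast h2
  calc _ ≤ normSq (7 / 3) (radius lam t) (lap ε φ t)
        + 4 * normSq (7 / 3) (radius lam t) (lap ε φ t)
        + 13 * normSq (7 / 3) (radius lam t) (lap ε φ t) := by gcongr
    _ = _ := by ring

omit P in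
/-- At time `0` only the values of `φ` are prescribed, and they determine its spatial derivatives.
-/
lemma _root_.HydroNS.lap_eq_zero (h : ∀ x, ∀ y ∈ Icc (0 : ℝ) 1, φ 0 x y = 0) (x : ℝ) {y : ℝ}
    (hy : y ∈ Icc (0 : ℝ) 1) : lap ε φ 0 x y = 0 := by
  have h1 : ∀ x, dx φ 0 x y = 0 := fun x => by
    have : (fun z => φ 0 z y) = fun _ => 0 := by ext z; exact h z y hy
    rw [dx, this, deriv_const]
  have h2 : dx (dx φ) 0 x y = 0 := by
    have : (fun z => dx φ 0 z y) = fun _ => 0 := by ext z; exact h1 z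
    rw [dx, this, deriv_const]
  have h3 : ∀ {f : ℝ → ℝ → ℝ → ℝ}, (∀ y ∈ Icc (0 : ℝ) 1, f 0 x y = 0) →
      ∀ y ∈ Icc (0 : ℝ) 1, dy f 0 x y = 0 := by
    intro f hf y hy
    rw [dy_congr (g := fun _ _ _ => 0) hf hy]
    simp [dy]
  rw [lap, h2, h3 (h3 (h x)) y hy]
  ring

end Problem

lemma normSq_eq_zero {r τ : ℝ} {F : ℝ → ℝ → ℝ} (h : ∀ x, ∀ y ∈ Icc (0 : ℝ) 1, F x y = 0) :
    normSq r τ F = 0 := by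
  have e : normSq r τ F = ∫⁻ _ in Ioo (0 : ℝ) 1, 0 := by
    refine setLIntegral_congr_fun measurableSet_Ioo fun y hy => ?_
    simp only [fun x => h x y (Ioo_subset_Icc_self hy)]
    rw [traceNormSq_eq]
    have : fc (fun _ => (0 : ℝ)) = 0 := by
      ext k; simp [fc, cfc_eq_integral]
    simp [this]
  rw [e, lintegral_zero]

end

end

end HydroNS

open HydroNS in
theorem proposition6p1 (M c₀ : ℝ) (hM : 0 < M) (hc₀ : 0 < c₀) :
    ∃ lam₀ K : ℝ, 1 < lam₀ ∧ 0 < K ∧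
      ∀ lam : ℝ, lam₀ ≤ lam →
      ∀ ε : ℝ, 0 < ε → ε ≤ 1 →
      -- the approximate solution `(u₀ + ε² u₂, v₀ + ε² v₂)` on the time interval of length `Tp`
      ∀ Tp : ℝ, 0 < Tp →
      ∀ u₀ v₀ p₀ u₂ v₂ p₂ : ℝ → ℝ → ℝ → ℝ,
        HydroNS.IsHydrostatic Tp u₀ v₀ p₀ →
        HydroNS.IsCorrector Tp u₀ v₀ u₂ v₂ p₂ →
        HydroNS.GevreyBound Tp lam M 12 u₀ v₀ →
        HydroNS.GevreyBound Tp lam M 10 u₂ v₂ →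
        (∀ t ∈ Ioo 0 Tp, ∀ x, ∀ y ∈ Ioo (0 : ℝ) 1,
          c₀ ≤ HydroNS.dy (HydroNS.dy (HydroNS.composite ε u₀ u₂)) t x y) →
      ∀ T : ℝ, 0 < T → T < min Tp (1 / (2 * lam)) →
      -- the sources
      ∀ (Nu Nv f₁ f₂ : ℝ → ℝ → ℝ → ℝ) (C : ℝ → ℝ),
        HydroNS.SmoothOn 1 (Ioo 0 T) Nu → HydroNS.SmoothOn 1 (Ioo 0 T) Nv →
        HydroNS.SmoothOn 0 (Ioo 0 T) f₁ → HydroNS.SmoothOn 0 (Ioo 0 T) f₂ →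
        ContinuousOn C (Ioo 0 T) →
        HydroNS.PeriodicX Nu → HydroNS.PeriodicX Nv →
        HydroNS.PeriodicX f₁ → HydroNS.PeriodicX f₂ →
      ∀ φ : ℝ → ℝ → ℝ → ℝ,
        HydroNS.IsSlipSolution ε T (HydroNS.composite ε u₀ u₂) (HydroNS.composite ε v₀ v₂)
          Nu Nv f₁ f₂ C φ →
      ∀ t ∈ Icc 0 T,
        HydroNS.normSq 2 (HydroNS.radius lam t) (HydroNS.lap ε φ t)
          + ENNReal.ofReal lam * (∫⁻ s in Ioc 0 t,
              (HydroNS.normSq (7 / 3) (HydroNS.radius lam s) (HydroNS.lap ε φ s)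
                + HydroNS.gradNormSq ε (7 / 3) (HydroNS.radius lam s) φ s
                + HydroNS.gradTraceSq ε (7 / 3) (HydroNS.radius lam s) φ s))
          + (∫⁻ s in Ioc 0 t,
              HydroNS.gradNormSq ε 2 (HydroNS.radius lam s) (HydroNS.lap ε φ) s)
        ≤ ENNReal.ofReal K * (∫⁻ s in Ioc 0 t,
              (HydroNS.normSq 2 (HydroNS.radius lam s) (Nu s)
                + HydroNS.normSq 2 (HydroNS.radius lam s) (fun x y => ε * Nv s x y)))
          + ENNReal.ofReal (K / lam) * (∫⁻ s in Ioc 0 t,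
              (HydroNS.normSq (5 / 3) (HydroNS.radius lam s) (fun _ _ => C s)
                + HydroNS.normSq (5 / 3) (HydroNS.radius lam s) (fun x y => ε ^ 2 * f₁ s x y)
                + HydroNS.normSq (5 / 3) (HydroNS.radius lam s) (f₂ s))) := by
  obtain ⟨lam₀, K, hlam₀, hK, main⟩ :=
    Evolution.integrated c₀ (profileConst M) hc₀ (one_le_profileConst hM)
  refine ⟨lam₀, 18 * K, hlam₀, by positivity, ?_⟩
  intro lam hlam ε hε0 hε1 Tp hTp u₀ v₀ p₀ u₂ v₂ p₂ hydro corr bound₀ bound₂ convex T hT hTm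
    Nu Nv f₁ f₂ C sNu sNv sf₁ sf₂ sC pNu pNv pf₁ pf₂ φ sol t ht
  obtain rfl | ht0 := ht.1.eq_or_lt
  · rw [normSq_eq_zero fun x y hy => lap_eq_zero sol.initial x hy]
    simp
  have P : Problem M c₀ lam ε Tp T u₀ v₀ p₀ u₂ v₂ p₂ Nu Nv f₁ f₂ C φ := {
    hM := hM
    hc₀ := hc₀
    hlam := by linarith
    hε0 := hε0
    hε1 := hε1
    hydro := hydro
    corr := corr
    bound₀ := bound₀
    bound₂ := bound₂
    convex := convex
    hTp := hTm.trans_le (min_le_left _ _)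
    hTlam := hTm.trans_le (min_le_right _ _)
    sNu := sNu
    sNv := sNv
    sf₁ := sf₁
    sf₂ := sf₂
    sC := sC
    pNu := pNu
    pNv := pNv
    pf₁ := pf₁
    pf₂ := pf₂
    sol := sol }
  have H : EnergyBound K c₀ (profileConst M) lam ε := fun a b E N h1 h2 h3 =>
    main lam ε a b E N hlam h1 h2 h3
  have key := P.energy_estimate hK H ⟨ht0, ht.2⟩
  have e18 : ENNReal.ofReal 18 = 18 := by norm_num
  have hR : ENNReal.ofReal (18 * K) * (∫⁻ s in Ioc 0 t, (normSq 2 (radius lam s) (Nu s)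
      + normSq 2 (radius lam s) (fun x y => ε * Nv s x y)))
      + ENNReal.ofReal (18 * K / lam) * (∫⁻ s in Ioc 0 t,
        (normSq (5 / 3) (radius lam s) (fun _ _ => C s)
        + normSq (5 / 3) (radius lam s) (fun x y => ε ^ 2 * f₁ s x y)
        + normSq (5 / 3) (radius lam s) (f₂ s))) = 18 * rhs K lam ε Nu Nv f₁ f₂ C t := by
    rw [rhs, mul_div_assoc, ENNReal.ofReal_mul (by norm_num), ENNReal.ofReal_mul (by norm_num), e18]
    ring
  rw [hR]
  refine le_trans ?_ (mul_le_mul_right key 18)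
  have ell : ∫⁻ s in Ioc 0 t, (normSq (7 / 3) (radius lam s) (lap ε φ s)
      + gradNormSq ε (7 / 3) (radius lam s) φ s + gradTraceSq ε (7 / 3) (radius lam s) φ s)
      ≤ 18 * ∫⁻ s in Ioc 0 t, normSq (7 / 3) (radius lam s) (lap ε φ s) := by
    rw [setLIntegral_congr Ioo_ae_eq_Ioc.symm, setLIntegral_congr Ioo_ae_eq_Ioc.symm,
      ← lintegral_const_mul' _ _ (by norm_num)]
    exact setLIntegral_mono' measurableSet_Ioo fun s hs => P.elliptic ⟨hs.1, hs.2.trans_le ht.2⟩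
  have one18 : ∀ a : ℝ≥0∞, a ≤ 18 * a := fun a => le_mul_of_one_le_left zero_le (by norm_num)
  calc _ ≤ 18 * normSq 2 (radius lam t) (lap ε φ t)
        + ENNReal.ofReal lam * (18 * ∫⁻ s in Ioc 0 t, normSq (7 / 3) (radius lam s) (lap ε φ s))
        + 18 * ∫⁻ s in Ioc 0 t, gradNormSq ε 2 (radius lam s) (lap ε φ) s := by
        gcongr
        · exact one18 _
        · exact one18 _
    _ = _ := by ring
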